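/- Let $p$ be a prime, let $W=\mathbb C^N$ carry a non-degenerate bilinear form $\langle\cdot,\cdot\rangle$ that is either symmetric or skew-symmetric, and let $\widehat H=\{g\in GL_N(\mathbb C): g^*=g^{-1},\ \det g=1\}$, with Lie algebra $\widehat{\mathfrak h}=\{x: x^*=-x\}$, where $*$ denotes the adjoint for the form. Let $\lambda$ be an unramified infinitesimal character with values in $\widehat H$, i.e. a semisimple element $s=\lambda(\mathrm{Fr})\in\widehat H$, and let $W_i$ be the eigenspace of $s$ for the eigenvalue $p^i$. Assume that all eigenvalues of $s$ are of the form $p^i$ with either all $i\in\mathbb Z$ or all $i\in\frac12+\mathbb Z$, and that there is an $i_0'$ with $W_{i_0'}\neq 0$ such that $\dim W_i\le\dim W_{i+1}$ for all $i\le i_0'$ and $\dim W_i\ge\dim W_{i+1}$ for all $i\ge i_0'$. Put $i_0=-1$ (resp. $i_0=-\frac12$) if the exponents are in $\mathbb Z$ (resp. in $\frac12+\mathbb Z$), and $n=\dim W_{i_0}$. If the form is symmetric and the exponents are in $\frac12+\mathbb Z$, assume that $n$ is even. Let $H_\lambda$ be the centralizer of $s$ in $\widehat H$, acting by conjugation on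 the Vogan variety $V_\lambda=\{x\in\widehat{\mathfrak h}: sxs^{-1}=px\}$; each $x\in V_\lambda$ maps $W_i$ to $W_{i+1}$. Let $V_\lambda^{reg}\subset V_\lambda$ be the open subvariety of those $x$ for which every $x:W_i\to W_{i+1}$ has the largest possible rank. Let $\varphi$ be the projection that forgets the component $W_{-1/2}\to W_{1/2}$ (exponents in $\frac12+\mathbb Z$), resp. the components $W_{-1}\to W_0$ and $W_0\to W_1$ (exponents in $\mathbb Z$), and let $V_\lambda^{reg,\diamond}=\varphi(V_\lambda^{reg})$. A point $x^\diamond\in V_\lambda^{reg,\diamond}$ defines a flag on $W_{i_0}$, formed by the images of the $W_{i_0-l}$, $l\ge 0$, under $(x^\diamond)^l$; let $P\subset GL(W_{i_0})\cong GL_n$ be its stabilizer (after the choice of a basis of $W_{i_0}$). Let $H_\lambda(x^\diamond)$ be the stabilizer of $x^\diamond$ in $H_\lambda$. Then: 1. $V_\lambda^{reg,\diamond}$ is a single $H_\lambda$-orbit. 2. For every $x^\diamond\in V_\lambda^{reg,\diamond}$ the map $(h,y)\mapsto hyh^{-1}$ induces an isomorphism $H_\lambda\times_{H_\lambda(x^\diamond)}\varphi^{-1}(x^\diamond)\cong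 V_\lambda^{reg}$, and there is an equivalence of quotient stacks $[H_\lambda\backslash V_\lambda^{reg}]\cong[H_\lambda(x^\diamond)\backslash\varphi^{-1}(x^\diamond)]$. 3. For every $x^\diamond\in V_\lambda^{reg,\diamond}$ and every basis of $W_{i_0}$, the group $H_\lambda(x^\diamond)$ acting on $\varphi^{-1}(x^\diamond)$ is isomorphic to the following group acting on the following variety, and the stack $[H_\lambda(x^\diamond)\backslash\varphi^{-1}(x^\diamond)]$ is equivalent to the corresponding quotient stack and also to the double coset stack $[\widehat K\backslash GL_n/P]$: (a) symmetric form, exponents in $\mathbb Z$: $[(P\times SO(n,\mathbb C))\backslash GL_n]$, with $\widehat K=SO(n,\mathbb C)$; (b) skew-symmetric form, exponents in $\mathbb Z$: $[(P\times Sp(n,\mathbb C))\backslash GL_n]$, with $\widehat K=Sp(n,\mathbb C)$; (c) skew-symmetric form, exponents in $\frac12+\mathbb Z$: $[P\backslash \mathrm{Sym}_n^{reg}]$, with $\widehat K=O(n,\mathbb C)$; (d) symmetric form, exponents in $\frac12+\mathbb Z$: $[P\backslash \mathrm{Skew}_n^{reg}]$, with $\widehat K=Sp(n,\mathbb C)$.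 Here $\mathrm{Sym}_n^{reg}$ and $\mathrm{Skew}_n^{reg}$ are the varieties of invertible symmetric, resp. skew-symmetric, $n\times n$ matrices with $P$ acting by congruence, $g\cdot x={}^tg^{-1}xg^{-1}$; in (a) and (b) the action is $(b,a)\cdot x=axb^{-1}$; and $[\widehat K\backslash GL_n/P]$ is the quotient stack of $GL_n$ by $\widehat K\times P$ acting by $(a,b)\cdot x=axb^{-1}$. -/

import Mathlib

open CategoryTheory Opposite
open scoped Matrix MatrixGroups

noncomputable section

namespace FullRank

/-! ### Quotient stacks over the étale site of affine complex schemes -/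

/-- Commutative `ℂ`-algebras; the opposite category is the category of affine schemes over `ℂ`. -/
abbrev Alg := CommAlgCat.{0} ℂ

/-- The `ℂ`-algebra `ℂ`, for taking complex points. -/
abbrev cpt : Alg := CommAlgCat.of ℂ ℂ

/-- The family `Spec (S i) → Spec R` is étale and jointly surjective. -/
def IsEtaleCover {R : Alg} {ι : Type} (S : ι → Alg) (f : ∀ i, R ⟶ S i) : Prop :=
  (∀ i, (f i).hom.toRingHom.Etale) ∧
    ∀ q : PrimeSpectrum R, ∃ i, ∃ q' : PrimeSpectrum (S i),
      PrimeSpectrum.comap (f i).hom.toRingHom q' = q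

/-- `Spec S → Spec R` is étale and surjective. -/
def IsEtaleCovering {R S : Alg} (f : R ⟶ S) : Prop :=
  IsEtaleCover (ι := Unit) (fun _ => S) (fun _ => f)

/-- The sheaf condition for the étale topology on affine schemes (finite covering families). -/
def IsEtaleSheaf (P : Alg ⥤ Type 1) : Prop :=
  ∀ (R : Alg) (ι : Type) [Finite ι] (S : ι → Alg) (f : ∀ i, R ⟶ S i), IsEtaleCover S f →
    ∀ x : ∀ i, P.obj (S i),
      (∀ (i j : ι) (T : Alg) (g : S i ⟶ T) (h : S j ⟶ T), f i ≫ g = f j ≫ h →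
        P.map g (x i) = P.map h (x j)) →
      ∃! y : P.obj R, ∀ i, P.map (f i) y = x i

/-- A group functor `G` acting from the left on a space `X`, both given by their functors of
points. -/
structure GSpace where
  G : Alg ⥤ GrpCat.{0}
  X : Alg ⥤ Type
  act : ∀ R, MulAction (G.obj R) (X.obj R)
  map_smul : ∀ {R S : Alg} (f : R ⟶ S) (g : G.obj R) (x : X.obj R),
    X.map f (g • x) = G.map f g • X.map f x

attribute [instance] GSpace.act

namespace GSpace

/-- An object of `[G\X]` over `Spec R`: an étale `G`-torsor `P → Spec R` together with a
`G`-equivariant map `P → X`. -/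
structure TorsorObj (A : GSpace) where
  R : Alg
  P : Alg ⥤ Type 1
  act : ∀ S, MulAction (A.G.obj S) (P.obj S)
  map_smul : ∀ {S T : Alg} (f : S ⟶ T) (g : A.G.obj S) (u : P.obj S),
    P.map f (g • u) = A.G.map f g • P.map f u
  isSheaf : IsEtaleSheaf P
  /-- the structure map `P → Spec R` -/
  π : ∀ {S : Alg}, P.obj S → (R ⟶ S)
  π_map : ∀ {S T : Alg} (f : S ⟶ T) (u : P.obj S), π (P.map f u) = π u ≫ f
  π_smul : ∀ {S : Alg} (g : A.G.obj S) (u : P.obj S), π (g • u) = π u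
  /-- `G` acts simply transitively on the fibres of the structure map -/
  simplyTransitive : ∀ {S : Alg} (u v : P.obj S), π u = π v → ∃! g : A.G.obj S, g • u = v
  /-- the structure map has sections étale locally -/
  locallyTrivial : ∃ (S : Alg) (f : R ⟶ S), IsEtaleCovering f ∧ ∃ u : P.obj S, π u = f
  /-- the equivariant map `P → X` -/
  toX : ∀ {S : Alg}, P.obj S → A.X.obj S
  toX_map : ∀ {S T : Alg} (f : S ⟶ T) (u : P.obj S), toX (P.map f u) = A.X.map f (toX u)
  toX_smul : ∀ {S : Alg} (g : A.G.obj S) (u : P.obj S), toX (g • u) = g • toX u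

attribute [instance] TorsorObj.act

/-- A morphism from `(P → Spec R, P → X)` to `(Q → Spec R', Q → X)`: a morphism
`Spec R → Spec R'` covered by an equivariant map `P → Q` compatible with the maps to `X`. -/
@[ext]
structure TorsorHom {A : GSpace} (P Q : TorsorObj A) where
  base : Q.R ⟶ P.R
  app : ∀ S : Alg, P.P.obj S → Q.P.obj S
  app_map : ∀ {S T : Alg} (f : S ⟶ T) (u : P.P.obj S), app T (P.P.map f u) = Q.P.map f (app S u)
  app_smul : ∀ {S : Alg} (g : A.G.obj S) (u : P.P.obj S), app S (g • u) = g • app S u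
  app_π : ∀ {S : Alg} (u : P.P.obj S), Q.π (app S u) = base ≫ P.π u
  app_toX : ∀ {S : Alg} (u : P.P.obj S), Q.toX (app S u) = P.toX u

instance (A : GSpace) : Category (TorsorObj A) where
  Hom P Q := TorsorHom P Q
  id P :=
    { base := 𝟙 _
      app := fun _ u => u
      app_map := fun _ _ => rfl
      app_smul := fun _ _ => rfl
      app_π := fun _ => by simp
      app_toX := fun _ => rfl }
  comp a b :=
    { base := b.base ≫ a.base
      app := fun S u => b.app S (a.app S u)
      app_map := fun f u => by rw [a.app_map, b.app_map]
      app_smul := fun g u => by rw [a.app_smul, b.app_smul]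
      app_π := fun u => by rw [b.app_π, a.app_π, Category.assoc]
      app_toX := fun u => by rw [b.app_toX, a.app_toX] }
  id_comp a := by apply TorsorHom.ext <;> simp
  comp_id a := by apply TorsorHom.ext <;> simp
  assoc a b c := by apply TorsorHom.ext <;> simp

/-- The quotient stack `[G\X]`, as a category over the category of affine schemes over `ℂ`. -/
def quotientStack (A : GSpace) : BasedCategory.{1, 2} Algᵒᵖ where
  obj := TorsorObj A
  category := inferInstance
  p :=
    { obj := fun P => op P.R
      map := fun {P Q} (a : TorsorHom P Q) => a.base.op
      map_id := fun _ => rfl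
      map_comp := fun _ _ => rfl }

/-- Equivalence of the quotient stacks, in the 2-category of categories over affine schemes. -/
def StackEquiv (A A' : GSpace) : Prop :=
  Nonempty (Bicategory.Equivalence A.quotientStack A'.quotientStack)

/-- A homomorphism of group functors together with an equivariant map of spaces. -/
structure Hom (A A' : GSpace) where
  onG : ∀ R : Alg, A.G.obj R →* A'.G.obj R
  onG_map : ∀ {R S : Alg} (f : R ⟶ S) (g : A.G.obj R), onG S (A.G.map f g) = A'.G.map f (onG R g)
  onX : ∀ R : Alg, A.X.obj R → A'.X.obj R
  onX_map : ∀ {R S : Alg} (f : R ⟶ S) (x : A.X.obj R), onX S (A.X.map f x) = A'.X.map f (onX R x)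
  onX_smul : ∀ {R : Alg} (g : A.G.obj R) (x : A.X.obj R), onX R (g • x) = onG R g • onX R x

/-- The group functors and the spaces are identified, compatibly with the actions. -/
def Hom.IsIso {A A' : GSpace} (u : Hom A A') : Prop :=
  ∀ R, Function.Bijective (u.onG R) ∧ Function.Bijective (u.onX R)

/-- The map `(g, x) ↦ g • u x` identifies `X'` with the contracted product
`G' ×_G X = (G' × X) / G`, where `k ∈ G` acts by `k • (g, x) = (g k⁻¹, k x)`: two points of
`G' × X` have the same image exactly when they differ by a (unique) point of `G`, and the map is
an epimorphism for the étale topology. -/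
def Hom.IsContractedProduct {A A' : GSpace} (u : Hom A A') : Prop :=
  (∀ (R : Alg) (g g' : A'.G.obj R) (x x' : A.X.obj R),
    g • u.onX R x = g' • u.onX R x' ↔ ∃! k : A.G.obj R, g' = g * (u.onG R k)⁻¹ ∧ x' = k • x) ∧
  ∀ (R : Alg) (y : A'.X.obj R), ∃ (S : Alg) (f : R ⟶ S), IsEtaleCovering f ∧
    ∃ (g : A'.G.obj S) (x : A.X.obj S), A'.X.map f y = g • u.onX S x

end GSpace

/-! ### Matrix groups and spaces of matrices as functors of points -/

/-- The image in `R` of a complex matrix. -/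
abbrev bc {k l : ℕ} (R : Alg) (M : Matrix (Fin k) (Fin l) ℂ) : Matrix (Fin k) (Fin l) R :=
  M.map (algebraMap ℂ R)

/-- Base change of invertible matrices. -/
abbrev glMap {k : ℕ} {R S : Alg} (f : R ⟶ S) : GL (Fin k) R →* GL (Fin k) S :=
  Matrix.GeneralLinearGroup.map f.hom.toRingHom

/-- A subgroup functor of `GL_k`. -/
structure MatGroup (k : ℕ) where
  pts : ∀ R : Alg, Subgroup (GL (Fin k) R)
  map_mem : ∀ {R S : Alg} (f : R ⟶ S) {g : GL (Fin k) R}, g ∈ pts R → glMap f g ∈ pts S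

/-- A subfunctor of the space of `k × k` matrices. -/
structure MatSpace (k : ℕ) where
  pts : ∀ R : Alg, Set (Matrix (Fin k) (Fin k) R)
  map_mem : ∀ {R S : Alg} (f : R ⟶ S) {x : Matrix (Fin k) (Fin k) R},
    x ∈ pts R → x.map f.hom ∈ pts S

/-- The functor of points of a matrix group. -/
def MatGroup.toFunctor {k : ℕ} (H : MatGroup k) : Alg ⥤ GrpCat.{0} where
  obj R := GrpCat.of (H.pts R)
  map {R S} f := GrpCat.ofHom (((glMap f).comp (H.pts R).subtype).codRestrict (H.pts S)
    (fun g => H.map_mem f g.2))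
  map_id R := by ext; rfl
  map_comp f g := by ext; rfl

/-- The functor of points of a space of matrices. -/
def MatSpace.toFunctor {k : ℕ} (X : MatSpace k) : Alg ⥤ Type where
  obj R := X.pts R
  map {R S} f := TypeCat.ofHom fun x => (⟨x.1.map f.hom, X.map_mem f x.2⟩ : X.pts S)
  map_id R := by ext; rfl
  map_comp f g := by ext; rfl

/-- The functor of points of a product of two matrix groups. -/
def MatGroup.prodFunctor {k l : ℕ} (H : MatGroup k) (K : MatGroup l) : Alg ⥤ GrpCat.{0} where
  obj R := GrpCat.of (H.pts R × K.pts R)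
  map f := GrpCat.ofHom (MonoidHom.prodMap (H.toFunctor.map f).hom (K.toFunctor.map f).hom)
  map_id R := by ext <;> rfl
  map_comp f g := by ext <;> rfl

theorem coe_glMap {k : ℕ} {R S : Alg} (f : R ⟶ S) (g : GL (Fin k) R) :
    (glMap f g : Matrix (Fin k) (Fin k) S) = (g : Matrix (Fin k) (Fin k) R).map f.hom := rfl

theorem coe_glMap_inv {k : ℕ} {R S : Alg} (f : R ⟶ S) (g : GL (Fin k) R) :
    (((glMap f g)⁻¹ : GL (Fin k) S) : Matrix (Fin k) (Fin k) S) =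
      ((g⁻¹ : GL (Fin k) R) : Matrix (Fin k) (Fin k) R).map f.hom := by
  rw [← map_inv]; rfl

theorem bc_map {k l : ℕ} {R S : Alg} (f : R ⟶ S) (M : Matrix (Fin k) (Fin l) ℂ) :
    (bc R M).map f.hom = bc S M := by
  ext i j
  simp

/-- `H` acting on `X` by conjugation, `g • x = g x g⁻¹`. -/
def conjSpace {k : ℕ} (H : MatGroup k) (X : MatSpace k)
    (hX : ∀ (R : Alg) (g : GL (Fin k) R), g ∈ H.pts R → ∀ x ∈ X.pts R,
      (g : Matrix (Fin k) (Fin k) R) * x * ((g⁻¹ : GL (Fin k) R) : Matrix (Fin k) (Fin k) R)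
        ∈ X.pts R) : GSpace where
  G := H.toFunctor
  X := X.toFunctor
  act R :=
    { smul := fun (g : H.pts R) (x : X.pts R) =>
        (⟨(g.1 : Matrix (Fin k) (Fin k) R) * x.1 *
          ((g.1⁻¹ : GL (Fin k) R) : Matrix (Fin k) (Fin k) R), hX R g.1 g.2 x.1 x.2⟩ : X.pts R)
      one_smul := fun (x : X.pts R) => Subtype.ext (by
        change ((1 : GL (Fin k) R) : Matrix (Fin k) (Fin k) R) * x.1 *
          (((1 : GL (Fin k) R)⁻¹ : GL (Fin k) R) : Matrix (Fin k) (Fin k) R) = x.1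
        simp)
      mul_smul := fun (g h : H.pts R) (x : X.pts R) => Subtype.ext (by
        change ((g.1 * h.1 : GL (Fin k) R) : Matrix (Fin k) (Fin k) R) * x.1 *
          (((g.1 * h.1)⁻¹ : GL (Fin k) R) : Matrix (Fin k) (Fin k) R) =
          (g.1 : Matrix (Fin k) (Fin k) R) * ((h.1 : Matrix (Fin k) (Fin k) R) * x.1 *
            ((h.1⁻¹ : GL (Fin k) R) : Matrix (Fin k) (Fin k) R)) *
            ((g.1⁻¹ : GL (Fin k) R) : Matrix (Fin k) (Fin k) R)
        rw [mul_inv_rev, Units.val_mul, Units.val_mul]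
        simp only [Matrix.mul_assoc]) }
  map_smul {R S} f (g : H.pts R) (x : X.pts R) := Subtype.ext (by
    change ((g.1 : Matrix (Fin k) (Fin k) R) * x.1 *
        ((g.1⁻¹ : GL (Fin k) R) : Matrix (Fin k) (Fin k) R)).map f.hom =
      (glMap f g.1 : Matrix (Fin k) (Fin k) S) * x.1.map f.hom *
        (((glMap f g.1)⁻¹ : GL (Fin k) S) : Matrix (Fin k) (Fin k) S)
    rw [coe_glMap_inv, Matrix.map_mul, Matrix.map_mul, coe_glMap])

/-- `P` acting on a space of bilinear forms by congruence: `g` carries the form with matrix `x`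
to the form `(v, w) ↦ x(g⁻¹ v, g⁻¹ w)`, with matrix `(g⁻¹)ᵀ x g⁻¹`. -/
def congrSpace {k : ℕ} (P : MatGroup k) (X : MatSpace k)
    (hX : ∀ (R : Alg) (g : GL (Fin k) R), ∀ x ∈ X.pts R,
      (g : Matrix (Fin k) (Fin k) R)ᵀ * x * (g : Matrix (Fin k) (Fin k) R) ∈ X.pts R) :
    GSpace where
  G := P.toFunctor
  X := X.toFunctor
  act R :=
    { smul := fun (g : P.pts R) (x : X.pts R) =>
        (⟨((g.1⁻¹ : GL (Fin k) R) : Matrix (Fin k) (Fin k) R)ᵀ * x.1 *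
          ((g.1⁻¹ : GL (Fin k) R) : Matrix (Fin k) (Fin k) R), hX R g.1⁻¹ x.1 x.2⟩ : X.pts R)
      one_smul := fun (x : X.pts R) => Subtype.ext (by
        change (((1 : GL (Fin k) R)⁻¹ : GL (Fin k) R) : Matrix (Fin k) (Fin k) R)ᵀ * x.1 *
          (((1 : GL (Fin k) R)⁻¹ : GL (Fin k) R) : Matrix (Fin k) (Fin k) R) = x.1
        simp)
      mul_smul := fun (g h : P.pts R) (x : X.pts R) => Subtype.ext (by
        change (((g.1 * h.1)⁻¹ : GL (Fin k) R) : Matrix (Fin k) (Fin k) R)ᵀ * x.1 *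
          (((g.1 * h.1)⁻¹ : GL (Fin k) R) : Matrix (Fin k) (Fin k) R) =
          ((g.1⁻¹ : GL (Fin k) R) : Matrix (Fin k) (Fin k) R)ᵀ *
            (((h.1⁻¹ : GL (Fin k) R) : Matrix (Fin k) (Fin k) R)ᵀ * x.1 *
            ((h.1⁻¹ : GL (Fin k) R) : Matrix (Fin k) (Fin k) R)) *
            ((g.1⁻¹ : GL (Fin k) R) : Matrix (Fin k) (Fin k) R)
        rw [mul_inv_rev, Units.val_mul, Matrix.transpose_mul]
        simp only [Matrix.mul_assoc]) }
  map_smul {R S} f (g : P.pts R) (x : X.pts R) := Subtype.ext (by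
    change (((g.1⁻¹ : GL (Fin k) R) : Matrix (Fin k) (Fin k) R)ᵀ * x.1 *
        ((g.1⁻¹ : GL (Fin k) R) : Matrix (Fin k) (Fin k) R)).map f.hom =
      (((glMap f g.1)⁻¹ : GL (Fin k) S) : Matrix (Fin k) (Fin k) S)ᵀ * x.1.map f.hom *
        (((glMap f g.1)⁻¹ : GL (Fin k) S) : Matrix (Fin k) (Fin k) S)
    rw [coe_glMap_inv, Matrix.map_mul, Matrix.map_mul, Matrix.transpose_map])

/-- The variety `GL_k`, as a space of matrices. -/
def glSpace (k : ℕ) : MatSpace k where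
  pts R := {x | IsUnit x.det}
  map_mem {R S} f {x} hx := by
    have h := RingHom.map_det f.hom.toRingHom x
    have h2 : (x.map f.hom).det = f.hom.toRingHom x.det := h.symm
    change IsUnit (x.map f.hom).det
    rw [h2]
    exact IsUnit.map _ hx

/-- `K × P` acting on `GL_k` by `(a, b) • x = a x b⁻¹`; the quotient stack is the double coset
stack `[K\GL_k/P]`. -/
def doubleCosetSpace {k : ℕ} (K P : MatGroup k) : GSpace where
  G := K.prodFunctor P
  X := (glSpace k).toFunctor
  act R :=
    { smul := fun (g : K.pts R × P.pts R) (x : (glSpace k).pts R) =>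
        (⟨(g.1.1 : Matrix (Fin k) (Fin k) R) * x.1 *
          ((g.2.1⁻¹ : GL (Fin k) R) : Matrix (Fin k) (Fin k) R), by
            change IsUnit (Matrix.det _)
            rw [Matrix.det_mul, Matrix.det_mul]
            exact (((Matrix.isUnit_iff_isUnit_det _).1 g.1.1.isUnit).mul x.2).mul
              ((Matrix.isUnit_iff_isUnit_det _).1 (g.2.1⁻¹).isUnit)⟩ : (glSpace k).pts R)
      one_smul := fun (x : (glSpace k).pts R) => Subtype.ext (by
        change ((1 : GL (Fin k) R) : Matrix (Fin k) (Fin k) R) * x.1 *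
          (((1 : GL (Fin k) R)⁻¹ : GL (Fin k) R) : Matrix (Fin k) (Fin k) R) = x.1
        simp)
      mul_smul := fun (g h : K.pts R × P.pts R) (x : (glSpace k).pts R) => Subtype.ext (by
        change ((g.1.1 * h.1.1 : GL (Fin k) R) : Matrix (Fin k) (Fin k) R) * x.1 *
          (((g.2.1 * h.2.1)⁻¹ : GL (Fin k) R) : Matrix (Fin k) (Fin k) R) =
          (g.1.1 : Matrix (Fin k) (Fin k) R) * ((h.1.1 : Matrix (Fin k) (Fin k) R) * x.1 *
            ((h.2.1⁻¹ : GL (Fin k) R) : Matrix (Fin k) (Fin k) R)) *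
            ((g.2.1⁻¹ : GL (Fin k) R) : Matrix (Fin k) (Fin k) R)
        rw [mul_inv_rev, Units.val_mul, Units.val_mul]
        simp only [Matrix.mul_assoc]) }
  map_smul {R S} f (g : K.pts R × P.pts R) (x : (glSpace k).pts R) := Subtype.ext (by
    change ((g.1.1 : Matrix (Fin k) (Fin k) R) * x.1 *
        ((g.2.1⁻¹ : GL (Fin k) R) : Matrix (Fin k) (Fin k) R)).map f.hom =
      (glMap f g.1.1 : Matrix (Fin k) (Fin k) S) * x.1.map f.hom *
        (((glMap f g.2.1)⁻¹ : GL (Fin k) S) : Matrix (Fin k) (Fin k) S)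
    rw [coe_glMap_inv, Matrix.map_mul, Matrix.map_mul, coe_glMap])

/-- `P × K` acting on `GL_k` by `(b, a) • x = a x b⁻¹`, as in `[(P × K)\GL_k]`. -/
def prodSpace {k : ℕ} (P K : MatGroup k) : GSpace where
  G := P.prodFunctor K
  X := (glSpace k).toFunctor
  act R :=
    letI : MulAction (K.pts R × P.pts R) ((glSpace k).pts R) := (doubleCosetSpace K P).act R
    MulAction.compHom ((glSpace k).pts R)
      (MulEquiv.prodComm (M := P.pts R) (N := K.pts R)).toMonoidHom
  map_smul {R _} f (g : P.pts R × K.pts R) x :=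
    (doubleCosetSpace K P).map_smul f (g.2, g.1) x

/-! ### The classical groups and the spaces of forms -/

/-- The isometry group of the bilinear form with matrix `B`. -/
def isomGroup {k : ℕ} (B : Matrix (Fin k) (Fin k) ℂ) : MatGroup k where
  pts R :=
    { carrier := {g | (g : Matrix (Fin k) (Fin k) R)ᵀ * bc R B * (g : Matrix (Fin k) (Fin k) R)
        = bc R B}
      one_mem' := by simp
      mul_mem' := fun {a b} ha hb => by
        simp only [Set.mem_ofPred_eq] at ha hb ⊢
        rw [Units.val_mul, Matrix.transpose_mul]
        calc _ = (b : Matrix (Fin k) (Fin k) R)ᵀ * ((a : Matrix (Fin k) (Fin k) R)ᵀ * bc R B *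
              (a : Matrix (Fin k) (Fin k) R)) * (b : Matrix (Fin k) (Fin k) R) := by
                simp only [Matrix.mul_assoc]
          _ = _ := by rw [ha, hb]
      inv_mem' := fun {a} ha => by
        simp only [Set.mem_ofPred_eq] at ha ⊢
        have h1 : (a : Matrix (Fin k) (Fin k) R) *
          ((a⁻¹ : GL (Fin k) R) : Matrix (Fin k) (Fin k) R) = 1 := a.mul_inv
        have h2 : ((a⁻¹ : GL (Fin k) R) : Matrix (Fin k) (Fin k) R)ᵀ *
          (a : Matrix (Fin k) (Fin k) R)ᵀ = 1 := by
          rw [← Matrix.transpose_mul, h1, Matrix.transpose_one]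
        calc _ = ((a⁻¹ : GL (Fin k) R) : Matrix (Fin k) (Fin k) R)ᵀ *
              ((a : Matrix (Fin k) (Fin k) R)ᵀ * bc R B * (a : Matrix (Fin k) (Fin k) R)) *
              ((a⁻¹ : GL (Fin k) R) : Matrix (Fin k) (Fin k) R) := by rw [ha]
          _ = (((a⁻¹ : GL (Fin k) R) : Matrix (Fin k) (Fin k) R)ᵀ *
              (a : Matrix (Fin k) (Fin k) R)ᵀ) * bc R B * ((a : Matrix (Fin k) (Fin k) R) *
              ((a⁻¹ : GL (Fin k) R) : Matrix (Fin k) (Fin k) R)) := by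
                simp only [Matrix.mul_assoc]
          _ = _ := by rw [h1, h2]; simp }
  map_mem {R S} f {g} hg := by
    change (glMap f g : Matrix (Fin k) (Fin k) S)ᵀ * bc S B *
      (glMap f g : Matrix (Fin k) (Fin k) S) = bc S B
    have hg' : (g : Matrix (Fin k) (Fin k) R)ᵀ * bc R B * (g : Matrix (Fin k) (Fin k) R)
        = bc R B := hg
    rw [coe_glMap, ← bc_map f B, ← Matrix.transpose_map, ← Matrix.map_mul, ← Matrix.map_mul, hg']

/-- The special linear group. -/
def slGroup (k : ℕ) : MatGroup k where
  pts _ := (Matrix.GeneralLinearGroup.det).ker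
  map_mem {R S} f {g} hg := by
    rw [MonoidHom.mem_ker] at hg ⊢
    rw [Matrix.GeneralLinearGroup.map_det, hg, map_one]

/-- The centralizer of a complex matrix. -/
def centralizerGroup {k : ℕ} (x : Matrix (Fin k) (Fin k) ℂ) : MatGroup k where
  pts R :=
    { carrier := {g | (g : Matrix (Fin k) (Fin k) R) * bc R x = bc R x * g}
      one_mem' := by simp
      mul_mem' := fun {a b} ha hb => by
        simp only [Set.mem_ofPred_eq] at ha hb ⊢
        rw [Units.val_mul, Matrix.mul_assoc, hb, ← Matrix.mul_assoc, ha, Matrix.mul_assoc]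
      inv_mem' := fun {a} ha => by
        have h : Commute (a : Matrix (Fin k) (Fin k) R) (bc R x) := ha
        exact h.units_inv_left }
  map_mem {R S} f {g} hg := by
    change (glMap f g : Matrix (Fin k) (Fin k) S) * bc S x = bc S x * (glMap f g).1
    have hg' : (g : Matrix (Fin k) (Fin k) R) * bc R x = bc R x * g := hg
    rw [coe_glMap, ← bc_map f x, ← Matrix.map_mul, hg', Matrix.map_mul]

/-- The intersection of two matrix groups. -/
def MatGroup.inter {k : ℕ} (H K : MatGroup k) : MatGroup k where
  pts R := H.pts R ⊓ K.pts R
  map_mem f _ hg := ⟨H.map_mem f hg.1, K.map_mem f hg.2⟩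

/-- `O(n, ℂ)`. -/
def orthogonalGroup (n : ℕ) : MatGroup n := isomGroup 1

/-- `SO(n, ℂ)`. -/
def specialOrthogonalGroup (n : ℕ) : MatGroup n := (orthogonalGroup n).inter (slGroup n)

/-- The antidiagonal matrix with entries `-1, 1, -1, …` from the top row down; it is
skew-symmetric when `n` is even. -/
def antidiagJ (n : ℕ) : Matrix (Fin n) (Fin n) ℂ :=
  Matrix.of fun i j => if (i : ℕ) + j + 1 = n then (-1) ^ ((i : ℕ) + 1) else 0

/-- `Sp(n, ℂ)`, for `n` even. -/
def symplecticGroup (n : ℕ) : MatGroup n := isomGroup (antidiagJ n)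

/-- Invertible matrices `x` with `xᵀ = c x`. -/
def formSpace (n : ℕ) (c : ℤ) : MatSpace n where
  pts R := {x | xᵀ = c • x ∧ IsUnit x.det}
  map_mem {R S} f {x} hx := by
    refine ⟨?_, (glSpace n).map_mem f hx.2⟩
    rw [← Matrix.transpose_map, hx.1]
    ext i j
    simp only [Matrix.map_apply, Matrix.smul_apply, map_zsmul]

theorem formSpace_congr (n : ℕ) (c : ℤ) (R : Alg) (g : GL (Fin n) R)
    (x : Matrix (Fin n) (Fin n) R) (hx : x ∈ (formSpace n c).pts R) :
    (g : Matrix (Fin n) (Fin n) R)ᵀ * x * (g : Matrix (Fin n) (Fin n) R) ∈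
      (formSpace n c).pts R := by
  refine ⟨?_, ?_⟩
  · rw [Matrix.transpose_mul, Matrix.transpose_mul, Matrix.transpose_transpose, hx.1]
    simp only [Matrix.mul_smul, Matrix.smul_mul, Matrix.mul_assoc]
  · have hg : IsUnit (g : Matrix (Fin n) (Fin n) R).det :=
      (Matrix.isUnit_iff_isUnit_det _).1 g.isUnit
    rw [Matrix.det_mul, Matrix.det_mul, Matrix.det_transpose]
    exact (hg.mul hx.2).mul hg

/-- `P` acting by congruence on the invertible symmetric matrices. -/
def symRegSpace {n : ℕ} (P : MatGroup n) : GSpace :=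
  congrSpace P (formSpace n 1) (formSpace_congr n 1)

/-- `P` acting by congruence on the invertible skew-symmetric matrices. -/
def skewRegSpace {n : ℕ} (P : MatGroup n) : GSpace :=
  congrSpace P (formSpace n (-1)) (formSpace_congr n (-1))

/-- The stabilizer in `GL_n` of a family `C` of subspaces of `ℂⁿ`. -/
def stabGroup {n : ℕ} (C : ℕ → Submodule ℂ (Fin n → ℂ)) : MatGroup n where
  pts R :=
    { carrier := {g | ∀ l, ∀ v ∈ Submodule.span R ((fun c : Fin n → ℂ => algebraMap ℂ R ∘ c) '' C l),
        (g : Matrix (Fin n) (Fin n) R) *ᵥ v ∈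
          Submodule.span R ((fun c : Fin n → ℂ => algebraMap ℂ R ∘ c) '' C l) ∧
        ((g⁻¹ : GL (Fin n) R) : Matrix (Fin n) (Fin n) R) *ᵥ v ∈
          Submodule.span R ((fun c : Fin n → ℂ => algebraMap ℂ R ∘ c) '' C l)}
      one_mem' := fun l v hv => by simpa using hv
      mul_mem' := fun {a b} ha hb l v hv => by
        rw [mul_inv_rev, Units.val_mul, Units.val_mul, ← Matrix.mulVec_mulVec,
          ← Matrix.mulVec_mulVec]
        exact ⟨(ha l _ (hb l v hv).1).1, (hb l _ (ha l v hv).2).2⟩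
      inv_mem' := fun {a} ha l v hv => by
        rw [inv_inv]
        exact (ha l v hv).symm }
  map_mem {R S} f {g} hg := by
    have key : ∀ l (v : Fin n → R),
        v ∈ Submodule.span R ((fun c : Fin n → ℂ => algebraMap ℂ R ∘ c) '' C l) →
        f.hom ∘ v ∈ Submodule.span S ((fun c : Fin n → ℂ => algebraMap ℂ S ∘ c) '' C l) := by
      intro l v hv
      induction hv using Submodule.span_induction with
      | mem x hx =>
        obtain ⟨c, hc, rfl⟩ := hx
        apply Submodule.subset_span
        refine ⟨c, hc, ?_⟩
        ext i
        simp
      | zero =>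
        have : f.hom ∘ (0 : Fin n → R) = 0 := by ext i; simp
        rw [this]; exact Submodule.zero_mem _
      | add x y _ _ hx hy =>
        have : f.hom ∘ (x + y) = f.hom ∘ x + f.hom ∘ y := by ext i; simp
        rw [this]; exact Submodule.add_mem _ hx hy
      | smul a x _ hx =>
        have : f.hom ∘ (a • x) = f.hom a • (f.hom ∘ x) := by ext i; simp
        rw [this]; exact Submodule.smul_mem _ _ hx
    have key2 : ∀ (M : Matrix (Fin n) (Fin n) R) (c : Fin n → ℂ),
        M.map f.hom *ᵥ (algebraMap ℂ S ∘ c) = f.hom ∘ (M *ᵥ (algebraMap ℂ R ∘ c)) := by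
      intro M c
      ext i
      simp [Matrix.mulVec, dotProduct]
    intro l v hv
    rw [coe_glMap_inv, coe_glMap]
    induction hv using Submodule.span_induction with
    | mem x hx =>
      obtain ⟨c, hc, rfl⟩ := hx
      have h := hg l _ (Submodule.subset_span ⟨c, hc, rfl⟩)
      dsimp only
      rw [key2, key2]
      exact ⟨key l _ h.1, key l _ h.2⟩
    | zero => simp
    | add x y _ _ hx hy =>
      rw [Matrix.mulVec_add, Matrix.mulVec_add]
      exact ⟨Submodule.add_mem _ hx.1 hy.1, Submodule.add_mem _ hx.2 hy.2⟩
    | smul a x _ hx =>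
      rw [Matrix.mulVec_smul, Matrix.mulVec_smul]
      exact ⟨Submodule.smul_mem _ _ hx.1, Submodule.smul_mem _ _ hx.2⟩

/-! ### The Vogan variety of an unramified infinitesimal character

The infinitesimal character is given by the image `s` of Frobenius, a semisimple element of the
dual group, which is the group of isometries of determinant one of the form with matrix `B`. -/

/-- Whether the form is symmetric or skew-symmetric. -/
inductive FormKind
  | symm
  | skew

/-- `B` is the matrix of a form of the given kind. -/
def FormKind.Holds {N : ℕ} (B : Matrix (Fin N) (Fin N) ℂ) : FormKind → Prop
  | .symm => Bᵀ = B
  | .skew => Bᵀ = -B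

/-- The exponents `i` of the eigenvalues `p ^ i` lie in `ℤ`, or in `1/2 + ℤ`. -/
inductive SupportKind
  | int
  | half

namespace SupportKind

/-- The set of allowed exponents. -/
def exponents : SupportKind → Set ℝ
  | .int => {i | ∃ m : ℤ, i = m}
  | .half => {i | ∃ m : ℤ, i = m + 1 / 2}

/-- The degree `i₀` at which the flag lives. -/
def i₀ : SupportKind → ℝ
  | .int => -1
  | .half => -1 / 2

/-- The degrees `i` for which the projection forgets the component `W_i → W_{i+1}`. -/
def forgotten : SupportKind → Set ℝ
  | .int => {-1, 0}
  | .half => {-1 / 2}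

end SupportKind

section Vogan

variable {N : ℕ} (p : ℕ) (B : Matrix (Fin N) (Fin N) ℂ) (s : GL (Fin N) ℂ)

/-- The complex number `p ^ i`. -/
def pw (i : ℝ) : ℂ := (((p : ℝ) ^ i : ℝ) : ℂ)

/-- The eigenspace `W_i` of `s` for the eigenvalue `p ^ i`, over a `ℂ`-algebra `R`. -/
def eig (R : Alg) (i : ℝ) : Submodule R (Fin N → R) :=
  Module.End.eigenspace (Matrix.toLin' (bc R s.1)) (algebraMap ℂ R (pw p i))

/-- `dim W_i`. -/
def eigDim (i : ℝ) : ℕ := Module.finrank ℂ (eig p s cpt i)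

/-- All eigenvalues of `s` are of the form `p ^ i`, with `i` in the given set of exponents. -/
def SupportedIn (σ : SupportKind) : Prop :=
  ∀ μ : ℂ, Module.End.HasEigenvalue (Matrix.toLin' s.1) μ → ∃ i ∈ σ.exponents, μ = pw p i

/-- There is `i` with `W_i ≠ 0` such that `dim W_j ≤ dim W_{j+1}` for `j ≤ i` and
`dim W_j ≥ dim W_{j+1}` for `j ≥ i`. -/
def Unimodal : Prop :=
  ∃ i : ℝ, Module.End.HasEigenvalue (Matrix.toLin' s.1) (pw p i) ∧
    (∀ j ≤ i, eigDim p s j ≤ eigDim p s (j + 1)) ∧ ∀ j ≥ i, eigDim p s (j + 1) ≤ eigDim p s j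

/-- The dual group: isometries of determinant one. -/
def dualGroup : MatGroup N := (isomGroup B).inter (slGroup N)

/-- `H_λ`, the centralizer of `s` in the dual group. -/
def hGroup : MatGroup N := (dualGroup B).inter (centralizerGroup s.1)

/-- The matrix `x` over `R` has full rank in every degree: at every point of `Spec R`, each
restriction `W_i → W_{i+1}` has the largest possible rank. -/
def IsFullRank {R : Alg} (x : Matrix (Fin N) (Fin N) R) : Prop :=
  ∀ (K : Type) [Field K] [Algebra ℂ K] (f : R →ₐ[ℂ] K) (i : ℝ),
    Module.finrank K
        ((eig p s (CommAlgCat.of ℂ K) i).map (Matrix.toLin' (x.map f) : (Fin N → K) →ₗ[K] _)) =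
      min (eigDim p s i) (eigDim p s (i + 1))

/-- The Vogan variety: `x` in the Lie algebra of the dual group (`xᵀ B + B x = 0`) with
`s x s⁻¹ = p x`. -/
def voganSpace : MatSpace N where
  pts R := {x | xᵀ * bc R B + bc R B * x = 0 ∧
    bc R s.1 * x * bc R (s⁻¹ : GL (Fin N) ℂ).1 = (p : R) • x}
  map_mem {R S} f {x} hx := by
    obtain ⟨h1, h2⟩ := hx
    refine ⟨?_, ?_⟩
    · have := congrArg (fun M : Matrix (Fin N) (Fin N) R => M.map f.hom) h1
      rw [Matrix.map_add _ (map_add f.hom), Matrix.map_mul, Matrix.map_mul, bc_map,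
        Matrix.map_zero _ (map_zero f.hom), Matrix.transpose_map] at this
      exact this
    · have := congrArg (fun M : Matrix (Fin N) (Fin N) R => M.map f.hom) h2
      rw [Matrix.map_mul, Matrix.map_mul, bc_map, bc_map] at this
      rw [this]
      ext i j
      simp

/-- The full rank part of the Vogan variety. -/
def vReg : MatSpace N where
  pts R := {x | x ∈ (voganSpace p B s).pts R ∧ IsFullRank p s x}
  map_mem {R S} f {x} hx := by
    refine ⟨(voganSpace p B s).map_mem f hx.1, ?_⟩
    intro K _ _ g i
    have := hx.2 K (g.comp f.hom) i
    rw [← this]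
    rfl

/-- `z` is obtained from `x` by forgetting the components `W_j → W_{j+1}` in the degrees `j` in
`T`: it agrees with `x` on `W_j` for `j` outside `T` and vanishes on `W_j` for `j` in `T`. (The
product of the remaining `Hom(W_j, W_{j+1})` is viewed inside `End(W)`, extending by zero.) -/
def IsForget (T : Set ℝ) (R : Alg) (x z : Matrix (Fin N) (Fin N) R) : Prop :=
  (∀ j, j ∉ T → ∀ v ∈ eig p s R j, z *ᵥ v = x *ᵥ v) ∧
    ∀ j ∈ T, ∀ v ∈ eig p s R j, z *ᵥ v = 0

/-- The image `V^{reg,⋄}` of the full rank part under the projection, on complex points. -/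
def vRegDiamond (σ : SupportKind) : Set (Matrix (Fin N) (Fin N) ℂ) :=
  {z | ∃ x ∈ (vReg p B s).pts cpt, IsForget p s σ.forgotten cpt x z}

/-- The stabilizer of `z` in `H_λ`. -/
def hStab (z : Matrix (Fin N) (Fin N) ℂ) : MatGroup N := (hGroup B s).inter (centralizerGroup z)

theorem eig_eq_span (R : Alg) (i : ℝ) (v : Fin N → R) (hv : v ∈ eig p s R i) :
    v ∈ Submodule.span R ((fun c : Fin N → ℂ => algebraMap ℂ R ∘ c) '' eig p s cpt i) := by
  classical
  let e := Module.Basis.ofVectorSpace ℂ R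
  let F : Finset (Module.Basis.ofVectorSpaceIndex ℂ R) :=
    Finset.univ.biUnion fun j => (e.repr (v j)).support
  let c : Module.Basis.ofVectorSpaceIndex ℂ R → Fin N → ℂ := fun b j => e.repr (v j) b
  have hsum : v = ∑ b ∈ F, e b • (algebraMap ℂ R ∘ c b) := by
    ext j
    have h1 : v j = ∑ b ∈ (e.repr (v j)).support, e.repr (v j) b • e b := by
      conv_lhs => rw [← e.linearCombination_repr (v j)]
      rfl
    have h2 : ∑ b ∈ (e.repr (v j)).support, e.repr (v j) b • e b =
        ∑ b ∈ F, e.repr (v j) b • e b := by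
      apply Finset.sum_subset
      · exact Finset.subset_biUnion_of_mem (fun j => (e.repr (v j)).support) (Finset.mem_univ j)
      · intro b _ hb
        rw [Finsupp.notMem_support_iff.1 hb, zero_smul]
    rw [h1, h2, Finset.sum_apply]
    apply Finset.sum_congr rfl
    intro b _
    simp only [Pi.smul_apply, Function.comp_apply, smul_eq_mul, c]
    rw [Algebra.smul_def, mul_comm]
  rw [hsum]
  refine Submodule.sum_mem _ fun b _ => Submodule.smul_mem _ _ (Submodule.subset_span ⟨c b, ?_, rfl⟩)
  change c b ∈ eig p s cpt i
  rw [eig, Module.End.mem_eigenspace_iff, Matrix.toLin'_apply] at hv ⊢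
  ext j
  have h1 := congrFun hv j
  simp only [Matrix.mulVec, dotProduct, Matrix.map_apply, Pi.smul_apply, smul_eq_mul,
    ← Algebra.smul_def] at h1
  have h2 := congrArg (fun r => e.repr r b) h1
  simp only [map_sum, map_smul, Finsupp.coe_finsetSum, Finset.sum_apply, Finsupp.smul_apply,
    smul_eq_mul] at h2
  simpa [Matrix.mulVec, dotProduct, c] using h2

theorem mulVec_mem_eig {R : Alg} {g : GL (Fin N) R} (hg : g ∈ (hGroup B s).pts R) (i : ℝ)
    {v : Fin N → R} (hv : v ∈ eig p s R i) : g.1 *ᵥ v ∈ eig p s R i := by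
  have hc : g.1 * bc R s.1 = bc R s.1 * g.1 := hg.2
  rw [eig, Module.End.mem_eigenspace_iff, Matrix.toLin'_apply] at hv ⊢
  rw [Matrix.mulVec_mulVec, ← hc, ← Matrix.mulVec_mulVec, hv, Matrix.mulVec_smul]

/-- The fibre of the projection over the complex point `z`. -/
def fiber (σ : SupportKind) (z : Matrix (Fin N) (Fin N) ℂ) : MatSpace N where
  pts R := {x | x ∈ (vReg p B s).pts R ∧ IsForget p s σ.forgotten R x (bc R z)}
  map_mem {R S} f {x} hx := by
    refine ⟨(vReg p B s).map_mem f hx.1, ?_⟩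
    have key : ∀ (M : Matrix (Fin N) (Fin N) R) (c : Fin N → ℂ),
        M.map f.hom *ᵥ (algebraMap ℂ S ∘ c) = f.hom ∘ (M *ᵥ (algebraMap ℂ R ∘ c)) := by
      intro M c
      ext i
      simp [Matrix.mulVec, dotProduct]
    have hmem : ∀ (j : ℝ) (c : Fin N → ℂ), c ∈ eig p s cpt j →
        algebraMap ℂ R ∘ c ∈ eig p s R j := by
      intro j c hc
      rw [eig, Module.End.mem_eigenspace_iff, Matrix.toLin'_apply] at hc ⊢
      ext i
      have := congrArg (algebraMap ℂ R) (congrFun hc i)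
      simpa [Matrix.mulVec, dotProduct] using this
    refine ⟨fun j hj v hv => ?_, fun j hj v hv => ?_⟩
    · have hv' := eig_eq_span p s S j v hv
      clear hv
      induction hv' using Submodule.span_induction with
      | mem x hx' =>
        obtain ⟨c, hc, rfl⟩ := hx'
        have h := hx.2.1 j hj _ (hmem j c hc)
        dsimp only
        rw [← bc_map f z, key, key, h]
      | zero => simp
      | add x y hx' hy' h1 h2 =>
        rw [Matrix.mulVec_add, Matrix.mulVec_add, h1, h2]
      | smul a x hx' h1 =>
        rw [Matrix.mulVec_smul, Matrix.mulVec_smul, h1]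
    · have hv' := eig_eq_span p s S j v hv
      clear hv
      induction hv' using Submodule.span_induction with
      | mem x hx' =>
        obtain ⟨c, hc, rfl⟩ := hx'
        have h := hx.2.2 j hj _ (hmem j c hc)
        dsimp only
        rw [← bc_map f z, key, h]
        ext i
        simp
      | zero => simp
      | add x y hx' hy' h1 h2 =>
        rw [Matrix.mulVec_add, h1, h2, add_zero]
      | smul a x hx' h1 =>
        rw [Matrix.mulVec_smul, h1, smul_zero]

theorem vReg_conj (R : Alg) (g : GL (Fin N) R) (hg : g ∈ (hGroup B s).pts R)
    (x : Matrix (Fin N) (Fin N) R) (hx : x ∈ (vReg p B s).pts R) :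
    g.1 * x * (g⁻¹ : GL (Fin N) R).1 ∈ (vReg p B s).pts R := by
  have hB : g.1ᵀ * bc R B * g.1 = bc R B := hg.1.1
  have hc : g.1 * bc R s.1 = bc R s.1 * g.1 := hg.2
  have h1 : g.1 * (g⁻¹ : GL (Fin N) R).1 = 1 := g.mul_inv
  have h2 : (g⁻¹ : GL (Fin N) R).1ᵀ * g.1ᵀ = 1 := by
    rw [← Matrix.transpose_mul, h1, Matrix.transpose_one]
  refine ⟨⟨?_, ?_⟩, ?_⟩
  · have e1 : g.1ᵀ * bc R B = bc R B * (g⁻¹ : GL (Fin N) R).1 := by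
      rw [← hB, Matrix.mul_assoc _ g.1, h1, Matrix.mul_one, hB]
    have e2 : bc R B * g.1 = (g⁻¹ : GL (Fin N) R).1ᵀ * bc R B := by
      rw [← hB, ← Matrix.mul_assoc, ← Matrix.mul_assoc, h2, Matrix.one_mul, hB]
    have e3 := hx.1.1
    calc _ = (g⁻¹ : GL (Fin N) R).1ᵀ * xᵀ * (g.1ᵀ * bc R B) +
          (bc R B * g.1) * x * (g⁻¹ : GL (Fin N) R).1 := by
            simp only [Matrix.transpose_mul, Matrix.mul_assoc]
      _ = (g⁻¹ : GL (Fin N) R).1ᵀ * (xᵀ * bc R B + bc R B * x) * (g⁻¹ : GL (Fin N) R).1 := by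
            rw [e1, e2]
            simp only [Matrix.mul_add, Matrix.add_mul, Matrix.mul_assoc]
      _ = 0 := by rw [e3]; simp
  · let t : GL (Fin N) R := Matrix.GeneralLinearGroup.map (algebraMap ℂ R) s
    have ht : t.1 = bc R s.1 := rfl
    have ht' : (t⁻¹ : GL (Fin N) R).1 = bc R (s⁻¹ : GL (Fin N) ℂ).1 := by
      rw [← map_inv]; rfl
    have hgt : Commute g t := Units.ext hc
    have e1 : t.1 * g.1 = g.1 * t.1 := hc.symm
    have e2 : (g⁻¹ : GL (Fin N) R).1 * (t⁻¹ : GL (Fin N) R).1 =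
        (t⁻¹ : GL (Fin N) R).1 * (g⁻¹ : GL (Fin N) R).1 :=
      congrArg Units.val hgt.inv_inv
    have e3 := hx.1.2
    rw [← ht, ← ht'] at e3 ⊢
    calc _ = (t.1 * g.1) * x * ((g⁻¹ : GL (Fin N) R).1 * (t⁻¹ : GL (Fin N) R).1) := by
            simp only [Matrix.mul_assoc]
      _ = g.1 * (t.1 * x * (t⁻¹ : GL (Fin N) R).1) * (g⁻¹ : GL (Fin N) R).1 := by
            rw [e1, e2]; simp only [Matrix.mul_assoc]
      _ = _ := by rw [e3, Matrix.mul_smul, Matrix.smul_mul]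
  · intro K _ _ f i
    let φ : R ⟶ CommAlgCat.of ℂ K := CommAlgCat.ofHom f
    have hgK : glMap φ g ∈ (hGroup B s).pts (CommAlgCat.of ℂ K) := (hGroup B s).map_mem φ hg
    have hgK' := Subgroup.inv_mem _ hgK
    rw [← hx.2 K f i]
    have hm : (g.1 * x * (g⁻¹ : GL (Fin N) R).1).map f =
        (glMap φ g).1 * x.map f * ((glMap φ g)⁻¹ : GL (Fin N) K).1 := by
      rw [Matrix.map_mul, Matrix.map_mul, coe_glMap_inv, coe_glMap]; rfl
    have hW : (eig p s (CommAlgCat.of ℂ K) i).map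
        (Matrix.toLin' ((glMap φ g)⁻¹ : GL (Fin N) K).1) = eig p s (CommAlgCat.of ℂ K) i := by
      apply le_antisymm
      · rintro _ ⟨v, hv, rfl⟩
        exact mulVec_mem_eig p B s hgK' i hv
      · intro v hv
        refine ⟨(glMap φ g).1 *ᵥ v, mulVec_mem_eig p B s hgK i hv, ?_⟩
        rw [Matrix.toLin'_apply, Matrix.mulVec_mulVec]
        have : ((glMap φ g)⁻¹ : GL (Fin N) K).1 * (glMap φ g).1 = 1 := (glMap φ g).inv_mul
        rw [this, Matrix.one_mulVec]
    have hinj : Function.Injective (Matrix.toLin' (glMap φ g).1) := by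
      intro v w hvw
      have := congrArg (fun u => ((glMap φ g)⁻¹ : GL (Fin N) K).1 *ᵥ u) hvw
      simp only [Matrix.toLin'_apply, Matrix.mulVec_mulVec] at this
      have e : ((glMap φ g)⁻¹ : GL (Fin N) K).1 * (glMap φ g).1 = 1 := (glMap φ g).inv_mul
      rwa [e, Matrix.one_mulVec, Matrix.one_mulVec] at this
    rw [hm, Matrix.toLin'_mul, Matrix.toLin'_mul, Submodule.map_comp, hW, Submodule.map_comp]
    exact (Submodule.equivMapOfInjective _ hinj _).symm.finrank_eq

theorem fiber_conj (σ : SupportKind) (z : Matrix (Fin N) (Fin N) ℂ) (R : Alg)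
    (g : GL (Fin N) R) (hg : g ∈ (hStab B s z).pts R)
    (x : Matrix (Fin N) (Fin N) R) (hx : x ∈ (fiber p B s σ z).pts R) :
    g.1 * x * (g⁻¹ : GL (Fin N) R).1 ∈ (fiber p B s σ z).pts R := by
  have hc : g.1 * bc R z = bc R z * g.1 := hg.2
  have h1 : g.1 * (g⁻¹ : GL (Fin N) R).1 = 1 := g.mul_inv
  have hz : bc R z = g.1 * bc R z * (g⁻¹ : GL (Fin N) R).1 := by
    rw [hc, Matrix.mul_assoc, h1, Matrix.mul_one]
  have hg' := Subgroup.inv_mem _ hg.1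
  refine ⟨vReg_conj p B s R g hg.1 x hx.1, fun j hj v hv => ?_, fun j hj v hv => ?_⟩
  · rw [hz, ← Matrix.mulVec_mulVec, ← Matrix.mulVec_mulVec, ← Matrix.mulVec_mulVec,
      ← Matrix.mulVec_mulVec, hx.2.1 j hj _ (mulVec_mem_eig p B s hg' j hv)]
  · rw [hz, ← Matrix.mulVec_mulVec, ← Matrix.mulVec_mulVec,
      hx.2.2 j hj _ (mulVec_mem_eig p B s hg' j hv), Matrix.mulVec_zero]

/-- `H_λ` acting on the full rank part of the Vogan variety by conjugation. -/
def vRegSpace : GSpace := conjSpace (hGroup B s) (vReg p B s) (vReg_conj p B s)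

/-- The stabilizer of `z` in `H_λ` acting on the fibre over `z` by conjugation. -/
def fiberSpace (σ : SupportKind) (z : Matrix (Fin N) (Fin N) ℂ) : GSpace :=
  conjSpace (hStab B s z) (fiber p B s σ z) (fiber_conj p B s σ z)

/-- The inclusion of the stabilizer and of the fibre. -/
def fiberInclusion (σ : SupportKind) (z : Matrix (Fin N) (Fin N) ℂ) :
    (fiberSpace p B s σ z).Hom (vRegSpace p B s) where
  onG R := (Subgroup.inclusion (inf_le_left :
    (hStab B s z).pts R ≤ (hGroup B s).pts R) : _ →* _)
  onG_map _ _ := rfl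
  onX R := fun x : (fiber p B s σ z).pts R => (⟨x.1, x.2.1⟩ : (vReg p B s).pts R)
  onX_map _ _ := rfl
  onX_smul _ _ := rfl

/-- In the coordinates of the basis `b` of `W_{i₀}`, the subspace `z ^ l (W_{i₀ - l})` of
`W_{i₀}`. -/
def flag (σ : SupportKind) (z : Matrix (Fin N) (Fin N) ℂ) {n : ℕ}
    (b : Module.Basis (Fin n) ℂ (eig p s cpt σ.i₀)) (l : ℕ) : Submodule ℂ (Fin n → ℂ) :=
  ((eig p s cpt (σ.i₀ - l)).map (Matrix.toLin' (z ^ l))).comap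
    ((eig p s cpt σ.i₀).subtype ∘ₗ b.equivFun.symm.toLinearMap)

/-- The parabolic subgroup `P(λ)` of `GL_n`: the stabilizer of the flag on `W_{i₀}` formed by the
images of the `W_i`, `i ≤ i₀`, under powers of `z`. -/
def parabolic (σ : SupportKind) (z : Matrix (Fin N) (Fin N) ℂ) {n : ℕ}
    (b : Module.Basis (Fin n) ℂ (eig p s cpt σ.i₀)) : MatGroup n :=
  stabGroup (flag p s σ z b)

/-- The group `K̂` attached to each case. -/
def kHat (n : ℕ) : SupportKind → FormKind → MatGroup n
  | .int, .symm => specialOrthogonalGroup n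
  | .int, .skew => symplecticGroup n
  | .half, .skew => orthogonalGroup n
  | .half, .symm => symplecticGroup n

/-- The explicit model of the fibre with its group action in each case:
`P × SO(n)` or `P × Sp(n)` acting on `GL_n`, or `P` acting by congruence on the invertible
symmetric or skew-symmetric matrices. -/
def model {n : ℕ} (P : MatGroup n) : SupportKind → FormKind → GSpace
  | .int, .symm => prodSpace P (specialOrthogonalGroup n)
  | .int, .skew => prodSpace P (symplecticGroup n)
  | .half, .skew => symRegSpace P
  | .half, .symm => skewRegSpace P

end Vogan

end FullRank

end

open FullRank

noncomputable section

set_option linter.unusedSimpArgs false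
set_option linter.unusedSectionVars false

namespace FullRank

open scoped TensorProduct

/-! ### Étale coverings -/

/-! The form pairs `W_i` with `W_{-i}`, and a point `x` of the Vogan variety is a skew-adjoint
operator of degree one, so its components in the degrees `i` and `-i - 1` determine each other. As
`dim W_{-i} = dim W_i`, unimodality makes the dimensions weakly increase up to degree `i₀ + 1`, so
full rank means that `x` is injective on every `W_{i₀ - l}` (`Datum.isFullRank_iff`). Moreover
`W_{i₀}` and `W_{i₀ + 1}` have the same dimension: by duality for half-integral exponents, by
unimodality again for integral ones. Hence the component forgotten in degree `i₀` is bijective.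

A point of `V^{reg,⋄}` is thus a chain of injections ending in `W_{i₀}`, together with the adjoint
chain. Two such chains are intertwined by an automorphism `a` of the lower half of `W`, constructed
degree by degree (`Good.exists_frame`), and `a * (adj a)⁻¹` is an isometry of determinant one with
the same effect there (`exists_isometry`). Over `ℂ` this proves that there is one orbit. Over a ring
it works after localization and gives the contracted product
(`Good.fiberInclusion_isContractedProduct`).

An element of the stabilizer of `z` is determined on `W_{i₀ - l}` by its action on `W_{i₀}`, because
`z ^ l` is injective, and on the dual half by adjunction. The operators on `W_{i₀}` that occur are
those preserving the images of the `z ^ l`, which is the parabolic `P`. For integral exponents there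
is an independent factor acting on `W_0` by isometries of determinant one. The fibre is parametrized
by the single block `W_{i₀} → W_{i₀ + 1}`: an arbitrary invertible matrix in the integral case, and
in the half-integral case, where the target is the dual of the source, an invertible form whose sign
is opposite to that of `B` (`Good.exists_iso_int`, `Good.exists_iso_half`).

Equivalences of stacks come from one criterion, `Hom.IsLocalEquiv.stackEquiv`: a morphism of group
actions that is fully faithful on action groupoids and étale locally essentially surjective induces
one, with pull-back and induction of torsors as mutually inverse functors. For the double cosets
with half-integral exponents it is applied to `x ↦ xᵀ J x`, which is locally surjective because
invertible forms are étale locally standard (`locCongr_one`, `locCongr_J`). -/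

theorem IsEtaleCover.pi_faithfullyFlat {R : Alg} {ι : Type} [Finite ι] {S : ι → Alg}
    {f : ∀ i, R ⟶ S i} (hf : IsEtaleCover S f) :
    letI (i : ι) : Algebra R (S i) := (f i).hom.toRingHom.toAlgebra
    Module.FaithfullyFlat R (∀ i, S i) := by
  let (i : ι) : Algebra R (S i) := (f i).hom.toRingHom.toAlgebra
  have (i : ι) : Algebra.Etale R (S i) := hf.1 i
  have : Module.Flat R (∀ i, S i) := inferInstance
  refine Module.FaithfullyFlat.of_comap_surjective fun q => ?_
  obtain ⟨i, q₁, h⟩ := hf.2 q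
  exact ⟨PrimeSpectrum.comap (Pi.evalRingHom (fun i => (S i : Type)) i) q₁, h⟩

/-- Descent of elements along a finite étale covering family. -/
theorem IsEtaleCover.existsUnique_ring {R : Alg} {ι : Type} [Finite ι] {S : ι → Alg}
    {f : ∀ i, R ⟶ S i} (hf : IsEtaleCover S f) (x : ∀ i, S i)
    (hx : ∀ (i j : ι) (T : Alg) (g : S i ⟶ T) (h : S j ⟶ T), f i ≫ g = f j ≫ h →
      g.hom (x i) = h.hom (x j)) :
    ∃! r : R, ∀ i, (f i).hom r = x i := by
  classical
  have := Fintype.ofFinite ι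
  let (i : ι) : Algebra R (S i) := (f i).hom.toRingHom.toAlgebra
  have : ∀ i, IsScalarTower ℂ R (S i) := fun i => IsScalarTower.of_algebraMap_eq fun c =>
    ((f i).hom.commutes c).symm
  have := hf.pi_faithfullyFlat
  have hinj : Function.Injective (algebraMap R (∀ i, S i)) := FaithfulSMul.algebraMap_injective _ _
  -- By faithfully flat descent an element of `∏ S i` comes from `R` when its two images in the
  -- tensor square agree. That square is the product of the `S i ⊗[R] S j`, and in each factor the
  -- equality is the hypothesis for `T = S i ⊗[R] S j`.
  have key : x ⊗ₜ[R] (1 : ∀ i, S i) = (1 : ∀ i, S i) ⊗ₜ[R] x := by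
    apply (TensorProduct.piRight R R (∀ i, S i) (fun i => (S i : Type))).injective
    ext j
    apply (TensorProduct.piLeft R (S j) (fun i => (S i : Type))).injective
    ext i
    simp only [TensorProduct.piRight_apply, TensorProduct.piRightHom_tmul,
      Pi.one_apply]
    let T : Alg := CommAlgCat.of ℂ (S i ⊗[R] S j)
    let g : S i ⟶ T := CommAlgCat.ofHom (Algebra.TensorProduct.includeLeft)
    let h : S j ⟶ T := CommAlgCat.ofHom
      ((Algebra.TensorProduct.includeRight : S j →ₐ[R] S i ⊗[R] S j).restrictScalars ℂ)
    have hgh : f i ≫ g = f j ≫ h := by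
      ext r
      exact (Algebra.TensorProduct.tmul_one_eq_one_tmul r)
    exact hx i j T g h hgh
  obtain ⟨r, hr⟩ := (Algebra.IsEffective.of_faithfullyFlat R (∀ i, S i) x).1
    (by simp [key])
  refine ⟨r, fun i => congrFun hr i, fun r' hr' => hinj ?_⟩
  ext i
  exact (hr' i).trans (congrFun hr i).symm

theorem IsEtaleCover.ring_ext {R : Alg} {ι : Type} [Finite ι] {S : ι → Alg}
    {f : ∀ i, R ⟶ S i} (hf : IsEtaleCover S f) {a b : R}
    (h : ∀ i, (f i).hom a = (f i).hom b) : a = b := by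
  have := hf.pi_faithfullyFlat
  let (i : ι) : Algebra R (S i) := (f i).hom.toRingHom.toAlgebra
  exact FaithfulSMul.algebraMap_injective R (∀ i, S i) (funext h)

/-- A non-unit lies in a maximal ideal; at a point of the cover above it, a unit would lie in a
prime ideal. -/
theorem IsEtaleCover.isUnit_of {R : Alg} {ι : Type} {S : ι → Alg}
    {f : ∀ i, R ⟶ S i} (hf : IsEtaleCover S f) {a : R}
    (h : ∀ i, IsUnit ((f i).hom a)) : IsUnit a := by
  by_contra ha
  obtain ⟨m, hm, ham⟩ := exists_max_ideal_of_mem_nonunits ha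
  obtain ⟨i, q', hq'⟩ := hf.2 ⟨m, hm.isPrime⟩
  have : (f i).hom a ∈ q'.asIdeal := by
    have h1 : a ∈ (PrimeSpectrum.comap (f i).hom.toRingHom q').asIdeal := by rw [hq']; exact ham
    exact h1
  exact q'.isPrime.ne_top (Ideal.eq_top_of_isUnit_mem _ this (h i))

theorem IsEtaleCover.matrix_ext {R : Alg} {ι : Type} [Finite ι] {S : ι → Alg}
    {f : ∀ i, R ⟶ S i} (hf : IsEtaleCover S f) {k l : Type} {a b : Matrix k l R}
    (h : ∀ i, a.map (f i).hom = b.map (f i).hom) : a = b := by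
  ext u v
  exact hf.ring_ext fun i => congrFun (congrFun (h i) u) v

theorem IsEtaleCover.existsUnique_matrix {R : Alg} {ι : Type} [Finite ι] {S : ι → Alg}
    {f : ∀ i, R ⟶ S i} (hf : IsEtaleCover S f) {k l : Type} (x : ∀ i, Matrix k l (S i))
    (hx : ∀ (i j : ι) (T : Alg) (g : S i ⟶ T) (h : S j ⟶ T), f i ≫ g = f j ≫ h →
      (x i).map g.hom = (x j).map h.hom) :
    ∃! y : Matrix k l R, ∀ i, y.map (f i).hom = x i := by
  have := fun u v => hf.existsUnique_ring (fun i => x i u v) fun i j T g h hgh =>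
    congrFun (congrFun (hx i j T g h hgh) u) v
  choose y hy _ using this
  exact ⟨Matrix.of y, fun i => by ext u v; exact hy u v i,
    fun y' hy' => hf.matrix_ext fun i => (hy' i).trans (by ext u v; exact (hy u v i).symm)⟩

theorem isEtaleCovering_id (R : Alg) : IsEtaleCovering (𝟙 R) :=
  ⟨fun _ => RingHom.Etale.of_bijective Function.bijective_id, fun q => ⟨(), q, rfl⟩⟩

theorem IsEtaleCovering.comp {R S T : Alg} {f : R ⟶ S} {g : S ⟶ T} (hf : IsEtaleCovering f)
    (hg : IsEtaleCovering g) : IsEtaleCovering (f ≫ g) := by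
  refine ⟨fun _ => RingHom.Etale.stableUnderComposition _ _ (hf.1 ()) (hg.1 ()), fun q => ?_⟩
  obtain ⟨_, q1, rfl⟩ := hf.2 q
  obtain ⟨_, q2, rfl⟩ := hg.2 q1
  exact ⟨(), q2, rfl⟩

/-- Two field-valued points over the same point of `Spec R` have a common extension. -/
theorem exists_common_field {R S : Alg} (f : R ⟶ S) (K : Type) [Field K] [Algebra ℂ K]
    (g : R →ₐ[ℂ] K) (q : PrimeSpectrum S)
    (hq : (PrimeSpectrum.comap f.hom.toRingHom q).asIdeal = RingHom.ker g) :
    ∃ (L : Type) (_ : Field L) (_ : Algebra ℂ L) (a : K →ₐ[ℂ] L) (b : S →ₐ[ℂ] L),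
      a.comp g = b.comp f.hom := by
  let q0 := PrimeSpectrum.comap f.hom.toRingHom q
  let k := q0.asIdeal.ResidueField
  let i : k →+* K := Ideal.ResidueField.lift q0.asIdeal g.toRingHom (le_of_eq hq) (fun r hr => by
    have h1 : r ∉ q0.asIdeal := hr
    have h2 : g r ≠ 0 := fun h => h1 (hq.symm ▸ h)
    exact (isUnit_iff_ne_zero.2 h2 : IsUnit (g r)))
  let j : k →+* q.asIdeal.ResidueField := Ideal.ResidueField.map q0.asIdeal q.asIdeal
    f.hom.toRingHom rfl
  let _ : Algebra k K := i.toAlgebra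
  let _ : Algebra k q.asIdeal.ResidueField := j.toAlgebra
  -- Two extensions of the residue field `k` have a non-zero tensor product, and any residue field
  -- of it contains both.
  have : Nontrivial (K ⊗[k] q.asIdeal.ResidueField) := inferInstance
  obtain ⟨m, hm⟩ := Ideal.exists_maximal (K ⊗[k] q.asIdeal.ResidueField)
  let L := (K ⊗[k] q.asIdeal.ResidueField) ⧸ m
  let a0 : K →+* L := (Ideal.Quotient.mk m).comp Algebra.TensorProduct.includeLeftRingHom
  let _ : Field L := Ideal.Quotient.field m
  let _ : Algebra ℂ L := (a0.comp (algebraMap ℂ K)).toAlgebra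
  let b0 : S →+* L := ((Ideal.Quotient.mk m).comp
    (Algebra.TensorProduct.includeRight : q.asIdeal.ResidueField →ₐ[k] _).toRingHom).comp
      (algebraMap S q.asIdeal.ResidueField)
  have hab : ∀ r : R, a0 (g r) = b0 (f.hom r) := by
    intro r
    have e1 : g r = algebraMap k K (algebraMap R k r) :=
      (Ideal.ResidueField.lift_algebraMap _ _ _ _ r).symm
    have e2 : algebraMap S q.asIdeal.ResidueField (f.hom r) =
        algebraMap k q.asIdeal.ResidueField (algebraMap R k r) :=
      (Ideal.ResidueField.map_algebraMap _ _ _ _ r).symm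
    change Ideal.Quotient.mk m (g r ⊗ₜ[k] 1) =
      Ideal.Quotient.mk m (1 ⊗ₜ[k] algebraMap S q.asIdeal.ResidueField (f.hom r))
    rw [e1, e2, Algebra.TensorProduct.tmul_one_eq_one_tmul]
  refine ⟨L, inferInstance, inferInstance, { a0 with commutes' := fun _ => rfl },
    { b0 with commutes' := fun c => ?_ }, ?_⟩
  · change b0 (algebraMap ℂ S c) = a0 (algebraMap ℂ K c)
    rw [← f.hom.commutes, ← hab, g.commutes]
  · ext r; exact hab r

/-- Base change of a finite étale covering family. -/
theorem IsEtaleCover.exists_pushout {R R' : Alg} {ι : Type} {S : ι → Alg}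
    {f : ∀ i, R ⟶ S i} (hf : IsEtaleCover S f) (g : R ⟶ R') :
    ∃ (S' : ι → Alg) (f' : ∀ i, R' ⟶ S' i) (g' : ∀ i, S i ⟶ S' i),
      IsEtaleCover S' f' ∧ ∀ i, f i ≫ g' i = g ≫ f' i := by
  let _ (i : ι) : Algebra R (S i) := (f i).hom.toRingHom.toAlgebra
  let _ : Algebra R R' := g.hom.toRingHom.toAlgebra
  have (i : ι) : IsScalarTower ℂ R (S i) :=
    IsScalarTower.of_algebraMap_eq fun c => ((f i).hom.commutes c).symm
  have : IsScalarTower ℂ R R' := IsScalarTower.of_algebraMap_eq fun c => (g.hom.commutes c).symm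
  have (i : ι) : Algebra.Etale R (S i) := hf.1 i
  refine ⟨fun i => CommAlgCat.of ℂ (R' ⊗[R] S i),
    fun i => CommAlgCat.ofHom Algebra.TensorProduct.includeLeft,
    fun i => CommAlgCat.ofHom
      ((Algebra.TensorProduct.includeRight : S i →ₐ[R] R' ⊗[R] S i).restrictScalars ℂ),
    ⟨fun i => RingHom.etale_algebraMap.2 (inferInstance : Algebra.Etale R' (R' ⊗[R] S i)), ?_⟩, ?_⟩
  · intro q
    obtain ⟨i, q1, hq1⟩ := hf.2 (PrimeSpectrum.comap g.hom.toRingHom q)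
    let κ := q.asIdeal.ResidueField
    let c : R' →ₐ[ℂ] κ := IsScalarTower.toAlgHom ℂ R' κ
    have hc : ∀ r, c r = 0 ↔ r ∈ q.asIdeal := fun r => Ideal.algebraMap_residueField_eq_zero
    -- Surjectivity is stable under base change: a field containing both the residue field at `q`
    -- and a point of `S i` over the same point of `Spec R` gives a point of `R' ⊗[R] S i` above
    -- `q`.
    obtain ⟨L, _, _, a, b, hab⟩ := exists_common_field (f i) κ (c.comp g.hom) q1 (by
      rw [hq1]; ext r; exact (hc (g.hom r)).symm)
    let _ : Algebra R L := ((a.comp c).comp g.hom).toRingHom.toAlgebra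
    let a' : R' →ₐ[R] L := { (a.comp c).toRingHom with commutes' := fun r => rfl }
    let b' : S i →ₐ[R] L := { b.toRingHom with
      commutes' := fun r => (DFunLike.congr_fun hab r).symm }
    let l : R' ⊗[R] S i →ₐ[R] L := Algebra.TensorProduct.lift a' b' fun _ _ => Commute.all _ _
    refine ⟨i, ⟨RingHom.ker l, RingHom.ker_isPrime _⟩, ?_⟩
    ext r
    change l (r ⊗ₜ 1) = 0 ↔ _
    rw [← hc r, Algebra.TensorProduct.lift_tmul, map_one, mul_one]
    exact map_eq_zero a
  · intro i
    ext r
    exact (Algebra.TensorProduct.tmul_one_eq_one_tmul r).symm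

theorem IsEtaleCovering.exists_pushout {R S R' : Alg} {f : R ⟶ S} (hf : IsEtaleCovering f)
    (g : R ⟶ R') : ∃ (S' : Alg) (f' : R' ⟶ S') (g' : S ⟶ S'),
      IsEtaleCovering f' ∧ f ≫ g' = g ≫ f' := by
  obtain ⟨S', f', g', h, e⟩ := IsEtaleCover.exists_pushout hf g
  exact ⟨S' (), f' (), g' (), h, e ()⟩

/-- A family of étale algebras whose spectra cover `Spec R` can be refined to a single étale
covering, the product of finitely many members. -/
theorem exists_pi_covering {R : Alg} (P : ∀ S : Alg, (R ⟶ S) → Prop)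
    (hloc : ∀ q : PrimeSpectrum R, ∃ (S : Alg) (f : R ⟶ S), f.hom.toRingHom.Etale ∧
      q ∈ Set.range (PrimeSpectrum.comap f.hom.toRingHom) ∧ P S f) :
    ∃ (m : ℕ) (S : Fin m → Alg) (f : ∀ i, R ⟶ S i), (∀ i, P (S i) (f i)) ∧
      IsEtaleCovering (R := R) (S := CommAlgCat.of ℂ (∀ i, S i))
        (CommAlgCat.ofHom (AlgHom.pi fun i => (f i).hom)) := by
  choose S f het hq hP using hloc
  -- Étale maps are flat of finite presentation, hence open, so quasi-compactness leaves finitely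
  -- many of them.
  have hopen : ∀ q, IsOpen (Set.range (PrimeSpectrum.comap (f q).hom.toRingHom)) := fun q => by
    let : Algebra R (S q) := (f q).hom.toRingHom.toAlgebra
    have : Algebra.Etale R (S q) := het q
    exact (PrimeSpectrum.isOpenMap_comap_of_hasGoingDown_of_finitePresentation
      (R := R) (S := S q)).isOpen_range
  obtain ⟨t, ht⟩ := isCompact_univ.elim_finite_subcover
    (fun q => Set.range (PrimeSpectrum.comap (f q).hom.toRingHom)) hopen
    (fun q _ => Set.mem_iUnion.2 ⟨q, hq q⟩)
  let e := t.equivFin.symm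
  refine ⟨t.card, fun i => S (e i), fun i => f (e i), fun i => hP _, ?_, ?_⟩
  · intro _
    let (i : Fin t.card) : Algebra R (S (e i)) := (f (e i)).hom.toRingHom.toAlgebra
    have (i : Fin t.card) : Algebra.Etale R (S (e i)) := het _
    have : Algebra.Etale R (∀ i, S (e i)) := inferInstance
    exact RingHom.etale_algebraMap.2 this
  · intro q
    obtain ⟨q0, hq0, q', hq'⟩ : ∃ q0 ∈ t, q ∈ Set.range (PrimeSpectrum.comap
        (f q0).hom.toRingHom) := by simpa using ht (Set.mem_univ q)
    obtain ⟨i, hi⟩ := e.surjective ⟨q0, hq0⟩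
    have : ∃ q₂ : PrimeSpectrum (S (e i)), PrimeSpectrum.comap (f (e i)).hom.toRingHom q₂ = q := by
      rw [hi]; exact ⟨q', hq'⟩
    obtain ⟨q₂, h⟩ := this
    exact ⟨(), PrimeSpectrum.comap (Pi.evalRingHom (fun i => (S (e i) : Type)) i) q₂, h⟩

/-- An étale covering of the point has a point. -/
theorem IsEtaleCovering.exists_point {S : Alg} {f : cpt ⟶ S} (hf : IsEtaleCovering f) :
    Nonempty (S ⟶ cpt) := by
  obtain ⟨_, q, -⟩ := hf.2 ⟨⊥, Ideal.isPrime_bot⟩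
  have : Nontrivial S := ⟨⟨0, 1, fun h => q.isPrime.ne_top
    ((Ideal.eq_top_iff_one _).2 (h ▸ q.asIdeal.zero_mem))⟩⟩
  have hff : f.hom.toRingHom = algebraMap ℂ S := by
    ext c; exact f.hom.commutes c
  have het : Algebra.Etale ℂ S := by
    rw [← RingHom.etale_algebraMap, ← hff]; exact hf.1 ()
  -- By the Nullstellensatz the residue field at a maximal ideal is finite over `ℂ`, so it maps to
  -- `ℂ`.
  obtain ⟨m, hm⟩ := Ideal.exists_maximal S
  let := Ideal.Quotient.field m
  have : Algebra.FiniteType ℂ (S ⧸ m) :=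
    Algebra.FiniteType.of_surjective (Ideal.Quotient.mkₐ ℂ m) (Ideal.Quotient.mkₐ_surjective ℂ m)
  have : Module.Finite ℂ (S ⧸ m) := finite_of_finite_type_of_isJacobsonRing ℂ (S ⧸ m)
  have : Algebra.IsAlgebraic ℂ (S ⧸ m) := inferInstance
  exact ⟨CommAlgCat.ofHom ((IsAlgClosed.lift (M := ℂ) : (S ⧸ m) →ₐ[ℂ] ℂ).comp
    (Ideal.Quotient.mkₐ ℂ m))⟩

/-- Adjoining a square root of a unit is an étale covering. -/
theorem exists_sqrt_covering {R : Alg} (a : R) (ha : IsUnit a) :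
    ∃ (S : Alg) (f : R ⟶ S), IsEtaleCovering f ∧ ∃ t : S, t * t = f.hom a := by
  obtain ⟨b, hb⟩ := ha.exists_right_inv
  let P : StandardEtalePair R :=
    { f := .X ^ 2 - .C a
      monic_f := Polynomial.monic_X_pow_sub_C a two_ne_zero
      g := 1
      cond := by
        let c : R := algebraMap ℂ R (1 / 2)
        have hc : (2 : R) * c = 1 := by
          rw [← map_ofNat (algebraMap ℂ R) 2, ← map_mul]; norm_num
        -- With `c = 1/2` and `b = a⁻¹`, the Bézout relation is `2X · (bcX) - b · (X² - a) = ab =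
        -- 1`: the derivative is invertible on the roots.
        refine ⟨.C (b * c) * .X, - .C b, 1, ?_⟩
        have h1 : (Polynomial.C a * Polynomial.C b : Polynomial R) = 1 := by
          rw [← Polynomial.C_mul, hb, Polynomial.C_1]
        have h2 : (2 * Polynomial.C c : Polynomial R) = 1 := by
          rw [← map_ofNat Polynomial.C 2, ← Polynomial.C_mul, hc, Polynomial.C_1]
        simp only [Polynomial.derivative_sub, Polynomial.derivative_X_pow, Polynomial.derivative_C,
          Polynomial.C_mul]
        rw [Nat.cast_ofNat, map_ofNat]
        linear_combination (Polynomial.C b * Polynomial.X ^ 2) * h2 + h1 }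
  let _ : Algebra ℂ P.Ring := ((algebraMap R P.Ring).comp (algebraMap ℂ R)).toAlgebra
  have : IsScalarTower ℂ R P.Ring := IsScalarTower.of_algebraMap_eq fun _ => rfl
  refine ⟨CommAlgCat.of ℂ P.Ring, CommAlgCat.ofHom (IsScalarTower.toAlgHom ℂ R P.Ring),
    ⟨?_, ?_⟩, P.X, ?_⟩
  · intro _
    exact RingHom.etale_algebraMap.2 (inferInstance : Algebra.Etale R P.Ring)
  · intro q
    let K := AlgebraicClosure q.asIdeal.ResidueField
    obtain ⟨x, hx⟩ := IsAlgClosed.exists_pow_nat_eq (algebraMap R K a) (n := 2) two_pos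
    have hmap : P.HasMap x := ⟨by simp [P, hx], by simp [P]⟩
    refine ⟨(), ⟨RingHom.ker (P.lift x hmap), RingHom.ker_isPrime _⟩, ?_⟩
    ext r
    change P.lift x hmap (algebraMap R P.Ring r) = 0 ↔ r ∈ q.asIdeal
    rw [AlgHom.commutes, IsScalarTower.algebraMap_apply R q.asIdeal.ResidueField K,
      map_eq_zero, Ideal.algebraMap_residueField_eq_zero]
  · have := P.hasMap_X.1
    have h2 : P.X ^ 2 - algebraMap R P.Ring a = 0 := by simpa [P] using this
    rw [← pow_two]
    exact sub_eq_zero.1 h2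

/-- Localization at an element is étale, with image the corresponding basic open set. -/
theorem exists_localization {R : Alg} (a : R) :
    ∃ (S : Alg) (f : R ⟶ S), f.hom.toRingHom.Etale ∧ IsUnit (f.hom a) ∧
      ∀ q : PrimeSpectrum R, a ∉ q.asIdeal →
        q ∈ Set.range (PrimeSpectrum.comap f.hom.toRingHom) := by
  refine ⟨CommAlgCat.of ℂ (Localization.Away a),
    CommAlgCat.ofHom (IsScalarTower.toAlgHom ℂ R (Localization.Away a)), ?_, ?_, ?_⟩
  · exact RingHom.etale_algebraMap.2 (Algebra.Etale.of_isLocalizationAway a)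
  · exact IsLocalization.Away.algebraMap_isUnit (S := Localization.Away a) a
  · intro q hq
    have := PrimeSpectrum.localization_away_comap_range (Localization.Away a) a
    exact this.symm ▸ hq

/-! ### Sheaves and torsors -/

universe v

/-- The étale sheaf condition, for functors to types in an arbitrary universe. -/
def IsSheaf (P : Alg ⥤ Type v) : Prop :=
  ∀ (R : Alg) (ι : Type) [Finite ι] (S : ι → Alg) (f : ∀ i, R ⟶ S i), IsEtaleCover S f →
    ∀ x : ∀ i, P.obj (S i),
      (∀ (i j : ι) (T : Alg) (g : S i ⟶ T) (h : S j ⟶ T), f i ≫ g = f j ≫ h →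
        P.map g (x i) = P.map h (x j)) →
      ∃! y : P.obj R, ∀ i, P.map (f i) y = x i

theorem IsSheaf.ext {P : Alg ⥤ Type v} (hP : IsSheaf P) {R : Alg} {ι : Type} [Finite ι]
    {S : ι → Alg} {f : ∀ i, R ⟶ S i} (hf : IsEtaleCover S f) {x y : P.obj R}
    (h : ∀ i, P.map (f i) x = P.map (f i) y) : x = y := by
  refine (hP R ι S f hf (fun i => P.map (f i) y) ?_).unique h fun _ => rfl
  intro i j T g k hgk
  have := congrArg (fun a => P.map a y) hgk
  simpa using this

theorem IsSheaf.ext_covering {P : Alg ⥤ Type v} (hP : IsSheaf P) {R S : Alg} {f : R ⟶ S}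
    (hf : IsEtaleCovering f) {x y : P.obj R} (h : P.map f x = P.map f y) : x = y :=
  hP.ext hf fun _ => h

theorem IsSheaf.exists_covering {P : Alg ⥤ Type v} (hP : IsSheaf P) {R S : Alg} {f : R ⟶ S}
    (hf : IsEtaleCovering f) (x : P.obj S)
    (hx : ∀ (T : Alg) (g h : S ⟶ T), f ≫ g = f ≫ h → P.map g x = P.map h x) :
    ∃ y : P.obj R, P.map f y = x := by
  obtain ⟨y, hy, -⟩ := hP R Unit (fun _ => S) (fun _ => f) hf (fun _ => x)
    (fun _ _ T g h hgh => hx T g h hgh)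
  exact ⟨y, hy ()⟩

theorem IsEtaleCover.hom_ext {R Q : Alg} {ι : Type} [Finite ι] {S : ι → Alg}
    {f : ∀ i, R ⟶ S i} (hf : IsEtaleCover S f) {a b : Q ⟶ R} (h : ∀ i, a ≫ f i = b ≫ f i) :
    a = b := by
  ext x
  exact hf.ring_ext fun i => ConcreteCategory.congr_hom (h i) x

/-- Morphisms out of an affine scheme glue. -/
theorem IsEtaleCover.existsUnique_hom {R Q : Alg} {ι : Type} [Finite ι] {S : ι → Alg}
    {f : ∀ i, R ⟶ S i} (hf : IsEtaleCover S f) (x : ∀ i, Q ⟶ S i)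
    (hx : ∀ (i j : ι) (T : Alg) (g : S i ⟶ T) (h : S j ⟶ T), f i ≫ g = f j ≫ h →
      x i ≫ g = x j ≫ h) :
    ∃! y : Q ⟶ R, ∀ i, y ≫ f i = x i := by
  have key := fun q : Q => (hf.existsUnique_ring (fun i => (x i).hom q) fun i j T g h hgh =>
    ConcreteCategory.congr_hom (hx i j T g h hgh) q).exists
  choose y hy using key
  let y' : Q →ₐ[ℂ] R :=
    { toFun := y
      map_one' := hf.ring_ext fun i => by rw [hy]; simp
      map_zero' := hf.ring_ext fun i => by rw [hy]; simp
      map_add' := fun a b => hf.ring_ext fun i => by rw [hy]; simp [hy]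
      map_mul' := fun a b => hf.ring_ext fun i => by rw [hy]; simp [hy]
      commutes' := fun c => hf.ring_ext fun i => by rw [hy]; simp }
  refine ⟨CommAlgCat.ofHom y', fun i => by ext q; exact hy q i, fun z hz => hf.hom_ext fun i => ?_⟩
  rw [hz]
  ext q
  exact (hy q i).symm

namespace GSpace

variable {A A' : GSpace}

/-- Étale locally on the base, a torsor has a section. -/
theorem TorsorObj.exists_section (P : TorsorObj A) {S : Alg} (b : P.R ⟶ S) :
    ∃ (T : Alg) (f : S ⟶ T), IsEtaleCovering f ∧ ∃ p : P.P.obj T, P.π p = b ≫ f := by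
  obtain ⟨S0, f0, h0, p0, hp0⟩ := P.locallyTrivial
  obtain ⟨T, f, g, hf, hfg⟩ := h0.exists_pushout b
  exact ⟨T, f, hf, P.P.map g p0, by rw [P.π_map, hp0, hfg]⟩

theorem TorsorObj.isSheaf' (P : TorsorObj A) : IsSheaf P.P := fun R ι _ => P.isSheaf R ι

/-- An invariant function on a torsor with values in a sheaf comes from the base. -/
theorem TorsorObj.existsUnique_descent (P : TorsorObj A) {S : Alg} (b : P.R ⟶ S)
    {F : Alg ⥤ Type v} (hF : IsSheaf F)
    (w : ∀ (T : Alg) (f : S ⟶ T) (p : P.P.obj T), P.π p = b ≫ f → F.obj T)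
    (w_map : ∀ (T T' : Alg) (f : S ⟶ T) (h : T ⟶ T') (p : P.P.obj T) (hp : P.π p = b ≫ f)
      (hp' : P.π (P.P.map h p) = b ≫ f ≫ h), w T' (f ≫ h) (P.P.map h p) hp' = F.map h (w T f p hp))
    (w_smul : ∀ (T : Alg) (f : S ⟶ T) (k : A.G.obj T) (p : P.P.obj T) (hp : P.π p = b ≫ f)
      (hp' : P.π (k • p) = b ≫ f), w T f (k • p) hp' = w T f p hp) :
    ∃! y : F.obj S, ∀ (T : Alg) (f : S ⟶ T) (p : P.P.obj T) (hp : P.π p = b ≫ f),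
      F.map f y = w T f p hp := by
  -- Two sections over the same point of the base differ by an element of the group, so an invariant
  -- `w` depends only on `f`. This makes the value on one local section compatible on overlaps.
  have w_congr : ∀ (T : Alg) (f f' : S ⟶ T) (p p' : P.P.obj T) (hp : P.π p = b ≫ f)
      (hp' : P.π p' = b ≫ f'), f = f' → w T f p hp = w T f' p' hp' := by
    rintro T f _ p p' hp hp' rfl
    obtain ⟨k, rfl, -⟩ := P.simplyTransitive p p' (hp.trans hp'.symm)
    exact (w_smul T f k p hp hp').symm
  obtain ⟨T0, f0, h0, p0, hp0⟩ := P.exists_section b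
  have hπ : ∀ (T : Alg) (g : T0 ⟶ T), P.π (P.P.map g p0) = b ≫ f0 ≫ g := fun T g => by
    rw [P.π_map, hp0, Category.assoc]
  obtain ⟨y, hy⟩ := hF.exists_covering h0 (w T0 f0 p0 hp0) (fun T g h hgh => by
    rw [← w_map T0 T f0 g p0 hp0 (hπ T g), ← w_map T0 T f0 h p0 hp0 (hπ T h)]
    exact w_congr _ _ _ _ _ _ _ hgh)
  refine ⟨y, fun T f p hp => ?_, fun y' hy' => hF.ext_covering h0
    ((hy' T0 f0 p0 hp0).trans hy.symm)⟩
  obtain ⟨T', f', g', hf', hfg⟩ := h0.exists_pushout f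
  apply hF.ext_covering hf'
  have hp' : P.π (P.P.map f' p) = b ≫ f ≫ f' := by rw [P.π_map, hp, Category.assoc]
  rw [← w_map T T' f f' p hp hp']
  have e1 : F.map f' (F.map f y) = F.map g' (F.map f0 y) := by
    have := congrArg (fun a => F.map a y) hfg
    simpa using this.symm
  rw [e1, hy, ← w_map T0 T' f0 g' p0 hp0 (hπ T' g')]
  exact w_congr _ _ _ _ _ _ _ hfg

/-- Points with the same image lie over the same base point, so they differ by some `g`; this `g`
fixes the image, and freeness of the action on `Q` forces `g = 1`. -/
theorem TorsorHom.app_injective {P Q : TorsorObj A} (a : TorsorHom P Q) [Epi a.base] (S : Alg) :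
    Function.Injective (a.app S) := by
  intro p p' h
  have hπ : P.π p = P.π p' := by
    have := (a.app_π p).symm.trans ((congrArg Q.π h).trans (a.app_π p'))
    exact (cancel_epi _).1 this
  obtain ⟨g, rfl, -⟩ := P.simplyTransitive p p' hπ
  obtain ⟨g', -, hu⟩ := Q.simplyTransitive (a.app S p) (a.app S p) rfl
  have h1 : g = g' := hu g ((a.app_smul g p).symm.trans h.symm)
  have h2 : 1 = g' := hu 1 (one_smul _ _)
  rw [h1, ← h2, one_smul]

/-- A point of `Q` is reached étale locally by translating a local section of `P`; by injectivity
the local preimages agree on overlaps and descend. -/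
theorem TorsorHom.app_surjective {P Q : TorsorObj A} (a : TorsorHom P Q) [IsIso a.base]
    (S : Alg) : Function.Surjective (a.app S) := by
  intro q
  obtain ⟨T, f, hf, p, hp⟩ := P.exists_section (inv a.base ≫ Q.π q)
  obtain ⟨g, hg, -⟩ := Q.simplyTransitive (a.app T p) (Q.P.map f q) (by
    rw [a.app_π, hp, Q.π_map, Category.assoc, IsIso.hom_inv_id_assoc])
  rw [← a.app_smul] at hg
  obtain ⟨p', hp'⟩ := P.isSheaf'.exists_covering hf (g • p) (fun T' h k hhk => by
    apply a.app_injective T'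
    rw [a.app_map, a.app_map, hg]
    have := congrArg (fun a => Q.P.map a q) hhk
    simpa using this)
  refine ⟨p', Q.isSheaf'.ext_covering hf ?_⟩
  rw [← a.app_map, hp', hg]

/-- A morphism of torsors over an isomorphism of the bases is an isomorphism. -/
theorem TorsorHom.isIso {P Q : TorsorObj A} (a : P ⟶ Q) (ha : IsIso (TorsorHom.base a)) :
    IsIso a := by
  have hb : ∀ S, Function.Bijective (TorsorHom.app a S) := fun S =>
    ⟨TorsorHom.app_injective a S, TorsorHom.app_surjective a S⟩
  choose c hc using fun S => Function.bijective_iff_has_inverse.1 (hb S)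
  let b : TorsorHom Q P :=
    { base := inv (TorsorHom.base a)
      app := c
      app_map := fun {S T} f q => by
        apply (hb T).1
        rw [TorsorHom.app_map a, (hc T).2, (hc S).2]
      app_smul := fun {S} g q => by
        apply (hb S).1
        rw [TorsorHom.app_smul a, (hc S).2, (hc S).2]
      app_π := fun {S} q => by
        have := TorsorHom.app_π a (c S q)
        rw [(hc S).2] at this
        rw [this, IsIso.inv_hom_id_assoc]
      app_toX := fun {S} q => by
        have := TorsorHom.app_toX a (c S q)
        rw [(hc S).2] at this
        exact this.symm }
  refine ⟨b, TorsorHom.ext ?_ ?_, TorsorHom.ext ?_ ?_⟩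
  · exact IsIso.inv_hom_id _
  · funext S p; exact (hc S).1 p
  · exact IsIso.hom_inv_id _
  · funext S p; exact (hc S).2 p

end GSpace

namespace GSpace

variable {A A' : GSpace}

/-! ### Equivalences of quotient stacks -/

/-- The map of action groupoids induced by `u` is fully faithful, and étale locally essentially
surjective. -/
structure Hom.IsLocalEquiv (u : Hom A A') : Prop where
  existsUnique : ∀ (R : Alg) (x x' : A.X.obj R) (g' : A'.G.obj R),
    g' • u.onX R x = u.onX R x' → ∃! g : A.G.obj R, u.onG R g = g' ∧ g • x = x'
  exists_locally : ∀ (R : Alg) (y : A'.X.obj R), ∃ (S : Alg) (f : R ⟶ S), IsEtaleCovering f ∧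
    ∃ (g : A'.G.obj S) (x : A.X.obj S), A'.X.map f y = g • u.onX S x

section Pullback

variable {u : Hom A A'} (hu : u.IsLocalEquiv) (hX : IsSheaf A.X) (hX' : IsSheaf A'.X)

abbrev PullbackPt (u : Hom A A') (Q : TorsorObj A') (S : Alg) : Type 1 :=
  {d : Q.P.obj S × A.X.obj S // Q.toX d.1 = u.onX S d.2}

/-- The functor of points of `Q ×_{X'} X`. -/
def pullbackPts (u : Hom A A') (Q : TorsorObj A') : Alg ⥤ Type 1 where
  obj S := PullbackPt u Q S
  map {S T} f := TypeCat.ofHom fun d : PullbackPt u Q S =>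
    (⟨(Q.P.map f d.1.1, A.X.map f d.1.2), by rw [Q.toX_map, d.2, u.onX_map]⟩ : PullbackPt u Q T)
  map_id S := by
    ext d
    · change Q.P.map (𝟙 S) d.1.1 = d.1.1
      simp
    · change A.X.map (𝟙 S) d.1.2 = d.1.2
      simp
  map_comp f g := by
    ext d
    · change Q.P.map (f ≫ g) d.1.1 = Q.P.map g (Q.P.map f d.1.1)
      simp
    · change A.X.map (f ≫ g) d.1.2 = A.X.map g (A.X.map f d.1.2)
      simp

theorem pullbackPts_isSheaf {u : Hom A A'} (hX : IsSheaf A.X) (hX' : IsSheaf A'.X)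
    (Q : TorsorObj A') : IsEtaleSheaf (pullbackPts u Q) := by
  intro R ι _ S f hf (x : ∀ i, PullbackPt u Q (S i)) hx
  obtain ⟨q, hq, hq'⟩ := Q.isSheaf R ι S f hf (fun i => (x i).1.1)
    fun i j T g h hgh => congrArg (fun d : PullbackPt u Q T => d.1.1) (hx i j T g h hgh)
  obtain ⟨y, hy, hy'⟩ := hX R ι S f hf (fun i => (x i).1.2)
    fun i j T g h hgh => congrArg (fun d : PullbackPt u Q T => d.1.2) (hx i j T g h hgh)
  have hqy : Q.toX q = u.onX R y := hX'.ext hf fun i => by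
    rw [← Q.toX_map, ← u.onX_map]
    exact (congrArg Q.toX (hq i)).trans ((x i).2.trans (congrArg (u.onX _) (hy i)).symm)
  refine ⟨(⟨(q, y), hqy⟩ : PullbackPt u Q R), fun i => Subtype.ext (Prod.ext (hq i) (hy i)), ?_⟩
  intro (d : PullbackPt u Q R) hd
  exact Subtype.ext (Prod.ext
    (hq' d.1.1 fun i => congrArg (fun d : PullbackPt u Q (S i) => d.1.1) (hd i))
    (hy' d.1.2 fun i => congrArg (fun d : PullbackPt u Q (S i) => d.1.2) (hd i)))

/-- The pull-back `Q ×_{X'} X` of a `G'`-torsor, as a `G`-torsor. -/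
def pullback (Q : TorsorObj A') : TorsorObj A where
  R := Q.R
  P := pullbackPts u Q
  act S :=
    { smul := fun g (d : PullbackPt u Q S) => (⟨(u.onG S g • d.1.1, g • d.1.2), by
        rw [Q.toX_smul, d.2, u.onX_smul]⟩ : PullbackPt u Q S)
      one_smul := fun (d : PullbackPt u Q S) => Subtype.ext (Prod.ext
        (by change u.onG S 1 • d.1.1 = d.1.1; rw [map_one, one_smul])
        (one_smul _ d.1.2))
      mul_smul := fun g h (d : PullbackPt u Q S) => Subtype.ext (Prod.ext
        (by change u.onG S (g * h) • d.1.1 = u.onG S g • u.onG S h • d.1.1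
            rw [map_mul, mul_smul])
        (mul_smul g h d.1.2)) }
  map_smul {S T} f g (d : PullbackPt u Q S) := Subtype.ext (Prod.ext
    (by change Q.P.map f (u.onG S g • d.1.1) = u.onG T (A.G.map f g) • Q.P.map f d.1.1
        rw [Q.map_smul, u.onG_map])
    (A.map_smul f g d.1.2))
  isSheaf := pullbackPts_isSheaf hX hX' Q
  π {S} (d : PullbackPt u Q S) := Q.π d.1.1
  π_map {S _} f (d : PullbackPt u Q S) := Q.π_map f d.1.1
  π_smul {S} _ (d : PullbackPt u Q S) := Q.π_smul _ d.1.1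
  simplyTransitive {S} (d e : PullbackPt u Q S) hde := by
    obtain ⟨g', hg', hg''⟩ := Q.simplyTransitive d.1.1 e.1.1 hde
    have h1 : g' • u.onX S d.1.2 = u.onX S e.1.2 := by
      rw [← d.2, ← e.2, ← Q.toX_smul, hg']
    obtain ⟨g, ⟨hg1, hg2⟩, hg3⟩ := hu.existsUnique S d.1.2 e.1.2 g' h1
    refine ⟨g, Subtype.ext (Prod.ext ?_ hg2), fun k hk => hg3 k ⟨hg'' _ ?_, ?_⟩⟩
    · change u.onG S g • d.1.1 = e.1.1
      rw [hg1, hg']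
    · exact congrArg (fun d : PullbackPt u Q S => d.1.1) hk
    · exact congrArg (fun d : PullbackPt u Q S => d.1.2) hk
  locallyTrivial := by
    obtain ⟨S, f, hf, q, hq⟩ := Q.locallyTrivial
    -- After a further covering the image of `q` in `X'` is `g' • u x`, so `g'⁻¹ • q` lifts to the
    -- fibre product.
    obtain ⟨T, g, hg, g', x, h⟩ := hu.exists_locally S (Q.toX q)
    refine ⟨T, f ≫ g, hf.comp hg, (⟨(g'⁻¹ • Q.P.map g q, x), ?_⟩ : PullbackPt u Q T), ?_⟩
    · rw [Q.toX_smul, Q.toX_map, h, inv_smul_smul]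
    · change Q.π (g'⁻¹ • Q.P.map g q) = _
      rw [Q.π_smul, Q.π_map, hq]
  toX {S} (d : PullbackPt u Q S) := d.1.2
  toX_map _ _ := rfl
  toX_smul _ _ := rfl

/-- Every section of a `G'`-torsor locally is a translate of a section of the pull-back. -/
theorem exists_pullback_section (hu : u.IsLocalEquiv) (Q : TorsorObj A') {S : Alg} (q : Q.P.obj S) :
    ∃ (T : Alg) (f : S ⟶ T), IsEtaleCovering f ∧ ∃ (g : A'.G.obj T)
      (d : PullbackPt u Q T), Q.P.map f q = g • d.1.1 := by
  obtain ⟨T, f, hf, g, x, h⟩ := hu.exists_locally S (Q.toX q)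
  refine ⟨T, f, hf, g, ⟨(g⁻¹ • Q.P.map f q, x), ?_⟩, (smul_inv_smul _ _).symm⟩
  rw [Q.toX_smul, Q.toX_map, h, inv_smul_smul]

/-- The pull-back functor on torsors. -/
def pullbackFunctor : TorsorObj A' ⥤ TorsorObj A where
  obj Q := pullback hu hX hX' Q
  map {Q Q'} (a : TorsorHom Q Q') :=
    { base := a.base
      app := fun S (d : PullbackPt u Q S) =>
        (⟨(a.app S d.1.1, d.1.2), (a.app_toX d.1.1).trans d.2⟩ : PullbackPt u Q' S)
      app_map := fun {S _} f (d : PullbackPt u Q S) => Subtype.ext (Prod.ext (a.app_map f d.1.1) rfl)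
      app_smul := fun {S} _ (d : PullbackPt u Q S) => Subtype.ext (Prod.ext (a.app_smul _ d.1.1) rfl)
      app_π := fun {S} (d : PullbackPt u Q S) => a.app_π d.1.1
      app_toX := fun _ => rfl }
  map_id _ := rfl
  map_comp _ _ := rfl

section Full

variable {Q Q' : TorsorObj A'}
  (b : TorsorHom (pullback hu hX hX' Q) (pullback hu hX hX' Q'))

/-- A section of `Q` is a translate `g • d.1.1` in many ways. Any two of them differ by an element
of `A.G`, by full faithfulness of `u`, so the candidate value `g • b d` does not depend on the
choice. -/
theorem pullback_hom_smul {T : Alg} (g g' : A'.G.obj T) (d d' : PullbackPt u Q T)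
    (h : g • d.1.1 = g' • d'.1.1) : g • (b.app T d : PullbackPt u Q' T).1.1 = g' • (b.app T d').1.1 := by
  have h1 : (g'⁻¹ * g) • d.1.1 = d'.1.1 := by rw [mul_smul, h, inv_smul_smul]
  have h2 : (g'⁻¹ * g) • u.onX T d.1.2 = u.onX T d'.1.2 := by
    rw [← d.2, ← d'.2, ← Q.toX_smul, h1]
  obtain ⟨k, ⟨hk1, hk2⟩, -⟩ := hu.existsUnique T _ _ _ h2
  let d₁ : (pullback hu hX hX' Q).P.obj T := d
  have h3 : k • d₁ = d' := Subtype.ext (Prod.ext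
    ((congrArg (fun a => a • d.1.1) hk1).trans h1) hk2)
  have h4 : (b.app T d').1.1 = (g'⁻¹ * g) • (b.app T d : PullbackPt u Q' T).1.1 := by
    rw [← h3, b.app_smul, ← hk1]; rfl
  rw [h4, mul_smul, smul_inv_smul]

/-- The relation that characterizes the extension to `Q` of a morphism on the pull-back. -/
def Extends {S : Alg} (q : Q.P.obj S) (r : Q'.P.obj S) : Prop :=
  ∀ (T : Alg) (f : S ⟶ T) (g : A'.G.obj T) (d : PullbackPt u Q T),
    Q.P.map f q = g • d.1.1 → Q'.P.map f r = g • (b.app T d : PullbackPt u Q' T).1.1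

/-- Locally `q = g0 • d0.1.1`, which forces the value `g0 • b d0`. Independence of the presentation
makes these values descend and gives the relation for every other presentation. -/
theorem existsUnique_extends {S : Alg} (q : Q.P.obj S) : ∃! r, Extends hu hX hX' b q r := by
  obtain ⟨T0, f0, h0, g0, d0, e0⟩ := exists_pullback_section hu Q q
  have key : ∀ (T : Alg) (f : S ⟶ T) (h : T0 ⟶ T), f0 ≫ h = f →
      Q.P.map f q = A'.G.map h g0 • ((pullbackPts u Q).map h d0 : PullbackPt u Q T).1.1 := by
    rintro T _ h rfl
    have : Q.P.map h (Q.P.map f0 q) = A'.G.map h g0 • Q.P.map h d0.1.1 := by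
      rw [e0, Q.map_smul]
    refine Eq.trans ?_ this
    simp
  have key2 : ∀ (T : Alg) (h : T0 ⟶ T), Q'.P.map h (g0 • (b.app T0 d0 : PullbackPt u Q' T0).1.1) =
      A'.G.map h g0 • (b.app T ((pullbackPts u Q).map h d0) : PullbackPt u Q' T).1.1 := by
    intro T h
    exact (Q'.map_smul _ _ _).trans (congrArg (fun a => A'.G.map h g0 • a)
      (congrArg (fun d : PullbackPt u Q' T => d.1.1) (b.app_map h d0)).symm)
  obtain ⟨r, hr⟩ := Q'.isSheaf'.exists_covering h0 (g0 • (b.app T0 d0 : PullbackPt u Q' T0).1.1) (fun T h k hhk => by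
    rw [key2, key2]
    exact pullback_hom_smul hu hX hX' b _ _ _ _ ((key T _ h rfl).symm.trans (key T _ k hhk.symm)))
  refine ⟨r, fun T f g d hd => ?_, fun r' hr' => ?_⟩
  · obtain ⟨T', f', g', hf', hfg⟩ := h0.exists_pushout f
    apply Q'.isSheaf'.ext_covering hf'
    have e1 : Q'.P.map f' (Q'.P.map f r) = Q'.P.map g' (Q'.P.map f0 r) := by
      have := congrArg (fun a => Q'.P.map a r) hfg
      simpa using this.symm
    have e2 : Q.P.map (f ≫ f') q =
        A'.G.map f' g • ((pullbackPts u Q).map f' d : PullbackPt u Q T').1.1 := by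
      have : Q.P.map f' (Q.P.map f q) = A'.G.map f' g • Q.P.map f' d.1.1 := by
        rw [hd, Q.map_smul]
      refine Eq.trans ?_ this
      simp
    rw [e1, hr, key2, Q'.map_smul]
    refine (pullback_hom_smul hu hX hX' b _ _ _ _
      ((key T' _ g' hfg).symm.trans e2)).trans ?_
    exact congrArg (fun a => A'.G.map f' g • a)
      (congrArg (fun d : PullbackPt u Q' T' => d.1.1) (b.app_map f' d))
  · exact Q'.isSheaf'.ext_covering h0 ((hr' T0 f0 g0 d0 e0).trans hr.symm)

theorem Extends.map {S T : Alg} (f : S ⟶ T) {q : Q.P.obj S} {r : Q'.P.obj S}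
    (h : Extends hu hX hX' b q r) : Extends hu hX hX' b (Q.P.map f q) (Q'.P.map f r) := by
  intro T' f' g d hd
  have := h T' (f ≫ f') g d (by simpa using hd)
  simpa using this

theorem Extends.smul {S : Alg} (k : A'.G.obj S) {q : Q.P.obj S} {r : Q'.P.obj S}
    (h : Extends hu hX hX' b q r) : Extends hu hX hX' b (k • q) (k • r) := by
  intro T f g d hd
  rw [Q.map_smul] at hd
  rw [Q'.map_smul, h T f ((A'.G.map f k)⁻¹ * g) d (by rw [mul_smul, ← hd, inv_smul_smul]),
    mul_smul, smul_inv_smul]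

/-- The extension to `Q` of a morphism on the pull-back. -/
def extendHom : TorsorHom Q Q' where
  base := b.base
  app S q := (existsUnique_extends hu hX hX' b q).choose
  app_map {S T} f q := ((existsUnique_extends hu hX hX' b (Q.P.map f q)).choose_spec.2 _
    (Extends.map hu hX hX' b f (existsUnique_extends hu hX hX' b q).choose_spec.1)).symm
  app_smul {S} k q := ((existsUnique_extends hu hX hX' b (k • q)).choose_spec.2 _
    (Extends.smul hu hX hX' b k (existsUnique_extends hu hX hX' b q).choose_spec.1)).symm
  app_π {S} q := by
    obtain ⟨T, f, hf, g, d, e⟩ := exists_pullback_section hu Q q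
    have h := (existsUnique_extends hu hX hX' b q).choose_spec.1 T f g d e
    refine IsEtaleCover.hom_ext hf fun _ => ?_
    have hq : Q.π d.1.1 = Q.π q ≫ f := by rw [← Q.π_map, e, Q.π_smul]
    rw [← Q'.π_map, h, Q'.π_smul]
    exact (b.app_π d).trans ((congrArg (fun a => b.base ≫ a) hq).trans (Category.assoc _ _ _).symm)
  app_toX {S} q := by
    obtain ⟨T, f, hf, g, d, e⟩ := exists_pullback_section hu Q q
    have h := (existsUnique_extends hu hX hX' b q).choose_spec.1 T f g d e
    apply hX'.ext_covering hf
    rw [← Q'.toX_map, h, Q'.toX_smul, ← Q.toX_map, e, Q.toX_smul, d.2, (b.app T d : PullbackPt u Q' T).2]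
    have := b.app_toX d
    exact congrArg (fun x => g • u.onX T x) this

theorem extendHom_app {S : Alg} (d : PullbackPt u Q S) :
    (extendHom hu hX hX' b).app S d.1.1 = (b.app S d : PullbackPt u Q' S).1.1 := by
  have := (existsUnique_extends hu hX hX' b d.1.1).choose_spec.1 S (𝟙 S) 1 d (by simp)
  change Exists.choose _ = _
  simpa using this

end Full

instance : (pullbackFunctor hu hX hX').Full where
  map_surjective {Q Q'} b := by
    refine ⟨extendHom hu hX hX' b, TorsorHom.ext rfl ?_⟩
    funext S (d : PullbackPt u Q S)
    exact Subtype.ext (Prod.ext (extendHom_app hu hX hX' b d) (TorsorHom.app_toX b d).symm)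

instance : (pullbackFunctor hu hX hX').Faithful where
  map_injective {Q Q' a a'} h := by
    have hb : TorsorHom.base a = TorsorHom.base a' := congrArg
      (fun c : TorsorHom (pullback hu hX hX' Q) (pullback hu hX hX' Q') => c.base) h
    refine TorsorHom.ext hb ?_
    funext S q
    obtain ⟨T, f, hf, g, d, e⟩ := exists_pullback_section hu Q q
    apply Q'.isSheaf'.ext_covering hf
    rw [← TorsorHom.app_map, ← TorsorHom.app_map, e, TorsorHom.app_smul, TorsorHom.app_smul]
    have h1 := congrFun (congrFun (congrArg
      (fun c : TorsorHom (pullback hu hX hX' Q) (pullback hu hX hX' Q') => c.app) h) T) d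
    have h2 : TorsorHom.app a T d.1.1 = TorsorHom.app a' T d.1.1 := congrArg (fun d : PullbackPt u Q' T => d.1.1) h1
    rw [h2]

end Pullback

end GSpace

/-! ### Extension of the structure group of a torsor. -/

namespace GSpace

variable {A A' : GSpace}

section Induced

/-- A section over `Spec S` of the `G'`-torsor induced from the `G`-torsor `P`: a point `base` of
the base, and a map `φ` to `G'` on the fibre of `P` with `φ (k • p) = φ p * (u k)⁻¹`. -/
structure IndSection (u : Hom A A') (P : TorsorObj A) (S : Alg) : Type 1 where
  base : P.R ⟶ S
  φ : ∀ (T : Alg) (f : S ⟶ T) (p : P.P.obj T), P.π p = base ≫ f → A'.G.obj T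
  φ_map : ∀ (T T' : Alg) (f : S ⟶ T) (h : T ⟶ T') (p : P.P.obj T) (hp : P.π p = base ≫ f)
    (hp' : P.π (P.P.map h p) = base ≫ f ≫ h),
    φ T' (f ≫ h) (P.P.map h p) hp' = A'.G.map h (φ T f p hp)
  φ_smul : ∀ (T : Alg) (f : S ⟶ T) (k : A.G.obj T) (p : P.P.obj T) (hp : P.π p = base ≫ f)
    (hp' : P.π (k • p) = base ≫ f), φ T f (k • p) hp' = φ T f p hp * (u.onG T k)⁻¹

variable {u : Hom A A'} {P : TorsorObj A}

theorem IndSection.ext' {S : Alg} {a b : IndSection u P S} (h : a.base = b.base)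
    (hφ : ∀ (T : Alg) (f : S ⟶ T) (p : P.P.obj T) (hp : P.π p = a.base ≫ f)
      (hp' : P.π p = b.base ≫ f), a.φ T f p hp = b.φ T f p hp') : a = b := by
  obtain ⟨base, φ, _, _⟩ := a
  obtain ⟨base', φ', _, _⟩ := b
  obtain rfl : base = base' := h
  have : φ = φ' := by
    funext T f p hp
    exact hφ T f p hp hp
  subst this
  rfl

/-- Restriction of sections. -/
def IndSection.map {S S' : Alg} (r : S ⟶ S') (a : IndSection u P S) : IndSection u P S' where
  base := a.base ≫ r
  φ T f p hp := a.φ T (r ≫ f) p (by rw [hp, Category.assoc])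
  φ_map T T' f h p hp hp' := by
    simpa using a.φ_map T T' (r ≫ f) h p (by rw [hp, Category.assoc]) (by simpa using hp')
  φ_smul T f k p hp hp' := a.φ_smul T (r ≫ f) k p _ _

theorem IndSection.φ_congr {S T : Alg} (a : IndSection u P S) {f f' : S ⟶ T} (h : f = f')
    (p : P.P.obj T) (hp : P.π p = a.base ≫ f) (hp' : P.π p = a.base ≫ f') :
    a.φ T f p hp = a.φ T f' p hp' := by
  subst h; rfl

theorem IndSection.φ_congr' {S T : Alg} {a b : IndSection u P S} (h : a = b) (f : S ⟶ T)
    (p : P.P.obj T) (hp : P.π p = a.base ≫ f) (hp' : P.π p = b.base ≫ f) :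
    a.φ T f p hp = b.φ T f p hp' := by
  subst h; rfl

variable (u P) in
/-- The functor of points of the induced torsor. -/
def indPts : Alg ⥤ Type 1 where
  obj S := IndSection u P S
  map r := TypeCat.ofHom (IndSection.map r)
  map_id S := by
    refine ConcreteCategory.hom_ext _ _ fun (a : IndSection u P _) => ?_
    refine IndSection.ext' (Category.comp_id _) fun T f p hp hp' => ?_
    exact IndSection.φ_congr a (Category.id_comp f) p _ _
  map_comp r r' := by
    refine ConcreteCategory.hom_ext _ _ fun (a : IndSection u P _) => ?_
    refine IndSection.ext' (Category.assoc _ _ _).symm fun T f p hp hp' => ?_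
    exact IndSection.φ_congr a (Category.assoc _ _ _) p _ _

/-- Since sections are equivariant functions with values in `A'.G`, and not classes in `(A'.G × P) /
A.G`, no sheafification is needed: the sheaf condition is inherited from `A'.G`, one value of `φ` at
a time. -/
theorem indPts_isSheaf (hG' : IsSheaf (A'.G ⋙ forget GrpCat)) : IsEtaleSheaf (indPts u P) := by
  intro R ι _ S f hf (x : ∀ i, IndSection u P (S i)) hx
  have hx' : ∀ (i j : ι) (T : Alg) (g : S i ⟶ T) (h : S j ⟶ T), f i ≫ g = f j ≫ h →
      (x i).map g = (x j).map h := hx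
  obtain ⟨b, hb, hb'⟩ := hf.existsUnique_hom (fun i => (x i).base) fun i j T g h hgh =>
    congrArg IndSection.base (hx' i j T g h hgh)
  -- the value of the glued section is characterized by its restrictions
  have key : ∀ (T : Alg) (c : R ⟶ T) (p : P.P.obj T), P.π p = b ≫ c →
      ∃! y : A'.G.obj T, ∀ (i : ι) (T' : Alg) (g : S i ⟶ T') (h : T ⟶ T') (_ : f i ≫ g = c ≫ h)
        (hp : P.π (P.P.map h p) = (x i).base ≫ g),
        A'.G.map h y = (x i).φ T' g (P.P.map h p) hp := by
    intro T c p hp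
    obtain ⟨S', f', g', hf', hfg⟩ := hf.exists_pushout c
    have hπ : ∀ (i : ι) (T' : Alg) (g : S i ⟶ T') (h : T ⟶ T'), f i ≫ g = c ≫ h →
        P.π (P.P.map h p) = (x i).base ≫ g := by
      intro i T' g h e
      rw [P.π_map, hp, Category.assoc, ← e, ← Category.assoc, hb]
    have compat : ∀ (i j : ι) (T' : Alg) (g : S i ⟶ T') (g₂ : S j ⟶ T') (h : T ⟶ T')
        (e : f i ≫ g = c ≫ h) (e₂ : f j ≫ g₂ = c ≫ h),
        (x i).φ T' g (P.P.map h p) (hπ i T' g h e) =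
          (x j).φ T' g₂ (P.P.map h p) (hπ j T' g₂ h e₂) := by
      intro i j T' g g₂ h e e₂
      have h1 := IndSection.φ_congr' (hx' i j T' g g₂ (e.trans e₂.symm)) (𝟙 T') (P.P.map h p)
        (by rw [Category.comp_id]; exact hπ i T' g h e)
        (by rw [Category.comp_id]; exact hπ j T' g₂ h e₂)
      have h2 := IndSection.φ_congr (x i) (Category.comp_id g) (P.P.map h p)
        (by rw [Category.comp_id]; exact hπ i T' g h e) (hπ i T' g h e)
      have h3 := IndSection.φ_congr (x j) (Category.comp_id g₂) (P.P.map h p)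
        (by rw [Category.comp_id]; exact hπ j T' g₂ h e₂) (hπ j T' g₂ h e₂)
      exact h2.symm.trans (h1.trans h3)
    have φ_map : ∀ (i : ι) (T' T'' : Alg) (g : S i ⟶ T') (h : T ⟶ T') (k : T' ⟶ T'')
        (e : f i ≫ g = c ≫ h) (e' : f i ≫ g ≫ k = c ≫ h ≫ k),
        A'.G.map k ((x i).φ T' g (P.P.map h p) (hπ i T' g h e)) =
          (x i).φ T'' (g ≫ k) (P.P.map (h ≫ k) p) (hπ i T'' _ _ e') := by
      intro i T' T'' g h k e e'
      have h1 : P.P.map k (P.P.map h p) = P.P.map (h ≫ k) p := by simp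
      have h2 := (x i).φ_map T' T'' g k (P.P.map h p) (hπ i T' g h e)
        (by rw [h1]; exact hπ i T'' _ _ e')
      rw [← h2]
      simp only [h1]
    -- The value at `p` over `c : R ⟶ T` is glued along the base change of the covering by `c`;
    -- `compat` shows that the local values depend only on the test map out of `T`.
    obtain ⟨y, hy, hyu⟩ := hG' T ι S' f' hf'
      (fun i => (x i).φ (S' i) (g' i) (P.P.map (f' i) p) (hπ i _ _ _ (hfg i)))
      (fun i j T' g h hgh => by
        have ei : f i ≫ g' i ≫ g = c ≫ f' i ≫ g := by
          rw [← Category.assoc, hfg, Category.assoc]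
        have ej : f j ≫ g' j ≫ h = c ≫ f' j ≫ h := by
          rw [← Category.assoc, hfg, Category.assoc]
        refine (φ_map i _ T' _ _ g (hfg i) ei).trans ?_
        refine Eq.trans ?_ (φ_map j _ T' _ _ h (hfg j) ej).symm
        have ei' : f i ≫ g' i ≫ g = c ≫ f' j ≫ h := by rw [ei, hgh]
        refine Eq.trans ?_ (compat i j T' (g' i ≫ g) (g' j ≫ h) (f' j ≫ h) ei' ej)
        simp only [hgh])
    refine ⟨y, fun i T' g h e hp' => ?_, fun y' hy' => hyu y' fun i => ?_⟩
    · obtain ⟨S'', f'', g'', hf'', hfg''⟩ := IsEtaleCover.exists_pushout hf' h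
      apply hG'.ext hf''
      intro j
      have ej : f j ≫ g' j ≫ g'' j = c ≫ h ≫ f'' j := by
        rw [← Category.assoc, hfg, Category.assoc, hfg'']
      have e' : f i ≫ g ≫ f'' j = c ≫ h ≫ f'' j := by rw [← Category.assoc, e, Category.assoc]
      have e1 : A'.G.map (f'' j) (A'.G.map h y) = A'.G.map (g'' j) (A'.G.map (f' j) y) := by
        have := congrArg (fun a => A'.G.map a y) (hfg'' j)
        simpa using this.symm
      refine e1.trans ?_
      refine (congrArg (A'.G.map (g'' j)) (hy j)).trans ?_
      refine (φ_map j _ _ _ _ (g'' j) (hfg j) (by rw [ej, hfg''])).trans ?_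
      refine Eq.trans ?_ (φ_map i _ _ g h (f'' j) e e').symm
      refine Eq.trans ?_ (compat j i _ _ _ _ ej e')
      simp only [hfg'']
    · exact hy' i (S' i) (g' i) (f' i) (hfg i) _
  choose φ hφ hφu using key
  refine ⟨(⟨b, φ, ?_, ?_⟩ : IndSection u P R), ?_, ?_⟩
  · intro T T' c h p hp hp'
    refine (hφu T' (c ≫ h) (P.P.map h p) hp' _ fun i T'' g k e hp'' => ?_).symm
    have h1 : P.P.map k (P.P.map h p) = P.P.map (h ≫ k) p := by simp
    have := hφ T c p hp i T'' g (h ≫ k) (by rw [e, Category.assoc]) (by rw [← h1]; exact hp'')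
    simp only [h1]
    rw [← this]
    simp
  · intro T c k p hp hp'
    refine (hφu T c (k • p) hp' _ fun i T' g h e hp'' => ?_).symm
    rw [map_mul, map_inv, ← u.onG_map]
    have h1 : P.P.map h (k • p) = A.G.map h k • P.P.map h p := P.map_smul h k p
    have h2 : P.π (P.P.map h p) = (x i).base ≫ g := by
      rw [← hp'', h1, P.π_smul]
    rw [hφ T c p hp i T' g h e h2]
    simp only [h1]
    exact ((x i).φ_smul T' g _ _ h2 (by rw [P.π_smul, h2])).symm
  · intro i
    refine IndSection.ext' (hb i) fun T c p hp hp' => ?_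
    have hp0 : P.π p = b ≫ f i ≫ c := by rw [hp', ← hb, Category.assoc]
    have := hφ T (f i ≫ c) p hp0 i T c (𝟙 T) (by simp) (by simpa using hp')
    change φ T (f i ≫ c) p hp0 = _
    simpa using this
  · intro (y : IndSection u P R) hy
    have hy' : ∀ i, y.map (f i) = x i := hy
    have hyb : y.base = b := hb' y.base fun i => congrArg IndSection.base (hy' i)
    refine IndSection.ext' hyb fun T c p hp hp' => ?_
    refine hφu T c p hp' _ fun i T' g h e hp'' => ?_
    have hpc : P.π (P.P.map h p) = y.base ≫ c ≫ h := by rw [P.π_map, hp, Category.assoc]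
    rw [← y.φ_map T T' c h p hp hpc]
    have h1 := IndSection.φ_congr' (hy' i) g (P.P.map h p)
      (by rw [hpc, ← e]; exact (Category.assoc _ _ _).symm) hp''
    rw [← h1]
    exact IndSection.φ_congr y e.symm _ _ _

/-- The values of two sections with the same base differ by a unique element of `G'`. -/
theorem IndSection.existsUnique_smul (hG' : IsSheaf (A'.G ⋙ forget GrpCat)) {S : Alg}
    (a b : IndSection u P S) (h : a.base = b.base) :
    ∃! g : A'.G.obj S, ∀ (T : Alg) (f : S ⟶ T) (p : P.P.obj T) (hp : P.π p = a.base ≫ f)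
      (hp' : P.π p = b.base ≫ f), A'.G.map f g * a.φ T f p hp = b.φ T f p hp' := by
  have hb : ∀ {T : Alg} {f : S ⟶ T} {p : P.P.obj T}, P.π p = a.base ≫ f → P.π p = b.base ≫ f :=
    fun hp => by rw [← h]; exact hp
  -- In `b.φ p * (a.φ p)⁻¹` the right factors `(u k)⁻¹` cancel, so this quotient is invariant under
  -- `A.G` and comes from the base.
  obtain ⟨g, hg, hgu⟩ := P.existsUnique_descent a.base hG'
    (fun T f p hp => (b.φ T f p (hb hp) * (a.φ T f p hp)⁻¹ : A'.G.obj T))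
    (fun T T' f k p hp hp' => by
      change _ = A'.G.map k _
      rw [a.φ_map T T' f k p hp hp', b.φ_map T T' f k p (hb hp) (hb hp'), map_mul, map_inv])
    (fun T f k p hp hp' => by
      rw [a.φ_smul T f k p hp hp', b.φ_smul T f k p (hb hp) (hb hp')]
      group)
  refine ⟨g, fun T f p hp hp' => ?_, fun g' hg' => hgu g' fun T f p hp => ?_⟩
  · have : A'.G.map f g = b.φ T f p (hb hp) * (a.φ T f p hp)⁻¹ := hg T f p hp
    rw [this, inv_mul_cancel_right]
  · exact eq_mul_inv_of_mul_eq (hg' T f p hp (hb hp))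

/-- The translate of a section. -/
instance (S : Alg) : MulAction (A'.G.obj S) (IndSection u P S) where
  smul g a :=
    { base := a.base
      φ := fun T f p hp => A'.G.map f g * a.φ T f p hp
      φ_map := fun T T' f h p hp hp' => by
        rw [a.φ_map T T' f h p hp hp', map_mul]
        simp
      φ_smul := fun T f k p hp hp' => by
        rw [a.φ_smul T f k p hp hp', mul_assoc] }
  one_smul a := IndSection.ext' rfl fun T f p hp hp' => by
    change A'.G.map f 1 * a.φ T f p hp = _
    rw [map_one, one_mul]
  mul_smul g h a := IndSection.ext' rfl fun T f p hp hp' => by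
    change A'.G.map f (g * h) * a.φ T f p hp = A'.G.map f g * (A'.G.map f h * a.φ T f p hp)
    rw [map_mul, mul_assoc]

theorem IndSection.smul_φ {S : Alg} (g : A'.G.obj S) (a : IndSection u P S) (T : Alg) (f : S ⟶ T)
    (p : P.P.obj T) (hp : P.π p = a.base ≫ f) :
    (g • a).φ T f p hp = A'.G.map f g * a.φ T f p hp := rfl

theorem exists_unique_trans {S T : Alg} (p₀ : P.P.obj S) (f : S ⟶ T) (p : P.P.obj T)
    (hp : P.π p = P.π p₀ ≫ f) : ∃! k : A.G.obj T, k • P.P.map f p₀ = p :=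
  P.simplyTransitive _ _ (by rw [P.π_map, hp])

variable (u) in
/-- The section of the induced torsor defined by a section of the torsor. -/
def toInd {S : Alg} (p₀ : P.P.obj S) : IndSection u P S where
  base := P.π p₀
  -- This is the only equivariant function with value `1` at `p₀`.
  φ T f p hp := (u.onG T (exists_unique_trans p₀ f p hp).choose)⁻¹
  φ_map T T' f h p hp hp' := by
    rw [map_inv, ← u.onG_map]
    congr 2
    refine ((exists_unique_trans p₀ (f ≫ h) _ hp').choose_spec.2 _ ?_).symm
    have := congrArg (P.P.map h) (exists_unique_trans p₀ f p hp).choose_spec.1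
    rw [P.map_smul] at this
    rw [← this]
    simp
  φ_smul T f k p hp hp' := by
    rw [← mul_inv_rev, ← map_mul]
    congr 2
    refine ((exists_unique_trans p₀ f _ hp').choose_spec.2 _ ?_).symm
    have := (exists_unique_trans p₀ f p hp).choose_spec.1
    change _ • _ = _
    rw [mul_smul]
    exact congrArg (fun a => k • a) this

theorem toInd_φ {S T : Alg} (p₀ : P.P.obj S) (f : S ⟶ T) (k : A.G.obj T) (p : P.P.obj T)
    (hp : P.π p = P.π p₀ ≫ f) (hk : k • P.P.map f p₀ = p) :
    (toInd u p₀).φ T f p hp = (u.onG T k)⁻¹ := by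
  have := (exists_unique_trans p₀ f p hp).choose_spec.2 k hk
  change (u.onG T _)⁻¹ = _
  rw [this]

theorem toInd_map {S T : Alg} (f : S ⟶ T) (p : P.P.obj S) :
    toInd u (P.P.map f p) = (toInd u p).map f := by
  refine IndSection.ext' (P.π_map f p) fun T' f' p' hp hp' => ?_
  have hp1 : P.π p' = P.π p ≫ f ≫ f' := by
    have : P.π p' = (P.π p ≫ f) ≫ f' := hp'
    rw [this, Category.assoc]
  obtain ⟨k, hk, -⟩ := exists_unique_trans p (f ≫ f') p' hp1
  rw [toInd_φ (P.P.map f p) f' k p' hp (by rw [← hk]; simp)]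
  exact (toInd_φ p (f ≫ f') k p' hp1 hk).symm

theorem toInd_smul {S : Alg} (k : A.G.obj S) (p : P.P.obj S) :
    toInd u (k • p) = u.onG S k • toInd u p := by
  refine IndSection.ext' (P.π_smul k p) fun T f p' hp hp' => ?_
  have hp1 : P.π p' = P.π p ≫ f := hp'
  obtain ⟨l, hl, -⟩ := exists_unique_trans p f p' hp1
  rw [IndSection.smul_φ, toInd_φ p f l p' hp1 hl, toInd_φ (k • p) f (l * (A.G.map f k)⁻¹) p' hp
    (by rw [P.map_smul, mul_smul, inv_smul_smul, hl]), map_mul, map_inv, ← u.onG_map]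
  group

/-- The equivariant map from the induced torsor to `X'`. -/
theorem IndSection.existsUnique_toX (hX' : IsSheaf A'.X) {S : Alg} (a : IndSection u P S) :
    ∃! y : A'.X.obj S, ∀ (T : Alg) (f : S ⟶ T) (p : P.P.obj T) (hp : P.π p = a.base ≫ f),
      A'.X.map f y = a.φ T f p hp • u.onX T (P.toX p) :=
  P.existsUnique_descent a.base hX' (fun T f p hp => a.φ T f p hp • u.onX T (P.toX p))
    (fun T T' f h p hp hp' => by
      rw [a.φ_map T T' f h p hp hp', P.toX_map, u.onX_map, A'.map_smul])
    (fun T f k p hp hp' => by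
      rw [a.φ_smul T f k p hp hp', P.toX_smul, u.onX_smul, mul_smul, inv_smul_smul])

variable (u P) in
/-- The `G'`-torsor induced from a `G`-torsor. -/
def induced (hG' : IsSheaf (A'.G ⋙ forget GrpCat)) (hX' : IsSheaf A'.X) : TorsorObj A' where
  R := P.R
  P := indPts u P
  act S := inferInstanceAs (MulAction (A'.G.obj S) (IndSection u P S))
  map_smul {S T} f g (a : IndSection u P S) :=
    IndSection.ext' rfl fun T' f' p hp hp' => by
      change A'.G.map (f ≫ f') g * _ = A'.G.map f' (A'.G.map f g) * _
      simp
      rfl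
  isSheaf := indPts_isSheaf hG'
  π {S} (a : IndSection u P S) := a.base
  π_map _ _ := rfl
  π_smul _ _ := rfl
  simplyTransitive {S} (a b : IndSection u P S) h := by
    obtain ⟨g, hg, hgu⟩ := IndSection.existsUnique_smul hG' a b h
    refine ⟨g, IndSection.ext' h fun T f p hp hp' => hg T f p hp hp', fun g' hg' => ?_⟩
    refine hgu g' fun T f p hp hp' => ?_
    have e : g' • a = b := hg'
    exact IndSection.φ_congr' e f p hp hp'
  locallyTrivial := by
    obtain ⟨S, f, hf, p, hp⟩ := P.locallyTrivial
    exact ⟨S, f, hf, toInd u p, hp⟩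
  toX {S} (a : IndSection u P S) := (a.existsUnique_toX hX').choose
  toX_map {S T} f (a : IndSection u P S) := by
    refine (((a.map f).existsUnique_toX hX').choose_spec.2 _ fun T' f' p hp => ?_).symm
    have hp1 : P.π p = a.base ≫ f ≫ f' := by
      have : P.π p = (a.base ≫ f) ≫ f' := hp
      rw [this, Category.assoc]
    have := (a.existsUnique_toX hX').choose_spec.1 T' (f ≫ f') p hp1
    refine Eq.trans ?_ this
    simp
  toX_smul {S} g (a : IndSection u P S) := by
    refine (((g • a).existsUnique_toX hX').choose_spec.2 _ fun T f p hp => ?_).symm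
    rw [A'.map_smul, (a.existsUnique_toX hX').choose_spec.1 T f p hp, IndSection.smul_φ, mul_smul]

theorem induced_toX (hG' : IsSheaf (A'.G ⋙ forget GrpCat)) (hX' : IsSheaf A'.X) {S : Alg}
    (p : P.P.obj S) : (induced u P hG' hX').toX (S := S) (toInd u p) = u.onX S (P.toX p) := by
  refine (((toInd u p).existsUnique_toX hX').choose_spec.2 _ fun T f p' hp => ?_).symm
  obtain ⟨k, rfl, -⟩ := exists_unique_trans p f p' hp
  rw [toInd_φ p f k _ hp rfl, P.toX_smul, u.onX_smul, inv_smul_smul, P.toX_map, u.onX_map]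

end Induced

end GSpace

/-! ### Pull-back and induction as inverse functors over the category of affine schemes. -/

namespace GSpace

variable {A A' : GSpace}

section Equiv

variable {u : Hom A A'} (hu : u.IsLocalEquiv) (hX : IsSheaf A.X) (hX' : IsSheaf A'.X)
  (hG' : IsSheaf (A'.G ⋙ forget GrpCat))

/-- A torsor maps to the pull-back of the torsor induced from it. -/
def toPullbackInduced (P : TorsorObj A) :
    P ⟶ (pullbackFunctor hu hX hX').obj (induced u P hG' hX') :=
  ({ base := 𝟙 _
     app := fun S p => (⟨(toInd u p, P.toX p), induced_toX hG' hX' p⟩ :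
      PullbackPt u (induced u P hG' hX') S)
     app_map := fun f p => Subtype.ext (Prod.ext (toInd_map f p) (P.toX_map f p))
     app_smul := fun k p => Subtype.ext (Prod.ext (toInd_smul k p) (P.toX_smul k p))
     app_π := fun _ => (Category.id_comp _).symm
     app_toX := fun _ => rfl } :
    TorsorHom P (pullback hu hX hX' (induced u P hG' hX')))

/-- A morphism of torsors covering an isomorphism of the bases is invertible, and here the bases are
equal. -/
instance (P : TorsorObj A) : IsIso (toPullbackInduced hu hX hX' hG' P) :=
  TorsorHom.isIso _ (inferInstanceAs (IsIso (𝟙 P.R)))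

/-- The unit isomorphism, on torsors. -/
def inducedIso (P : TorsorObj A) : (pullbackFunctor hu hX hX').obj (induced u P hG' hX') ≅ P :=
  (asIso (toPullbackInduced hu hX hX' hG' P)).symm

theorem base_comp {P Q R : TorsorObj A} (a : P ⟶ Q) (b : Q ⟶ R) :
    TorsorHom.base (a ≫ b) = TorsorHom.base b ≫ TorsorHom.base a := rfl

theorem inducedIso_inv_base (P : TorsorObj A) :
    TorsorHom.base (inducedIso hu hX hX' hG' P).inv = 𝟙 P.R := rfl

theorem inducedIso_hom_base (P : TorsorObj A) :
    TorsorHom.base (inducedIso hu hX hX' hG' P).hom = 𝟙 P.R := by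
  have h := congrArg TorsorHom.base (inducedIso hu hX hX' hG' P).inv_hom_id
  have h2 : TorsorHom.base (inducedIso hu hX hX' hG' P).hom ≫ 𝟙 P.R = 𝟙 P.R := h
  exact (Category.comp_id _).symm.trans h2

theorem preimage_base {Q Q' : TorsorObj A'} (b : (pullbackFunctor hu hX hX').obj Q ⟶
    (pullbackFunctor hu hX hX').obj Q') :
    TorsorHom.base ((pullbackFunctor hu hX hX').preimage b) = TorsorHom.base b :=
  congrArg TorsorHom.base ((pullbackFunctor hu hX hX').map_preimage b)

/-- The induction functor on torsors, inverse to the pull-back functor. -/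
def inducedFunctor : TorsorObj A ⥤ TorsorObj A' where
  obj P := induced u P hG' hX'
  -- Pull-back is fully faithful, so morphisms between induced torsors may be prescribed after
  -- pulling back; functoriality then follows from faithfulness.
  map {P Q} a := (pullbackFunctor hu hX hX').preimage
    ((inducedIso hu hX hX' hG' P).hom ≫ a ≫ (inducedIso hu hX hX' hG' Q).inv)
  map_id P := by
    apply (pullbackFunctor hu hX hX').map_injective
    simp
  map_comp a b := by
    apply (pullbackFunctor hu hX hX').map_injective
    simp

theorem inducedFunctor_map_base {P Q : TorsorObj A} (a : P ⟶ Q) :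
    TorsorHom.base ((inducedFunctor hu hX hX' hG').map a) = TorsorHom.base a := by
  refine (preimage_base hu hX hX' _).trans ?_
  rw [base_comp, base_comp, inducedIso_inv_base, inducedIso_hom_base]
  exact (Category.comp_id _).trans (Category.id_comp _)

theorem pullback_map_inducedFunctor_map {P Q : TorsorObj A} (a : P ⟶ Q) :
    (pullbackFunctor hu hX hX').map ((inducedFunctor hu hX hX' hG').map a) =
      (inducedIso hu hX hX' hG' P).hom ≫ a ≫ (inducedIso hu hX hX' hG' Q).inv :=
  (pullbackFunctor hu hX hX').map_preimage _

/-- Induction followed by pull-back is isomorphic to the identity. -/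
def inducedPullbackIso :
    inducedFunctor hu hX hX' hG' ⋙ pullbackFunctor hu hX hX' ≅ 𝟭 (TorsorObj A) :=
  NatIso.ofComponents (fun P => inducedIso hu hX hX' hG' P) (fun {P Q} a => by
    have h : ((inducedIso hu hX hX' hG' P).hom ≫ a ≫ (inducedIso hu hX hX' hG' Q).inv) ≫
      (inducedIso hu hX hX' hG' Q).hom = (inducedIso hu hX hX' hG' P).hom ≫ a := by simp
    exact (congrArg (fun b => b ≫ (inducedIso hu hX hX' hG' Q).hom)
      (pullback_map_inducedFunctor_map hu hX hX' hG' a)).trans h)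

/-- Pull-back followed by induction is isomorphic to the identity. -/
def pullbackInducedIso :
    𝟭 (TorsorObj A') ≅ pullbackFunctor hu hX hX' ⋙ inducedFunctor hu hX hX' hG' :=
  NatIso.ofComponents (fun Q => ((pullbackFunctor hu hX hX').preimageIso (inducedIso hu hX hX' hG'
      ((pullbackFunctor hu hX hX').obj Q))).symm) (fun {P Q} a => by
    apply (pullbackFunctor hu hX hX').map_injective
    let e := fun Q => inducedIso hu hX hX' hG' ((pullbackFunctor hu hX hX').obj Q)
    have h1 : (pullbackFunctor hu hX hX').map (a ≫ (pullbackFunctor hu hX hX').preimage (e Q).inv) =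
        (pullbackFunctor hu hX hX').map a ≫ (e Q).inv := by
      rw [Functor.map_comp, Functor.map_preimage]
    have h2 : (pullbackFunctor hu hX hX').map ((pullbackFunctor hu hX hX').preimage (e P).inv ≫
        (pullbackFunctor hu hX hX').preimage
          ((e P).hom ≫ (pullbackFunctor hu hX hX').map a ≫ (e Q).inv)) =
        (pullbackFunctor hu hX hX').map a ≫ (e Q).inv := by
      rw [Functor.map_comp, Functor.map_preimage, Functor.map_preimage, Iso.inv_hom_id_assoc]
    exact h1.trans h2.symm)

/-- Pull-back, over the category of affine schemes. -/
def pullbackBased : BasedFunctor A'.quotientStack A.quotientStack where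
  __ := pullbackFunctor hu hX hX'
  w := rfl

/-- Induction, over the category of affine schemes. -/
def inducedBased : BasedFunctor A.quotientStack A'.quotientStack where
  __ := inducedFunctor hu hX hX' hG'
  w := CategoryTheory.Functor.ext (fun _ => rfl) fun P Q a => by
    refine (congrArg Quiver.Hom.op (inducedFunctor_map_base hu hX hX' hG' a)).trans ?_
    exact ((Category.id_comp _).trans (Category.comp_id _)).symm

/-- Natural isomorphisms over the category of affine schemes must have components lying over
identities; this is the form in which that condition is checked for the unit and the counit. -/
theorem isHomLift_id {P Q : TorsorObj A} (h : P.R = Q.R) (a : P ⟶ Q)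
    (ha : TorsorHom.base a = eqToHom h.symm) :
    A.quotientStack.p.IsHomLift (𝟙 (op P.R)) a := by
  have h1 : (TorsorHom.base a).op = eqToHom (congrArg op h) := by rw [ha, eqToHom_op]
  have h2 : 𝟙 (op P.R) = eqToHom rfl ≫ (TorsorHom.base a).op ≫ eqToHom (congrArg op h.symm) := by
    rw [h1, eqToHom_trans, eqToHom_trans, eqToHom_refl]
  exact IsHomLift.of_fac A.quotientStack.p _ _ rfl (congrArg op h.symm) h2

/-- The counit of the equivalence. -/
def counitIso : inducedBased hu hX hX' hG' ≫ pullbackBased hu hX hX' ≅ 𝟙 A.quotientStack :=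
  BasedNatIso.mkNatIso (inducedPullbackIso hu hX hX' hG') fun P =>
    isHomLift_id (A := A) (P := (pullbackFunctor hu hX hX').obj (induced u P hG' hX')) (Q := P) rfl
      (inducedIso hu hX hX' hG' P).hom (inducedIso_hom_base hu hX hX' hG' P)

/-- The unit of the equivalence. -/
def unitIso : 𝟙 A'.quotientStack ≅ pullbackBased hu hX hX' ≫ inducedBased hu hX hX' hG' :=
  BasedNatIso.mkNatIso (pullbackInducedIso hu hX hX' hG') fun (Q : TorsorObj A') =>
    isHomLift_id (A := A') (P := Q)
      (Q := induced u ((pullbackFunctor hu hX hX').obj Q) hG' hX') rfl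
      ((pullbackFunctor hu hX hX').preimage
        (inducedIso hu hX hX' hG' ((pullbackFunctor hu hX hX').obj Q)).inv)
      (preimage_base hu hX hX' _)

/-- The criterion behind every equivalence of stacks below. The sheaf conditions on `A.X` and `A'.X`
make the pull-back a torsor and let its morphisms extend; those on `A'.G` and `A'.X` do the same for
induction. The equivalence goes in the direction of pull-back, from `A'` to `A`. -/
theorem Hom.IsLocalEquiv.stackEquiv (hu : u.IsLocalEquiv) (hX : IsSheaf A.X) (hX' : IsSheaf A'.X)
    (hG' : IsSheaf (A'.G ⋙ forget GrpCat)) : StackEquiv A' A :=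
  ⟨Bicategory.Equivalence.mkOfAdjointifyCounit (unitIso hu hX hX' hG') (counitIso hu hX hX' hG')⟩

end Equiv

end GSpace

/-! ### Formal properties of morphisms between group actions. -/

namespace GSpace

variable {A A' A'' : GSpace}

/-- Full faithfulness is the criterion for equality in the contracted product, applied to the pairs
`(g', x)` and `(1, x')`. -/
theorem Hom.IsContractedProduct.isLocalEquiv {u : Hom A A'} (hu : u.IsContractedProduct) :
    u.IsLocalEquiv where
  existsUnique R x x' g' h := by
    obtain ⟨k, ⟨hk1, hk2⟩, hk3⟩ := (hu.1 R g' 1 x x').1 (by rw [h, one_smul])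
    refine ⟨k, ⟨(mul_inv_eq_one.1 hk1.symm).symm, hk2.symm⟩, fun l hl => hk3 l ⟨?_, hl.2.symm⟩⟩
    rw [hl.1, mul_inv_cancel]
  exists_locally := hu.2

/-- The composition of two morphisms. -/
def Hom.comp (u : Hom A A') (w : Hom A' A'') : Hom A A'' where
  onG R := (w.onG R).comp (u.onG R)
  onG_map f g := by
    change w.onG _ (u.onG _ _) = A''.G.map f (w.onG _ (u.onG _ _))
    rw [u.onG_map, w.onG_map]
  onX R x := w.onX R (u.onX R x)
  onX_map f x := by rw [u.onX_map, w.onX_map]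
  onX_smul g x := by rw [u.onX_smul, w.onX_smul]; rfl

theorem Hom.IsIso.exists_inv {u : Hom A A'} (hu : u.IsIso) : ∃ w : Hom A' A, w.IsIso := by
  let eG := fun R => MulEquiv.ofBijective (u.onG R) (hu R).1
  let eX := fun R => Equiv.ofBijective (u.onX R) (hu R).2
  refine ⟨{ onG := fun R => (eG R).symm.toMonoidHom
            onG_map := fun {R S} f g => (hu S).1.1 ?_
            onX := fun R => (eX R).symm
            onX_map := fun {R S} f x => (hu S).2.1 ?_
            onX_smul := fun {R} g x => (hu R).2.1 ?_ },
    fun R => ⟨(eG R).symm.bijective, (eX R).symm.bijective⟩⟩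
  · rw [u.onG_map]
    exact ((eG S).apply_symm_apply _).trans
      (congrArg (A'.G.map f) ((eG R).apply_symm_apply g).symm)
  · rw [u.onX_map]
    exact ((eX S).apply_symm_apply _).trans
      (congrArg (A'.X.map f) ((eX R).apply_symm_apply x).symm)
  · rw [u.onX_smul]
    refine ((eX R).apply_symm_apply _).trans ?_
    exact (congrArg₂ (fun (a : A'.G.obj R) (b : A'.X.obj R) => a • b)
      ((eG R).apply_symm_apply g) ((eX R).apply_symm_apply x)).symm

theorem Hom.IsLocalEquiv.comp_isIso {u : Hom A A'} {w : Hom A' A''} (hu : u.IsLocalEquiv)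
    (hw : w.IsIso) : (u.comp w).IsLocalEquiv where
  existsUnique R x x' g' h := by
    obtain ⟨g₁, rfl⟩ := (hw R).1.2 g'
    have h1 : g₁ • u.onX R x = u.onX R x' := (hw R).2.1 (by rw [w.onX_smul]; exact h)
    obtain ⟨k, ⟨hk1, hk2⟩, hk3⟩ := hu.existsUnique R x x' g₁ h1
    exact ⟨k, ⟨congrArg (w.onG R) hk1, hk2⟩, fun l hl => hk3 l ⟨(hw R).1.1 hl.1, hl.2⟩⟩
  exists_locally R y := by
    obtain ⟨y₁, rfl⟩ := (hw R).2.2 y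
    obtain ⟨S, f, hf, g, x, h⟩ := hu.exists_locally R y₁
    refine ⟨S, f, hf, w.onG S g, x, ?_⟩
    rw [← w.onX_map, h, w.onX_smul]
    rfl

theorem Hom.IsIso.isLocalEquiv {u : Hom A A'} (hu : u.IsIso) : u.IsLocalEquiv where
  existsUnique R x x' g' h := by
    obtain ⟨g, rfl⟩ := (hu R).1.2 g'
    exact ⟨g, ⟨rfl, (hu R).2.1 (by rw [u.onX_smul, h])⟩, fun l hl => (hu R).1.1 hl.1⟩
  exists_locally R y := by
    obtain ⟨x, rfl⟩ := (hu R).2.2 y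
    exact ⟨R, 𝟙 R, isEtaleCovering_id R, 1, x, by simp⟩

end GSpace

/-! ### Spaces of matrices are sheaves -/

/-- Membership in the space of matrices is étale local. -/
def MatSpace.IsLocal {k : ℕ} (X : MatSpace k) : Prop :=
  ∀ (R : Alg) (ι : Type) [Finite ι] (S : ι → Alg) (f : ∀ i, R ⟶ S i), IsEtaleCover S f →
    ∀ x : Matrix (Fin k) (Fin k) R, (∀ i, x.map (f i).hom ∈ X.pts (S i)) → x ∈ X.pts R

/-- Membership in the matrix group is étale local. -/
def MatGroup.IsLocal {k : ℕ} (H : MatGroup k) : Prop :=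
  ∀ (R : Alg) (ι : Type) [Finite ι] (S : ι → Alg) (f : ∀ i, R ⟶ S i), IsEtaleCover S f →
    ∀ g : GL (Fin k) R, (∀ i, glMap (f i) g ∈ H.pts (S i)) → g ∈ H.pts R

theorem MatSpace.IsLocal.isSheaf {k : ℕ} {X : MatSpace k} (hX : X.IsLocal) :
    IsSheaf X.toFunctor := by
  intro R ι _ S f hf (x : ∀ i, X.pts (S i)) hx
  obtain ⟨y, hy, hyu⟩ := hf.existsUnique_matrix (fun i => (x i).1) fun i j T g h hgh =>
    congrArg (fun a : X.pts T => a.1) (hx i j T g h hgh)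
  refine ⟨(⟨y, hX R ι S f hf y fun i => by rw [hy]; exact (x i).2⟩ : X.pts R),
    fun i => Subtype.ext (hy i), fun (y' : X.pts R) hy' => Subtype.ext (hyu y'.1 fun i => ?_)⟩
  exact congrArg (fun a : X.pts (S i) => a.1) (hy' i)

theorem MatGroup.IsLocal.isSheaf {k : ℕ} {H : MatGroup k} (hH : H.IsLocal) :
    IsSheaf (H.toFunctor ⋙ forget GrpCat) := by
  intro R ι _ S f hf (x : ∀ i, H.pts (S i)) hx
  have hx' : ∀ (i j : ι) (T : Alg) (g : S i ⟶ T) (h : S j ⟶ T), f i ≫ g = f j ≫ h →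
      glMap g (x i).1 = glMap h (x j).1 := fun i j T g h hgh =>
    congrArg (fun a : H.pts T => a.1) (hx i j T g h hgh)
  obtain ⟨y, hy, hyu⟩ := hf.existsUnique_matrix (fun i => (x i).1.1) fun i j T g h hgh =>
    congrArg Units.val (hx' i j T g h hgh)
  have hdet : IsUnit y.det := hf.isUnit_of fun i => by
    have h1 : (f i).hom y.det = (y.map (f i).hom).det := RingHom.map_det (f i).hom.toRingHom y
    rw [h1, hy]
    exact (Matrix.isUnit_iff_isUnit_det _).1 (x i).1.isUnit
  let g : GL (Fin k) R := Matrix.GeneralLinearGroup.mk'' y hdet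
  have hg : ∀ i, glMap (f i) g = (x i).1 := fun i => Units.ext (hy i)
  refine ⟨(⟨g, hH R ι S f hf g fun i => by rw [hg]; exact (x i).2⟩ : H.pts R),
    fun i => Subtype.ext (hg i), fun (y' : H.pts R) hy' =>
      Subtype.ext (Units.ext (hyu y'.1.1 fun i => ?_))⟩
  exact congrArg (fun a : H.pts (S i) => a.1.1) (hy' i)

theorem glSpace_isLocal (k : ℕ) : (glSpace k).IsLocal := by
  intro R ι _ S f hf x hx
  refine hf.isUnit_of fun i => ?_
  have h1 : (f i).hom x.det = (x.map (f i).hom).det := RingHom.map_det (f i).hom.toRingHom x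
  rw [h1]
  exact hx i

theorem formSpace_isLocal (k : ℕ) (c : ℤ) : (formSpace k c).IsLocal := by
  intro R ι _ S f hf x hx
  refine ⟨hf.matrix_ext fun i => ?_, glSpace_isLocal k R ι S f hf x fun i => (hx i).2⟩
  rw [Matrix.transpose_map, (hx i).1]
  ext a b
  simp only [Matrix.map_apply, Matrix.smul_apply, map_zsmul]

theorem MatGroup.IsLocal.inter {k : ℕ} {H K : MatGroup k} (hH : H.IsLocal) (hK : K.IsLocal) :
    (H.inter K).IsLocal := fun R ι _ S f hf g hg =>
  ⟨hH R ι S f hf g fun i => (hg i).1, hK R ι S f hf g fun i => (hg i).2⟩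

theorem isomGroup_isLocal {k : ℕ} (B : Matrix (Fin k) (Fin k) ℂ) : (isomGroup B).IsLocal := by
  intro R ι _ S f hf g hg
  refine hf.matrix_ext fun i => ?_
  rw [Matrix.map_mul, Matrix.map_mul, bc_map, Matrix.transpose_map]
  exact hg i

theorem slGroup_isLocal (k : ℕ) : (slGroup k).IsLocal := by
  intro R ι _ S f hf g hg
  refine Units.ext (hf.ring_ext fun i => ?_)
  have h1 : Matrix.GeneralLinearGroup.det (glMap (f i) g) = 1 := hg i
  rw [Matrix.GeneralLinearGroup.map_det] at h1
  exact (congrArg Units.val h1).trans (map_one (f i).hom).symm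

theorem centralizerGroup_isLocal {k : ℕ} (x : Matrix (Fin k) (Fin k) ℂ) :
    (centralizerGroup x).IsLocal := by
  intro R ι _ S f hf g hg
  refine hf.matrix_ext fun i => ?_
  rw [Matrix.map_mul, Matrix.map_mul, bc_map]
  exact hg i

theorem hGroup_isLocal {N : ℕ} (B : Matrix (Fin N) (Fin N) ℂ) (s : GL (Fin N) ℂ) :
    (hGroup B s).IsLocal :=
  ((isomGroup_isLocal B).inter (slGroup_isLocal N)).inter (centralizerGroup_isLocal s.1)

theorem hStab_isLocal {N : ℕ} (B : Matrix (Fin N) (Fin N) ℂ) (s : GL (Fin N) ℂ)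
    (z : Matrix (Fin N) (Fin N) ℂ) : (hStab B s z).IsLocal :=
  (hGroup_isLocal B s).inter (centralizerGroup_isLocal z)

/-! ### Spectral projectors -/

section Pw

variable (p : ℕ) [hp : Fact p.Prime]

theorem pw_injective : Function.Injective (pw p) := by
  intro i j h
  have h1 : ((p : ℝ) ^ i : ℝ) = (p : ℝ) ^ j := Complex.ofReal_injective h
  have hp1 : (1 : ℝ) < p := by exact_mod_cast hp.out.one_lt
  exact (Real.rpow_right_inj (by linarith) (by linarith)).1 h1

theorem pw_ne_zero (i : ℝ) : pw p i ≠ 0 := by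
  have hp1 : (0 : ℝ) < p := by exact_mod_cast hp.out.pos
  exact Complex.ofReal_ne_zero.2 (Real.rpow_pos_of_pos hp1 i).ne'

theorem pw_add_one (i : ℝ) : pw p (i + 1) = p * pw p i := by
  have hp1 : (0 : ℝ) < p := by exact_mod_cast hp.out.pos
  rw [pw, Real.rpow_add hp1, Real.rpow_one, mul_comm]
  push_cast
  rfl

theorem pw_neg_mul (i : ℝ) : pw p (-i) * pw p i = 1 := by
  have hp1 : (0 : ℝ) < p := by exact_mod_cast hp.out.pos
  rw [pw, pw, ← Complex.ofReal_mul, ← Real.rpow_add hp1, neg_add_cancel, Real.rpow_zero,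
    Complex.ofReal_one]

end Pw

/-- The projectors onto the eigenspaces `W_i`. -/
structure Grading {N : ℕ} (p : ℕ) (s : GL (Fin N) ℂ) (σ : SupportKind) where
  e : ℝ → Matrix (Fin N) (Fin N) ℂ
  I : Finset ℝ
  eq_zero : ∀ i ∉ I, e i = 0
  mem_exponents : ∀ i ∈ I, i ∈ σ.exponents
  sum_e : ∑ i ∈ I, e i = 1
  s_mul : ∀ i, s.1 * e i = pw p i • e i
  mul_s : ∀ i, e i * s.1 = pw p i • e i

/-- The projectors are Lagrange interpolation polynomials in `s`, so they commute with `s`. By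
semisimplicity eigenvectors span `W`, hence identities between operators may be tested on them.
Unimodality serves only to know that there is an eigenvalue, without which the interpolation
polynomials would not sum to one. -/
theorem exists_grading {N : ℕ} (p : ℕ) [Fact p.Prime] (s : GL (Fin N) ℂ)
    (hss : Module.End.IsSemisimple (Matrix.toLin' s.1)) (σ : SupportKind)
    (hσ : SupportedIn p s σ) (huni : Unimodal p s) : Nonempty (Grading p s σ) := by
  classical
  let f : Module.End ℂ (Fin N → ℂ) := Matrix.toLin' s.1
  let Z : Finset ℂ := (minpoly ℂ f).roots.toFinset
  have hZ : ∀ μ, μ ∈ Z ↔ f.HasEigenvalue μ := fun μ => by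
    rw [Module.End.hasEigenvalue_iff_isRoot, Multiset.mem_toFinset,
      Polynomial.mem_roots (minpoly.ne_zero (Algebra.IsIntegral.isIntegral f))]
  have hne : Z.Nonempty := by
    obtain ⟨i, hi, -⟩ := huni
    exact ⟨_, (hZ _).2 hi⟩
  have hex : ∀ μ ∈ Z, ∃ i ∈ σ.exponents, μ = pw p i := fun μ hμ => hσ μ ((hZ μ).1 hμ)
  choose! w hw1 hw2 using hex
  let L : ℂ → Polynomial ℂ := Lagrange.basis Z id
  let E : ℂ → Matrix (Fin N) (Fin N) ℂ := fun μ => Polynomial.aeval s.1 (L μ)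
  have hE : ∀ μ, Matrix.toLin' (E μ) = Polynomial.aeval f (L μ) := fun μ =>
    (Polynomial.aeval_algHom_apply (Matrix.toLinAlgEquiv' : _ ≃ₐ[ℂ] _).toAlgHom s.1 (L μ)).symm
  have hext : ∀ a b : Module.End ℂ (Fin N → ℂ),
      (∀ ν ∈ Z, ∀ v, f v = ν • v → a v = b v) → a = b := by
    intro a b h
    have htop := hss.iSup_eigenspace_eq_top
    have hle : ⨆ μ, f.eigenspace μ ≤ LinearMap.eqLocus a b := by
      refine iSup_le fun ν v hv => ?_
      by_cases h0 : v = 0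
      · rw [h0]; exact Submodule.zero_mem _
      · exact h ν ((hZ ν).2 (Module.End.hasEigenvalue_of_hasEigenvector ⟨hv, h0⟩)) v
          (Module.End.mem_eigenspace_iff.1 hv)
    rw [htop] at hle
    exact LinearMap.ext fun v => hle Submodule.mem_top
  have hs : ∀ μ ∈ Z, s.1 * E μ = μ • E μ := by
    intro μ hμ
    apply Matrix.toLin'.injective
    rw [map_smul, Matrix.toLin'_mul, hE]
    apply hext
    intro ν hν v hv
    by_cases h0 : v = 0
    · simp [h0]
    have hv' : f.HasEigenvector ν v := ⟨Module.End.mem_eigenspace_iff.2 hv, h0⟩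
    rw [LinearMap.comp_apply, LinearMap.smul_apply,
      Module.End.aeval_apply_of_hasEigenvector hv', map_smul]
    change _ • f v = _
    rw [hv]
    by_cases hνμ : ν = μ
    · rw [hνμ, smul_comm]
    · have : (L μ).eval ν = 0 := Lagrange.eval_basis_of_ne (v := id) (Ne.symm hνμ) hν
      simp [this]
  have hcomm : ∀ μ, E μ * s.1 = s.1 * E μ := fun μ =>
    Polynomial.aeval_X (R := ℂ) s.1 ▸ (Commute.all (L μ) Polynomial.X).map (Polynomial.aeval s.1)
  refine ⟨{ e := fun i => if pw p i ∈ Z then E (pw p i) else 0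
            I := Z.image w
            eq_zero := fun i hi => if_neg fun h => hi ?_
            mem_exponents := fun i hi => ?_
            sum_e := ?_
            s_mul := fun i => ?_
            mul_s := fun i => ?_ }⟩
  · exact Finset.mem_image.2 ⟨_, h, pw_injective p (hw2 _ h).symm⟩
  · obtain ⟨μ, hμ, rfl⟩ := Finset.mem_image.1 hi
    exact hw1 μ hμ
  · rw [Finset.sum_image (fun μ hμ ν hν h => by rw [hw2 μ hμ, hw2 ν hν, h])]
    rw [Finset.sum_congr rfl (g := E) fun μ hμ => by rw [← hw2 μ hμ, if_pos hμ]]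
    change ∑ μ ∈ Z, Polynomial.aeval s.1 (L μ) = 1
    rw [← map_sum, Lagrange.sum_basis (Function.injective_id.injOn) hne, map_one]
  · split_ifs with h
    · exact hs _ h
    · simp
  · split_ifs with h
    · rw [hcomm, hs _ h]
    · simp

/-! ### Base change of complex matrices -/

section Bc

variable {k l m : ℕ} (R : Alg)

theorem bc_mul (M : Matrix (Fin k) (Fin l) ℂ) (M' : Matrix (Fin l) (Fin m) ℂ) :
    bc R (M * M') = bc R M * bc R M' := Matrix.map_mul

theorem bc_one : bc R (1 : Matrix (Fin k) (Fin k) ℂ) = 1 := by simp [bc]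

theorem bc_zero : bc R (0 : Matrix (Fin k) (Fin l) ℂ) = 0 := by simp [bc]

theorem bc_sub (M M' : Matrix (Fin k) (Fin l) ℂ) : bc R (M - M') = bc R M - bc R M' :=
  Matrix.map_sub _ (map_sub _) _ _

theorem bc_neg (M : Matrix (Fin k) (Fin l) ℂ) : bc R (-M) = -bc R M := by
  ext i j; simp

theorem bc_smul (c : ℂ) (M : Matrix (Fin k) (Fin l) ℂ) :
    bc R (c • M) = algebraMap ℂ R c • bc R M := by
  ext i j; simp

theorem bc_transpose (M : Matrix (Fin k) (Fin l) ℂ) : bc R Mᵀ = (bc R M)ᵀ := Matrix.transpose_map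

theorem bc_sum {ι : Type*} (t : Finset ι) (M : ι → Matrix (Fin k) (Fin l) ℂ) :
    bc R (∑ i ∈ t, M i) = ∑ i ∈ t, bc R (M i) := by
  ext i j; simp [Matrix.sum_apply]

theorem bc_cpt (M : Matrix (Fin k) (Fin l) ℂ) : bc cpt M = M := by
  ext i j; rfl

/-- Scalars from `ℂ` that act in the same way on a non-zero vector are equal. -/
theorem eq_zero_of_smul_eq {V : Type*} [AddCommGroup V] [Module R V] {c d : ℂ} (h : c ≠ d) {v : V}
    (hv : algebraMap ℂ R c • v = algebraMap ℂ R d • v) : v = 0 := by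
  have h1 : algebraMap ℂ R (c - d) • v = 0 := by rw [map_sub, sub_smul, hv, sub_self]
  have h2 : algebraMap ℂ R (c - d)⁻¹ • algebraMap ℂ R (c - d) • v = 0 := by rw [h1, smul_zero]
  rwa [smul_smul, ← map_mul, inv_mul_cancel₀ (sub_ne_zero.2 h), map_one, one_smul] at h2

end Bc

namespace Grading

variable {N : ℕ} {p : ℕ} {s : GL (Fin N) ℂ} {σ : SupportKind} (G : Grading p s σ)

theorem eq_zero_of_notMem {i : ℝ} (hi : i ∉ σ.exponents) : G.e i = 0 :=
  G.eq_zero i fun h => hi (G.mem_exponents i h)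

/-- The projector over `R`. -/
abbrev eR (R : Alg) (i : ℝ) : Matrix (Fin N) (Fin N) R := bc R (G.e i)

theorem sum_eR (R : Alg) : ∑ i ∈ G.I, G.eR R i = 1 := by
  rw [← bc_sum, G.sum_e, bc_one]

/-- A matrix is determined by its products with the projectors. -/
theorem ext_right {R : Alg} {m : Type*} {a b : Matrix m (Fin N) R}
    (h : ∀ i, a * G.eR R i = b * G.eR R i) : a = b := by
  rw [← Matrix.mul_one a, ← Matrix.mul_one b, ← G.sum_eR R, Matrix.mul_sum, Matrix.mul_sum]
  exact Finset.sum_congr rfl fun i _ => h i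

variable [hp : Fact p.Prime]

theorem e_mul_e_of_ne {i j : ℝ} (h : i ≠ j) : G.e i * G.e j = 0 := by
  refine eq_zero_of_smul_eq cpt (c := pw p i) (d := pw p j) ((pw_injective p).ne h) ?_
  change pw p i • _ = pw p j • _
  rw [← Matrix.smul_mul, ← G.mul_s, Matrix.mul_assoc, G.s_mul, Matrix.mul_smul]

theorem e_mul_e (i : ℝ) : G.e i * G.e i = G.e i := by
  by_cases hi : i ∈ G.I
  · conv_rhs => rw [← Matrix.mul_one (G.e i), ← G.sum_e, Finset.mul_sum]
    rw [Finset.sum_eq_single_of_mem i hi fun j _ hj => G.e_mul_e_of_ne hj.symm]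
  · rw [G.eq_zero i hi, Matrix.mul_zero]

theorem eR_mul_eR_of_ne (R : Alg) {i j : ℝ} (h : i ≠ j) : G.eR R i * G.eR R j = 0 := by
  rw [← bc_mul, G.e_mul_e_of_ne h, bc_zero]

theorem eR_mul_eR (R : Alg) (i : ℝ) : G.eR R i * G.eR R i = G.eR R i := by
  rw [← bc_mul, G.e_mul_e]

/-- No spectral theory over `R` is needed: differences of distinct eigenvalues are non-zero complex
numbers, hence units in `R`, so an eigenvector for `p ^ i` is killed by every other projector. -/
theorem mem_eig_iff {R : Alg} {i : ℝ} {v : Fin N → R} :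
    v ∈ eig p s R i ↔ G.eR R i *ᵥ v = v := by
  rw [eig, Module.End.mem_eigenspace_iff, Matrix.toLin'_apply]
  constructor
  · intro h
    have h0 : ∀ j, j ≠ i → G.eR R j *ᵥ v = 0 := by
      intro j hj
      refine eq_zero_of_smul_eq R (c := pw p j) (d := pw p i) ((pw_injective p).ne hj) ?_
      rw [← Matrix.smul_mulVec, ← bc_smul, ← G.mul_s, bc_mul, ← Matrix.mulVec_mulVec, h,
        Matrix.mulVec_smul]
    conv_rhs => rw [← Matrix.one_mulVec v, ← G.sum_eR R, Matrix.sum_mulVec]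
    by_cases hi : i ∈ G.I
    · rw [Finset.sum_eq_single_of_mem i hi fun j _ hj => h0 j hj]
    · rw [Finset.sum_eq_zero fun j hj => h0 j fun e => hi (e ▸ hj), eR, G.eq_zero i hi, bc_zero,
        Matrix.zero_mulVec]
  · intro h
    conv_lhs => rw [← h]
    rw [Matrix.mulVec_mulVec, ← bc_mul, G.s_mul, bc_smul, Matrix.smul_mulVec, h]

theorem eR_mulVec_mem (R : Alg) (i : ℝ) (v : Fin N → R) : G.eR R i *ᵥ v ∈ eig p s R i :=
  G.mem_eig_iff.2 (by rw [Matrix.mulVec_mulVec, eR_mul_eR])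

theorem eig_eq_range (R : Alg) (i : ℝ) :
    eig p s R i = LinearMap.range (Matrix.toLin' (G.eR R i)) := by
  ext v
  rw [G.mem_eig_iff]
  refine ⟨fun h => ⟨v, h⟩, ?_⟩
  rintro ⟨w, rfl⟩
  rw [Matrix.toLin'_apply, Matrix.mulVec_mulVec, eR_mul_eR]

theorem commute_iff {R : Alg} {g : Matrix (Fin N) (Fin N) R} :
    g * bc R s.1 = bc R s.1 * g ↔ ∀ i, g * G.eR R i = G.eR R i * g := by
  constructor
  · intro h
    have h0 : ∀ i j, i ≠ j → G.eR R i * (g * G.eR R j) = 0 := by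
      intro i j hij
      refine eq_zero_of_smul_eq R (c := pw p i) (d := pw p j) ((pw_injective p).ne hij) ?_
      rw [← Matrix.smul_mul, ← bc_smul, ← G.mul_s, bc_mul, Matrix.mul_assoc, ← Matrix.mul_assoc _ g,
        ← h, Matrix.mul_assoc g, ← bc_mul R s.1, G.s_mul, bc_smul, Matrix.mul_smul, Matrix.mul_smul]
    intro i
    have h1 : g * G.eR R i = G.eR R i * (g * G.eR R i) := by
      conv_lhs => rw [← Matrix.one_mul (g * G.eR R i), ← G.sum_eR R, Finset.sum_mul]
      by_cases hi : i ∈ G.I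
      · rw [Finset.sum_eq_single_of_mem i hi fun j _ hj => h0 j i hj]
      · rw [Finset.sum_eq_zero fun j hj => h0 j i fun e => hi (e ▸ hj), eR, G.eq_zero i hi, bc_zero,
          Matrix.zero_mul]
    have h2 : G.eR R i * g = G.eR R i * g * G.eR R i := by
      conv_lhs => rw [← Matrix.mul_one (G.eR R i * g), ← G.sum_eR R, Finset.mul_sum]
      by_cases hi : i ∈ G.I
      · rw [Finset.sum_eq_single_of_mem i hi fun j _ hj => by
          rw [Matrix.mul_assoc, h0 i j hj.symm]]
      · rw [Finset.sum_eq_zero fun j hj => by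
          rw [Matrix.mul_assoc, h0 i j fun e => hi (e ▸ hj)]]
        rw [eR, G.eq_zero i hi, bc_zero, Matrix.zero_mul, Matrix.zero_mul]
    rw [h1, h2, Matrix.mul_assoc]
  · intro h
    apply G.ext_right
    intro i
    rw [Matrix.mul_assoc, ← bc_mul, G.s_mul, bc_smul, Matrix.mul_smul, Matrix.mul_assoc, h,
      ← Matrix.mul_assoc, ← bc_mul, G.s_mul, bc_smul, Matrix.smul_mul]

/-- The block `e_i x e_j` is multiplied by `p ^ i` when computed on the left and by `p ^ (j + 1)` on
the right, so only the blocks with `i = j + 1` survive. -/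
theorem mul_eR_of_scaling {R : Alg} {x : Matrix (Fin N) (Fin N) R}
    (hx : bc R s.1 * x = (p : R) • (x * bc R s.1)) (i : ℝ) :
    x * G.eR R i = G.eR R (i + 1) * x := by
  have hpR : algebraMap ℂ R (p : ℂ) = (p : R) := map_natCast _ _
  have h0 : ∀ i j, i ≠ j + 1 → G.eR R i * (x * G.eR R j) = 0 := by
    intro i j hij
    refine eq_zero_of_smul_eq R (c := pw p i) (d := pw p (j + 1)) ((pw_injective p).ne hij) ?_
    rw [← Matrix.smul_mul, ← bc_smul, ← G.mul_s, bc_mul, Matrix.mul_assoc, ← Matrix.mul_assoc _ x,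
      hx, Matrix.smul_mul, Matrix.mul_assoc x, ← bc_mul R s.1, G.s_mul, bc_smul, Matrix.mul_smul,
      Matrix.mul_smul, Matrix.mul_smul, smul_smul, pw_add_one, map_mul, hpR]
  have h1 : x * G.eR R i = G.eR R (i + 1) * (x * G.eR R i) := by
    conv_lhs => rw [← Matrix.one_mul (x * G.eR R i), ← G.sum_eR R, Finset.sum_mul]
    by_cases hi : i + 1 ∈ G.I
    · rw [Finset.sum_eq_single_of_mem (i + 1) hi fun j _ hj => h0 j i hj]
    · rw [Finset.sum_eq_zero fun j hj => h0 j i fun e => hi (e ▸ hj), eR, eR, G.eq_zero _ hi,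
        bc_zero, Matrix.zero_mul]
  have h2 : G.eR R (i + 1) * x = G.eR R (i + 1) * x * G.eR R i := by
    conv_lhs => rw [← Matrix.mul_one (G.eR R (i + 1) * x), ← G.sum_eR R, Finset.mul_sum]
    have h0' : ∀ j, j ≠ i → G.eR R (i + 1) * x * G.eR R j = 0 := fun j hj => by
      rw [Matrix.mul_assoc, h0 (i + 1) j fun e => hj (by linarith)]
    by_cases hi : i ∈ G.I
    · rw [Finset.sum_eq_single_of_mem i hi fun j _ hj => h0' j hj]
    · rw [Finset.sum_eq_zero fun j hj => h0' j fun e => hi (e ▸ hj), eR, eR, G.eq_zero i hi,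
        bc_zero, Matrix.mul_zero]
  rw [h1, h2, Matrix.mul_assoc]

end Grading

/-! ### Ranks over fields -/

section Rank

variable {K : Type*} [Field K] {m : ℕ}

/-- The rank normal form has entries `0` and `1`, which are preserved by `f`, and invertible
matrices stay invertible. -/
theorem rank_map_field {L : Type*} [Field L] (f : K →+* L) (M : Matrix (Fin m) (Fin m) K) :
    (M.map f).rank = M.rank := by
  obtain ⟨V, U, e, hV, hU, h⟩ := M.exists_rank_normal_form
  have hV' : IsUnit (V.map f).det := (Matrix.isUnit_iff_isUnit_det _).1 (hV.map f.mapMatrix)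
  have hU' : IsUnit (U.map f).det := (Matrix.isUnit_iff_isUnit_det _).1 (hU.map f.mapMatrix)
  have h1 : (V.map f * M.map f * U.map f) =
      (Matrix.fromBlocks 1 0 0 0).submatrix e e := by
    rw [← Matrix.map_mul, ← Matrix.map_mul, h, ← Matrix.submatrix_map, Matrix.fromBlocks_map]
    simp
  have h2 : ∀ (F : Type _) [Field F],
      (Matrix.fromBlocks 1 0 0 0 : Matrix (Fin M.rank ⊕ Fin (Fintype.card (Fin m) - M.rank))
        (Fin M.rank ⊕ Fin (Fintype.card (Fin m) - M.rank)) F).rank = M.rank := by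
    classical
    intro F _
    have : (Matrix.fromBlocks 1 0 0 0 : Matrix (Fin M.rank ⊕ Fin (Fintype.card (Fin m) - M.rank))
        (Fin M.rank ⊕ Fin (Fintype.card (Fin m) - M.rank)) F) =
        Matrix.diagonal (Sum.elim (fun _ => 1) fun _ => 0) := by
      rw [← Matrix.diagonal_one, ← Matrix.diagonal_zero, Matrix.fromBlocks_diagonal]
    rw [this, Matrix.rank_diagonal, Fintype.card_subtype, Finset.card_filter,
      Fintype.sum_sum_type]
    simp
  rw [← Matrix.rank_mul_eq_right_of_isUnit_det _ _ hV',
    ← Matrix.rank_mul_eq_left_of_isUnit_det _ _ hU', h1, Matrix.rank_submatrix, h2]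

/-- A matrix of the same rank as one of its multiples is recovered from it. -/
theorem rank_mul_eq_iff {a b : Matrix (Fin m) (Fin m) K} :
    (a * b).rank = b.rank ↔ ∃ t : Matrix (Fin m) (Fin m) K, t * (a * b) = b := by
  constructor
  · intro h
    let W := LinearMap.range (Matrix.toLin' b)
    let φ : W →ₗ[K] (Fin m → K) := (Matrix.toLin' a).domRestrict W
    have hr : LinearMap.range φ = LinearMap.range (Matrix.toLin' (a * b)) := by
      rw [Matrix.toLin'_mul, LinearMap.range_comp, LinearMap.range_domRestrict]
    have hk : LinearMap.ker φ = ⊥ := by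
      have h1 := φ.finrank_range_add_finrank_ker
      rw [hr] at h1
      have h2 : Module.finrank K (LinearMap.range (Matrix.toLin' (a * b))) = Module.finrank K W := h
      exact Submodule.finrank_eq_zero.1 (by omega)
    obtain ⟨g, hg⟩ := φ.exists_leftInverse_of_injective hk
    refine ⟨LinearMap.toMatrix' (W.subtype ∘ₗ g), Matrix.toLin'.injective ?_⟩
    rw [Matrix.toLin'_mul, Matrix.toLin'_toMatrix', Matrix.toLin'_mul]
    refine LinearMap.ext fun v => ?_
    have := congrArg W.subtype (LinearMap.congr_fun hg ⟨Matrix.toLin' b v, v, rfl⟩)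
    exact this
  · rintro ⟨t, h⟩
    refine le_antisymm (Matrix.rank_mul_le_right _ _) ?_
    conv_lhs => rw [← h]
    exact Matrix.rank_mul_le_right _ _

end Rank

/-! ### Forms compatible with the grading -/

/-- The projectors together with a symmetric or skew-symmetric form preserved by `s`. -/
structure FormGrading {N : ℕ} (p : ℕ) (B : Matrix (Fin N) (Fin N) ℂ) (s : GL (Fin N) ℂ)
    (σ : SupportKind) extends Grading p s σ where
  c : ℂ
  c_mul_c : c * c = 1
  transpose_B : Bᵀ = c • B
  isUnit_B : IsUnit B.det
  isometry : s.1ᵀ * B * s.1 = B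

namespace FormGrading

variable {N p : ℕ} {B : Matrix (Fin N) (Fin N) ℂ} {s : GL (Fin N) ℂ} {σ : SupportKind}
  (D : FormGrading p B s σ)

/-- The adjoint of a matrix for the form. -/
def adj {R : Alg} (_ : FormGrading p B s σ) (a : Matrix (Fin N) (Fin N) R) :
    Matrix (Fin N) (Fin N) R := bc R B⁻¹ * aᵀ * bc R B

theorem inv_mul_B (D : FormGrading p B s σ) (R : Alg) : bc R B⁻¹ * bc R B = 1 := by
  rw [← bc_mul, Matrix.nonsing_inv_mul _ D.isUnit_B, bc_one]

theorem B_mul_inv (D : FormGrading p B s σ) (R : Alg) : bc R B * bc R B⁻¹ = 1 := by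
  rw [← bc_mul, Matrix.mul_nonsing_inv _ D.isUnit_B, bc_one]

theorem B_mul_adj {R : Alg} (a : Matrix (Fin N) (Fin N) R) : bc R B * D.adj a = aᵀ * bc R B := by
  rw [adj, ← Matrix.mul_assoc, ← Matrix.mul_assoc, D.B_mul_inv, Matrix.one_mul]

theorem eq_of_B_mul (D : FormGrading p B s σ) {R : Alg} {m : Type*} {a b : Matrix (Fin N) m R}
    (h : bc R B * a = bc R B * b) : a = b := by
  rw [← Matrix.one_mul a, ← Matrix.one_mul b, ← D.inv_mul_B R, Matrix.mul_assoc, h, Matrix.mul_assoc]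

theorem adj_eq_iff {R : Alg} {a b : Matrix (Fin N) (Fin N) R} :
    D.adj a = b ↔ aᵀ * bc R B = bc R B * b := by
  rw [← D.B_mul_adj]
  exact ⟨fun h => by rw [h], fun h => D.eq_of_B_mul h⟩

theorem adj_mul {R : Alg} (a b : Matrix (Fin N) (Fin N) R) :
    D.adj (a * b) = D.adj b * D.adj a := by
  rw [D.adj_eq_iff, ← Matrix.mul_assoc, D.B_mul_adj, Matrix.mul_assoc _ (bc R B), D.B_mul_adj,
    Matrix.transpose_mul, Matrix.mul_assoc]

theorem adj_add {R : Alg} (a b : Matrix (Fin N) (Fin N) R) :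
    D.adj (a + b) = D.adj a + D.adj b := by
  simp only [adj, Matrix.transpose_add, Matrix.mul_add, Matrix.add_mul]

theorem adj_neg {R : Alg} (a : Matrix (Fin N) (Fin N) R) : D.adj (-a) = -D.adj a := by
  simp only [adj, Matrix.transpose_neg, Matrix.mul_neg, Matrix.neg_mul]

theorem adj_sub {R : Alg} (a b : Matrix (Fin N) (Fin N) R) :
    D.adj (a - b) = D.adj a - D.adj b := by
  rw [sub_eq_add_neg, adj_add, adj_neg, sub_eq_add_neg]

theorem adj_zero {R : Alg} : D.adj (0 : Matrix (Fin N) (Fin N) R) = 0 := by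
  simp [adj]

theorem adj_one {R : Alg} : D.adj (1 : Matrix (Fin N) (Fin N) R) = 1 := by
  rw [adj, Matrix.transpose_one, Matrix.mul_one, D.inv_mul_B]

theorem adj_adj {R : Alg} (a : Matrix (Fin N) (Fin N) R) : D.adj (D.adj a) = a := by
  have hB : (bc R B)ᵀ = algebraMap ℂ R D.c • bc R B := by
    rw [← bc_transpose, D.transpose_B, bc_smul]
  have hc : algebraMap ℂ R D.c * algebraMap ℂ R D.c = 1 := by
    rw [← map_mul, D.c_mul_c, map_one]
  have h := congrArg Matrix.transpose (D.B_mul_adj a)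
  rw [Matrix.transpose_mul, Matrix.transpose_mul, Matrix.transpose_transpose, hB, Matrix.mul_smul,
    Matrix.smul_mul] at h
  rw [D.adj_eq_iff]
  have h2 := congrArg (fun M => algebraMap ℂ R D.c • M) h
  simpa only [smul_smul, hc, one_smul] using h2

theorem bc_adj (R : Alg) (a : Matrix (Fin N) (Fin N) cpt) : bc R (D.adj a) = D.adj (bc R a) := by
  rw [adj, adj, bc_cpt, bc_cpt, bc_mul, bc_mul, bc_transpose]

theorem det_adj {R : Alg} (a : Matrix (Fin N) (Fin N) R) : (D.adj a).det = a.det := by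
  have h := congrArg Matrix.det (D.inv_mul_B R)
  rw [Matrix.det_mul, Matrix.det_one] at h
  rw [adj, Matrix.det_mul, Matrix.det_mul, Matrix.det_transpose, mul_right_comm, h, one_mul]

theorem rank_adj {K : Type} [Field K] [Algebra ℂ K]
    (a : Matrix (Fin N) (Fin N) (CommAlgCat.of ℂ K)) :
    Matrix.rank (R := K) (D.adj a) = Matrix.rank (R := K) a := by
  have h : IsUnit (bc (CommAlgCat.of ℂ K) B).det := by
    have := congrArg Matrix.det (D.inv_mul_B (CommAlgCat.of ℂ K))
    rw [Matrix.det_mul, Matrix.det_one] at this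
    exact .of_mul_eq_one _ ((mul_comm _ _).trans this)
  have h1 : (bc (CommAlgCat.of ℂ K) B * D.adj a).rank = Matrix.rank (R := K) (D.adj a) :=
    Matrix.rank_mul_eq_right_of_isUnit_det (R := K) _ _ h
  rw [← h1, D.B_mul_adj]
  exact (Matrix.rank_mul_eq_left_of_isUnit_det (R := K) _ _ h).trans
    (Matrix.rank_transpose (R := K) a)

theorem mem_isomGroup_iff {R : Alg} {g : GL (Fin N) R} :
    g ∈ (isomGroup B).pts R ↔ D.adj g.1 * g.1 = 1 := by
  constructor
  · intro h
    apply D.eq_of_B_mul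
    rw [← Matrix.mul_assoc, D.B_mul_adj, Matrix.mul_one]
    exact h
  · intro h
    change g.1ᵀ * bc R B * g.1 = bc R B
    rw [← D.B_mul_adj, Matrix.mul_assoc, h, Matrix.mul_one]

variable [hp : Fact p.Prime]

/-- The isometry `s` scales the pairing of `W_i` with `W_j` by `p ^ (i + j)`, so the pairing
vanishes unless `i + j = 0`. -/
theorem adj_e (i : ℝ) : D.adj (R := cpt) (D.e i) = D.e (-i) := by
  have key : ∀ i j, i ≠ -j → (D.e i)ᵀ * B * D.e j = 0 := by
    intro i j hij
    refine eq_zero_of_smul_eq cpt (c := pw p i * pw p j) (d := 1) (fun h => hij ?_) ?_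
    · apply pw_injective p
      have := pw_neg_mul p j
      exact mul_right_cancel₀ (pw_ne_zero p j) (h.trans this.symm)
    · change (pw p i * pw p j) • _ = (1 : ℂ) • _
      have h1 : (D.e i)ᵀ * s.1ᵀ = pw p i • (D.e i)ᵀ := by
        rw [← Matrix.transpose_mul, D.s_mul, Matrix.transpose_smul]
      rw [mul_smul, one_smul, ← Matrix.mul_smul, ← D.s_mul, ← Matrix.smul_mul, ← Matrix.smul_mul,
        ← h1]
      have h2 := congrArg (fun M => (D.e i)ᵀ * M * D.e j) D.isometry
      simpa only [Matrix.mul_assoc] using h2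
  rw [D.adj_eq_iff]
  apply D.ext_right
  intro j
  simp only [bc_cpt]
  by_cases hij : i = -j
  · have h1 : (D.e i)ᵀ * B * D.e j = B * D.e j := by
      have : B * D.e j = ((∑ k ∈ D.I, D.e k)ᵀ) * B * D.e j := by rw [D.sum_e]; simp
      rw [this, Matrix.transpose_sum, Finset.sum_mul, Finset.sum_mul]
      by_cases hi : i ∈ D.I
      · rw [Finset.sum_eq_single_of_mem i hi fun k _ hk => key k j (hij ▸ hk)]
      · rw [Finset.sum_eq_zero fun k hk => key k j fun e => hi (hij ▸ e ▸ hk), D.eq_zero i hi]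
        simp
    rw [h1, hij, neg_neg, Matrix.mul_assoc, D.e_mul_e]
  · rw [key i j hij, Matrix.mul_assoc, D.e_mul_e_of_ne fun h => hij (by linarith), Matrix.mul_zero]

theorem adj_eR (R : Alg) (i : ℝ) : D.adj (D.eR R i) = D.eR R (-i) := by
  have h := D.bc_adj R (D.e i)
  rw [D.adj_e] at h
  exact h.symm

theorem mem_hGroup_iff {R : Alg} {g : GL (Fin N) R} :
    g ∈ (hGroup B s).pts R ↔
      D.adj g.1 * g.1 = 1 ∧ g.1.det = 1 ∧ ∀ i, g.1 * D.eR R i = D.eR R i * g.1 := by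
  have h2 : g ∈ (slGroup N).pts R ↔ g.1.det = 1 := by
    change g ∈ (Matrix.GeneralLinearGroup.det).ker ↔ _
    rw [MonoidHom.mem_ker, Units.ext_iff]
    rfl
  have h3 : g ∈ (centralizerGroup s.1).pts R ↔ g.1 * bc R s.1 = bc R s.1 * g.1 := Iff.rfl
  rw [← D.commute_iff, ← h3, ← h2, ← D.mem_isomGroup_iff, ← and_assoc]
  rfl

theorem mem_vogan_iff {R : Alg} {x : Matrix (Fin N) (Fin N) R} :
    x ∈ (voganSpace p B s).pts R ↔
      D.adj x = -x ∧ ∀ i, x * D.eR R i = D.eR R (i + 1) * x := by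
  have h1 : D.adj x = -x ↔ xᵀ * bc R B + bc R B * x = 0 := by
    rw [D.adj_eq_iff, Matrix.mul_neg, eq_neg_iff_add_eq_zero]
  have hs : bc R (s⁻¹ : GL (Fin N) ℂ).1 * bc R s.1 = 1 := by
    rw [← bc_mul, ← bc_one]
    exact congrArg _ s.inv_mul
  have hs' : bc R s.1 * bc R (s⁻¹ : GL (Fin N) ℂ).1 = 1 := by
    rw [← bc_mul, ← bc_one]
    exact congrArg _ s.mul_inv
  rw [h1]
  refine and_congr_right fun _ => ⟨fun h => D.mul_eR_of_scaling ?_, fun h => ?_⟩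
  · rw [← Matrix.smul_mul, ← h, Matrix.mul_assoc, hs, Matrix.mul_one]
  · have : bc R s.1 * x = ((p : R) • x) * bc R s.1 := by
      apply D.ext_right
      intro i
      have hpR : algebraMap ℂ R (p : ℂ) = (p : R) := map_natCast _ _
      rw [Matrix.mul_assoc, h, ← Matrix.mul_assoc, ← bc_mul, D.s_mul, bc_smul, pw_add_one, map_mul,
        hpR, Matrix.mul_assoc, ← bc_mul, D.s_mul, bc_smul, Matrix.mul_smul, Matrix.smul_mul,
        Matrix.smul_mul, ← h, smul_smul, mul_comm]
    rw [this, Matrix.mul_assoc, hs', Matrix.mul_one]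

end FormGrading

/-! ### Full rank -/

theorem mul_eq_mul_iff_mulVec {R : Type*} [CommRing R] {m : ℕ} {a b e : Matrix (Fin m) (Fin m) R} :
    a * e = b * e ↔ ∀ v, a *ᵥ (e *ᵥ v) = b *ᵥ (e *ᵥ v) := by
  constructor
  · intro h v
    rw [Matrix.mulVec_mulVec, h, Matrix.mulVec_mulVec]
  · intro h
    apply Matrix.toLin'.injective
    refine LinearMap.ext fun v => ?_
    rw [Matrix.toLin'_apply, Matrix.toLin'_apply, ← Matrix.mulVec_mulVec, h, Matrix.mulVec_mulVec]

namespace Grading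

variable {N p : ℕ} [hp : Fact p.Prime] {s : GL (Fin N) ℂ} {σ : SupportKind} (G : Grading p s σ)

theorem eigDim_eq_rank (i : ℝ) : eigDim p s i = (G.e i).rank := by
  rw [eigDim, G.eig_eq_range, eR, bc_cpt]
  rfl

theorem rank_eR (K : Type) [Field K] [Algebra ℂ K] (i : ℝ) :
    Matrix.rank (R := K) (G.eR (CommAlgCat.of ℂ K) i) = eigDim p s i := by
  rw [G.eigDim_eq_rank]
  exact rank_map_field (algebraMap ℂ K) (G.e i)

theorem isFullRank_iff_rank {R : Alg} {x : Matrix (Fin N) (Fin N) R} :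
    IsFullRank p s x ↔ ∀ (K : Type) [Field K] [Algebra ℂ K] (f : R →ₐ[ℂ] K) (i : ℝ),
      Matrix.rank (R := K) (x.map f * G.eR (CommAlgCat.of ℂ K) i) =
        min (eigDim p s i) (eigDim p s (i + 1)) := by
  have key : ∀ (K : Type) [Field K] [Algebra ℂ K] (f : R →ₐ[ℂ] K) (i : ℝ),
      Module.finrank K ((eig p s (CommAlgCat.of ℂ K) i).map
        (Matrix.toLin' (x.map f) : (Fin N → K) →ₗ[K] _)) =
      Matrix.rank (R := K) (x.map f * G.eR (CommAlgCat.of ℂ K) i) := by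
    intro K _ _ f i
    have h1 : (eig p s (CommAlgCat.of ℂ K) i).map
        (Matrix.toLin' (x.map f) : (Fin N → K) →ₗ[K] _) =
        LinearMap.range (Matrix.toLin' (R := K) (x.map f * G.eR (CommAlgCat.of ℂ K) i)) := by
      rw [G.eig_eq_range, Matrix.toLin'_mul, LinearMap.range_comp]
    rw [h1]
    rfl
  constructor
  · intro h K _ _ f i
    rw [← key, h K f i]
  · intro h K _ _ f i
    rw [key, h K f i]

theorem isForget_iff {T : Set ℝ} {R : Alg} {x z : Matrix (Fin N) (Fin N) R} :
    IsForget p s T R x z ↔ (∀ j ∉ T, z * G.eR R j = x * G.eR R j) ∧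
      ∀ j ∈ T, z * G.eR R j = 0 := by
  refine and_congr (forall_congr' fun j => forall_congr' fun _ => ?_)
    (forall_congr' fun j => forall_congr' fun _ => ?_)
  · rw [mul_eq_mul_iff_mulVec]
    exact ⟨fun h v => h _ (G.eR_mulVec_mem R j v), fun h v hv => by
      rw [← G.mem_eig_iff.1 hv]; exact h v⟩
  · rw [← Matrix.zero_mul (G.eR R j), mul_eq_mul_iff_mulVec]
    simp only [Matrix.zero_mulVec]
    exact ⟨fun h v => h _ (G.eR_mulVec_mem R j v), fun h v hv => by
      rw [← G.mem_eig_iff.1 hv]; exact h v⟩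

theorem eigDim_eq_zero (G : Grading p s σ) {i : ℝ} (hi : i ∉ σ.exponents) : eigDim p s i = 0 := by
  rw [G.eigDim_eq_rank, G.eq_zero_of_notMem hi, Matrix.rank_zero]

end Grading

/-! ### The standing data and the combinatorics of the exponents. -/

/-- The sign of a form. -/
def FormKind.sign : FormKind → ℤ
  | .symm => 1
  | .skew => -1

/-- The form, the projectors, and the consequences of unimodality for the dimensions. -/
structure Datum {N : ℕ} (p : ℕ) (B : Matrix (Fin N) (Fin N) ℂ) (s : GL (Fin N) ℂ)
    (σ : SupportKind) extends FormGrading p B s σ where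
  dim_le : ∀ j : ℝ, j ≤ -1 / 2 → eigDim p s j ≤ eigDim p s (j + 1)
  dim_eq : σ = .int → eigDim p s (-1) = eigDim p s 0

theorem FormGrading.eigDim_neg {N p : ℕ} [Fact p.Prime] {B : Matrix (Fin N) (Fin N) ℂ}
    {s : GL (Fin N) ℂ} {σ : SupportKind} (D : FormGrading p B s σ) (i : ℝ) :
    eigDim p s (-i) = eigDim p s i := by
  rw [D.eigDim_eq_rank, D.eigDim_eq_rank, ← D.adj_e]
  exact D.rank_adj (K := ℂ) (D.e i)

/-- The symmetry `dim W_{-j} = dim W_j` replaces the unknown peak `i` by the centre of symmetry. For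
`j ≤ -1/2` beyond the peak, the decreasing half at `-j - 1` says `dim W_{-j} ≤ dim W_{-j-1}`, which
is the wanted inequality reflected. For integral exponents the peak is either `≥ 0` or `≤ -1`, and
`dim W_{-1}`, `dim W_0`, `dim W_1 = dim W_{-1}` are then monotone, hence equal. -/
theorem exists_datum (p : ℕ) [Fact p.Prime] {N : ℕ} (B : Matrix (Fin N) (Fin N) ℂ)
    (hB : IsUnit B.det) (ε : FormKind) (hε : ε.Holds B) (s : GL (Fin N) ℂ)
    (hsB : s.1ᵀ * B * s.1 = B) (hss : Module.End.IsSemisimple (Matrix.toLin' s.1))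
    (σ : SupportKind) (hσ : SupportedIn p s σ) (huni : Unimodal p s) :
    ∃ D : Datum p B s σ, D.c = ε.sign := by
  obtain ⟨G⟩ := exists_grading p s hss σ hσ huni
  let D : FormGrading p B s σ :=
    { G with
      c := ε.sign
      c_mul_c := by cases ε <;> simp [FormKind.sign]
      transpose_B := by
        cases ε
        · exact hε.trans (by simp [FormKind.sign])
        · exact hε.trans (by simp [FormKind.sign])
      isUnit_B := hB
      isometry := hsB }
  obtain ⟨i, hi, hup, hdown⟩ := huni
  refine ⟨{ D with dim_le := fun j hj => ?_, dim_eq := ?_ }, rfl⟩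
  · by_cases hji : j ≤ i
    · exact hup j hji
    · have h := hdown (-j - 1) (by linarith)
      rw [← D.eigDim_neg j, ← D.eigDim_neg (j + 1)]
      convert h using 2 <;> ring
  · rintro rfl
    obtain ⟨j, ⟨m, rfl⟩, hj⟩ := hσ _ hi
    obtain rfl := pw_injective p hj
    have h1 : eigDim p s (-1) = eigDim p s 1 := D.eigDim_neg 1
    by_cases hm : 0 ≤ m
    · have hm' : (0 : ℝ) ≤ m := by exact_mod_cast hm
      have h2 := hup 0 hm'
      have h3 := hup (-1) (by linarith)
      norm_num at h2 h3
      omega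
    · have hm' : (m : ℝ) ≤ -1 := by exact_mod_cast (by omega : m ≤ -1)
      have h2 := hdown (-1) hm'
      have h3 := hdown 0 (by linarith)
      norm_num at h2 h3
      omega

/-- The component in degree `i` is minus the adjoint of the one in degree `-i - 1`; of these two
partners one always lies on the ladder `i₀, i₀ - 1, …`. -/
theorem SupportKind.exists_of_mem {σ : SupportKind} {i : ℝ} (hi : i ∈ σ.exponents) :
    (∃ l : ℕ, i = σ.i₀ - l) ∨ ∃ l : ℕ, -i - 1 = σ.i₀ - l := by
  cases σ
  · obtain ⟨m, rfl⟩ := hi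
    by_cases hm : m ≤ -1
    · refine .inl ⟨(-1 - m).toNat, ?_⟩
      have : (((-1 - m).toNat : ℤ) : ℝ) = ((-1 - m : ℤ) : ℝ) := by
        rw [Int.toNat_of_nonneg (by omega)]
      push_cast at this
      rw [this, i₀]
      ring
    · refine .inr ⟨m.toNat, ?_⟩
      have : ((m.toNat : ℤ) : ℝ) = (m : ℝ) := by rw [Int.toNat_of_nonneg (by omega)]
      push_cast at this
      rw [this, i₀]
      ring
  · obtain ⟨m, rfl⟩ := hi
    by_cases hm : m ≤ -1
    · refine .inl ⟨(-1 - m).toNat, ?_⟩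
      have : (((-1 - m).toNat : ℤ) : ℝ) = ((-1 - m : ℤ) : ℝ) := by
        rw [Int.toNat_of_nonneg (by omega)]
      push_cast at this
      rw [this, i₀]
      ring
    · refine .inr ⟨(m + 1).toNat, ?_⟩
      have : (((m + 1).toNat : ℤ) : ℝ) = ((m + 1 : ℤ) : ℝ) := by
        rw [Int.toNat_of_nonneg (by omega)]
      push_cast at this
      rw [this, i₀]
      ring

/-- The forgotten degrees are the top step `l = 0` of the ladder and its partner, which coincide for
half-integral exponents; this is why the remaining degrees are indexed by `l + 1`. -/
theorem SupportKind.exists_of_notMem_forgotten {σ : SupportKind} {i : ℝ} (hi : i ∈ σ.exponents)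
    (hT : i ∉ σ.forgotten) :
    (∃ l : ℕ, i = σ.i₀ - (l + 1 : ℕ)) ∨ ∃ l : ℕ, -i - 1 = σ.i₀ - (l + 1 : ℕ) := by
  rcases exists_of_mem hi with ⟨l, hl⟩ | ⟨l, hl⟩
  · rcases l with _ | l
    · cases σ
      · exact (hT (.inl (by simpa [i₀] using hl))).elim
      · exact (hT (show i = -1 / 2 by simpa [i₀] using hl)).elim
    · exact .inl ⟨l, hl⟩
  · rcases l with _ | l
    · cases σ
      · exact (hT (.inr (by simp [i₀] at hl; simpa using hl))).elim
      · refine (hT ?_).elim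
        simp only [i₀, Nat.cast_zero, sub_zero] at hl
        change i = -1 / 2
        linarith
    · exact .inr ⟨l, hl⟩

theorem SupportKind.i₀_sub_notMem_forgotten (σ : SupportKind) (l : ℕ) :
    σ.i₀ - (l + 1 : ℕ) ∉ σ.forgotten := by
  have : (0 : ℝ) ≤ l := Nat.cast_nonneg l
  cases σ
  · rintro (h | h)
    · simp only [i₀] at h; push_cast at h; linarith
    · simp only [i₀, Set.mem_singleton_iff] at h; push_cast at h; linarith
  · intro h
    change (-1 / 2 : ℝ) - (l + 1 : ℕ) = -1 / 2 at h
    push_cast at h; linarith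

theorem SupportKind.neg_sub_one_mem_forgotten {σ : SupportKind} {i : ℝ} :
    -i - 1 ∈ σ.forgotten ↔ i ∈ σ.forgotten := by
  cases σ
  · simp only [forgotten, Set.mem_insert_iff, Set.mem_singleton_iff]
    constructor <;> rintro (h | h)
    · right; linarith
    · left; linarith
    · right; linarith
    · left; linarith
  · simp only [forgotten, Set.mem_singleton_iff]
    constructor <;> intro h <;> linarith

theorem voganSpace_isLocal {N p : ℕ} {B : Matrix (Fin N) (Fin N) ℂ} {s : GL (Fin N) ℂ} : (voganSpace p B s).IsLocal := by
  intro R ι _ S f hf x hx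
  refine ⟨hf.matrix_ext fun i => ?_, hf.matrix_ext fun i => ?_⟩
  · have := (hx i).1
    rw [Matrix.map_add _ (map_add _), Matrix.map_mul, Matrix.map_mul, bc_map,
      Matrix.transpose_map, this, Matrix.map_zero _ (map_zero _)]
  · have := (hx i).2
    rw [Matrix.map_mul, Matrix.map_mul, bc_map, bc_map, this]
    ext a b
    simp

/-! ### Full rank as injectivity, and its étale locality. -/

namespace Datum

variable {N p : ℕ} [hp : Fact p.Prime] {B : Matrix (Fin N) (Fin N) ℂ} {s : GL (Fin N) ℂ}
  {σ : SupportKind} (D : Datum p B s σ)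

/-- The projector onto `W_{i₀ - l}`. -/
abbrev E (R : Alg) (l : ℕ) : Matrix (Fin N) (Fin N) R := D.eR R (σ.i₀ - l)

/-- Below the middle the source is the smaller space, so maximal rank means having a left inverse.
In the partner degree the component is minus the adjoint, with the same rank and the same upper
bound, and outside the exponents all spaces vanish. -/
theorem isFullRank_iff {R : Alg} {x : Matrix (Fin N) (Fin N) R}
    (hx : x ∈ (voganSpace p B s).pts R) :
    IsFullRank p s x ↔ ∀ (K : Type) [Field K] [Algebra ℂ K] (f : R →ₐ[ℂ] K) (l : ℕ),
      ∃ t : Matrix (Fin N) (Fin N) K, t * (x.map f * D.E (CommAlgCat.of ℂ K) l) =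
        D.E (CommAlgCat.of ℂ K) l := by
  have hle : ∀ l : ℕ, eigDim p s (σ.i₀ - l) ≤ eigDim p s (σ.i₀ - l + 1) := fun l => by
    apply D.dim_le
    have : (0 : ℝ) ≤ l := Nat.cast_nonneg l
    have : σ.i₀ ≤ -1 / 2 := by cases σ <;> norm_num [SupportKind.i₀]
    linarith
  have key : (∀ (K : Type) [Field K] [Algebra ℂ K] (f : R →ₐ[ℂ] K) (l : ℕ),
      ∃ t : Matrix (Fin N) (Fin N) K, t * (x.map f * D.E (CommAlgCat.of ℂ K) l) =
        D.E (CommAlgCat.of ℂ K) l) ↔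
      ∀ (K : Type) [Field K] [Algebra ℂ K] (f : R →ₐ[ℂ] K) (l : ℕ),
        Matrix.rank (R := K) (x.map f * D.E (CommAlgCat.of ℂ K) l) =
          min (eigDim p s (σ.i₀ - l)) (eigDim p s (σ.i₀ - l + 1)) := by
    constructor
    · intro h K _ _ f l
      rw [min_eq_left (hle l), ← D.rank_eR K]
      exact rank_mul_eq_iff.2 (h K f l)
    · intro h K _ _ f l
      refine rank_mul_eq_iff.1 ?_
      rw [h K f l, min_eq_left (hle l)]
      exact (D.rank_eR K _).symm
  rw [key, D.isFullRank_iff_rank]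
  refine ⟨fun h K _ _ f l => h K f _, fun h K _ _ f i => ?_⟩
  by_cases hi : i ∈ σ.exponents
  · rcases SupportKind.exists_of_mem hi with ⟨l, rfl⟩ | ⟨l, hl⟩
    · exact h K f l
    · let φ : R ⟶ CommAlgCat.of ℂ K := CommAlgCat.ofHom f
      obtain ⟨h1, h2⟩ := D.mem_vogan_iff.1 ((voganSpace p B s).map_mem φ hx)
      have h3 : Matrix.rank (R := K) (x.map f * D.eR (CommAlgCat.of ℂ K) (-i - 1)) =
          min (eigDim p s (-i - 1)) (eigDim p s (-i - 1 + 1)) := by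
        rw [hl]
        exact h K f l
      have h4 : D.adj (x.map φ.hom * D.eR (CommAlgCat.of ℂ K) i) =
          -(x.map φ.hom * D.eR (CommAlgCat.of ℂ K) (-i - 1)) := by
        rw [D.adj_mul, D.adj_eR, h1, Matrix.mul_neg, h2]
        congr 3
        ring
      have h5 := D.rank_adj (K := K) (x.map φ.hom * D.eR (CommAlgCat.of ℂ K) i)
      rw [h4] at h5
      have h6 : ∀ M : Matrix (Fin N) (Fin N) K, (-M).rank = M.rank := fun M => by
        have := Matrix.rank_mul_eq_right_of_isUnit_det (-1) M (by simp [Matrix.det_neg])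
        simpa using this
      refine h5.symm.trans ((h6 _).trans (h3.trans ?_))
      rw [min_comm]
      congr 1
      · rw [← D.eigDim_neg i]
        congr 1
        ring
      · rw [← D.eigDim_neg (i + 1)]
        congr 1
        ring
  · have h0 := D.eigDim_eq_zero hi
    rw [h0, Nat.zero_min, Grading.eR, D.eq_zero_of_notMem hi, bc_zero]
    have : x.map f * (0 : Matrix (Fin N) (Fin N) K) = 0 := Matrix.mul_zero _
    exact (congrArg (Matrix.rank (R := K)) this).trans Matrix.rank_zero

/-- A field-valued point of `Spec R` lifts, after extending the field, to a member of the covering,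
and ranks are insensitive to extension of the field. -/
theorem vReg_isLocal (D : Datum p B s σ) : (vReg p B s).IsLocal := by
  intro R ι _ S f hf x hx
  refine ⟨voganSpace_isLocal R ι S f hf x fun i => (hx i).1, ?_⟩
  rw [D.isFullRank_iff_rank]
  intro K _ _ g j
  obtain ⟨i, q, hq⟩ := hf.2 ⟨RingHom.ker g, RingHom.ker_isPrime g⟩
  obtain ⟨L, _, _, a, b, hab⟩ := exists_common_field (f i) K g q (by rw [hq])
  have h1 := D.isFullRank_iff_rank.1 (hx i).2 L b j
  rw [← h1, ← rank_map_field a.toRingHom]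
  congr 1
  have h2 : (x.map g * D.eR (CommAlgCat.of ℂ K) j).map a.toRingHom =
      (x.map g).map a.toRingHom * (D.eR (CommAlgCat.of ℂ K) j).map a.toRingHom := Matrix.map_mul
  have h3 : (D.eR (CommAlgCat.of ℂ K) j).map a.toRingHom = D.eR (CommAlgCat.of ℂ L) j :=
    bc_map (CommAlgCat.ofHom a) _
  rw [h2, h3]
  have h4 : (x.map g).map a.toRingHom = (x.map (f i).hom).map b := by
    ext k l
    exact DFunLike.congr_fun hab (x k l)
  rw [h4]

theorem fiber_isLocal (D : Datum p B s σ) (z : Matrix (Fin N) (Fin N) ℂ) :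
    (fiber p B s σ z).IsLocal := by
  intro R ι _ S f hf x hx
  refine ⟨D.vReg_isLocal R ι S f hf x fun i => (hx i).1, D.isForget_iff.2 ⟨fun j hj => ?_,
    fun j hj => ?_⟩⟩
  · refine hf.matrix_ext fun i => ?_
    rw [Matrix.map_mul, Matrix.map_mul, bc_map, bc_map]
    exact (D.isForget_iff.1 (hx i).2).1 j hj
  · refine hf.matrix_ext fun i => ?_
    rw [Matrix.map_mul, bc_map, bc_map, Matrix.map_zero _ (map_zero _)]
    exact (D.isForget_iff.1 (hx i).2).2 j hj

end Datum

/-- The space `W` is the sum of the lower half, of the upper half dual to it and, for integral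
exponents, of `W_0`. -/
theorem SupportKind.mem_trichotomy {σ : SupportKind} {i : ℝ} (hi : i ∈ σ.exponents) :
    (∃ l : ℕ, i = σ.i₀ - l) ∨ (∃ l : ℕ, -i = σ.i₀ - l) ∨ σ = .int ∧ i = 0 := by
  rcases exists_of_mem hi with h | ⟨l, hl⟩
  · exact .inl h
  · rcases l with _ | l
    · cases σ
      · refine .inr (.inr ⟨rfl, ?_⟩)
        simp only [i₀, Nat.cast_zero] at hl
        linarith
      · refine .inl ⟨0, ?_⟩
        simp only [i₀, Nat.cast_zero] at hl ⊢
        linarith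
    · refine .inr (.inl ⟨l, ?_⟩)
      push_cast at hl
      linarith

theorem SupportKind.i₀_neg (σ : SupportKind) : σ.i₀ < 0 := by
  cases σ <;> norm_num [i₀]

theorem SupportKind.i₀_sub_le (σ : SupportKind) (l : ℕ) : σ.i₀ - l ≤ σ.i₀ := by
  have : (0 : ℝ) ≤ l := Nat.cast_nonneg l
  linarith

namespace Grading

variable {N p : ℕ} {s : GL (Fin N) ℂ} {σ : SupportKind} (G : Grading p s σ)

theorem ext_right_of_mem {R : Alg} {m : Type*} {a b : Matrix m (Fin N) R}
    (h : ∀ i ∈ σ.exponents, a * G.eR R i = b * G.eR R i) : a = b := by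
  refine G.ext_right fun i => ?_
  by_cases hi : i ∈ σ.exponents
  · exact h i hi
  · rw [eR, G.eq_zero_of_notMem hi, bc_zero, Matrix.mul_zero, Matrix.mul_zero]

variable [hp : Fact p.Prime]

/-- The sum of a family of blocks `A i` in `End(W_i)`. -/
theorem sum_mul_eR {R : Alg} (A : ℝ → Matrix (Fin N) (Fin N) R) (k : ℝ)
    (hA : ∀ i, A i * G.eR R (i + k) = A i) (i : ℝ) :
    (∑ j ∈ G.I, A (j - k)) * G.eR R i = A (i - k) := by
  have h0 : ∀ j, j ≠ i → A (j - k) * G.eR R i = 0 := fun j hj => by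
    rw [← hA, sub_add_cancel, Matrix.mul_assoc, G.eR_mul_eR_of_ne R hj, Matrix.mul_zero]
  rw [Finset.sum_mul]
  by_cases hi : i ∈ G.I
  · rw [Finset.sum_eq_single_of_mem i hi fun j _ hj => h0 j hj]
    conv_rhs => rw [← hA, sub_add_cancel]
  · rw [Finset.sum_eq_zero fun j hj => h0 j fun e => hi (e ▸ hj), ← hA, sub_add_cancel, eR,
      G.eq_zero i hi, bc_zero, Matrix.mul_zero]

/-- Matrices with prescribed blocks. -/
theorem exists_blocks {R : Alg} (A : ℝ → Matrix (Fin N) (Fin N) R) (k : ℝ) :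
    ∃ x : Matrix (Fin N) (Fin N) R, (∀ i, x * G.eR R i = G.eR R (i + k) * x) ∧
      ∀ i, x * G.eR R i = G.eR R (i + k) * A i * G.eR R i := by
  let x := ∑ j ∈ G.I, G.eR R (j + k) * A j * G.eR R j
  have h1 : ∀ i, x * G.eR R i = G.eR R (i + k) * A i * G.eR R i := fun i => by
    have := G.sum_mul_eR (fun j => G.eR R (j + k) * A j * G.eR R j) 0
      (fun i => by rw [add_zero, Matrix.mul_assoc, G.eR_mul_eR]) i
    simpa only [sub_zero] using this
  refine ⟨x, fun i => ?_, h1⟩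
  apply G.ext_right
  intro j
  by_cases hij : i = j
  · rw [Matrix.mul_assoc, ← hij, G.eR_mul_eR, Matrix.mul_assoc, h1, ← Matrix.mul_assoc,
      ← Matrix.mul_assoc, G.eR_mul_eR]
  · rw [Matrix.mul_assoc, G.eR_mul_eR_of_ne R hij, Matrix.mul_assoc, h1, ← Matrix.mul_assoc,
      ← Matrix.mul_assoc, G.eR_mul_eR_of_ne R fun h => hij (by linarith)]
    simp only [Matrix.mul_zero, Matrix.zero_mul]

end Grading

namespace Datum

variable {N p : ℕ} [hp : Fact p.Prime] {B : Matrix (Fin N) (Fin N) ℂ} {s : GL (Fin N) ℂ}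
  {σ : SupportKind} (D : Datum p B s σ)

/-! ### Points of the group -/

/-- An invertible matrix acting only on the `W_i` with `i ≤ i₀` extends to an isometry, without
changing the action on these subspaces and on `W_0`. -/
theorem exists_isometry {R : Alg} (a : Matrix (Fin N) (Fin N) R) (ha : IsUnit a.det)
    (hc : ∀ i, a * D.eR R i = D.eR R i * a) (h1 : ∀ i, σ.i₀ < i → a * D.eR R i = D.eR R i) :
    ∃ h : GL (Fin N) R, h ∈ (hGroup B s).pts R ∧ (∀ l, h.1 * D.E R l = a * D.E R l) ∧
      (σ = .int → h.1 * D.eR R 0 = D.eR R 0) := by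
  have hc' : ∀ i, D.adj a * D.eR R i = D.eR R i * D.adj a := fun i => by
    have := congrArg D.adj (hc (-i))
    rw [D.adj_mul, D.adj_mul, D.adj_eR, neg_neg] at this
    exact this.symm
  have h1' : ∀ i, σ.i₀ < -i → D.adj a * D.eR R i = D.eR R i := fun i hi => by
    rw [hc', ← neg_neg i, ← D.adj_eR, ← D.adj_mul, h1 _ hi]
  have hneg := σ.i₀_neg
  -- The matrix `a` is the identity in degrees above `i₀` and `adj a` in degrees below `-i₀`; since
  -- `i₀ < 0`, in every degree one of the two is trivial.
  have hcomm : a * D.adj a = D.adj a * a := by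
    apply D.ext_right
    intro i
    by_cases hi : σ.i₀ < i
    · rw [Matrix.mul_assoc, hc', ← Matrix.mul_assoc, h1 i hi, Matrix.mul_assoc, h1 i hi, hc']
    · have : σ.i₀ < -i := by linarith [not_lt.1 hi]
      rw [Matrix.mul_assoc, h1' i this, Matrix.mul_assoc, hc, ← Matrix.mul_assoc, h1' i this]
  have hu : IsUnit (D.adj a).det := by rwa [D.det_adj]
  let u : GL (Fin N) R := Matrix.GeneralLinearGroup.mk'' a ha
  let v : GL (Fin N) R := Matrix.GeneralLinearGroup.mk'' (D.adj a) hu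
  have huv : Commute u v := Units.ext hcomm
  have hu1 : u.1 = a := rfl
  have hv1 : v.1 = D.adj a := rfl
  have hve : ∀ i, Commute v.1 (D.eR R i) := fun i => hc' i
  have hve' : ∀ i, (v⁻¹).1 * D.eR R i = D.eR R i * (v⁻¹).1 := fun i => (hve i).units_inv_left
  have hvi : ∀ i, σ.i₀ < -i → (v⁻¹).1 * D.eR R i = D.eR R i := fun i hi => by
    conv_lhs => rw [← h1' i hi, ← hv1, ← Matrix.mul_assoc]
    rw [Units.inv_mul, Matrix.one_mul]
  have hval : (u * v⁻¹).1 = a * (v⁻¹).1 := rfl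
  -- The isometry is `a * (adj a)⁻¹`, the contragredient of `a` on the dual half. As `a` and `adj a`
  -- have the same determinant, its determinant is one whatever `a` is.
  refine ⟨u * v⁻¹, D.mem_hGroup_iff.2 ⟨?_, ?_, fun i => ?_⟩, fun l => ?_, ?_⟩
  · have h2 : D.adj (v⁻¹).1 * a = 1 := by
      have := congrArg D.adj (show v.1 * (v⁻¹).1 = 1 from v.mul_inv)
      rwa [D.adj_mul, hv1, D.adj_adj, D.adj_one] at this
    have h3 : a * D.adj (v⁻¹).1 = 1 := by
      have := congrArg D.adj (show (v⁻¹).1 * v.1 = 1 from v.inv_mul)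
      rwa [D.adj_mul, hv1, D.adj_adj, D.adj_one] at this
    rw [hval, D.adj_mul]
    calc D.adj (v⁻¹).1 * D.adj a * (a * (v⁻¹).1)
        = D.adj (v⁻¹).1 * (D.adj a * a) * (v⁻¹).1 := by simp only [Matrix.mul_assoc]
      _ = (D.adj (v⁻¹).1 * a) * (D.adj a * (v⁻¹).1) := by
          rw [← hcomm]; simp only [Matrix.mul_assoc]
      _ = 1 := by rw [h2, ← hv1, Matrix.one_mul]; exact v.mul_inv
  · have h2 : v.1.det * (v⁻¹).1.det = 1 := by
      rw [← Matrix.det_mul, show v.1 * (v⁻¹).1 = 1 from v.mul_inv, Matrix.det_one]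
    rw [hval, Matrix.det_mul, ← D.det_adj a, ← hv1, h2]
  · rw [hval, Matrix.mul_assoc, hve', ← Matrix.mul_assoc, hc, Matrix.mul_assoc]
  · have := σ.i₀_sub_le l
    rw [hval, Matrix.mul_assoc, hvi _ (by linarith)]
  · rintro rfl
    rw [hval, Matrix.mul_assoc, hvi _ (by norm_num [SupportKind.i₀]),
      h1 _ (by norm_num [SupportKind.i₀])]

theorem adj_eq_inv {R : Alg} {h : GL (Fin N) R} (hh : h ∈ (hGroup B s).pts R) :
    D.adj h.1 = (h⁻¹).1 := by
  have h1 := (D.mem_hGroup_iff.1 hh).1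
  rw [← Matrix.mul_one (D.adj h.1), ← show h.1 * (h⁻¹).1 = 1 from h.mul_inv, ← Matrix.mul_assoc, h1,
    Matrix.one_mul]

/-- An isometry intertwines two points of the Vogan variety in all degrees that are not forgotten
as soon as it does so in negative degrees. -/
theorem intertwine {R : Alg} {h : GL (Fin N) R} (hh : h ∈ (hGroup B s).pts R)
    {x y : Matrix (Fin N) (Fin N) R} (hx : x ∈ (voganSpace p B s).pts R)
    (hy : y ∈ (voganSpace p B s).pts R)
    (hxy : ∀ l, y * h.1 * D.E R (l + 1) = h.1 * x * D.E R (l + 1)) {i : ℝ} (hi : i ∉ σ.forgotten) :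
    y * h.1 * D.eR R i = h.1 * x * D.eR R i := by
  by_cases hi' : i ∈ σ.exponents
  swap
  · rw [Grading.eR, D.eq_zero_of_notMem hi', bc_zero, Matrix.mul_zero, Matrix.mul_zero]
  rcases SupportKind.exists_of_notMem_forgotten hi' hi with ⟨l, rfl⟩ | ⟨l, hl⟩
  · exact hxy l
  obtain ⟨hx1, hx2⟩ := D.mem_vogan_iff.1 hx
  obtain ⟨hy1, hy2⟩ := D.mem_vogan_iff.1 hy
  have hc := (D.mem_hGroup_iff.1 hh).2.2
  have h0 := hxy l
  have e1 : y * h.1 * D.eR R (-i - 1) = h.1 * x * D.eR R (-i - 1) := by rw [hl]; exact h0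
  -- The relation in degree `i` is the adjoint of the relation in the partner degree `-i - 1`.
  have e2 := congrArg D.adj e1
  rw [D.adj_mul, D.adj_mul, D.adj_mul, D.adj_mul, hx1, hy1, D.adj_eR, D.adj_eq_inv hh,
    show -(-i - 1) = i + 1 by ring] at e2
  rw [Matrix.mul_neg, Matrix.mul_neg, Matrix.neg_mul, Matrix.mul_neg, neg_inj] at e2
  have hinv : h.1 * (h⁻¹).1 = 1 := h.mul_inv
  have hinv' : (h⁻¹).1 * h.1 = 1 := h.inv_mul
  calc y * h.1 * D.eR R i = h.1 * (D.eR R (i + 1) * ((h⁻¹).1 * y)) * h.1 := by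
        rw [← Matrix.mul_assoc, hc, ← Matrix.mul_assoc, Matrix.mul_assoc _ h.1 (h⁻¹).1, hinv,
          Matrix.mul_one, ← hy2, Matrix.mul_assoc, hc, Matrix.mul_assoc]
    _ = h.1 * (D.eR R (i + 1) * (x * (h⁻¹).1)) * h.1 := by rw [e2]
    _ = h.1 * (D.eR R (i + 1) * x) * ((h⁻¹).1 * h.1) := by simp only [Matrix.mul_assoc]
    _ = _ := by rw [hinv', Matrix.mul_one, ← hx2, Matrix.mul_assoc]

/-! ### Good points -/

/-- Points of the Vogan variety vanishing in the forgotten degrees and injective in the others,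
with a left inverse `r` in negative degrees. -/
structure Good (D : Datum p B s σ) (z : Matrix (Fin N) (Fin N) ℂ) where
  mem : z ∈ (voganSpace p B s).pts cpt
  forget : ∀ j ∈ σ.forgotten, z * D.e j = 0
  r : Matrix (Fin N) (Fin N) ℂ
  r_mul : ∀ l : ℕ, r * (z * D.e (σ.i₀ - (l + 1 : ℕ))) = D.e (σ.i₀ - (l + 1 : ℕ))
  r_shift : ∀ i, r * D.e i = D.e (i - 1) * r

/-- Left inverses chosen separately in each degree are cut down to the blocks `W_{i+1} → W_i` and
assembled into a single operator of degree `-1`. -/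
theorem Good.exists_of (z : Matrix (Fin N) (Fin N) ℂ) (hz : z ∈ (voganSpace p B s).pts cpt)
    (hf : ∀ j ∈ σ.forgotten, z * D.e j = 0)
    (ht : ∀ l : ℕ, ∃ t : Matrix (Fin N) (Fin N) ℂ, t * (z * D.e (σ.i₀ - (l + 1 : ℕ))) =
      D.e (σ.i₀ - (l + 1 : ℕ))) : Nonempty (D.Good z) := by
  classical
  have ht' : ∀ i : ℝ, ∃ t : Matrix (Fin N) (Fin N) ℂ, (∃ l : ℕ, i = σ.i₀ - (l + 1 : ℕ)) →
      t * (z * D.e i) = D.e i := by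
    intro i
    by_cases h : ∃ l : ℕ, i = σ.i₀ - (l + 1 : ℕ)
    · obtain ⟨l, rfl⟩ := h
      obtain ⟨t, ht⟩ := ht l
      exact ⟨t, fun _ => ht⟩
    · exact ⟨0, fun h' => (h h').elim⟩
  choose t ht' using ht'
  obtain ⟨r, hr1, hr2⟩ := D.exists_blocks (R := cpt) (fun i => t (i - 1)) (-1)
  have hr1' : ∀ i, r * D.e i = D.e (i - 1) * r := fun i => by
    have := hr1 i
    simpa only [Grading.eR, bc_cpt, ← sub_eq_add_neg] using this
  have hr2' : ∀ i, r * D.e i = D.e (i - 1) * t (i - 1) * D.e i := fun i => by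
    have := hr2 i
    simpa only [Grading.eR, bc_cpt, ← sub_eq_add_neg] using this
  have hz2 : ∀ i, z * D.e i = D.e (i + 1) * z := fun i => by
    have := (D.mem_vogan_iff.1 hz).2 i
    simpa only [Grading.eR, bc_cpt] using this
  refine ⟨⟨hz, hf, r, fun l => ?_, hr1'⟩⟩
  have h0 := ht' (σ.i₀ - (l + 1 : ℕ)) ⟨l, rfl⟩
  set i := σ.i₀ - (l + 1 : ℕ)
  have h1 : z * D.e i = D.e (i + 1) * (z * D.e i) := by
    rw [← Matrix.mul_assoc, ← hz2, Matrix.mul_assoc, D.e_mul_e]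
  rw [h1, ← Matrix.mul_assoc, hr2', add_sub_cancel_right, Matrix.mul_assoc, ← h1, Matrix.mul_assoc,
    h0, D.e_mul_e]

/-- The set of forgotten degrees is stable under `i ↦ -i - 1`, so extending by zero keeps
skew-adjointness, and `z` is itself a point of the Vogan variety. Full rank of a lift gives the left
inverses in the degrees `l + 1`. -/
theorem good_of_mem_vRegDiamond {z : Matrix (Fin N) (Fin N) ℂ} (hz : z ∈ vRegDiamond p B s σ) :
    Nonempty (D.Good z) := by
  obtain ⟨x, hx, hxz⟩ := hz
  obtain ⟨h1, h2⟩ := D.isForget_iff.1 hxz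
  obtain ⟨hx1, hx2⟩ := D.mem_vogan_iff.1 hx.1
  have hsh : ∀ i, z * D.eR cpt i = D.eR cpt (i + 1) * (z * D.eR cpt i) := fun i => by
    by_cases hi : i ∈ σ.forgotten
    · rw [h2 i hi, Matrix.mul_zero]
    · rw [h1 i hi, ← Matrix.mul_assoc, ← hx2, Matrix.mul_assoc, D.eR_mul_eR]
  have hsh' : ∀ i, z * D.eR cpt i = D.eR cpt (i + 1) * z := fun i => by
    apply D.ext_right (R := cpt)
    intro j
    by_cases hij : i = j
    · rw [← hij, Matrix.mul_assoc, D.eR_mul_eR, Matrix.mul_assoc, ← hsh]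
    · rw [Matrix.mul_assoc, D.eR_mul_eR_of_ne _ hij, Matrix.mul_zero, Matrix.mul_assoc, hsh,
        ← Matrix.mul_assoc, D.eR_mul_eR_of_ne _ fun h => hij (by linarith), Matrix.zero_mul]
  refine Good.exists_of D z (D.mem_vogan_iff.2 ⟨?_, hsh'⟩) (fun j hj => ?_) fun l => ?_
  · apply D.ext_right (R := cpt)
    intro k
    have e1 : D.adj (R := cpt) z * D.eR cpt k = D.adj (z * D.eR cpt (-k - 1)) := by
      rw [hsh', D.adj_mul, D.adj_eR]
      congr 2
      ring
    rw [e1]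
    by_cases hk : k ∈ σ.forgotten
    · rw [h2 _ (SupportKind.neg_sub_one_mem_forgotten.2 hk), D.adj_zero, Matrix.neg_mul, h2 k hk,
        neg_zero]
    · rw [h1 _ fun h => hk (SupportKind.neg_sub_one_mem_forgotten.1 h), hx2, D.adj_mul, hx1,
        D.adj_eR, Matrix.neg_mul, Matrix.neg_mul, h1 k hk, show -(-k - 1 + 1) = k by ring]
  · have := h2 j hj
    rwa [Grading.eR, bc_cpt] at this
  · obtain ⟨t, ht⟩ := (D.isFullRank_iff hx.1).1 hx.2 ℂ (AlgHom.id ℂ ℂ) (l + 1)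
    refine ⟨t, ?_⟩
    have h3 := h1 _ (σ.i₀_sub_notMem_forgotten l)
    rw [Grading.eR, bc_cpt] at h3
    rw [h3]
    exact ht

end Datum

/-! ### Completing an injective matrix to an invertible one -/

/-- A matrix over an extension field `K` which is injective modulo the range of a complex matrix `Q`
becomes invertible after adding a matrix of the form `c Q` with `c` complex. -/
theorem exists_complex_completion {N : ℕ} (K : Type) [Field K] [Algebra ℂ K]
    (φ t : Matrix (Fin N) (Fin N) K) (Q : Matrix (Fin N) (Fin N) ℂ)
    (h : t * φ = 1 - Q.map (algebraMap ℂ K)) :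
    ∃ c : Matrix (Fin N) (Fin N) ℂ,
      (φ + c.map (algebraMap ℂ K) * Q.map (algebraMap ℂ K)).det ≠ 0 := by
  classical
  let M : Matrix (Fin N) (Fin N) ℂ → Matrix (Fin N) (Fin N) K := fun c =>
    φ + c.map (algebraMap ℂ K) * Q.map (algebraMap ℂ K)
  let d : Matrix (Fin N) (Fin N) ℂ → ℕ := fun c =>
    Module.finrank K (LinearMap.ker (Matrix.toLin' (M c)))
  -- If the kernel for a `c` of minimal kernel dimension were non-zero, a correction by one matrix
  -- unit would make it smaller. Matrix units are complex, so `c` never leaves `ℂ`.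
  let c := Function.argmin d
  refine ⟨c, fun hdet => ?_⟩
  obtain ⟨v, hv0, hv⟩ := Matrix.exists_mulVec_eq_zero_iff.2 hdet
  obtain ⟨w, hw0, hw⟩ := Matrix.exists_vecMul_eq_zero_iff.2 hdet
  have hQv : Q.map (algebraMap ℂ K) *ᵥ v ≠ 0 := by
    intro h0
    apply hv0
    have h1 : φ *ᵥ v = 0 := by
      rwa [Matrix.add_mulVec, ← Matrix.mulVec_mulVec, h0, Matrix.mulVec_zero, add_zero] at hv
    have h2 : (t * φ) *ᵥ v = v := by
      rw [h, Matrix.sub_mulVec, h0, Matrix.one_mulVec, sub_zero]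
    rw [← h2, ← Matrix.mulVec_mulVec, h1, Matrix.mulVec_zero]
  obtain ⟨i, hi⟩ := Function.ne_iff.1 hQv
  obtain ⟨j, hj⟩ := Function.ne_iff.1 hw0
  -- For `u` in the new kernel, pairing with the left null vector `w` gives `w j * (Q u) i = 0`,
  -- hence `(Q u) i = 0` and `u` lies in the old kernel. The old null vector `v` has `(Q v) i ≠ 0`
  -- and is lost.
  let c' := c + Matrix.single j i 1
  have hM : ∀ u, M c' *ᵥ u = M c *ᵥ u + Pi.single j ((Q.map (algebraMap ℂ K) *ᵥ u) i) := by
    intro u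
    have h1 : M c' = M c + Matrix.single j i 1 * Q.map (algebraMap ℂ K) := by
      change φ + (c + Matrix.single j i 1).map _ * _ = φ + _ + _
      rw [Matrix.map_add _ (map_add _), Matrix.map_single, map_one, Matrix.add_mul, add_assoc]
    rw [h1, Matrix.add_mulVec, ← Matrix.mulVec_mulVec]
    congr 1
    ext k
    rw [Matrix.single_mulVec]
    simp [Function.update_apply, Pi.single_apply]
  refine Function.not_lt_argmin d c' ?_
  refine Submodule.finrank_lt_finrank_of_lt (lt_of_le_of_ne ?_ ?_)
  · intro u hu
    rw [LinearMap.mem_ker, Matrix.toLin'_apply] at hu ⊢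
    have h1 : (Q.map (algebraMap ℂ K) *ᵥ u) i = 0 := by
      have h2 := congrArg (fun x => w ⬝ᵥ x) hu
      simp only [hM] at h2
      rw [dotProduct_add, Matrix.dotProduct_mulVec, hw, zero_dotProduct, zero_add,
        dotProduct_single, dotProduct_zero] at h2
      exact (mul_eq_zero.1 h2).resolve_left hj
    have h2 := hM u
    rwa [hu, h1, Pi.single_zero, add_zero, eq_comm] at h2
  · intro he
    have h1 : v ∈ LinearMap.ker (Matrix.toLin' (M c)) := hv
    rw [← he, LinearMap.mem_ker, Matrix.toLin'_apply, hM,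
      show M c *ᵥ v = 0 from hv, zero_add] at h1
    have := congrFun h1 j
    rw [Pi.single_eq_same] at this
    exact hi this

/-! ### Matrices over products -/

section PiMat

variable {m : ℕ} (S : Fin m → Alg)

/-- The projection from a product of algebras. -/
def piProj (i : Fin m) : CommAlgCat.of ℂ (∀ i, S i) ⟶ S i :=
  CommAlgCat.ofHom (Pi.evalAlgHom ℂ (fun i => S i) i)

variable {S}

theorem pi_matrix_ext {k l : Type*}
    {a b : Matrix k l (CommAlgCat.of ℂ (∀ i, S i))}
    (h : ∀ i, a.map (piProj S i).hom = b.map (piProj S i).hom) : a = b := by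
  ext x y i
  exact congrFun (congrFun (h i) x) y

theorem exists_pi_matrix {k l : Type*} (M : ∀ i, Matrix k l (S i)) :
    ∃ a : Matrix k l (CommAlgCat.of ℂ (∀ i, S i)),
      ∀ i, a.map (piProj S i).hom = M i :=
  ⟨Matrix.of fun x y i => M i x y, fun _ => rfl⟩

theorem isUnit_pi_det {k : Type*} [Fintype k] [DecidableEq k]
    {a : Matrix k k (CommAlgCat.of ℂ (∀ i, S i))}
    (h : ∀ i, IsUnit (a.map (piProj S i).hom).det) : IsUnit a.det := by
  refine Pi.isUnit_iff.2 fun i => ?_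
  have h1 : (piProj S i).hom a.det = (a.map (piProj S i).hom).det :=
    RingHom.map_det (piProj S i).hom.toRingHom a
  have h2 := h i
  rw [← h1] at h2
  exact h2

end PiMat

/-! ### Intertwining an arbitrary full rank point with a good point. -/

theorem mul_mul_of_eq {A : Type*} [Semigroup A] {p q w : A} (h : p * q = w) (x : A) :
    p * (q * x) = w * x := by
  rw [← mul_assoc, h]

/-- One step of the construction of an intertwiner. Here `E` and `E'` project onto consecutive
degrees. In the degree of `E` the new map must be `y a r` on the image of `z`, and it is free on the
image of `Q`, a complement of it. Injectivity of `y` (the left inverse `t`) lets a suitable complex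
`c` on that complement make the whole invertible. -/
theorem exists_frame_completion {N : ℕ} (K : Type) [Field K] [Algebra ℂ K]
    (a y t z r E E' : Matrix (Fin N) (Fin N) K) (Q : Matrix (Fin N) (Fin N) ℂ) (ha : a.det ≠ 0)
    (haE : a * E = E * a) (haE' : a * E' = E' * a) (hE : E * E = E) (hy : y * E' = E * y)
    (hr : r * E = E' * r) (hz : z * E' = E * z) (hty : t * (y * E') = E')
    (hQ : Q.map (algebraMap ℂ K) = E - z * (r * E)) :
    ∃ c : Matrix (Fin N) (Fin N) ℂ, (a * (1 - E) +
      E * (y * a * r + c.map (algebraMap ℂ K) * Q.map (algebraMap ℂ K)) * E).det ≠ 0 := by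
  let u : GL (Fin N) K := Matrix.GeneralLinearGroup.mk'' a (isUnit_iff_ne_zero.2 ha)
  obtain ⟨b, hb⟩ : ∃ b, b = (u⁻¹).1 := ⟨_, rfl⟩
  have hab : a * b = 1 := hb ▸ u.mul_inv
  have hba : b * a = 1 := hb ▸ u.inv_mul
  have hbE : b * E = E * b := hb ▸ (show Commute u.1 E from haE).units_inv_left
  have hbE' : b * E' = E' * b := hb ▸ (show Commute u.1 E' from haE').units_inv_left
  rw [hy] at hty
  have hty' : ∀ x, t * (E * (y * x)) = E' * x := fun x => by rw [← hty]; simp only [mul_assoc]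
  have hQE : Q.map (algebraMap ℂ K) * E = Q.map (algebraMap ℂ K) := by
    rw [hQ, sub_mul, hE, mul_assoc, mul_assoc, hE]
  -- The factor on the left undoes the matrix step by step: `t` inverts `y`, `b` inverts `a`, and
  -- `z` inverts `r` up to `Q`.
  have hφ : (b * (1 - E) + z * b * t * E) * (a * (1 - E) + E * (y * a * r) * E) =
      1 - Q.map (algebraMap ℂ K) := by
    simp only [mul_assoc, mul_sub, sub_mul, mul_add, add_mul, mul_one, one_mul, hQ, haE, mul_mul_of_eq haE,
      haE', mul_mul_of_eq haE', hE, mul_mul_of_eq hE, hy, mul_mul_of_eq hy, hr, mul_mul_of_eq hr, hz, mul_mul_of_eq hz, hty, hty', hab, mul_mul_of_eq hab, hba,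
      mul_mul_of_eq hba, hbE, mul_mul_of_eq hbE, hbE', mul_mul_of_eq hbE']
    abel
  obtain ⟨c, hc⟩ := exists_complex_completion K _ _ Q hφ
  refine ⟨c, ?_⟩
  generalize Q.map (algebraMap ℂ K) = Q' at *
  generalize c.map (algebraMap ℂ K) = c' at *
  clear hQ
  have h0 : Q' * (1 - E) = 0 := by rw [mul_sub, hQE, mul_one, sub_self]
  -- The completion found so far may have components of `c' * Q'` outside the degree of `E`; a
  -- unipotent factor removes them without affecting invertibility.
  have h1 : a * (1 - E) + E * (y * a * r + c' * Q') * E =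
      (a * (1 - E) + E * (y * a * r) * E + c' * Q') * (1 - b * (1 - E) * c' * Q') := by
    simp only [mul_assoc, mul_sub, sub_mul, mul_add, add_mul, mul_one, one_mul, haE, mul_mul_of_eq haE,
      haE', mul_mul_of_eq haE', hE, mul_mul_of_eq hE, hy, mul_mul_of_eq hy, hr, mul_mul_of_eq hr, hab, mul_mul_of_eq hab, hba,
      mul_mul_of_eq hba, hbE, mul_mul_of_eq hbE, hbE', mul_mul_of_eq hbE', hQE, mul_mul_of_eq hQE]
    abel
  have h2 : (1 - b * (1 - E) * c' * Q') * (1 + b * (1 - E) * c' * Q') = 1 := by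
    simp only [mul_assoc, mul_sub, sub_mul, mul_add, add_mul, mul_one, one_mul, hE, mul_mul_of_eq hE,
      hbE, mul_mul_of_eq hbE, hQE, mul_mul_of_eq hQE]
    abel
  have h3 := congrArg Matrix.det h2
  rw [Matrix.det_mul, Matrix.det_one] at h3
  rw [h1, Matrix.det_mul]
  exact mul_ne_zero hc (left_ne_zero_of_mul (h3.trans_ne one_ne_zero))

namespace Datum

variable {N p : ℕ} [hp : Fact p.Prime] {B : Matrix (Fin N) (Fin N) ℂ} {s : GL (Fin N) ℂ}
  {σ : SupportKind} (D : Datum p B s σ)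

theorem exists_bound : ∃ L : ℕ, ∀ k : ℕ, L ≤ k → D.e (σ.i₀ - k) = 0 := by
  obtain ⟨L, hL⟩ := exists_nat_gt (∑ i ∈ D.I, |σ.i₀ - i|)
  refine ⟨L, fun k hk => D.eq_zero _ fun h => ?_⟩
  have h1 := Finset.single_le_sum (f := fun i => |σ.i₀ - i|) (fun i _ => abs_nonneg _) h
  have h2 : (L : ℝ) ≤ k := by exact_mod_cast hk
  have h3 := le_abs_self (σ.i₀ - (σ.i₀ - k))
  linarith

namespace Good

variable {D} {z : Matrix (Fin N) (Fin N) ℂ}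

theorem shift (hz : D.Good z) (R : Alg) (i : ℝ) : bc R z * D.eR R i = D.eR R (i + 1) * bc R z := by
  have := (D.mem_vogan_iff.1 hz.mem).2 i
  simp only [Grading.eR, bc_cpt] at this
  rw [← bc_mul, this, bc_mul]

theorem r_shift' (hz : D.Good z) (R : Alg) (i : ℝ) : bc R hz.r * D.eR R i = D.eR R (i - 1) * bc R hz.r := by
  rw [← bc_mul, hz.r_shift, bc_mul]

theorem sub_add_one (l : ℕ) : σ.i₀ - (l + 1 : ℕ) + 1 = σ.i₀ - l := by push_cast; ring

theorem sub_sub_one (l : ℕ) : σ.i₀ - l - 1 = σ.i₀ - (l + 1 : ℕ) := by push_cast; ring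

theorem z_mul_E (hz : D.Good z) (R : Alg) (l : ℕ) : bc R z * D.E R (l + 1) = D.E R l * bc R z := by
  rw [hz.shift, sub_add_one]

theorem r_mul_E (hz : D.Good z) (R : Alg) (l : ℕ) : bc R hz.r * D.E R l = D.E R (l + 1) * bc R hz.r := by
  rw [hz.r_shift', sub_sub_one]

theorem r_mul_z (hz : D.Good z) (R : Alg) (l : ℕ) : bc R hz.r * (bc R z * D.E R (l + 1)) = D.E R (l + 1) := by
  rw [← bc_mul, ← bc_mul, hz.r_mul]

theorem mem_vogan (hz : D.Good z) (R : Alg) : bc R z ∈ (voganSpace p B s).pts R := by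
  refine D.mem_vogan_iff.2 ⟨?_, hz.shift R⟩
  have h := (D.mem_vogan_iff.1 hz.mem).1
  rw [← D.bc_adj, h]
  exact bc_neg R z

/-- The condition `y a = a z` prescribes `a` on the image of `z` in each degree from its value one
degree lower, and leaves it free on a complement. The free part is filled by a complex matrix chosen
to make `a` invertible at the given point of `Spec R`; being complex, it makes sense over `R`. -/
theorem exists_frame (hz : D.Good z) {R : Alg} {y : Matrix (Fin N) (Fin N) R} (hy : y ∈ (vReg p B s).pts R)
    (K : Type) [Field K] [Algebra ℂ K] (f : R →ₐ[ℂ] K) :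
    ∃ a : Matrix (Fin N) (Fin N) R, (a.map f).det ≠ 0 ∧ (∀ i, a * D.eR R i = D.eR R i * a) ∧
      (∀ i, σ.i₀ < i → a * D.eR R i = D.eR R i) ∧
      ∀ l, y * a * D.E R (l + 1) = a * bc R z * D.E R (l + 1) := by
  obtain ⟨L, hL⟩ := D.exists_bound
  -- Induction from the far end `l = L` of the ladder, where all projectors vanish and `a = 1`
  -- works, up to `l = 0`.
  have key : ∀ m l, l + m = L → ∃ a : Matrix (Fin N) (Fin N) R, (a.map f).det ≠ 0 ∧
      (∀ i, a * D.eR R i = D.eR R i * a) ∧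
      (∀ i, (∀ k, l ≤ k → i ≠ σ.i₀ - k) → a * D.eR R i = D.eR R i) ∧
      ∀ k, l ≤ k → y * a * D.E R (k + 1) = a * bc R z * D.E R (k + 1) := by
    intro m
    induction m with
    | zero =>
      rintro l rfl
      refine ⟨1, ?_, fun i => by rw [Matrix.one_mul, Matrix.mul_one],
        fun i _ => Matrix.one_mul _, fun k hk => ?_⟩
      · rw [Matrix.map_one _ (map_zero f) (map_one f), Matrix.det_one]
        exact one_ne_zero
      · rw [E, Grading.eR, hL (k + 1) (by omega), bc_zero, Matrix.mul_zero, Matrix.mul_zero]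
    | succ m ih =>
      intro l hl
      obtain ⟨a, ha, hac, ha1, hay⟩ := ih (l + 1) (by omega)
      have hy2 := (D.mem_vogan_iff.1 hy.1).2
      have hyE : y * D.E R (l + 1) = D.E R l * y := by rw [hy2, sub_add_one]
      -- The projector of `W_{i₀ - l}` along the image of `z`, with kernel inside `W_{i₀ - l}` equal
      -- to that image.
      let Q := D.e (σ.i₀ - l) - z * (hz.r * D.e (σ.i₀ - l))
      obtain ⟨t, ht⟩ := (D.isFullRank_iff hy.1).1 hy.2 K f (l + 1)
      let φ : R ⟶ CommAlgCat.of ℂ K := CommAlgCat.ofHom f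
      have hm : ∀ {u v w x : Matrix (Fin N) (Fin N) R}, u * v = w * x →
          u.map f * v.map f = w.map f * x.map f := fun h => by
        rw [← Matrix.map_mul, h, Matrix.map_mul]
      have hEK : ∀ k, (D.E R k).map f = D.E (CommAlgCat.of ℂ K) k := fun k => bc_map φ _
      have hzK : ∀ M : Matrix (Fin N) (Fin N) ℂ, (bc R M).map f = bc (CommAlgCat.of ℂ K) M :=
        fun M => bc_map φ _
      obtain ⟨c, hc⟩ := exists_frame_completion K (a.map f) (y.map f) t
        ((bc R z).map f) ((bc R hz.r).map f) ((D.E R l).map f) ((D.E R (l + 1)).map f) Q ha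
        (hm (hac _)) (hm (hac _)) (by rw [← Matrix.map_mul, D.eR_mul_eR]) (hm hyE)
        (hm (hz.r_mul_E R l)) (hm (hz.z_mul_E R l)) (by rw [hEK]; exact ht) (by
          rw [hEK, hzK, hzK]
          change bc (CommAlgCat.of ℂ K) Q = _
          rw [bc_sub, bc_mul, bc_mul])
      have hEl : a * D.E R l = D.E R l := ha1 _ fun k hk h => by
        have : (k : ℝ) = l := by linarith
        have : k = l := by exact_mod_cast this
        omega
      obtain ⟨X, hX⟩ : ∃ X, X = y * a * bc R hz.r + bc R c * bc R Q := ⟨_, rfl⟩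
      let a' := a * (1 - D.E R l) + D.E R l * X * D.E R l
      have hne : ∀ i, i ≠ σ.i₀ - l → a' * D.eR R i = a * D.eR R i := fun i hi => by
        have h0 : D.E R l * D.eR R i = 0 := D.eR_mul_eR_of_ne R hi.symm
        rw [Matrix.add_mul, Matrix.mul_assoc, Matrix.sub_mul, h0, Matrix.mul_assoc _ (D.E R l), h0]
        simp
      have heq : a' * D.E R l = D.E R l * X * D.E R l := by
        rw [Matrix.add_mul, Matrix.mul_assoc, Matrix.sub_mul, Matrix.mul_assoc _ (D.E R l),
          D.eR_mul_eR]
        simp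
      have hne' : ∀ k, l ≤ k → σ.i₀ - (k + 1 : ℕ) ≠ σ.i₀ - l := fun k hk h => by
        have h2 : ((k + 1 : ℕ) : ℝ) = l := by linarith
        have : k + 1 = l := by exact_mod_cast h2
        omega
      refine ⟨a', ?_, fun i => ?_, fun i hi => ?_, fun k hk => ?_⟩
      · convert hc using 2
        have hmul : ∀ u v : Matrix (Fin N) (Fin N) R, (u * v).map f = u.map f * v.map f :=
          fun _ _ => Matrix.map_mul
        have hQK : ∀ M : Matrix (Fin N) (Fin N) ℂ, (bc R M).map f = M.map (algebraMap ℂ K) :=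
          fun M => bc_map φ _
        rw [Matrix.map_add _ (map_add f), hmul, hmul, hmul, hX, Matrix.map_add _ (map_add f), hmul,
          hmul, hmul, Matrix.map_sub _ (map_sub f), Matrix.map_one _ (map_zero f) (map_one f),
          hQK c, hQK Q]
      · by_cases hi : i = σ.i₀ - l
        · rw [hi, heq, Matrix.mul_add, ← Matrix.mul_assoc, ← hac, Matrix.mul_assoc a,
            Matrix.mul_sub, D.eR_mul_eR, Matrix.mul_one, sub_self, Matrix.mul_zero, zero_add,
            ← Matrix.mul_assoc, ← Matrix.mul_assoc, D.eR_mul_eR]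
        · have h0 : D.eR R i * D.E R l = 0 := D.eR_mul_eR_of_ne R hi
          rw [hne i hi, hac, Matrix.mul_add, ← Matrix.mul_assoc, ← hac, Matrix.mul_assoc a,
            Matrix.mul_sub, h0, ← Matrix.mul_assoc, ← Matrix.mul_assoc, h0]
          simp
      · rw [hne i (hi l le_rfl), ha1 i fun k hk => hi k (by omega)]
      · rw [Matrix.mul_assoc, hne _ (hne' k hk), Matrix.mul_assoc a', hz.z_mul_E,
          ← Matrix.mul_assoc a']
        rcases hk.eq_or_lt with rfl | hk
        · rw [heq, Matrix.mul_assoc, ← hz.z_mul_E, Matrix.mul_assoc, hX, Matrix.add_mul]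
          -- Since `Q` kills the image of `z`, the arbitrary part `c Q` does not disturb the
          -- intertwining relation.
          have e1 : bc R Q * (bc R z * D.E R (l + 1)) = 0 := by
            rw [bc_sub, bc_mul, bc_mul, Matrix.sub_mul, Matrix.mul_assoc, Matrix.mul_assoc]
            have : D.E R l * (bc R z * D.E R (l + 1)) = bc R z * D.E R (l + 1) := by
              rw [← Matrix.mul_assoc, ← hz.z_mul_E, Matrix.mul_assoc, D.eR_mul_eR]
            rw [this, hz.r_mul_z, sub_self]
          rw [Matrix.mul_assoc (bc R c), e1, Matrix.mul_zero, add_zero, Matrix.mul_assoc (y * a),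
            hz.r_mul_z, Matrix.mul_assoc, hac, ← Matrix.mul_assoc, hyE, ← Matrix.mul_assoc,
            ← Matrix.mul_assoc, D.eR_mul_eR]
        · rw [hne _ (by
            obtain ⟨k, rfl⟩ := Nat.exists_eq_add_of_lt hk
            exact hne' (l + k) (by omega)), Matrix.mul_assoc, ← hz.z_mul_E, ← Matrix.mul_assoc,
            ← Matrix.mul_assoc]
          exact hay k hk
  obtain ⟨a, h1, h2, h3, h4⟩ := key L 0 (by omega)
  refine ⟨a, h1, h2, fun i hi => h3 i fun k _ h => ?_, fun l => h4 l (Nat.zero_le l)⟩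
  have := σ.i₀_sub_le k
  linarith

end Good

end Datum

theorem GSpace.Hom.mul_inv_smul_smul {A A' : GSpace} (u : A.Hom A') {R : Alg} (g : A'.G.obj R)
    (k : A.G.obj R) (x : A.X.obj R) :
    (g * (u.onG R k)⁻¹) • u.onX R (k • x) = g • u.onX R x := by
  rw [u.onX_smul, smul_smul, inv_mul_cancel_right]

namespace Datum

variable {N p : ℕ} [hp : Fact p.Prime] {B : Matrix (Fin N) (Fin N) ℂ} {s : GL (Fin N) ℂ}
  {σ : SupportKind} {D : Datum p B s σ} {z : Matrix (Fin N) (Fin N) ℂ}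

/-! ### Local transitivity -/

theorem Good.forget' (hz : D.Good z) (R : Alg) {j : ℝ} (hj : j ∈ σ.forgotten) :
    bc R z * D.eR R j = 0 := by
  rw [← bc_mul, hz.forget j hj, bc_zero]

theorem Good.exists_intertwiner (hz : D.Good z) {R : Alg} {y : Matrix (Fin N) (Fin N) R}
    (hy : y ∈ (vReg p B s).pts R) (a : Matrix (Fin N) (Fin N) R) (ha : IsUnit a.det)
    (hc : ∀ i, a * D.eR R i = D.eR R i * a) (h1 : ∀ i, σ.i₀ < i → a * D.eR R i = D.eR R i)
    (h2 : ∀ l, y * a * D.E R (l + 1) = a * bc R z * D.E R (l + 1)) :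
    ∃ h ∈ (hGroup B s).pts R, ∀ i ∉ σ.forgotten, y * h.1 * D.eR R i = h.1 * bc R z * D.eR R i := by
  obtain ⟨h, hh, hE, -⟩ := D.exists_isometry a ha hc h1
  refine ⟨h, hh, fun i hi => D.intertwine hh (hz.mem_vogan R) hy.1 (fun l => ?_) hi⟩
  rw [Matrix.mul_assoc, hE, ← Matrix.mul_assoc, h2, Matrix.mul_assoc, hz.z_mul_E, ← Matrix.mul_assoc,
    ← hE, Matrix.mul_assoc, ← hz.z_mul_E, Matrix.mul_assoc]

theorem Good.conj_mem_fiber (hz : D.Good z) {R : Alg} {y : Matrix (Fin N) (Fin N) R}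
    (hy : y ∈ (vReg p B s).pts R) {h : GL (Fin N) R} (hh : h ∈ (hGroup B s).pts R)
    (hyz : ∀ i ∉ σ.forgotten, y * h.1 * D.eR R i = h.1 * bc R z * D.eR R i) :
    (h⁻¹).1 * y * h.1 ∈ (fiber p B s σ z).pts R := by
  have hinv : (h⁻¹).1 * h.1 = 1 := h.inv_mul
  refine ⟨?_, D.isForget_iff.2 ⟨fun j hj => ?_, fun j hj => hz.forget' R hj⟩⟩
  · have := vReg_conj p B s R h⁻¹ (Subgroup.inv_mem _ hh) y hy
    rwa [inv_inv] at this
  · rw [Matrix.mul_assoc, Matrix.mul_assoc, ← Matrix.mul_assoc y, hyz j hj, ← Matrix.mul_assoc,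
      ← Matrix.mul_assoc, hinv, Matrix.one_mul]

/-- The frame built at the residue field of `q` stays invertible where its determinant is a unit, a
basic open neighbourhood of `q`. Finitely many of these cover, and the frames over them form one
frame over the product. -/
theorem Good.exists_locally (hz : D.Good z) {R : Alg} {y : Matrix (Fin N) (Fin N) R}
    (hy : y ∈ (vReg p B s).pts R) :
    ∃ (S : Alg) (f : R ⟶ S), IsEtaleCovering f ∧ ∃ h ∈ (hGroup B s).pts S,
      (h⁻¹).1 * y.map f.hom * h.1 ∈ (fiber p B s σ z).pts S := by
  obtain ⟨m, S, f, hP, hf⟩ := exists_pi_covering (R := R) (fun S f =>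
    ∃ a : Matrix (Fin N) (Fin N) S, IsUnit a.det ∧ (∀ i, a * D.eR S i = D.eR S i * a) ∧
      (∀ i, σ.i₀ < i → a * D.eR S i = D.eR S i) ∧
      ∀ l, y.map f.hom * a * D.E S (l + 1) = a * bc S z * D.E S (l + 1)) (by
    intro q
    obtain ⟨a, ha, hc, h1, h2⟩ := hz.exists_frame hy q.asIdeal.ResidueField
      (IsScalarTower.toAlgHom ℂ R q.asIdeal.ResidueField)
    obtain ⟨S, f, hf, hu, hq⟩ := exists_localization a.det
    have hd : ∀ {T : Type} [CommRing T] (g : R →+* T), (a.map g).det = g a.det :=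
      fun g => (RingHom.map_det g a).symm
    refine ⟨S, f, hf, hq q fun hm => ha ?_, a.map f.hom, ?_, fun i => ?_, fun i hi => ?_,
      fun l => ?_⟩
    · exact (hd (algebraMap R q.asIdeal.ResidueField)).trans
        (Ideal.algebraMap_residueField_eq_zero.2 hm)
    · rw [show (a.map f.hom).det = f.hom a.det from hd f.hom.toRingHom]
      exact hu
    · rw [Grading.eR, ← bc_map f, ← Matrix.map_mul, hc, Matrix.map_mul]
    · rw [Grading.eR, ← bc_map f, ← Matrix.map_mul, h1 i hi]
    · rw [E, Grading.eR, ← bc_map f, ← bc_map f z, ← Matrix.map_mul, ← Matrix.map_mul,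
        ← Matrix.map_mul, ← Matrix.map_mul, h2])
  choose M hu hc h1 h2 using hP
  obtain ⟨a, ha⟩ := exists_pi_matrix M
  refine ⟨_, _, hf, ?_⟩
  have hyT := (vReg p B s).map_mem (R := R) (S := CommAlgCat.of ℂ (∀ i, S i))
    (CommAlgCat.ofHom (AlgHom.pi fun i => (f i).hom)) hy
  obtain ⟨h, hh, hyz⟩ := hz.exists_intertwiner hyT a (isUnit_pi_det fun i => by
      rw [ha]; exact hu i)
    (fun j => pi_matrix_ext fun i => by
      rw [Matrix.map_mul, Matrix.map_mul, bc_map, ha]; exact hc i j)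
    (fun j hj => pi_matrix_ext fun i => by
      rw [Matrix.map_mul, bc_map, ha]; exact h1 i j hj)
    (fun l => pi_matrix_ext fun i => by
      rw [Matrix.map_mul, Matrix.map_mul, Matrix.map_mul, Matrix.map_mul, bc_map, bc_map, ha]
      exact h2 i l)
  exact ⟨h, hh, hz.conj_mem_fiber hyT hh hyz⟩

/-- If `g • x = g' • x'`, the only possible element is `g'⁻¹ * g`. It preserves the grading, so it
is compatible with forgetting components; as `x` and `x'` both project to `z`, it stabilizes `z`. -/
theorem Good.fiberInclusion_isContractedProduct (hz : D.Good z) :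
    (fiberInclusion p B s σ z).IsContractedProduct := by
  refine ⟨?_, ?_⟩
  · intro R (g : (hGroup B s).pts R) (g' : (hGroup B s).pts R) (x : (fiber p B s σ z).pts R)
      (x' : (fiber p B s σ z).pts R)
    constructor
    · intro h
      have h' : g.1.1 * x.1 * (g.1⁻¹).1 = g'.1.1 * x'.1 * (g'.1⁻¹).1 :=
        congrArg (fun u : (vReg p B s).pts R => u.1) h
      let k : GL (Fin N) R := g'.1⁻¹ * g.1
      have hk : k ∈ (hGroup B s).pts R := Subgroup.mul_mem _ (Subgroup.inv_mem _ g'.2) g.2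
      have hkx : k.1 * x.1 = x'.1 * k.1 := by
        have e1 : (g'.1⁻¹).1 * g'.1.1 = 1 := g'.1.inv_mul
        have e2 : (g.1⁻¹).1 * g.1.1 = 1 := g.1.inv_mul
        have hkv : k.1 = (g'.1⁻¹).1 * g.1.1 := rfl
        calc k.1 * x.1 = (g'.1⁻¹).1 * (g.1.1 * x.1 * (g.1⁻¹).1) * g.1.1 := by
              rw [hkv, Matrix.mul_assoc _ _ g.1.1, Matrix.mul_assoc _ _ g.1.1, e2, Matrix.mul_one,
                Matrix.mul_assoc]
          _ = ((g'.1⁻¹).1 * g'.1.1) * x'.1 * ((g'.1⁻¹).1 * g.1.1) := by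
              rw [h']; simp only [Matrix.mul_assoc]
          _ = _ := by rw [e1, Matrix.one_mul, hkv]
      have hkc := (D.mem_hGroup_iff.1 hk).2.2
      have hkz : k.1 * bc R z = bc R z * k.1 := by
        apply D.ext_right
        intro j
        have hx := D.isForget_iff.1 x.2.2
        have hx' := D.isForget_iff.1 x'.2.2
        by_cases hj : j ∈ σ.forgotten
        · rw [Matrix.mul_assoc, hx.2 j hj, Matrix.mul_assoc, hkc, ← Matrix.mul_assoc, hx'.2 j hj]
          simp
        · rw [Matrix.mul_assoc, hx.1 j hj, ← Matrix.mul_assoc, hkx, Matrix.mul_assoc, hkc,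
            ← Matrix.mul_assoc, ← hx'.1 j hj, Matrix.mul_assoc, ← hkc, Matrix.mul_assoc]
      refine ⟨(⟨k, hk, hkz⟩ : (hStab B s z).pts R), ⟨Subtype.ext ?_, Subtype.ext ?_⟩, ?_⟩
      · change g'.1 = g.1 * (g'.1⁻¹ * g.1)⁻¹
        group
      · change x'.1 = k.1 * x.1 * (k⁻¹).1
        rw [hkx, Matrix.mul_assoc, show k.1 * (k⁻¹).1 = 1 from k.mul_inv, Matrix.mul_one]
      · rintro (k' : (hStab B s z).pts R) ⟨h1, -⟩
        have h2 : g'.1 = g.1 * k'.1⁻¹ := congrArg (fun u : (hGroup B s).pts R => u.1) h1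
        apply Subtype.ext
        change k'.1 = g'.1⁻¹ * g.1
        rw [h2]
        group
    · rintro ⟨k, ⟨rfl, rfl⟩, -⟩
      exact ((fiberInclusion p B s σ z).mul_inv_smul_smul g k x).symm
  · intro R (y : (vReg p B s).pts R)
    obtain ⟨S, f, hf, h, hh, hx⟩ := hz.exists_locally y.2
    refine ⟨S, f, hf, (⟨h, hh⟩ : (hGroup B s).pts S), (⟨_, hx⟩ : (fiber p B s σ z).pts S),
      Subtype.ext ?_⟩
    change y.1.map f.hom = h.1 * ((h⁻¹).1 * y.1.map f.hom * h.1) * (h⁻¹).1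
    have e1 : h.1 * (h⁻¹).1 = 1 := h.mul_inv
    rw [Matrix.mul_assoc, Matrix.mul_assoc, e1, Matrix.mul_one, ← Matrix.mul_assoc, e1,
      Matrix.one_mul]

theorem Good.stackEquiv (hz : D.Good z) :
    GSpace.StackEquiv (vRegSpace p B s) (fiberSpace p B s σ z) :=
  hz.fiberInclusion_isContractedProduct.isLocalEquiv.stackEquiv (D.fiber_isLocal z).isSheaf
    D.vReg_isLocal.isSheaf (hGroup_isLocal B s).isSheaf

/-! ### Orbits of complex points -/

theorem conj_mem_vRegDiamond (D : Datum p B s σ) (hz : z ∈ vRegDiamond p B s σ) {g : GL (Fin N) ℂ}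
    (hg : g ∈ (hGroup B s).pts cpt) : g.1 * z * (g⁻¹).1 ∈ vRegDiamond p B s σ := by
  obtain ⟨x, hx, hxz⟩ := hz
  refine ⟨g.1 * x * (g⁻¹).1, vReg_conj p B s cpt g hg x hx, ?_⟩
  have hc : ∀ i, (g⁻¹).1 * D.eR cpt i = D.eR cpt i * (g⁻¹).1 :=
    (D.mem_hGroup_iff.1 (Subgroup.inv_mem _ hg)).2.2
  obtain ⟨h1, h2⟩ := D.isForget_iff.1 hxz
  refine D.isForget_iff.2 ⟨fun j hj => ?_, fun j hj => ?_⟩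
  · rw [Matrix.mul_assoc, hc, Matrix.mul_assoc, ← Matrix.mul_assoc z, h1 j hj, Matrix.mul_assoc,
      ← hc, ← Matrix.mul_assoc, ← Matrix.mul_assoc]
  · rw [Matrix.mul_assoc, hc, Matrix.mul_assoc, ← Matrix.mul_assoc z, h2 j hj]
    simp

/-- Over the field `ℂ` the frame at the unique point is already invertible, so no covering is
needed. -/
theorem Good.exists_conj (hz : D.Good z) {z' : Matrix (Fin N) (Fin N) ℂ}
    (hz' : z' ∈ vRegDiamond p B s σ) :
    ∃ g ∈ (hGroup B s).pts cpt, z' = g.1 * z * (g⁻¹ : GL (Fin N) ℂ).1 := by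
  obtain ⟨x, hx, hxz⟩ := hz'
  obtain ⟨a, ha, hc, h1, h2⟩ := hz.exists_frame hx ℂ (AlgHom.id ℂ ℂ)
  obtain ⟨h, hh, hyz⟩ := hz.exists_intertwiner hx a (isUnit_iff_ne_zero.2 ha) hc h1 h2
  refine ⟨h, hh, ?_⟩
  obtain ⟨e1, e2⟩ := D.isForget_iff.1 hxz
  have hhc := (D.mem_hGroup_iff.1 hh).2.2
  have key : (show Matrix (Fin N) (Fin N) cpt from z') * h.1 = h.1 * bc cpt z := by
    apply D.ext_right
    intro j
    by_cases hj : j ∈ σ.forgotten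
    · rw [Matrix.mul_assoc, hhc, ← Matrix.mul_assoc, e2 j hj, Matrix.mul_assoc, hz.forget' cpt hj]
      simp
    · rw [← hyz j hj, Matrix.mul_assoc, hhc, ← Matrix.mul_assoc, e1 j hj, Matrix.mul_assoc, ← hhc,
        Matrix.mul_assoc]
  rw [bc_cpt] at key
  have : z' * h.1 * (h⁻¹).1 = h.1 * z * (h⁻¹).1 := congrArg (fun M => M * (h⁻¹).1) key
  rw [← this, Matrix.mul_assoc, show h.1 * (h⁻¹).1 = 1 from h.mul_inv, Matrix.mul_one]

end Datum

/-! ### Local normal forms of symmetric and skew-symmetric forms -/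

section NormalForm

/-- Congruence of bilinear forms. -/
def MatCongr {ι R : Type*} [Fintype ι] [DecidableEq ι] [CommRing R] (y c : Matrix ι ι R) : Prop :=
  ∃ x : Matrix ι ι R, IsUnit x.det ∧ y = xᵀ * c * x

/-- Congruence étale locally. -/
def LocCongr {ι : Type} [Fintype ι] [DecidableEq ι] {R : Alg} (y c : Matrix ι ι R) : Prop :=
  ∃ (S : Alg) (f : R ⟶ S), IsEtaleCovering f ∧ MatCongr (y.map f.hom) (c.map f.hom)

variable {ι κ : Type} [Fintype ι] [DecidableEq ι] [Fintype κ] [DecidableEq κ]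

theorem map_det' {R S : Alg} (f : R ⟶ S) (x : Matrix ι ι R) : (x.map f.hom).det = f.hom x.det :=
  (RingHom.map_det f.hom.toRingHom x).symm

theorem isUnit_map_det {R S : Alg} (f : R ⟶ S) {x : Matrix ι ι R} (hx : IsUnit x.det) :
    IsUnit (x.map f.hom).det := by
  rw [map_det']
  exact hx.map f.hom

theorem MatCongr.map {R S : Alg} {y c : Matrix ι ι R} (h : MatCongr y c) (f : R ⟶ S) :
    MatCongr (y.map f.hom) (c.map f.hom) := by
  obtain ⟨x, hx, rfl⟩ := h
  refine ⟨x.map f.hom, isUnit_map_det f hx, ?_⟩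
  rw [Matrix.map_mul, Matrix.map_mul, Matrix.transpose_map]

theorem MatCongr.trans {R : Type*} [CommRing R] {y c d : Matrix ι ι R} (h : MatCongr y c)
    (h' : MatCongr c d) : MatCongr y d := by
  obtain ⟨x, hx, rfl⟩ := h
  obtain ⟨x', hx', rfl⟩ := h'
  refine ⟨x' * x, by rw [Matrix.det_mul]; exact hx'.mul hx, ?_⟩
  simp only [Matrix.transpose_mul, Matrix.mul_assoc]

theorem MatCongr.symm {R : Type*} [CommRing R] {y c : Matrix ι ι R} (h : MatCongr y c) :
    MatCongr c y := by
  obtain ⟨x, hx, rfl⟩ := h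
  refine ⟨x⁻¹, Matrix.isUnit_nonsing_inv_det x hx, ?_⟩
  have h1 : x * x⁻¹ = 1 := Matrix.mul_nonsing_inv x hx
  have h2 : (x⁻¹)ᵀ * xᵀ = 1 := by rw [← Matrix.transpose_mul, h1, Matrix.transpose_one]
  calc c = ((x⁻¹)ᵀ * xᵀ) * c * (x * x⁻¹) := by rw [h1, h2, Matrix.one_mul, Matrix.mul_one]
    _ = _ := by simp only [Matrix.mul_assoc]

theorem MatCongr.fromBlocks {R : Type*} [CommRing R] {y c : Matrix ι ι R} {y' c' : Matrix κ κ R}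
    (h : MatCongr y c) (h' : MatCongr y' c') :
    MatCongr (Matrix.fromBlocks y 0 0 y') (Matrix.fromBlocks c 0 0 c') := by
  obtain ⟨x, hx, rfl⟩ := h
  obtain ⟨x', hx', rfl⟩ := h'
  refine ⟨Matrix.fromBlocks x 0 0 x', by rw [Matrix.det_fromBlocks_zero₂₁]; exact hx.mul hx', ?_⟩
  simp [Matrix.fromBlocks_transpose, Matrix.fromBlocks_multiply]

theorem MatCongr.of_submatrix {R : Type*} [CommRing R] {y c : Matrix ι ι R} (e : κ ≃ ι)
    (h : MatCongr (y.submatrix e e) (c.submatrix e e)) : MatCongr y c := by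
  obtain ⟨x, hx, h⟩ := h
  refine ⟨x.submatrix e.symm e.symm, by rwa [Matrix.det_submatrix_equiv_self], ?_⟩
  have h1 := congrArg (fun M => M.submatrix e.symm e.symm) h
  simp only [Matrix.submatrix_submatrix, Equiv.self_comp_symm, Matrix.submatrix_id_id] at h1
  rw [h1, ← Matrix.submatrix_mul_equiv _ _ _ e.symm, ← Matrix.submatrix_mul_equiv _ _ _ e.symm,
    Matrix.transpose_submatrix]
  simp only [Matrix.submatrix_submatrix, Equiv.self_comp_symm, Matrix.submatrix_id_id]

theorem matCongr_submatrix {R : Type*} [CommRing R] (y : Matrix ι ι R) (τ : Equiv.Perm ι) :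
    MatCongr (y.submatrix τ τ) y := by
  refine ⟨(1 : Matrix ι ι R).submatrix id τ, ?_, ?_⟩
  · refine Matrix.isUnit_det_of_left_inverse (B := (1 : Matrix ι ι R).submatrix τ id) ?_
    ext i j
    simp [Matrix.mul_apply, Matrix.one_apply]
  · ext i j
    simp [Matrix.mul_apply, Matrix.one_apply]

theorem LocCongr.common {R : Alg} {y c : Matrix ι ι R} {y' c' : Matrix κ κ R} (h : LocCongr y c)
    (h' : LocCongr y' c') : ∃ (S : Alg) (f : R ⟶ S), IsEtaleCovering f ∧
      MatCongr (y.map f.hom) (c.map f.hom) ∧ MatCongr (y'.map f.hom) (c'.map f.hom) := by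
  obtain ⟨S, f, hf, h⟩ := h
  obtain ⟨S', f', hf', h'⟩ := h'
  obtain ⟨T, g, g', hg, he⟩ := hf.exists_pushout f'
  refine ⟨T, f' ≫ g, hf'.comp hg, ?_, h'.map g⟩
  rw [← he]
  exact h.map g'

theorem MatCongr.locCongr {R : Alg} {y c : Matrix ι ι R} (h : MatCongr y c) : LocCongr y c :=
  ⟨R, 𝟙 R, isEtaleCovering_id R, h.map (𝟙 R)⟩

theorem LocCongr.trans {R : Alg} {y c d : Matrix ι ι R} (h : LocCongr y c) (h' : LocCongr c d) :
    LocCongr y d := by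
  obtain ⟨S, f, hf, h1, h2⟩ := h.common h'
  exact ⟨S, f, hf, h1.trans h2⟩

theorem LocCongr.fromBlocks {R : Alg} {y c : Matrix ι ι R} {y' c' : Matrix κ κ R}
    (h : LocCongr y c) (h' : LocCongr y' c') :
    LocCongr (Matrix.fromBlocks y 0 0 y') (Matrix.fromBlocks c 0 0 c') := by
  obtain ⟨S, f, hf, h1, h2⟩ := h.common h'
  refine ⟨S, f, hf, ?_⟩
  rw [Matrix.fromBlocks_map, Matrix.fromBlocks_map, Matrix.map_zero _ (map_zero f.hom),
    Matrix.map_zero _ (map_zero f.hom)]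
  exact h1.fromBlocks h2

theorem LocCongr.of_submatrix {R : Alg} {y c : Matrix ι ι R} (e : κ ≃ ι)
    (h : LocCongr (y.submatrix e e) (c.submatrix e e)) : LocCongr y c := by
  obtain ⟨S, f, hf, h⟩ := h
  exact ⟨S, f, hf, .of_submatrix e h⟩

theorem LocCongr.of_local {R : Alg} {y c : Matrix ι ι R}
    (h : ∀ q : PrimeSpectrum R, ∃ (S : Alg) (f : R ⟶ S), f.hom.toRingHom.Etale ∧
      q ∈ Set.range (PrimeSpectrum.comap f.hom.toRingHom) ∧
      LocCongr (y.map f.hom) (c.map f.hom)) : LocCongr y c := by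
  obtain ⟨m, S, f, hP, hf⟩ := exists_pi_covering (R := R)
    (fun S f => MatCongr (y.map f.hom) (c.map f.hom)) (by
      intro q
      obtain ⟨S, f, hf, ⟨q', hq'⟩, T, g, hg, hc⟩ := h q
      obtain ⟨_, q'', hq''⟩ := hg.2 q'
      refine ⟨T, f ≫ g, ?_, ⟨q'', ?_⟩, hc⟩
      · exact RingHom.Etale.stableUnderComposition _ _ hf (hg.1 ())
      · rw [← hq', ← hq'']
        rfl)
  choose x hx he using hP
  obtain ⟨a, ha⟩ := exists_pi_matrix x
  refine ⟨_, _, hf, a, isUnit_pi_det fun i => by rw [ha]; exact hx i,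
    pi_matrix_ext fun i => ?_⟩
  rw [Matrix.map_mul, Matrix.map_mul, Matrix.transpose_map, ha]
  exact he i

/-- Completing the square: with an invertible upper left block `A`, the form splits as the
orthogonal sum of `A` and its Schur complement, which is again invertible with the same symmetry.
The hypothesis `h2` receives the induction hypothesis. -/
theorem LocCongr.of_blocks {R : Alg} {ε : ℤ} (hε : ε * ε = 1) {C : Matrix ι ι R} {D : Matrix κ κ R}
    {y : Matrix (ι ⊕ κ) (ι ⊕ κ) R} (hy : yᵀ = ε • y) (hdet : IsUnit y.det)
    (hA : IsUnit y.toBlocks₁₁.det) (h1 : LocCongr y.toBlocks₁₁ C)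
    (h2 : ∀ d : Matrix κ κ R, dᵀ = ε • d → IsUnit d.det → LocCongr d D) :
    LocCongr y (Matrix.fromBlocks C 0 0 D) := by
  obtain ⟨A, hA'⟩ : ∃ A, A = y.toBlocks₁₁ := ⟨_, rfl⟩
  obtain ⟨b, hb⟩ : ∃ b, b = y.toBlocks₁₂ := ⟨_, rfl⟩
  obtain ⟨c, hc⟩ : ∃ c, c = y.toBlocks₂₁ := ⟨_, rfl⟩
  obtain ⟨d, hd⟩ : ∃ d, d = y.toBlocks₂₂ := ⟨_, rfl⟩
  have hyb : y = Matrix.fromBlocks A b c d := by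
    rw [hA', hb, hc, hd, Matrix.fromBlocks_toBlocks]
  rw [← hA'] at hA h1
  rw [hyb, Matrix.fromBlocks_transpose, Matrix.fromBlocks_smul, Matrix.fromBlocks_inj] at hy
  obtain ⟨e1, e2, e3, e4⟩ := hy
  let _ := Matrix.invertibleOfIsUnitDet A hA
  have hi : A⁻¹ᵀ = ε • A⁻¹ := by
    have h3 : Aᵀ * A⁻¹ᵀ = 1 := by
      rw [← Matrix.transpose_mul, Matrix.nonsing_inv_mul A hA, Matrix.transpose_one]
    have h4 : A * A⁻¹ᵀ = ε • 1 := by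
      rw [← h3, e1, Matrix.smul_mul, smul_smul, hε, one_smul]
    rw [← Matrix.one_mul A⁻¹ᵀ, ← Matrix.nonsing_inv_mul A hA, Matrix.mul_assoc, h4, Matrix.mul_smul,
      Matrix.mul_one]
  have hU : (A⁻¹ * b)ᵀ = c * A⁻¹ := by
    rw [Matrix.transpose_mul, hi, e3, Matrix.smul_mul, Matrix.mul_smul, smul_smul, hε, one_smul]
  have hS := Matrix.fromBlocks_eq_of_invertible₁₁ A b c d
  rw [Matrix.invOf_eq_nonsing_inv] at hS
  have hs1 : (d - c * A⁻¹ * b)ᵀ = ε • (d - c * A⁻¹ * b) := by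
    rw [Matrix.transpose_sub, Matrix.transpose_mul, Matrix.transpose_mul, hi, e2, e3, e4, smul_sub]
    simp only [Matrix.smul_mul, Matrix.mul_smul, smul_smul, hε, one_smul, Matrix.mul_assoc]
  have hs2 : IsUnit (d - c * A⁻¹ * b).det := by
    rw [hyb, Matrix.det_fromBlocks₁₁, Matrix.invOf_eq_nonsing_inv] at hdet
    exact isUnit_of_mul_isUnit_right hdet
  refine LocCongr.trans (MatCongr.locCongr ⟨Matrix.fromBlocks 1 (A⁻¹ * b) 0 1, ?_, ?_⟩)
    (h1.fromBlocks (h2 _ hs1 hs2))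
  · rw [Matrix.det_fromBlocks_zero₂₁, Matrix.det_one, Matrix.det_one, one_mul]
    exact isUnit_one
  · rw [hyb, hS, Matrix.fromBlocks_transpose, hU]
    simp

theorem exists_notMem_of_isUnit_det {R : Alg} {y : Matrix ι ι R} (hy : IsUnit y.det)
    (q : PrimeSpectrum R) (i : ι) : ∃ j, y i j ∉ q.asIdeal := by
  by_contra! h
  have h1 : (y.map (Ideal.Quotient.mk q.asIdeal)).det = 0 :=
    Matrix.det_eq_zero_of_row_eq_zero i fun j => Ideal.Quotient.eq_zero_iff_mem.2 (h j)
  have h2 : (y.map (Ideal.Quotient.mk q.asIdeal)).det = Ideal.Quotient.mk q.asIdeal y.det :=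
    (RingHom.map_det (Ideal.Quotient.mk q.asIdeal) y).symm
  rw [h2] at h1
  exact q.2.ne_top (Ideal.eq_top_of_isUnit_mem _ (Ideal.Quotient.eq_zero_iff_mem.1 h1) hy)

theorem two_ne_mem {R : Alg} (q : PrimeSpectrum R) : (2 : R) ∉ q.asIdeal := fun h => by
  refine q.2.ne_top (Ideal.eq_top_of_isUnit_mem _ h ?_)
  have h1 : IsUnit (algebraMap ℂ R 2) := (IsUnit.mk0 (2 : ℂ) two_ne_zero).map _
  rwa [map_ofNat] at h1

/-- Gram–Schmidt over an étale covering: a unit on the diagonal becomes `1` after adjoining a square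
root and splits off a line. Localization makes some entry a unit near a given point. -/
theorem locCongr_one (n : ℕ) : ∀ {ι : Type} [Fintype ι] [DecidableEq ι] {R : Alg}
    (y : Matrix ι ι R), Fintype.card ι = n → yᵀ = y → IsUnit y.det → LocCongr y 1 := by
  induction n with
  | zero =>
    intro ι _ _ R y hn _ _
    have : IsEmpty ι := Fintype.card_eq_zero_iff.1 hn
    exact MatCongr.locCongr ⟨1, by simp, Subsingleton.elim _ _⟩
  | succ n ih =>
    have pivot : ∀ {ι : Type} [Fintype ι] [DecidableEq ι] {R : Alg} (y : Matrix ι ι R),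
        Fintype.card ι = n + 1 → yᵀ = y → IsUnit y.det → ∀ i, IsUnit (y i i) → LocCongr y 1 := by
      intro ι _ _ R y hn hy hdet i hi
      let e := Equiv.sumCompl (fun a => a = i)
      apply LocCongr.of_submatrix e
      have h1 : (1 : Matrix ι ι R).submatrix e e = Matrix.fromBlocks 1 0 0 1 := by
        rw [Matrix.submatrix_one_equiv, Matrix.fromBlocks_one]
      have hA : (y.submatrix e e).toBlocks₁₁.det = y i i := by
        rw [Matrix.det_unique]
        rfl
      rw [h1]
      refine LocCongr.of_blocks (ε := 1) rfl (by rw [Matrix.transpose_submatrix, hy, one_smul])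
        (by rwa [Matrix.det_submatrix_equiv_self]) (by rwa [hA]) ?_ fun d hd hd' =>
          ih d ?_ (by rw [hd, one_smul]) hd'
      · obtain ⟨S, f, hf, t, ht⟩ := exists_sqrt_covering (y i i) hi
        refine ⟨S, f, hf, Matrix.of fun _ _ => t, ?_, ?_⟩
        · rw [Matrix.det_unique]
          refine isUnit_of_mul_isUnit_left (y := t) ?_
          change IsUnit (t * t)
          rw [ht]
          exact hi.map f.hom
        · rw [Matrix.map_one _ (map_zero f.hom) (map_one f.hom), Matrix.mul_one]
          ext a b
          obtain rfl := Subsingleton.elim a default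
          obtain rfl := Subsingleton.elim b default
          rw [Matrix.mul_apply, Fintype.sum_unique]
          exact ht.symm
      · have := Fintype.card_congr e
        rw [Fintype.card_sum, hn, Fintype.card_unique] at this
        omega
    have pivot' : ∀ {ι : Type} [Fintype ι] [DecidableEq ι] {R : Alg} (y : Matrix ι ι R),
        Fintype.card ι = n + 1 → yᵀ = y → IsUnit y.det → ∀ (q : PrimeSpectrum R) (i : ι),
        y i i ∉ q.asIdeal → ∃ (S : Alg) (f : R ⟶ S), f.hom.toRingHom.Etale ∧
          q ∈ Set.range (PrimeSpectrum.comap f.hom.toRingHom) ∧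
          LocCongr (y.map f.hom) ((1 : Matrix ι ι R).map f.hom) := by
      intro ι _ _ R y hn hy hdet q i hi
      obtain ⟨S, f, hf, hu, hq⟩ := exists_localization (y i i)
      refine ⟨S, f, hf, hq q hi, ?_⟩
      rw [Matrix.map_one _ (map_zero f.hom) (map_one f.hom)]
      exact pivot _ hn (by rw [← Matrix.transpose_map, hy]) (isUnit_map_det f hdet) i hu
    intro ι _ _ R y hn hy hdet
    refine LocCongr.of_local fun q => ?_
    by_cases h : ∃ i, y i i ∉ q.asIdeal
    · obtain ⟨i, hi⟩ := h
      exact pivot' y hn hy hdet q i hi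
    · push Not at h
      have : Nonempty ι := Fintype.card_pos_iff.1 (by omega)
      obtain ⟨i⟩ := this
      obtain ⟨j, hj⟩ := exists_notMem_of_isUnit_det hdet q i
      have hij : j ≠ i := fun e => hj (e ▸ h i)
      -- When all diagonal entries vanish at `q`, the basis vector `e_i` is replaced by `e_i + e_j`,
      -- of square `y i i + y j j + 2 * y i j`; this is non-zero at `q` because `2` is invertible.
      let P := Matrix.transvection j i (1 : R)
      have hP : P.det = 1 := Matrix.det_transvection_of_ne j i hij 1
      let y' := Pᵀ * y * P
      have hy' : y'ᵀ = y' := by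
        simp only [y', Matrix.transpose_mul, Matrix.transpose_transpose, hy, Matrix.mul_assoc]
      have hii : y' i i = y i i + y j j + 2 * y i j := by
        have hs : y j i = y i j := congrFun (congrFun hy i) j
        have hPt : Pᵀ = 1 + Matrix.single i j 1 := by
          simp [P, Matrix.transvection]
        have hy2 : y' = (1 + Matrix.single i j 1) * y * (1 + Matrix.single j i 1) :=
          congrArg (fun M => M * y * P) hPt
        simp only [hy2, Matrix.add_mul, Matrix.mul_add, Matrix.one_mul,
          Matrix.mul_one, Matrix.add_apply, Matrix.single_mul_apply_same,
          Matrix.mul_single_apply_same, hs, one_mul, mul_one]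
        ring
      obtain ⟨S, f, hf, hq, hc⟩ := pivot' y' hn hy' (by
        rw [Matrix.det_mul, Matrix.det_mul, Matrix.det_transpose, hP, one_mul, mul_one]
        exact hdet) q i (fun hm => by
        rw [hii] at hm
        have h1 := (Ideal.add_mem_iff_right _ (q.asIdeal.add_mem (h i) (h j))).1 hm
        rcases q.2.mem_or_mem h1 with h2 | h2
        · exact two_ne_mem q h2
        · exact hj h2)
      refine ⟨S, f, hf, hq, LocCongr.trans ?_ hc⟩
      have h1 : MatCongr y' y := ⟨P, by rw [hP]; exact isUnit_one, rfl⟩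
      exact (h1.symm.map f).locCongr

/-- A hyperbolic plane: rescaling one of the two basis vectors by the off-diagonal unit is enough,
and no root is needed. -/
theorem matCongr_J_of_unique {l R : Type*} [Unique l] [Fintype l] [DecidableEq l] [CommRing R]
    {A : Matrix (l ⊕ l) (l ⊕ l) R} (hA : Aᵀ = -A) (hd : ∀ a, A a a = 0)
    (hu : IsUnit (A (.inr default) (.inl default))) : MatCongr A (Matrix.J l R) := by
  refine ⟨Matrix.fromBlocks A.toBlocks₂₁ 0 0 1, ?_, ?_⟩
  · rw [Matrix.det_fromBlocks_zero₂₁, Matrix.det_one, mul_one, Matrix.det_unique]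
    exact hu
  · have h1 : A.toBlocks₁₁ = 0 := by
      ext a b
      obtain rfl := Subsingleton.elim a b
      exact hd (.inl a)
    have h2 : A.toBlocks₂₂ = 0 := by
      ext a b
      obtain rfl := Subsingleton.elim a b
      exact hd (.inr a)
    have h3 : A.toBlocks₁₂ = -A.toBlocks₂₁ᵀ := by
      ext a b
      have := congrFun (congrFun hA (.inr b)) (.inl a)
      exact this
    conv_lhs => rw [← Matrix.fromBlocks_toBlocks A, h1, h2, h3]
    simp [Matrix.J, Matrix.fromBlocks_transpose, Matrix.fromBlocks_multiply]

theorem skew_diag_eq_zero {R : Alg} {y : Matrix ι ι R} (hy : yᵀ = -y) (i : ι) : y i i = 0 := by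
  have h1 : y i i = -y i i := congrFun (congrFun hy i) i
  refine eq_zero_of_smul_eq R (c := 1) (d := -1) (by norm_num) ?_
  rw [map_neg, map_one, one_smul, neg_smul, one_smul]
  exact h1

/-- The same induction with hyperbolic planes in place of lines: a diagonal entry is always zero,
and a vector pairing to a unit with the first one splits off a plane with it. -/
theorem locCongr_J (n : ℕ) : ∀ {l : Type} [Fintype l] [DecidableEq l] {R : Alg}
    (y : Matrix (l ⊕ l) (l ⊕ l) R), Fintype.card l = n → yᵀ = -y → IsUnit y.det →
      LocCongr y (Matrix.J l R) := by
  induction n with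
  | zero =>
    intro l _ _ R y hn _ _
    have : IsEmpty l := Fintype.card_eq_zero_iff.1 hn
    exact MatCongr.locCongr ⟨1, by simp, Subsingleton.elim _ _⟩
  | succ n ih =>
    have pivot : ∀ {l : Type} [Fintype l] [DecidableEq l] {R : Alg}
        (y : Matrix (l ⊕ l) (l ⊕ l) R), Fintype.card l = n + 1 → yᵀ = -y → IsUnit y.det →
        ∀ i, IsUnit (y (.inl i) (.inr i)) → LocCongr y (Matrix.J l R) := by
      intro l _ _ R y hn hy hdet i hi
      let e₀ := Equiv.sumCompl (fun a => a = i)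
      let e := (Equiv.sumSumSumComm {a // a = i} {a // a = i} {a // ¬a = i} {a // ¬a = i}).trans
        (Equiv.sumCongr e₀ e₀)
      apply LocCongr.of_submatrix e
      have h1 : (Matrix.J l R).submatrix e e =
          Matrix.fromBlocks (Matrix.J {a // a = i} R) 0 0 (Matrix.J {a // ¬a = i} R) := by
        ext ((a | a) | (a | a)) ((b | b) | (b | b)) <;>
          simp [Matrix.J, e, e₀, Matrix.one_apply, Subtype.ext_iff]
        · exact fun h => (b.2 (h ▸ a.2)).elim
        · exact fun h => (b.2 (h ▸ a.2)).elim
        · exact fun h => (a.2 (h ▸ b.2)).elim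
        · exact fun h => (a.2 (h ▸ b.2)).elim
      have hys : (y.submatrix e e)ᵀ = -(y.submatrix e e) := by
        rw [Matrix.transpose_submatrix, hy, Matrix.submatrix_neg]
        rfl
      have hAs : (y.submatrix e e).toBlocks₁₁ᵀ = -(y.submatrix e e).toBlocks₁₁ := by
        ext a b
        exact congrFun (congrFun hys (.inl a)) (.inl b)
      have hA := matCongr_J_of_unique hAs (skew_diag_eq_zero hAs) (by
        have h2 : y (.inl i) (.inr i) = -y (.inr i) (.inl i) :=
          congrFun (congrFun hy (.inr i)) (.inl i)
        rw [h2] at hi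
        exact (IsUnit.neg_iff _).1 hi)
      rw [h1]
      refine LocCongr.of_blocks (ε := -1) (by norm_num) (by rw [hys, neg_smul, one_smul])
        (by rwa [Matrix.det_submatrix_equiv_self]) ?_ hA.locCongr fun d hd hd' =>
          ih d ?_ (by rw [hd, neg_smul, one_smul]) hd'
      · obtain ⟨x, hx, he⟩ := hA
        rw [he, Matrix.det_mul, Matrix.det_mul, Matrix.det_transpose]
        exact (hx.mul (Matrix.isUnit_det_J _ _)).mul hx
      · have := Fintype.card_congr e₀
        rw [Fintype.card_sum, hn, Fintype.card_unique] at this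
        omega
    intro l _ _ R y hn hy hdet
    refine LocCongr.of_local fun q => ?_
    have : Nonempty l := Fintype.card_pos_iff.1 (by omega)
    obtain ⟨i⟩ := this
    obtain ⟨j, hj⟩ := exists_notMem_of_isUnit_det hdet q (.inl i)
    have hij : j ≠ .inl i := fun e => hj (by
      rw [e, skew_diag_eq_zero hy]; exact q.asIdeal.zero_mem)
    -- The permutation puts the vector that pairs non-trivially with `inl i` in the position `inr
    -- i`, where the pivot expects it.
    let τ := Equiv.swap j (.inr i)
    have h1 : τ (.inl i) = .inl i := Equiv.swap_apply_of_ne_of_ne hij.symm (by simp)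
    have h2 : τ (.inr i) = j := Equiv.swap_apply_right _ _
    obtain ⟨S, f, hf, hu, hq⟩ := exists_localization (y (.inl i) j)
    refine ⟨S, f, hf, hq q hj, ?_⟩
    have h3 : (Matrix.J l R).map f.hom = Matrix.J l S := Matrix.map_J l f.hom
    rw [h3]
    refine LocCongr.trans (((matCongr_submatrix y τ).symm.map f).locCongr) (pivot _ hn ?_ ?_ i ?_)
    · ext a b
      have := congrArg f.hom (congrFun (congrFun hy (τ a)) (τ b))
      rw [Matrix.neg_apply, map_neg] at this
      exact this
    · refine isUnit_map_det f ?_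
      rwa [Matrix.det_submatrix_equiv_self]
    · rw [Matrix.map_apply, Matrix.submatrix_apply, h1, h2]
      exact hu

end NormalForm

/-! ### The standard forms -/

theorem antidiagJ_apply {n : ℕ} (i j : Fin n) :
    antidiagJ n i j = if j = i.rev then (-1) ^ ((i : ℕ) + 1) else 0 := by
  rw [antidiagJ, Matrix.of_apply]
  congr 1
  rw [eq_iff_iff, Fin.ext_iff, Fin.val_rev]
  omega

theorem antidiagJ_transpose {n : ℕ} (hn : Even n) : (antidiagJ n)ᵀ = -antidiagJ n := by
  ext i j
  rw [Matrix.transpose_apply, Matrix.neg_apply, antidiagJ, Matrix.of_apply, Matrix.of_apply]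
  by_cases h : (i : ℕ) + j + 1 = n
  · rw [if_pos h, if_pos (by omega)]
    obtain ⟨m, rfl⟩ := hn
    rcases Nat.even_or_odd (i : ℕ) with hi | hi
    · have hj : Odd (j : ℕ) := by
        rw [← Nat.not_even_iff_odd]; intro hj; obtain ⟨a, ha⟩ := hi; obtain ⟨b, hb⟩ := hj; omega
      rw [hi.add_one.neg_one_pow, hj.add_one.neg_one_pow, neg_neg]
    · have hj : Even (j : ℕ) := by
        rw [← Nat.not_odd_iff_even]; intro hj; obtain ⟨a, ha⟩ := hi; obtain ⟨b, hb⟩ := hj; omega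
      rw [hi.add_one.neg_one_pow, hj.add_one.neg_one_pow]
  · rw [if_neg h, if_neg (by omega), neg_zero]

theorem antidiagJ_mul_transpose (n : ℕ) : antidiagJ n * (antidiagJ n)ᵀ = 1 := by
  ext i j
  rw [Matrix.mul_apply]
  simp only [Matrix.transpose_apply, antidiagJ_apply]
  simp only [ite_mul, zero_mul, Finset.sum_ite_eq', Finset.mem_univ, if_true]
  refine Eq.trans ?_ (Matrix.one_apply (α := ℂ)).symm
  by_cases h : i = j
  · rw [h, if_pos rfl, if_pos rfl, ← mul_pow]; simp
  · rw [if_neg h, if_neg fun h' => h (Fin.rev_injective h'), mul_zero]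

theorem isUnit_det_antidiagJ (n : ℕ) : IsUnit (antidiagJ n).det :=
  Matrix.isUnit_det_of_right_inverse (antidiagJ_mul_transpose n)

/-- The standard form of each kind. -/
def stdForm (n : ℕ) : FormKind → Matrix (Fin n) (Fin n) ℂ
  | .symm => 1
  | .skew => antidiagJ n

/-- An étale covering of the point has a complex point, and specializing there removes the covering.
-/
theorem MatCongr.of_locCongr_cpt {ι : Type} [Fintype ι] [DecidableEq ι] {y c : Matrix ι ι ℂ}
    (h : LocCongr (R := cpt) y c) : MatCongr y c := by
  obtain ⟨S, f, hf, h⟩ := h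
  obtain ⟨g⟩ := hf.exists_point
  have h1 := h.map g
  have h2 : ∀ M : Matrix ι ι cpt, (M.map f.hom).map g.hom = M := fun M => by
    ext i j
    exact (f ≫ g).hom.commutes (M i j)
  rwa [h2, h2] at h1

/-- A skew-symmetric invertible matrix has even size. -/
theorem even_of_skew {n : ℕ} {y : Matrix (Fin n) (Fin n) ℂ} (hy : yᵀ = -y) (hu : IsUnit y.det) :
    Even n := by
  by_contra h
  have h1 := congrArg Matrix.det hy
  rw [Matrix.det_transpose, Matrix.det_neg, Fintype.card_fin,
    (Nat.not_even_iff_odd.1 h).neg_one_pow, neg_one_mul] at h1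
  exact hu.ne_zero (self_eq_neg.1 h1)

theorem exists_equiv_sum {n : ℕ} (hn : Even n) : ∃ m, Nonempty (Fin m ⊕ Fin m ≃ Fin n) := by
  obtain ⟨m, rfl⟩ := hn
  exact ⟨m, ⟨finSumFinEquiv⟩⟩

theorem matCongr_J_antidiagJ {n m : ℕ} (hn : Even n) (e : Fin m ⊕ Fin m ≃ Fin n) :
    MatCongr ((antidiagJ n).submatrix e e) (Matrix.J (Fin m) ℂ) := by
  refine MatCongr.of_locCongr_cpt (locCongr_J m (R := cpt) _ (Fintype.card_fin m) ?_ ?_)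
  · rw [Matrix.transpose_submatrix, antidiagJ_transpose hn]
    rfl
  · have := isUnit_det_antidiagJ n
    rwa [← Matrix.det_submatrix_equiv_self e] at this

/-- In the skew case both `y` and the antidiagonal form are compared with the block form `Matrix.J`.
-/
theorem locCongr_stdForm {n : ℕ} {R : Alg} {ε : FormKind} (hε : ε = .skew → Even n)
    {y : Matrix (Fin n) (Fin n) R} (hy : y ∈ (formSpace n ε.sign).pts R) :
    LocCongr y (bc R (stdForm n ε)) := by
  obtain ⟨h1, h2⟩ := hy
  cases ε
  · have h3 : bc R (stdForm n .symm) = 1 := bc_one R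
    rw [h3]
    exact locCongr_one n y (Fintype.card_fin n) (by rw [h1, FormKind.sign, one_smul]) h2
  · obtain ⟨m, ⟨e⟩⟩ := exists_equiv_sum (hε rfl)
    have h3 := matCongr_J_antidiagJ (hε rfl) e
    apply LocCongr.of_submatrix e
    have h4 : LocCongr (y.submatrix e e) (Matrix.J (Fin m) R) :=
      locCongr_J m _ (Fintype.card_fin m) (by
        rw [Matrix.transpose_submatrix, h1, FormKind.sign, neg_smul, one_smul]
        rfl) (by rwa [Matrix.det_submatrix_equiv_self])
    refine h4.trans (MatCongr.locCongr ?_)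
    obtain ⟨x, hx, he⟩ := h3.symm
    refine ⟨x.map (algebraMap ℂ R), ?_, ?_⟩
    · have : (x.map (algebraMap ℂ R)).det = algebraMap ℂ R x.det :=
        (RingHom.map_det (algebraMap ℂ R) x).symm
      rw [this]
      exact hx.map _
    · have h5 := congrArg (fun M => M.map (algebraMap ℂ R)) he
      rw [Matrix.map_mul, Matrix.map_mul, Matrix.map_J, Matrix.transpose_map] at h5
      exact h5

/-- A complex change of basis carries the antidiagonal form to `Matrix.J`, and over any commutative
ring the symplectic matrices for `Matrix.J` have determinant one. -/
theorem det_eq_one_of_mem_symplecticGroup {n : ℕ} (hn : Even n) {R : Alg} {g : GL (Fin n) R}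
    (hg : g ∈ (symplecticGroup n).pts R) : g.1.det = 1 := by
  obtain ⟨m, ⟨e⟩⟩ := exists_equiv_sum hn
  obtain ⟨x, hx, he⟩ := (matCongr_J_antidiagJ hn e).symm
  have hg' : g.1ᵀ * bc R (antidiagJ n) * g.1 = bc R (antidiagJ n) := hg
  let X := x.map (algebraMap ℂ R)
  have hdX : X.det = algebraMap ℂ R x.det := (RingHom.map_det (algebraMap ℂ R) x).symm
  have hX : IsUnit X.det := by rw [hdX]; exact hx.map _
  have heR : Matrix.J (Fin m) R = Xᵀ * (bc R (antidiagJ n)).submatrix e e * X := by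
    have h5 := congrArg (fun M => M.map (algebraMap ℂ R)) he
    rw [Matrix.map_mul, Matrix.map_mul, Matrix.map_J, Matrix.transpose_map] at h5
    exact h5
  let h := g.1.submatrix e e
  have hh : hᵀ * (bc R (antidiagJ n)).submatrix e e * h = (bc R (antidiagJ n)).submatrix e e := by
    have := congrArg (fun M => M.submatrix e e) hg'
    rwa [← Matrix.submatrix_mul_equiv _ _ _ e, ← Matrix.submatrix_mul_equiv _ _ _ e,
      ← Matrix.transpose_submatrix] at this
  have h1 : X * X⁻¹ = 1 := Matrix.mul_nonsing_inv X hX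
  have h2 : X⁻¹ᵀ * Xᵀ = 1 := by rw [← Matrix.transpose_mul, h1, Matrix.transpose_one]
  have hmem : X⁻¹ * h * X ∈ Matrix.symplecticGroup (Fin m) R := by
    rw [SymplecticGroup.mem_iff', heR]
    generalize (bc R (antidiagJ n)).submatrix e e = A at *
    calc (X⁻¹ * h * X)ᵀ * (Xᵀ * A * X) * (X⁻¹ * h * X)
        = Xᵀ * hᵀ * (X⁻¹ᵀ * Xᵀ) * A * (X * X⁻¹) * h * X := by
          simp only [Matrix.transpose_mul, Matrix.mul_assoc]
      _ = Xᵀ * (hᵀ * A * h) * X := by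
          rw [h1, h2, Matrix.mul_one, Matrix.mul_one]; simp only [Matrix.mul_assoc]
      _ = _ := by rw [hh]
  have hd := SymplecticGroup.det_eq_one hmem
  rw [Matrix.det_mul, Matrix.det_mul, mul_right_comm, ← Matrix.det_mul,
    Matrix.nonsing_inv_mul X hX, Matrix.det_one, one_mul, Matrix.det_submatrix_equiv_self] at hd
  exact hd

/-! ### Double coset stacks of symmetric pairs -/

/-- The map `x ↦ xᵀ J x` from `GL_n` with `K × P` to the space of forms with `P`, where `K` is the
isometry group of `J`. -/
def formHom {n : ℕ} (J : Matrix (Fin n) (Fin n) ℂ) (c : ℤ) (hJ : Jᵀ = c • J) (hJu : IsUnit J.det)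
    (P : MatGroup n) :
    (doubleCosetSpace (isomGroup J) P).Hom (congrSpace P (formSpace n c) (formSpace_congr n c)) where
  onG R := (MonoidHom.snd ((isomGroup J).pts R) (P.pts R) : _ →* _)
  onG_map _ _ := rfl
  onX R := fun x : (glSpace n).pts R => (⟨x.1ᵀ * bc R J * x.1, by
    refine ⟨?_, ?_⟩
    · rw [Matrix.transpose_mul, Matrix.transpose_mul, Matrix.transpose_transpose, ← bc_transpose, hJ,
        ← Matrix.mul_assoc]
      have : bc R (c • J) = c • bc R J := by
        ext i j
        exact map_zsmul (algebraMap ℂ R) c (J i j)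
      rw [this, Matrix.mul_smul, Matrix.smul_mul]
    · have h1 : IsUnit (bc R J).det := by
        have : (bc R J).det = algebraMap ℂ R J.det := (RingHom.map_det (algebraMap ℂ R) J).symm
        rw [this]
        exact hJu.map _
      rw [Matrix.det_mul, Matrix.det_mul, Matrix.det_transpose]
      exact (x.2.mul h1).mul x.2⟩ : (formSpace n c).pts R)
  onX_map {R S} f (x : (glSpace n).pts R) := Subtype.ext (by
    change (x.1.map f.hom)ᵀ * bc S J * x.1.map f.hom = (x.1ᵀ * bc R J * x.1).map f.hom
    rw [Matrix.map_mul, Matrix.map_mul, bc_map, Matrix.transpose_map])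
  onX_smul {R} (g : (isomGroup J).pts R × P.pts R) (x : (glSpace n).pts R) := Subtype.ext (by
    change (g.1.1.1 * x.1 * (g.2.1⁻¹).1)ᵀ * bc R J * (g.1.1.1 * x.1 * (g.2.1⁻¹).1) =
      (g.2.1⁻¹).1ᵀ * (x.1ᵀ * bc R J * x.1) * (g.2.1⁻¹).1
    have h : g.1.1.1ᵀ * bc R J * g.1.1.1 = bc R J := g.1.2
    calc _ = (g.2.1⁻¹).1ᵀ * (x.1ᵀ * (g.1.1.1ᵀ * bc R J * g.1.1.1) * x.1) * (g.2.1⁻¹).1 := by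
          simp only [Matrix.transpose_mul, Matrix.mul_assoc]
      _ = _ := by rw [h])

/-- The map `x ↦ xᵀ J x` makes `GL_n` a torsor under the isometry group of `J`: if `g` carries the
form of `x` to that of `x'`, then `x' g x⁻¹` is the unique isometry of `J` that works with it. Local
surjectivity is the local normal form `hloc`. -/
theorem formHom_isLocalEquiv {n : ℕ} (J : Matrix (Fin n) (Fin n) ℂ) (c : ℤ) (hJ : Jᵀ = c • J)
    (hJu : IsUnit J.det) (P : MatGroup n)
    (hloc : ∀ (R : Alg), ∀ y ∈ (formSpace n c).pts R, LocCongr y (bc R J)) :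
    (formHom J c hJ hJu P).IsLocalEquiv where
  existsUnique R (x : (glSpace n).pts R) (x' : (glSpace n).pts R) (g : P.pts R) h := by
    have h' : (g.1⁻¹).1ᵀ * (x.1ᵀ * bc R J * x.1) * (g.1⁻¹).1 = x'.1ᵀ * bc R J * x'.1 :=
      congrArg (fun u : (formSpace n c).pts R => u.1) h
    let X : GL (Fin n) R := Matrix.GeneralLinearGroup.mk'' x.1 x.2
    let X' : GL (Fin n) R := Matrix.GeneralLinearGroup.mk'' x'.1 x'.2
    let a : GL (Fin n) R := X' * g.1 * X⁻¹
    have hX : X.1 * (X⁻¹).1 = 1 := X.mul_inv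
    have hX' : X'.1ᵀ * bc R J * X'.1 = (g.1⁻¹).1ᵀ * (X.1ᵀ * bc R J * X.1) * (g.1⁻¹).1 := h'.symm
    have hg : (g.1⁻¹).1 * g.1.1 = 1 := g.1.inv_mul
    have hXt : (X⁻¹).1ᵀ * X.1ᵀ = 1 := by rw [← Matrix.transpose_mul, hX, Matrix.transpose_one]
    have hgt : g.1.1ᵀ * (g.1⁻¹).1ᵀ = 1 := by rw [← Matrix.transpose_mul, hg, Matrix.transpose_one]
    have ha : a ∈ (isomGroup J).pts R := by
      change (X'.1 * g.1.1 * (X⁻¹).1)ᵀ * bc R J * (X'.1 * g.1.1 * (X⁻¹).1) = bc R J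
      calc _ = (X⁻¹).1ᵀ * g.1.1ᵀ * (X'.1ᵀ * bc R J * X'.1) * g.1.1 * (X⁻¹).1 := by
            simp only [Matrix.transpose_mul, Matrix.mul_assoc]
        _ = (X⁻¹).1ᵀ * (g.1.1ᵀ * (g.1⁻¹).1ᵀ) * (X.1ᵀ * bc R J * X.1) * ((g.1⁻¹).1 * g.1.1) *
            (X⁻¹).1 := by rw [hX']; simp only [Matrix.mul_assoc]
        _ = ((X⁻¹).1ᵀ * X.1ᵀ) * bc R J * (X.1 * (X⁻¹).1) := by
            rw [hg, hgt]; simp only [Matrix.mul_assoc, Matrix.mul_one, Matrix.one_mul]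
        _ = _ := by rw [hX, hXt, Matrix.one_mul, Matrix.mul_one]
    refine ⟨((⟨a, ha⟩, g) : (isomGroup J).pts R × P.pts R), ⟨rfl, Subtype.ext ?_⟩, ?_⟩
    · change (X' * g.1 * X⁻¹ * X * g.1⁻¹).1 = X'.1
      congr 1
      group
    · rintro (k : (isomGroup J).pts R × P.pts R) ⟨hk1, hk2⟩
      have e1 : k.2 = g := hk1
      have e2 : k.1.1 * X * k.2.1⁻¹ = X' :=
        Units.ext (congrArg (fun u : (glSpace n).pts R => u.1) hk2)
      refine Prod.ext (Subtype.ext ?_) e1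
      change k.1.1 = X' * g.1 * X⁻¹
      rw [← e2, e1]
      group
  exists_locally R (y : (formSpace n c).pts R) := by
    obtain ⟨S, f, hf, x, hx, he⟩ := hloc R y.1 y.2
    refine ⟨S, f, hf, (1 : P.pts S), (⟨x, hx⟩ : (glSpace n).pts S), Subtype.ext ?_⟩
    rw [bc_map] at he
    change y.1.map f.hom = ((1 : GL (Fin n) S)⁻¹).1ᵀ * (xᵀ * bc S J * x) * ((1 : GL (Fin n) S)⁻¹).1
    rw [he]
    simp

/-- Exchanging the factors of the group. -/
theorem prodSpace_iso {n : ℕ} (P K : MatGroup n) :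
    ∃ u : (doubleCosetSpace K P).Hom (prodSpace P K), u.IsIso := by
  refine ⟨{ onG := fun R => (MulEquiv.prodComm (M := K.pts R) (N := P.pts R)).toMonoidHom
            onG_map := fun _ _ => rfl
            onX := fun R x => x
            onX_map := fun _ _ => rfl
            onX_smul := fun _ _ => rfl }, fun R =>
    ⟨(MulEquiv.prodComm (M := K.pts R) (N := P.pts R)).bijective, Function.bijective_id⟩⟩

theorem matrix_mul_mul_of_eq {R : Type*} [CommRing R] {j k l m : Type*} [Fintype k] [Fintype l]
    {a : Matrix j k R} {b : Matrix k l R} {w : Matrix j l R} (h : a * b = w) (x : Matrix l m R) :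
    a * (b * x) = w * x := by
  rw [← Matrix.mul_assoc, h]

/-! ### Frames of the eigenspaces -/

/-- A basis of `W_i`, given by the matrix of its vectors and the matrix of the coordinates. -/
structure Grading.Frame {N p : ℕ} {s : GL (Fin N) ℂ} {σ : SupportKind} (G : Grading p s σ) (i : ℝ)
    (n : ℕ) where
  vec : Matrix (Fin N) (Fin n) ℂ
  coord : Matrix (Fin n) (Fin N) ℂ
  coord_mul_vec : coord * vec = 1
  vec_mul_coord : vec * coord = G.e i

namespace Grading

variable {N p : ℕ} [hp : Fact p.Prime] {s : GL (Fin N) ℂ} {σ : SupportKind} (G : Grading p s σ)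

theorem exists_frame_of_basis {i : ℝ} {n : ℕ} (b : Module.Basis (Fin n) ℂ (eig p s cpt i)) :
    ∃ F : G.Frame i n, ∀ c : Fin n → ℂ, (b.equivFun.symm c : Fin N → ℂ) = F.vec *ᵥ c := by
  have hG : ∀ v : Fin N → ℂ, v ∈ eig p s cpt i ↔ G.e i *ᵥ v = v := fun v => by
    have := G.mem_eig_iff (R := cpt) (i := i) (v := v)
    rwa [eR, bc_cpt] at this
  have he : ∀ v : Fin N → ℂ, G.e i *ᵥ v ∈ eig p s cpt i := fun v =>
    (hG _).2 (by rw [Matrix.mulVec_mulVec, G.e_mul_e])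
  let f : (Fin n → ℂ) →ₗ[ℂ] (Fin N → ℂ) :=
    (eig p s cpt i).subtype ∘ₗ b.equivFun.symm.toLinearMap
  let g : (Fin N → ℂ) →ₗ[ℂ] (Fin n → ℂ) :=
    b.equivFun.toLinearMap ∘ₗ (Matrix.toLin' (G.e i)).codRestrict (eig p s cpt i) he
  have hf : ∀ c, LinearMap.toMatrix' f *ᵥ c = f c := fun c => by
    rw [← Matrix.toLin'_apply, Matrix.toLin'_toMatrix']
  refine ⟨⟨LinearMap.toMatrix' f, LinearMap.toMatrix' g, ?_, ?_⟩, fun c => (hf c).symm⟩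
  · rw [← LinearMap.toMatrix'_comp, ← LinearMap.toMatrix'_id]
    congr 1
    refine LinearMap.ext fun c => ?_
    have h1 : (Matrix.toLin' (G.e i)).codRestrict (eig p s cpt i) he (f c) = b.equivFun.symm c :=
      Subtype.ext ((hG _).1 (b.equivFun.symm c).2)
    change b.equivFun ((Matrix.toLin' (G.e i)).codRestrict (eig p s cpt i) he (f c)) = c
    rw [h1, LinearEquiv.apply_symm_apply]
  · rw [← LinearMap.toMatrix'_comp]
    apply Matrix.toLin'.injective
    rw [Matrix.toLin'_toMatrix']
    refine LinearMap.ext fun v => ?_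
    change ((b.equivFun.symm (b.equivFun _) : eig p s cpt i) : Fin N → ℂ) = _
    rw [LinearEquiv.symm_apply_apply]
    rfl

theorem exists_frame {i : ℝ} {n : ℕ} (hn : eigDim p s i = n) : Nonempty (G.Frame i n) := by
  obtain ⟨F, -⟩ := G.exists_frame_of_basis (Module.finBasisOfFinrankEq ℂ (eig p s cpt i) hn)
  exact ⟨F⟩

/-- An injective map `W_i → W_j`, with a left inverse. -/
theorem exists_injective {i j : ℝ} (h : eigDim p s i ≤ eigDim p s j) :
    ∃ m t : Matrix (Fin N) (Fin N) ℂ, t * (G.e j * m * G.e i) = G.e i := by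
  obtain ⟨F⟩ := G.exists_frame (i := i) rfl
  obtain ⟨F'⟩ := G.exists_frame (i := j) rfl
  let ι : Matrix (Fin (eigDim p s j)) (Fin (eigDim p s i)) ℂ :=
    (1 : Matrix (Fin (eigDim p s j)) (Fin (eigDim p s j)) ℂ).submatrix id (Fin.castLE h)
  have hι : ιᵀ * ι = 1 := by
    change ((1 : Matrix (Fin (eigDim p s j)) (Fin (eigDim p s j)) ℂ).submatrix id
      (Fin.castLE h))ᵀ * (1 : Matrix (Fin (eigDim p s j)) (Fin (eigDim p s j)) ℂ).submatrix id
      (Fin.castLE h) = 1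
    rw [Matrix.transpose_submatrix, Matrix.transpose_one, ← Matrix.submatrix_mul _ _ _ _ _
      Function.bijective_id, Matrix.one_mul, Matrix.submatrix_one _ (Fin.castLE_injective h)]
  refine ⟨F'.vec * ι * F.coord, F.vec * ιᵀ * F'.coord, ?_⟩
  rw [← F.vec_mul_coord, ← F'.vec_mul_coord]
  simp only [Matrix.mul_assoc, matrix_mul_mul_of_eq F.coord_mul_vec,
    matrix_mul_mul_of_eq F'.coord_mul_vec, Matrix.one_mul, matrix_mul_mul_of_eq hι]

variable {G} {i : ℝ} {n : ℕ}

theorem Frame.left (F : G.Frame i n) (R : Alg) : bc R F.coord * bc R F.vec = 1 := by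
  rw [← bc_mul, F.coord_mul_vec, bc_one]

theorem Frame.right (F : G.Frame i n) (R : Alg) : bc R F.vec * bc R F.coord = G.eR R i := by
  rw [← bc_mul, F.vec_mul_coord]

theorem Frame.e_mul_vec (F : G.Frame i n) (R : Alg) : G.eR R i * bc R F.vec = bc R F.vec := by
  rw [← F.right, Matrix.mul_assoc, F.left, Matrix.mul_one]

theorem Frame.coord_mul_e (F : G.Frame i n) (R : Alg) : bc R F.coord * G.eR R i = bc R F.coord := by
  rw [← F.right, ← Matrix.mul_assoc, F.left, Matrix.one_mul]

theorem Frame.coord_mul_e_of_ne (F : G.Frame i n) (R : Alg) {j : ℝ} (h : j ≠ i) :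
    bc R F.coord * G.eR R j = 0 := by
  rw [← F.coord_mul_e, Matrix.mul_assoc, G.eR_mul_eR_of_ne R h.symm, Matrix.mul_zero]

theorem Frame.e_mul_vec_of_ne (F : G.Frame i n) (R : Alg) {j : ℝ} (h : j ≠ i) :
    G.eR R j * bc R F.vec = 0 := by
  rw [← F.e_mul_vec, ← Matrix.mul_assoc, G.eR_mul_eR_of_ne R h, Matrix.zero_mul]

/-- The map `W_i → W_j` with matrix `y`. -/
theorem Frame.map_shift {k : ℝ} (F : G.Frame i n) (F' : G.Frame (i + k) n) {R : Alg}
    (y : Matrix (Fin n) (Fin n) R) (j : ℝ) :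
    bc R F'.vec * y * bc R F.coord * G.eR R j = G.eR R (j + k) * (bc R F'.vec * y * bc R F.coord) := by
  by_cases hj : j = i
  · rw [hj, Matrix.mul_assoc, F.coord_mul_e, ← Matrix.mul_assoc, ← Matrix.mul_assoc, F'.e_mul_vec]
  · rw [Matrix.mul_assoc, F.coord_mul_e_of_ne R hj, ← Matrix.mul_assoc, ← Matrix.mul_assoc,
      F'.e_mul_vec_of_ne R fun h => hj (by linarith), Matrix.mul_zero, Matrix.zero_mul,
      Matrix.zero_mul]

/-- The matrix of an operator preserving `W_i`. -/
def Frame.gl (F : G.Frame i n) {R : Alg} (h : GL (Fin N) R)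
    (hc : h.1 * G.eR R i = G.eR R i * h.1) : GL (Fin n) R where
  val := bc R F.coord * h.1 * bc R F.vec
  inv := bc R F.coord * (h⁻¹).1 * bc R F.vec
  val_inv := by
    have h1 : h.1 * (h⁻¹).1 = 1 := h.mul_inv
    simp only [Matrix.mul_assoc, matrix_mul_mul_of_eq (F.right R), matrix_mul_mul_of_eq hc]
    rw [← Matrix.mul_assoc (G.eR R i), ← hc, Matrix.mul_assoc, ← Matrix.mul_assoc (G.eR R i),
      (show Commute h.1 (G.eR R i) from hc).units_inv_left.symm, Matrix.mul_assoc (h⁻¹).1,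
      F.e_mul_vec, ← Matrix.mul_assoc h.1, h1, Matrix.one_mul, F.left]
  inv_val := by
    have h1 : (h⁻¹).1 * h.1 = 1 := h.inv_mul
    simp only [Matrix.mul_assoc, matrix_mul_mul_of_eq (F.right R)]
    rw [← Matrix.mul_assoc (G.eR R i), ← hc, Matrix.mul_assoc h.1, F.e_mul_vec,
      ← Matrix.mul_assoc _ h.1, h1, Matrix.one_mul, F.left]

end Grading

/-! ### Existence of a good point, and the flag it defines. -/

namespace Datum

variable {N p : ℕ} [hp : Fact p.Prime] {B : Matrix (Fin N) (Fin N) ℂ} {s : GL (Fin N) ℂ}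
  {σ : SupportKind} (D : Datum p B s σ)

/-- Injections in the degrees below `i₀` are assembled into an operator `w`, and `w - adj w` is
skew-adjoint. The operator `w` lives in degrees below `i₀` and `adj w` in degrees above `-i₀ - 1 ≥
i₀`, so the two do not interfere and both vanish in the forgotten degrees. -/
theorem exists_good : ∃ z, Nonempty (D.Good z) := by
  classical
  have hle : ∀ l : ℕ, eigDim p s (σ.i₀ - (l + 1 : ℕ)) ≤ eigDim p s (σ.i₀ - (l + 1 : ℕ) + 1) :=
    fun l => D.dim_le _ (by
      have : (0 : ℝ) ≤ l := Nat.cast_nonneg l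
      have : σ.i₀ ≤ -1 / 2 := by cases σ <;> norm_num [SupportKind.i₀]
      push_cast
      linarith)
  choose m t hmt using fun l => D.exists_injective (hle l)
  -- The index is arranged so that the degree `i₀ - (l + 1)` receives `m l`.
  let A : ℝ → Matrix (Fin N) (Fin N) ℂ := fun i =>
    if i < σ.i₀ then m (⌊σ.i₀ - i⌋₊ - 1) else 0
  have hA : ∀ l : ℕ, A (σ.i₀ - (l + 1 : ℕ)) = m l := fun l => by
    have h0 : (0 : ℝ) ≤ l := Nat.cast_nonneg l
    simp only [A]
    rw [if_pos (by push_cast; linarith), sub_sub_cancel, Nat.floor_natCast, Nat.add_sub_cancel]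
  have hA0 : ∀ i, σ.i₀ ≤ i → A i = 0 := fun i hi => if_neg (not_lt.2 hi)
  obtain ⟨w, hw1, hw2⟩ := D.exists_blocks (R := cpt) A 1
  have hz2 : ∀ i, (w - D.adj w) * D.eR cpt i = D.eR cpt (i + 1) * (w - D.adj w) := fun i => by
    have e1 : D.adj w * D.eR cpt i = D.eR cpt (i + 1) * D.adj w := by
      have := congrArg D.adj (hw1 (-i - 1))
      rw [D.adj_mul, D.adj_mul, D.adj_eR, D.adj_eR, show -(-i - 1 + 1) = i by ring,
        show -(-i - 1) = i + 1 by ring] at this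
      exact this.symm
    rw [Matrix.sub_mul, hw1, e1, Matrix.mul_sub]
  have hw0 : ∀ i, σ.i₀ ≤ i → w * D.eR cpt i = 0 := fun i hi => by
    rw [hw2, hA0 i hi]
    have : D.eR cpt (i + 1) * (0 : Matrix (Fin N) (Fin N) cpt) = 0 := Matrix.mul_zero _
    exact (congrArg (· * D.eR cpt i) this).trans (Matrix.zero_mul _)
  have hw0' : ∀ i, σ.i₀ ≤ -i - 1 → D.adj w * D.eR cpt i = 0 := fun i hi => by
    have := congrArg D.adj ((hw1 (-i - 1)).symm.trans (hw0 _ hi))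
    rwa [D.adj_mul, D.adj_eR, D.adj_zero, show -(-i - 1 + 1) = i by ring] at this
  refine ⟨w - D.adj w, Good.exists_of D _ (D.mem_vogan_iff.2 ⟨?_, hz2⟩) (fun j hj => ?_)
    fun l => ⟨t l, ?_⟩⟩
  · rw [D.adj_sub, D.adj_adj, neg_sub]
  · have hj' : σ.i₀ ≤ j ∧ σ.i₀ ≤ -j - 1 := by
      cases σ
      · rcases hj with rfl | hj
        · norm_num [SupportKind.i₀]
        · rw [Set.mem_singleton_iff.1 hj]; norm_num [SupportKind.i₀]
      · rw [show j = -1 / 2 from hj]; norm_num [SupportKind.i₀]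
    have : (w - D.adj w) * D.eR cpt j = 0 := by
      rw [Matrix.sub_mul, hw0 _ hj'.1, hw0' _ hj'.2, sub_zero]
    rwa [Grading.eR, bc_cpt] at this
  · have h1 := hw2 (σ.i₀ - (l + 1 : ℕ))
    rw [hA, Grading.eR, Grading.eR, bc_cpt, bc_cpt] at h1
    have h2 := hw0' (σ.i₀ - (l + 1 : ℕ)) (by
      have : (0 : ℝ) ≤ l := Nat.cast_nonneg l
      have : σ.i₀ ≤ -1 / 2 := by cases σ <;> norm_num [SupportKind.i₀]
      push_cast
      linarith)
    rw [Grading.eR, bc_cpt] at h2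
    have h3 : (w - D.adj w) * D.e (σ.i₀ - (l + 1 : ℕ)) =
        w * D.e (σ.i₀ - (l + 1 : ℕ)) - D.adj w * D.e (σ.i₀ - (l + 1 : ℕ)) := Matrix.sub_mul _ _ _
    refine (congrArg (t l * ·) (h3.trans ?_)).trans (hmt l)
    refine (congrArg₂ (· - ·) h1 h2).trans ?_
    exact sub_zero _

/-! ### The flag -/

/-- The maps `S l = z ^ l : W_{i₀ - l} → W_{i₀}` and left inverses `T l`, in the coordinates of a
basis of `W_{i₀}`. -/
structure FlagFrame (D : Datum p B s σ) (z : Matrix (Fin N) (Fin N) ℂ) {n : ℕ}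
    (F : D.Frame σ.i₀ n) where
  S : ℕ → Matrix (Fin n) (Fin N) ℂ
  T : ℕ → Matrix (Fin N) (Fin n) ℂ
  S_zero : S 0 = F.coord
  T_zero : T 0 = F.vec
  T_mul_S : ∀ l, T l * S l = D.e (σ.i₀ - l)
  e_mul_T : ∀ l : ℕ, D.e (σ.i₀ - l) * T l = T l
  S_mul_e : ∀ l : ℕ, S l * D.e (σ.i₀ - l) = S l
  z_mul_T : ∀ l, z * T (l + 1) = T l * (S (l + 1) * T (l + 1))
  S_mul_z : ∀ l, S l * (z * D.e (σ.i₀ - (l + 1 : ℕ))) = S (l + 1)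
  vec_mul_S : ∀ l : ℕ, F.vec * S l = z ^ l * D.e (σ.i₀ - l)

/-- The maps are `z ^ l` and `r ^ l` read in the basis of `W_{i₀}`; they are inverse on `W_{i₀ - l}`
because `r` inverts `z` from the left in every degree strictly below `i₀`. -/
theorem Good.flagFrame_nonempty {D : Datum p B s σ} {z : Matrix (Fin N) (Fin N) ℂ} (hz : D.Good z)
    {n : ℕ} (F : D.Frame σ.i₀ n) : Nonempty (D.FlagFrame z F) := by
  let e : ℕ → Matrix (Fin N) (Fin N) ℂ := fun l => D.e (σ.i₀ - l)
  have he : ∀ l, e l * e l = e l := fun l => D.e_mul_e _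
  have he0 : F.vec * F.coord = e 0 := by
    have := F.vec_mul_coord
    simpa [e] using this
  have hz1 : ∀ l, z * e (l + 1) = e l * z := fun l => by
    have := hz.z_mul_E cpt l
    simpa only [E, Grading.eR, bc_cpt] using this
  have hr1 : ∀ l, hz.r * e l = e (l + 1) * hz.r := fun l => by
    have := hz.r_mul_E cpt l
    simpa only [E, Grading.eR, bc_cpt] using this
  have hrz : ∀ l, hz.r * (z * e (l + 1)) = e (l + 1) := hz.r_mul
  have hzl : ∀ l, z ^ l * e l = e 0 * z ^ l := fun l => by
    induction l with
    | zero => simp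
    | succ l ih => rw [pow_succ, mul_assoc, hz1, ← mul_assoc, ih, mul_assoc]
  have hrl : ∀ l, hz.r ^ l * e 0 = e l * hz.r ^ l := fun l => by
    induction l with
    | zero => simp
    | succ l ih => rw [pow_succ', mul_assoc, ih, ← mul_assoc, hr1, mul_assoc]
  have hrzl : ∀ l, hz.r ^ l * (z ^ l * e l) = e l := fun l => by
    induction l with
    | zero => simp
    | succ l ih =>
      calc hz.r ^ (l + 1) * (z ^ (l + 1) * e (l + 1))
          = hz.r * (hz.r ^ l * (z ^ l * (z * e (l + 1)))) := by
            rw [pow_succ', pow_succ]; simp only [mul_assoc]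
        _ = hz.r * (hz.r ^ l * (z ^ l * e l) * z) := by
            rw [hz1]; simp only [mul_assoc]
        _ = _ := by rw [ih, ← hz1, hrz]
  have hc0 : F.coord * e 0 = F.coord := by
    rw [← he0, ← Matrix.mul_assoc, F.coord_mul_vec, Matrix.one_mul]
  have hv0 : e 0 * F.vec = F.vec := by
    rw [← he0, Matrix.mul_assoc, F.coord_mul_vec, Matrix.mul_one]
  have hvS : ∀ l, F.vec * (F.coord * (z ^ l * e l)) = z ^ l * e l := fun l => by
    rw [← Matrix.mul_assoc, he0, hzl, ← mul_assoc, he]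
  have hrv : ∀ l, e l * (hz.r ^ l * F.vec) = hz.r ^ l * F.vec := fun l => by
    rw [← Matrix.mul_assoc, ← hrl, Matrix.mul_assoc, hv0]
  refine ⟨⟨fun l => F.coord * (z ^ l * e l), fun l => hz.r ^ l * F.vec, ?_, ?_, fun l => ?_, hrv,
    fun l => ?_, fun l => ?_, fun l => ?_, hvS⟩⟩
  · rw [pow_zero, one_mul, hc0]
  · rw [pow_zero, Matrix.one_mul]
  · rw [Matrix.mul_assoc, hvS, hrzl]
  · change F.coord * (z ^ l * e l) * e l = F.coord * (z ^ l * e l)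
    rw [Matrix.mul_assoc, Matrix.mul_assoc, he]
  · calc z * (hz.r ^ (l + 1) * F.vec)
        = z * e (l + 1) * (hz.r ^ (l + 1) * F.vec) := by rw [Matrix.mul_assoc, hrv]
      _ = hz.r ^ l * (z ^ l * e l) * z * (hz.r ^ (l + 1) * F.vec) := by rw [hz1, hrzl]
      _ = hz.r ^ l * (z ^ (l + 1) * e (l + 1)) * (hz.r ^ (l + 1) * F.vec) := by
          rw [pow_succ z, Matrix.mul_assoc (z ^ l) z, hz1]; simp only [Matrix.mul_assoc]
      _ = hz.r ^ l * (F.vec * (F.coord * (z ^ (l + 1) * e (l + 1)))) *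
            (hz.r ^ (l + 1) * F.vec) := by rw [hvS]
      _ = _ := by simp only [Matrix.mul_assoc]
  · change F.coord * (z ^ l * e l) * (z * e (l + 1)) = F.coord * (z ^ (l + 1) * e (l + 1))
    rw [Matrix.mul_assoc, hz1, Matrix.mul_assoc, ← mul_assoc (e l), he, ← hz1, pow_succ, mul_assoc]

end Datum

/-- The `R`-span of the image of an idempotent complex matrix. -/
theorem mem_span_iff_of_idempotent {n : ℕ} {C : Submodule ℂ (Fin n → ℂ)}
    {Q : Matrix (Fin n) (Fin n) ℂ} (hQ : Q * Q = Q) (hC : ∀ c, c ∈ C ↔ Q *ᵥ c = c) {R : Alg}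
    {v : Fin n → R} :
    v ∈ Submodule.span R ((fun c : Fin n → ℂ => algebraMap ℂ R ∘ c) '' C) ↔ bc R Q *ᵥ v = v := by
  constructor
  · intro hv
    induction hv using Submodule.span_induction with
    | mem x hx =>
      obtain ⟨c, hc, rfl⟩ := hx
      have h1 := (hC c).1 hc
      ext i
      have h2 := congrArg (algebraMap ℂ R) (congrFun h1 i)
      simpa [Matrix.mulVec, dotProduct] using h2
    | zero => rw [Matrix.mulVec_zero]
    | add x y _ _ hx hy => rw [Matrix.mulVec_add, hx, hy]
    | smul a x _ hx => rw [Matrix.mulVec_smul, hx]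
  · intro hv
    have h1 : v = ∑ j, v j • (algebraMap ℂ R ∘ fun i => Q i j) := by
      conv_lhs => rw [← hv]
      ext i
      simp [Matrix.mulVec, dotProduct, mul_comm]
    rw [h1]
    refine Submodule.sum_mem _ fun j _ => Submodule.smul_mem _ _ (Submodule.subset_span
      ⟨fun i => Q i j, (hC _).2 ?_, rfl⟩)
    ext i
    exact congrFun (congrFun hQ i) j

/-- The idempotents `Q l` project onto the steps of the flag, and over `R` the span of a step is the
image of the base-changed idempotent; stability thus becomes a matrix identity. -/
theorem mem_stabGroup_iff {n : ℕ} {C : ℕ → Submodule ℂ (Fin n → ℂ)}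
    {Q : ℕ → Matrix (Fin n) (Fin n) ℂ} (hQ : ∀ l, Q l * Q l = Q l)
    (hC : ∀ l c, c ∈ C l ↔ Q l *ᵥ c = c) {R : Alg} {g : GL (Fin n) R} :
    g ∈ (stabGroup C).pts R ↔ ∀ l, bc R (Q l) * (g.1 * bc R (Q l)) = g.1 * bc R (Q l) ∧
      bc R (Q l) * ((g⁻¹).1 * bc R (Q l)) = (g⁻¹).1 * bc R (Q l) := by
  have key : ∀ l (a : Matrix (Fin n) (Fin n) R),
      (∀ v : Fin n → R, bc R (Q l) *ᵥ v = v → bc R (Q l) *ᵥ (a *ᵥ v) = a *ᵥ v) ↔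
        bc R (Q l) * (a * bc R (Q l)) = a * bc R (Q l) := by
    intro l a
    rw [← Matrix.mul_assoc, mul_eq_mul_iff_mulVec]
    constructor
    · intro h v
      rw [← Matrix.mulVec_mulVec, h _ (by rw [Matrix.mulVec_mulVec, ← bc_mul, hQ])]
    · intro h v hv
      have := h v
      rwa [hv, ← Matrix.mulVec_mulVec] at this
  constructor
  · intro hg l
    refine ⟨(key l _).1 fun v hv => ?_, (key l _).1 fun v hv => ?_⟩
    · exact (mem_span_iff_of_idempotent (hQ l) (hC l)).1
        (hg l v ((mem_span_iff_of_idempotent (hQ l) (hC l)).2 hv)).1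
    · exact (mem_span_iff_of_idempotent (hQ l) (hC l)).1
        (hg l v ((mem_span_iff_of_idempotent (hQ l) (hC l)).2 hv)).2
  · intro h l v hv
    have hv' := (mem_span_iff_of_idempotent (hQ l) (hC l)).1 hv
    exact ⟨(mem_span_iff_of_idempotent (hQ l) (hC l)).2 ((key l _).2 (h l).1 v hv'),
      (mem_span_iff_of_idempotent (hQ l) (hC l)).2 ((key l _).2 (h l).2 v hv')⟩

/-! ### The stabilizer of a good point, and coordinates on the fibre. -/

namespace Datum

variable {N p : ℕ} [hp : Fact p.Prime] {B : Matrix (Fin N) (Fin N) ℂ} {s : GL (Fin N) ℂ}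
  {σ : SupportKind} {D : Datum p B s σ} {z : Matrix (Fin N) (Fin N) ℂ} {n : ℕ}
  {F : D.Frame σ.i₀ n}

namespace FlagFrame

theorem mem_flag_iff (L : D.FlagFrame z F) (b : Module.Basis (Fin n) ℂ (eig p s cpt σ.i₀))
    (hb : ∀ c : Fin n → ℂ, (b.equivFun.symm c : Fin N → ℂ) = F.vec *ᵥ c) (l : ℕ) (c : Fin n → ℂ) :
    c ∈ flag p s σ z b l ↔ (L.S l * L.T l) *ᵥ c = c := by
  have h1 : c ∈ flag p s σ z b l ↔ ∃ v ∈ eig p s cpt (σ.i₀ - l), (z ^ l) *ᵥ v = F.vec *ᵥ c := by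
    rw [← hb]
    rfl
  have hG : ∀ v : Fin N → ℂ, v ∈ eig p s cpt (σ.i₀ - l) ↔ D.e (σ.i₀ - l) *ᵥ v = v := fun v => by
    have := D.mem_eig_iff (R := cpt) (i := σ.i₀ - l) (v := v)
    rwa [Grading.eR, bc_cpt] at this
  rw [h1]
  constructor
  · rintro ⟨v, hv, h⟩
    have e1 : c = L.S l *ᵥ v := by
      have e2 : F.vec *ᵥ c = F.vec *ᵥ (L.S l *ᵥ v) := by
        rw [← h, Matrix.mulVec_mulVec, L.vec_mul_S, ← Matrix.mulVec_mulVec, (hG v).1 hv]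
      have e3 := congrArg (F.coord *ᵥ ·) e2
      simpa only [Matrix.mulVec_mulVec, ← Matrix.mul_assoc, F.coord_mul_vec, Matrix.one_mul,
        Matrix.one_mulVec] using e3
    rw [e1, Matrix.mulVec_mulVec, Matrix.mul_assoc, L.T_mul_S, L.S_mul_e]
  · intro h
    refine ⟨L.T l *ᵥ c, (hG _).2 (by rw [Matrix.mulVec_mulVec, L.e_mul_T]), ?_⟩
    conv_rhs => rw [← h, Matrix.mulVec_mulVec, ← Matrix.mul_assoc, L.vec_mul_S, Matrix.mul_assoc,
      L.e_mul_T, ← Matrix.mulVec_mulVec]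

theorem S_mul_T_mul_S (L : D.FlagFrame z F) (l : ℕ) : L.S l * (L.T l * L.S l) = L.S l := by
  rw [L.T_mul_S, L.S_mul_e]

theorem mem_parabolic_iff (L : D.FlagFrame z F) {b : Module.Basis (Fin n) ℂ (eig p s cpt σ.i₀)}
    (hb : ∀ c : Fin n → ℂ, (b.equivFun.symm c : Fin N → ℂ) = F.vec *ᵥ c) {R : Alg}
    {g : GL (Fin n) R} :
    g ∈ (parabolic p s σ z b).pts R ↔ ∀ l,
      bc R (L.S l) * (bc R (L.T l) * (g.1 * bc R (L.S l))) = g.1 * bc R (L.S l) ∧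
      bc R (L.S l) * (bc R (L.T l) * ((g⁻¹).1 * bc R (L.S l))) = (g⁻¹).1 * bc R (L.S l) := by
  refine (mem_stabGroup_iff (Q := fun l => L.S l * L.T l) (fun l => ?_)
    (L.mem_flag_iff b hb)).trans (forall_congr' fun l => ?_)
  · rw [Matrix.mul_assoc, ← Matrix.mul_assoc (L.T l), ← Matrix.mul_assoc, S_mul_T_mul_S]
  · have hS : bc R (L.S l) * (bc R (L.T l) * bc R (L.S l)) = bc R (L.S l) := by
      rw [← bc_mul, ← bc_mul, S_mul_T_mul_S]
    have key : ∀ a : Matrix (Fin n) (Fin n) R,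
        bc R (L.S l * L.T l) * (a * bc R (L.S l * L.T l)) = a * bc R (L.S l * L.T l) ↔
          bc R (L.S l) * (bc R (L.T l) * (a * bc R (L.S l))) = a * bc R (L.S l) := by
      intro a
      rw [bc_mul]
      constructor
      · intro h
        have := congrArg (· * bc R (L.S l)) h
        simpa only [Matrix.mul_assoc, hS] using this
      · intro h
        have := congrArg (· * bc R (L.T l)) h
        simpa only [Matrix.mul_assoc] using this
    exact and_congr (key _) (key _)

theorem T_mul_S_eR (L : D.FlagFrame z F) (R : Alg) (l : ℕ) :
    bc R (L.T l) * bc R (L.S l) = D.E R l := by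
  rw [← bc_mul, L.T_mul_S]

/-- The action of an element of the stabilizer on `W_{i₀ - l}` is determined by its action on
`W_{i₀}`. -/
theorem S_mul (L : D.FlagFrame z F) {R : Alg} {h : GL (Fin N) R}
    (hh : h ∈ (hStab B s z).pts R) (l : ℕ) :
    bc R (L.S l) * h.1 = bc R F.coord * h.1 * bc R F.vec * bc R (L.S l) := by
  have hc := (D.mem_hGroup_iff.1 hh.1).2.2
  have hhz : h.1 * bc R z = bc R z * h.1 := hh.2
  induction l with
  | zero =>
    rw [L.S_zero, Matrix.mul_assoc _ (bc R F.vec), F.right, Matrix.mul_assoc, hc, ← Matrix.mul_assoc,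
      F.coord_mul_e]
  | succ l ih =>
    rw [← L.S_mul_z l, bc_mul, bc_mul, Matrix.mul_assoc, Matrix.mul_assoc, ← hc,
      ← Matrix.mul_assoc (bc R z), ← hhz, Matrix.mul_assoc, ← Matrix.mul_assoc _ h.1, ih,
      Matrix.mul_assoc _ (bc R (L.S l))]

theorem mul_E (L : D.FlagFrame z F) {R : Alg} {h : GL (Fin N) R}
    (hh : h ∈ (hStab B s z).pts R) (l : ℕ) :
    h.1 * D.E R l = bc R (L.T l) * (bc R F.coord * h.1 * bc R F.vec * bc R (L.S l)) := by
  have h1 : h.1 * D.E R l = D.E R l * h.1 := (D.mem_hGroup_iff.1 hh.1).2.2 _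
  rw [h1, ← L.T_mul_S_eR, Matrix.mul_assoc, L.S_mul hh]

/-- An element commuting with `z` and preserving `W_{i₀ - l}` preserves its image under `z ^ l`; its
inverse does so as well. -/
theorem gl_mem_parabolic (L : D.FlagFrame z F) {b : Module.Basis (Fin n) ℂ (eig p s cpt σ.i₀)}
    (hb : ∀ c : Fin n → ℂ, (b.equivFun.symm c : Fin N → ℂ) = F.vec *ᵥ c) {R : Alg}
    {h : GL (Fin N) R} (hh : h ∈ (hStab B s z).pts R)
    (hc : h.1 * D.eR R σ.i₀ = D.eR R σ.i₀ * h.1) :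
    F.gl h hc ∈ (parabolic p s σ z b).pts R := by
  rw [L.mem_parabolic_iff hb]
  have key : ∀ {h : GL (Fin N) R}, h ∈ (hStab B s z).pts R → ∀ l,
      bc R (L.S l) * (bc R (L.T l) * (bc R F.coord * h.1 * bc R F.vec * bc R (L.S l))) =
        bc R F.coord * h.1 * bc R F.vec * bc R (L.S l) := fun {h} hh l => by
    rw [← L.mul_E hh, ← Matrix.mul_assoc, L.S_mul hh, Matrix.mul_assoc, ← bc_mul, L.S_mul_e]
  exact fun l => ⟨key hh l, key (Subgroup.inv_mem _ hh) l⟩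

/-- Triviality on `W_{i₀}` spreads down the ladder because `z ^ l` is injective, and to the dual
half by taking adjoints of the inverse. Only `W_0` is not reached, hence the hypothesis `h0`. -/
theorem eq_one_of_gl (L : D.FlagFrame z F) {R : Alg} {h : GL (Fin N) R}
    (hh : h ∈ (hStab B s z).pts R) (h1 : bc R F.coord * h.1 * bc R F.vec = 1) {i : ℝ}
    (h0 : σ = .int → i = 0 → h.1 * D.eR R 0 = D.eR R 0) : h.1 * D.eR R i = D.eR R i := by
  by_cases hi : i ∈ σ.exponents
  swap
  · rw [Grading.eR, D.eq_zero_of_notMem hi, bc_zero, Matrix.mul_zero]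
  have hE : ∀ l, h.1 * D.E R l = D.E R l := fun l => by
    rw [L.mul_E hh, h1, Matrix.one_mul, L.T_mul_S_eR]
  rcases SupportKind.mem_trichotomy hi with ⟨l, rfl⟩ | ⟨l, hl⟩ | ⟨h2, rfl⟩
  · exact hE l
  · have hinv : (h⁻¹).1 * h.1 = 1 := h.inv_mul
    have e1 : (h⁻¹).1 * D.eR R (-i) = D.eR R (-i) := by
      have e3 := congrArg ((h⁻¹).1 * ·) (hE l)
      simp only [← Matrix.mul_assoc, hinv, Matrix.one_mul] at e3
      rw [hl]
      exact e3.symm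
    have e2 := congrArg D.adj e1
    rw [D.adj_mul, D.adj_eR, neg_neg, ← D.adj_eq_inv hh.1, D.adj_adj] at e2
    rw [(D.mem_hGroup_iff.1 hh.1).2.2, e2]
  · exact h0 h2 rfl

/-- An element of the parabolic restricts to each step of the flag. Transported to `W_{i₀ - l}` as
`T l * g * S l`, these restrictions commute with `z` on the lower half, and `exists_isometry`
extends them to the dual half. -/
theorem exists_stab (hz : D.Good z) (L : D.FlagFrame z F)
    {b : Module.Basis (Fin n) ℂ (eig p s cpt σ.i₀)}
    (hb : ∀ c : Fin n → ℂ, (b.equivFun.symm c : Fin N → ℂ) = F.vec *ᵥ c) {R : Alg}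
    {g : GL (Fin n) R} (hg : g ∈ (parabolic p s σ z b).pts R) :
    ∃ h ∈ (hStab B s z).pts R, bc R F.coord * h.1 * bc R F.vec = g.1 ∧
      (σ = .int → h.1 * D.eR R 0 = D.eR R 0) := by
  classical
  rw [L.mem_parabolic_iff hb] at hg
  have hblock : ∀ g : Matrix (Fin n) (Fin n) R, ∃ a : Matrix (Fin N) (Fin N) R,
      (∀ i, a * D.eR R i = D.eR R i * a) ∧ (∀ i, σ.i₀ < i → a * D.eR R i = D.eR R i) ∧
      ∀ l, a * D.E R l = bc R (L.T l) * (g * bc R (L.S l)) := by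
    intro g
    obtain ⟨a, h1, h2⟩ := D.exists_blocks (R := R) (fun i => if i ≤ σ.i₀ then
      bc R (L.T ⌊σ.i₀ - i⌋₊) * (g * bc R (L.S ⌊σ.i₀ - i⌋₊)) else 1) 0
    simp only [add_zero] at h1 h2
    refine ⟨a, h1, fun i hi => ?_, fun l => ?_⟩
    · rw [h2, if_neg (not_le.2 hi), Matrix.mul_one, D.eR_mul_eR]
    · rw [h2, if_pos (σ.i₀_sub_le l), sub_sub_cancel, Nat.floor_natCast, Matrix.mul_assoc,
        Matrix.mul_assoc, Matrix.mul_assoc, ← bc_mul, L.S_mul_e, ← Matrix.mul_assoc, ← bc_mul,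
        L.e_mul_T]
  obtain ⟨a, ha1, ha2, ha3⟩ := hblock g.1
  obtain ⟨a', -, ha2', ha3'⟩ := hblock (g⁻¹).1
  have hgi : g.1 * (g⁻¹).1 = 1 := g.mul_inv
  -- The same construction for `g⁻¹` gives the inverse; the product telescopes because `S l * T l`
  -- is the identity on the step of the flag, which `g⁻¹` preserves.
  have haa : a * a' = 1 := by
    apply D.ext_right_of_mem
    intro i hi
    by_cases hi' : σ.i₀ < i
    · rw [Matrix.mul_assoc, ha2' i hi', ha2 i hi', Matrix.one_mul]
    · have hneg := σ.i₀_neg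
      obtain ⟨l, rfl⟩ : ∃ l : ℕ, i = σ.i₀ - l := by
        rcases SupportKind.mem_trichotomy hi with h | ⟨l, hl⟩ | ⟨-, rfl⟩
        · exact h
        · have := σ.i₀_sub_le l
          exact (hi' (by linarith)).elim
        · exact (hi' hneg).elim
      have e1 : a' * D.E R l = D.E R l * (bc R (L.T l) * ((g⁻¹).1 * bc R (L.S l))) := by
        rw [ha3', ← Matrix.mul_assoc (D.E R l), ← bc_mul, L.e_mul_T]
      rw [Matrix.mul_assoc, e1, ← Matrix.mul_assoc, ha3, Matrix.mul_assoc, Matrix.mul_assoc,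
        (hg l).2, ← Matrix.mul_assoc g.1, hgi, Matrix.one_mul, Matrix.one_mul, L.T_mul_S_eR]
  obtain ⟨h, hh, hE, h0⟩ := D.exists_isometry a (Matrix.isUnit_det_of_right_inverse haa) ha1 ha2
  have hc := (D.mem_hGroup_iff.1 hh).2.2
  have hE' : ∀ l, h.1 * D.E R l = bc R (L.T l) * (g.1 * bc R (L.S l)) := fun l => by
    rw [hE, ha3]
  refine ⟨h, ⟨hh, ?_⟩, ?_, h0⟩
  · change h.1 * bc R z = bc R z * h.1
    apply D.ext_right
    intro i
    by_cases hi : i ∈ σ.forgotten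
    · rw [Matrix.mul_assoc, hz.forget' R hi, Matrix.mul_assoc, hc, ← Matrix.mul_assoc,
        hz.forget' R hi, Matrix.mul_zero, Matrix.zero_mul]
    · refine (D.intertwine hh (hz.mem_vogan R) (hz.mem_vogan R) (fun l => ?_) hi).symm
      have e1 : bc R z * bc R (L.T (l + 1)) =
          bc R (L.T l) * (bc R (L.S (l + 1)) * bc R (L.T (l + 1))) := by
        rw [← bc_mul, L.z_mul_T, bc_mul, bc_mul]
      have e2 : bc R (L.S l) * (bc R z * D.E R (l + 1)) = bc R (L.S (l + 1)) := by
        rw [← bc_mul, ← bc_mul, L.S_mul_z]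
      have e3 : bc R z * D.E R (l + 1) = D.E R l * (bc R z * D.E R (l + 1)) := by
        rw [← Matrix.mul_assoc, ← hz.z_mul_E, Matrix.mul_assoc, D.eR_mul_eR]
      rw [Matrix.mul_assoc, hE', ← Matrix.mul_assoc, e1, Matrix.mul_assoc, Matrix.mul_assoc,
        (hg (l + 1)).1, Matrix.mul_assoc h.1, e3, ← Matrix.mul_assoc h.1, hE', Matrix.mul_assoc,
        Matrix.mul_assoc, e2]
  · have h1 := hE' 0
    rw [L.S_zero, L.T_zero, E, Nat.cast_zero, sub_zero] at h1
    rw [← F.e_mul_vec, Matrix.mul_assoc, ← Matrix.mul_assoc h.1, h1]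
    simp only [Matrix.mul_assoc, F.left, Matrix.mul_one, matrix_mul_mul_of_eq (F.left R),
      Matrix.one_mul]

end FlagFrame

/-! ### The fibre -/

theorem mem_forgotten_iff {σ : SupportKind} {j : ℝ} : j ∈ σ.forgotten ↔ j = σ.i₀ ∨ j = -σ.i₀ - 1 := by
  cases σ
  · simp only [SupportKind.forgotten, SupportKind.i₀, Set.mem_insert_iff, Set.mem_singleton_iff]
    norm_num
  · simp only [SupportKind.forgotten, SupportKind.i₀, Set.mem_singleton_iff]
    norm_num

theorem mul_eR_of_mem_vogan (D : Datum p B s σ) {R : Alg} {x : Matrix (Fin N) (Fin N) R}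
    (hx : x ∈ (voganSpace p B s).pts R) : x * D.eR R (-σ.i₀ - 1) = -D.adj (x * D.eR R σ.i₀) := by
  obtain ⟨h1, h2⟩ := D.mem_vogan_iff.1 hx
  rw [h2, D.adj_mul, h1, D.adj_eR, show -σ.i₀ - 1 + 1 = -σ.i₀ by ring, Matrix.mul_neg, neg_neg]

/-- Outside the forgotten degrees both points agree with `z`, and of the forgotten degrees the
partner of `i₀` is determined by the block in degree `i₀`. -/
theorem fiber_ext (D : Datum p B s σ) {R : Alg} {x y : Matrix (Fin N) (Fin N) R}
    (hx : x ∈ (fiber p B s σ z).pts R) (hy : y ∈ (fiber p B s σ z).pts R)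
    (h : x * D.eR R σ.i₀ = y * D.eR R σ.i₀) : x = y := by
  apply D.ext_right
  intro j
  by_cases hj : j ∈ σ.forgotten
  · rcases mem_forgotten_iff.1 hj with rfl | rfl
    · exact h
    · rw [D.mul_eR_of_mem_vogan hx.1.1, D.mul_eR_of_mem_vogan hy.1.1, h]
  · rw [← (D.isForget_iff.1 hx.2).1 j hj, ← (D.isForget_iff.1 hy.2).1 j hj]

/-- In the degrees below `i₀` full rank is provided by the left inverse `r` of `z`; only the new
block in degree `i₀` has to be injective, which is the role of `t`. -/
theorem Good.add_mem_fiber (hz : D.Good z) {R : Alg} {w t : Matrix (Fin N) (Fin N) R}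
    (hw : D.adj w = -w) (hw1 : ∀ i, w * D.eR R i = D.eR R (i + 1) * w)
    (hw0 : ∀ i ∉ σ.forgotten, w * D.eR R i = 0) (ht : t * (w * D.eR R σ.i₀) = D.eR R σ.i₀) :
    bc R z + w ∈ (fiber p B s σ z).pts R := by
  obtain ⟨hz1, hz2⟩ := D.mem_vogan_iff.1 (hz.mem_vogan R)
  have hv : bc R z + w ∈ (voganSpace p B s).pts R := D.mem_vogan_iff.2 ⟨by
    rw [D.adj_add, hz1, hw, neg_add], fun i => by rw [Matrix.add_mul, hz2, hw1, Matrix.mul_add]⟩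
  refine ⟨⟨hv, (D.isFullRank_iff hv).2 fun K _ _ f l => ?_⟩, D.isForget_iff.2 ⟨fun j hj => ?_,
    fun j hj => hz.forget' R hj⟩⟩
  · obtain ⟨t', ht'⟩ : ∃ t' : Matrix (Fin N) (Fin N) R,
        t' * ((bc R z + w) * D.E R l) = D.E R l := by
      rcases l with _ | l
      · refine ⟨t, ?_⟩
        rw [E, Nat.cast_zero, sub_zero, Matrix.add_mul,
          hz.forget' R (mem_forgotten_iff.2 (.inl rfl)), zero_add, ht]
      · exact ⟨bc R hz.r, by
          rw [Matrix.add_mul, hw0 _ (σ.i₀_sub_notMem_forgotten l), add_zero, hz.r_mul_z]⟩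
    have hE : (D.E R l).map f = D.E (CommAlgCat.of ℂ K) l := bc_map (CommAlgCat.ofHom f) _
    refine ⟨t'.map f, ?_⟩
    rw [← hE, ← Matrix.map_mul, ← Matrix.map_mul, ht']
  · rw [Matrix.add_mul, hw0 j hj, add_zero]

theorem isUnit_of_forall_field {R : Alg} {a : R}
    (h : ∀ (K : Type) [Field K] [Algebra ℂ K] (f : R →ₐ[ℂ] K), f a ≠ 0) : IsUnit a := by
  by_contra ha
  obtain ⟨m, hm, ham⟩ := exists_max_ideal_of_mem_nonunits ha
  let _ := Ideal.Quotient.field m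
  exact h (R ⧸ m) (Ideal.Quotient.mkₐ ℂ m) (Ideal.Quotient.eq_zero_iff_mem.2 ham)

theorem vec_mul_coord_of_mem_vogan (F : D.Frame σ.i₀ n) (F' : D.Frame (σ.i₀ + 1) n) {R : Alg}
    {x : Matrix (Fin N) (Fin N) R} (hx : x ∈ (voganSpace p B s).pts R) :
    bc R F'.vec * (bc R F'.coord * x * bc R F.vec) * bc R F.coord = x * D.eR R σ.i₀ := by
  have h2 := (D.mem_vogan_iff.1 hx).2
  simp only [Matrix.mul_assoc, F.right]
  rw [h2, ← Matrix.mul_assoc, F'.right, ← Matrix.mul_assoc, D.eR_mul_eR]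

/-- Source and target have the same dimension `n`, so injectivity at every field-valued point makes
the determinant non-zero at all of them, hence a unit. -/
theorem isUnit_det_of_mem_vReg (F : D.Frame σ.i₀ n) (F' : D.Frame (σ.i₀ + 1) n) {R : Alg}
    {x : Matrix (Fin N) (Fin N) R} (hx : x ∈ (vReg p B s).pts R) :
    IsUnit (bc R F'.coord * x * bc R F.vec).det := by
  apply isUnit_of_forall_field
  intro K _ _ f
  let S := CommAlgCat.of ℂ K
  let φ : R ⟶ S := CommAlgCat.ofHom f
  obtain ⟨t, ht⟩ := (D.isFullRank_iff hx.1).1 hx.2 K f 0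
  rw [E, Nat.cast_zero, sub_zero] at ht
  have hdet : f (bc R F'.coord * x * bc R F.vec).det =
      ((bc R F'.coord * x * bc R F.vec).map f).det := RingHom.map_det f.toRingHom _
  have hx' := (voganSpace p B s).map_mem φ hx.1
  have hm : (bc R F'.coord * x * bc R F.vec).map φ.hom =
      bc S F'.coord * x.map φ.hom * bc S F.vec := by
    rw [Matrix.map_mul, Matrix.map_mul, bc_map, bc_map]
  have h1 := vec_mul_coord_of_mem_vogan F F' hx'
  have h2 : bc S F.coord * (show Matrix (Fin N) (Fin N) S from t) * bc S F'.vec *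
      (bc S F'.coord * x.map φ.hom * bc S F.vec) = 1 := by
    rw [← Matrix.mul_one (bc S F'.coord * x.map φ.hom * bc S F.vec), ← F.left,
      ← Matrix.mul_assoc _ (bc S F.coord), Matrix.mul_assoc _ (bc S F'.vec),
      ← Matrix.mul_assoc (bc S F'.vec), ← Matrix.mul_assoc (bc S F'.vec), h1, Matrix.mul_assoc,
      ← Matrix.mul_assoc _ _ (bc S F.vec)]
    have ht' : (show Matrix (Fin N) (Fin N) S from t) * (x.map φ.hom * D.eR S σ.i₀) = D.eR S σ.i₀ :=
      ht
    rw [ht', F.e_mul_vec, F.left]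
  have h3 := Matrix.isUnit_det_of_left_inverse h2
  rw [hdet]
  have h4 : IsUnit (((bc R F'.coord * x * bc R F.vec).map φ.hom).det) := by rw [hm]; exact h3
  exact h4.ne_zero

theorem coord_conj (F : D.Frame σ.i₀ n) (F' : D.Frame (σ.i₀ + 1) n) {R : Alg}
    {x h h' : Matrix (Fin N) (Fin N) R} (hx : x ∈ (voganSpace p B s).pts R)
    (hc : ∀ i, h * D.eR R i = D.eR R i * h) :
    bc R F'.coord * (h * x * h') * bc R F.vec = (bc R F'.coord * h * bc R F'.vec) *
      (bc R F'.coord * x * bc R F.vec) * (bc R F.coord * h' * bc R F.vec) := by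
  have h2 := (D.mem_vogan_iff.1 hx).2
  calc _ = bc R F'.coord * (D.eR R (σ.i₀ + 1) * h * x) * h' * bc R F.vec := by
        conv_lhs => rw [← F'.coord_mul_e]
        simp only [Matrix.mul_assoc]
    _ = bc R F'.coord * (h * (x * D.eR R σ.i₀)) * h' * bc R F.vec := by
        rw [← hc, h2, Matrix.mul_assoc h]
    _ = _ := by
        rw [← vec_mul_coord_of_mem_vogan F F' hx]
        simp only [Matrix.mul_assoc]

end Datum

namespace Datum

variable {N p : ℕ} [hp : Fact p.Prime] {B : Matrix (Fin N) (Fin N) ℂ} {s : GL (Fin N) ℂ}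
  {σ : SupportKind} {D : Datum p B s σ} {z : Matrix (Fin N) (Fin N) ℂ} {n : ℕ}

theorem commute_of_mem_hStab (D : Datum p B s σ) {R : Alg} {h : GL (Fin N) R}
    (hh : h ∈ (hStab B s z).pts R) (i : ℝ) : h.1 * D.eR R i = D.eR R i * h.1 :=
  (D.mem_hGroup_iff.1 hh.1).2.2 i

/-- The action of the stabilizer on `W_i`. -/
def glHom {i : ℝ} (F : D.Frame i n) (z : Matrix (Fin N) (Fin N) ℂ) (R : Alg) :
    (hStab B s z).pts R →* GL (Fin n) R where
  toFun h := F.gl h.1 (D.commute_of_mem_hStab h.2 i)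
  map_one' := Units.ext (by
    change bc R F.coord * (1 : Matrix (Fin N) (Fin N) R) * bc R F.vec = 1
    rw [Matrix.mul_one, F.left])
  map_mul' h k := Units.ext (by
    change bc R F.coord * (h.1.1 * k.1.1) * bc R F.vec =
      bc R F.coord * h.1.1 * bc R F.vec * (bc R F.coord * k.1.1 * bc R F.vec)
    simp only [Matrix.mul_assoc, matrix_mul_mul_of_eq (F.right R)]
    rw [← Matrix.mul_assoc (D.eR R i), ← D.commute_of_mem_hStab k.2 i, Matrix.mul_assoc,
      F.e_mul_vec])

theorem glHom_map {i : ℝ} (F : D.Frame i n) {R S : Alg} (f : R ⟶ S) {h : GL (Fin N) R}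
    (hh : h ∈ (hStab B s z).pts R) :
    glHom F z S ⟨glMap f h, (hStab B s z).map_mem f hh⟩ = glMap f (glHom F z R ⟨h, hh⟩) :=
  Units.ext (by
    change bc S F.coord * h.1.map f.hom * bc S F.vec = (bc R F.coord * h.1 * bc R F.vec).map f.hom
    rw [Matrix.map_mul, Matrix.map_mul, bc_map, bc_map])

theorem coord_mul_map {i j : ℝ} (F : D.Frame i n) (F' : D.Frame j n) {R S : Alg} (f : R ⟶ S)
    (x : Matrix (Fin N) (Fin N) R) :
    bc S F'.coord * x.map f.hom * bc S F.vec = (bc R F'.coord * x * bc R F.vec).map f.hom := by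
  rw [Matrix.map_mul, Matrix.map_mul, bc_map, bc_map]

/-! ### Half-integral exponents -/

section Half

variable {D : Datum p B s .half}

theorem half_i₀_add_one : SupportKind.half.i₀ + 1 = -SupportKind.half.i₀ := by
  norm_num [SupportKind.i₀]

/-- The dual basis of `W_{1/2}`. -/
def dualFrame (F : D.Frame SupportKind.half.i₀ n) : D.Frame (SupportKind.half.i₀ + 1) n where
  vec := B⁻¹ * F.coordᵀ
  coord := F.vecᵀ * B
  coord_mul_vec := by
    rw [Matrix.mul_assoc, ← Matrix.mul_assoc B, Matrix.mul_nonsing_inv _ D.isUnit_B,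
      Matrix.one_mul, ← Matrix.transpose_mul, F.coord_mul_vec, Matrix.transpose_one]
  vec_mul_coord := by
    have h := D.adj_e SupportKind.half.i₀
    rw [FormGrading.adj, bc_cpt, bc_cpt, ← half_i₀_add_one] at h
    rw [← h, ← F.vec_mul_coord]
    change _ = B⁻¹ * (F.vec * F.coord)ᵀ * B
    rw [Matrix.transpose_mul]
    simp only [Matrix.mul_assoc]

theorem dualFrame_coord (F : D.Frame SupportKind.half.i₀ n) (R : Alg) :
    bc R (dualFrame F).coord = (bc R F.vec)ᵀ * bc R B := by
  rw [← bc_transpose, ← bc_mul]; rfl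

theorem dualFrame_vec (F : D.Frame SupportKind.half.i₀ n) (R : Alg) :
    bc R (dualFrame F).vec = bc R B⁻¹ * (bc R F.coord)ᵀ := by
  rw [← bc_transpose, ← bc_mul]; rfl

/-- An isometry acts on the dual basis by the contragredient matrix; this turns conjugation of `x`
into congruence of its block. -/
theorem dualFrame_gl (F : D.Frame SupportKind.half.i₀ n) {R : Alg} {h : GL (Fin N) R}
    (hh : h ∈ (hStab B s z).pts R) :
    bc R (dualFrame F).coord * h.1 * bc R (dualFrame F).vec =
      (bc R F.coord * (h⁻¹).1 * bc R F.vec)ᵀ := by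
  have h1 : bc R B * h.1 = (h⁻¹).1ᵀ * bc R B := by
    rw [← D.B_mul_adj, D.adj_eq_inv (Subgroup.inv_mem _ hh.1), inv_inv]
  rw [dualFrame_coord, dualFrame_vec, Matrix.mul_assoc _ (bc R B), h1, Matrix.mul_assoc,
    Matrix.mul_assoc, ← Matrix.mul_assoc (bc R B), D.B_mul_inv, Matrix.one_mul, Matrix.transpose_mul,
    Matrix.transpose_mul]

theorem algebraMap_c_smul {c : ℤ} (hc : D.c = -(c : ℂ)) (R : Alg) {k l : ℕ}
    (M : Matrix (Fin k) (Fin l) R) : algebraMap ℂ R D.c • M = -(c • M) := by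
  rw [hc, map_neg, map_intCast, neg_smul, Int.cast_smul_eq_zsmul]

theorem int_mul_self {c : ℤ} (hc : D.c = -(c : ℂ)) : c * c = 1 := by
  have := D.c_mul_c
  rw [hc, neg_mul_neg] at this
  exact_mod_cast this

/-- In the dual basis the block of `x` is the Gram matrix of `(v, w) ↦ ⟨v, x w⟩` on `W_{-1/2}`.
Skew-adjointness of `x` reverses the sign of the form, hence `c` is opposite to `D.c`. -/
theorem transpose_dualFrame_mul (F : D.Frame SupportKind.half.i₀ n) {c : ℤ} (hc : D.c = -(c : ℂ))
    {R : Alg} {x : Matrix (Fin N) (Fin N) R} (hx : x ∈ (voganSpace p B s).pts R) :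
    (bc R (dualFrame F).coord * x * bc R F.vec)ᵀ =
      c • (bc R (dualFrame F).coord * x * bc R F.vec) := by
  have h1 := (D.mem_vogan_iff.1 hx).1
  have hB : (bc R B)ᵀ = -(c • bc R B) := by
    rw [← bc_transpose, D.transpose_B, bc_smul, algebraMap_c_smul hc]
  rw [dualFrame_coord, Matrix.transpose_mul, Matrix.transpose_mul, Matrix.transpose_mul,
    Matrix.transpose_transpose, hB]
  simp only [Matrix.neg_mul, Matrix.mul_neg, Matrix.smul_mul, Matrix.mul_smul]
  rw [← smul_neg]
  congr 1
  rw [Matrix.mul_assoc (bc R F.vec)ᵀ, ← neg_neg x, ← h1, Matrix.mul_neg, D.B_mul_adj]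
  simp only [Matrix.neg_mul, Matrix.mul_neg, Matrix.mul_assoc, Matrix.transpose_neg,
    FormGrading.adj_neg, h1, neg_neg]

theorem adj_dualFrame (F : D.Frame SupportKind.half.i₀ n) {c : ℤ} (hc : D.c = -(c : ℂ))
    {R : Alg} {y : Matrix (Fin n) (Fin n) R} (hy : yᵀ = c • y) :
    D.adj (bc R (dualFrame F).vec * y * bc R F.coord) =
      -(bc R (dualFrame F).vec * y * bc R F.coord) := by
  have hB : (bc R B)ᵀ = -(c • bc R B) := by
    rw [← bc_transpose, D.transpose_B, bc_smul, algebraMap_c_smul hc]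
  have hcc := int_mul_self hc
  have hBi : (bc R B⁻¹)ᵀ * bc R B = -(c • (1 : Matrix (Fin N) (Fin N) R)) := by
    have h1 := congrArg Matrix.transpose (D.B_mul_inv R)
    rw [Matrix.transpose_mul, hB, Matrix.transpose_one, Matrix.mul_neg, Matrix.mul_smul] at h1
    rw [← h1, smul_neg, smul_smul, hcc, one_smul, neg_neg]
  have hi : bc R B * bc R B⁻¹ = 1 := D.B_mul_inv R
  rw [D.adj_eq_iff, dualFrame_vec]
  simp only [Matrix.transpose_mul, Matrix.transpose_transpose, Matrix.mul_neg, Matrix.mul_assoc,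
    hBi, hy, matrix_mul_mul_of_eq hi, Matrix.one_mul, Matrix.smul_mul, Matrix.mul_smul,
    Matrix.mul_one, smul_neg, smul_smul, hcc, one_smul]

/-- There is no `W_0`, so the action on `W_{i₀}` identifies the stabilizer with the parabolic
(`eq_one_of_gl`, `exists_stab`). On the fibre, the Gram matrix determines the point, and a form `y`
is realized by adding to `z` the operator with block `y`, inverted on the left by `y⁻¹`. -/
theorem Good.exists_iso_half (hz : D.Good z)
    (b : Module.Basis (Fin n) ℂ (eig p s cpt SupportKind.half.i₀)) {c : ℤ} (hc : D.c = -(c : ℂ)) :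
    ∃ u : (fiberSpace p B s .half z).Hom (congrSpace (parabolic p s .half z b) (formSpace n c)
      (formSpace_congr n c)), u.IsIso := by
  obtain ⟨F, hb⟩ := D.exists_frame_of_basis b
  obtain ⟨L⟩ := hz.flagFrame_nonempty F
  let P := parabolic p s .half z b
  let F' := dualFrame F
  let u : (fiberSpace p B s .half z).Hom (congrSpace P (formSpace n c) (formSpace_congr n c)) :=
    { onG := fun R => ((glHom F z R).codRestrict (P.pts R)
        fun h => L.gl_mem_parabolic hb h.2 (D.commute_of_mem_hStab h.2 _) : (hStab B s z).pts R →* P.pts R)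
      onG_map := fun {R S} f (g : (hStab B s z).pts R) => Subtype.ext (glHom_map F f g.2)
      onX := fun R (x : (fiber p B s .half z).pts R) =>
        (⟨bc R F'.coord * x.1 * bc R F.vec, transpose_dualFrame_mul F hc x.2.1.1,
          isUnit_det_of_mem_vReg F F' x.2.1⟩ : (formSpace n c).pts R)
      onX_map := fun {R S} f (x : (fiber p B s .half z).pts R) =>
        Subtype.ext (coord_mul_map F F' f x.1)
      onX_smul := fun {R} (g : (hStab B s z).pts R) (x : (fiber p B s .half z).pts R) =>
        Subtype.ext (by
          change bc R F'.coord * (g.1.1 * x.1 * (g.1⁻¹).1) * bc R F.vec =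
            (bc R F.coord * (g.1⁻¹).1 * bc R F.vec)ᵀ * (bc R F'.coord * x.1 * bc R F.vec) *
              (bc R F.coord * (g.1⁻¹).1 * bc R F.vec)
          rw [coord_conj F F' x.2.1.1 (D.commute_of_mem_hStab g.2), dualFrame_gl F g.2]) }
  refine ⟨u, fun R => ⟨⟨?_, ?_⟩, ⟨?_, ?_⟩⟩⟩
  · rw [injective_iff_map_eq_one]
    intro (g : (hStab B s z).pts R) hg
    have h1 : bc R F.coord * g.1.1 * bc R F.vec = 1 :=
      congrArg (fun a : P.pts R => a.1.1) hg
    refine Subtype.ext (Units.ext (D.ext_right fun i => ?_))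
    rw [L.eq_one_of_gl g.2 h1 (by simp)]
    exact (Matrix.one_mul _).symm
  · intro (g : P.pts R)
    obtain ⟨h, hh, hg, -⟩ := L.exists_stab hz hb g.2
    exact ⟨(⟨h, hh⟩ : (hStab B s z).pts R), Subtype.ext (Units.ext hg)⟩
  · intro (x : (fiber p B s .half z).pts R) (y : (fiber p B s .half z).pts R) hxy
    have h1 : bc R F'.coord * x.1 * bc R F.vec = bc R F'.coord * y.1 * bc R F.vec :=
      congrArg (fun a : (formSpace n c).pts R => a.1) hxy
    refine Subtype.ext (D.fiber_ext x.2 y.2 ?_)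
    rw [← vec_mul_coord_of_mem_vogan F F' x.2.1.1, h1, vec_mul_coord_of_mem_vogan F F' y.2.1.1]
  · intro (y : (formSpace n c).pts R)
    let w := bc R F'.vec * y.1 * bc R F.coord
    have hw0 : ∀ i, i ≠ SupportKind.half.i₀ → w * D.eR R i = 0 := fun i hi => by
      rw [Matrix.mul_assoc, F.coord_mul_e_of_ne R hi, Matrix.mul_zero]
    have hw1 : w * D.eR R SupportKind.half.i₀ = w := by rw [Matrix.mul_assoc, F.coord_mul_e]
    have hw3 : ∀ i, w * D.eR R i = D.eR R (i + 1) * w := F.map_shift F' y.1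
    have hyy : (y.1)⁻¹ * y.1 = 1 := Matrix.nonsing_inv_mul _ y.2.2
    have hmem : bc R z + w ∈ (fiber p B s .half z).pts R :=
      hz.add_mem_fiber (t := bc R F.vec * (y.1)⁻¹ * bc R F'.coord) (adj_dualFrame F hc y.2.1) hw3
        (fun i hi => hw0 i fun h => hi (mem_forgotten_iff.2 (.inl h))) (by
          rw [hw1]
          simp only [w, Matrix.mul_assoc, matrix_mul_mul_of_eq (F'.left R), Matrix.one_mul,
            matrix_mul_mul_of_eq hyy, F.right])
    refine ⟨(⟨bc R z + w, hmem⟩ : (fiber p B s .half z).pts R), Subtype.ext ?_⟩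
    change bc R F'.coord * (bc R z + w) * bc R F.vec = y.1
    have e1 : (bc R z + w) * bc R F.vec = w * bc R F.vec := by
      rw [← F.e_mul_vec, ← Matrix.mul_assoc, Matrix.add_mul,
        hz.forget' R (mem_forgotten_iff.2 (.inl rfl)), zero_add, Matrix.mul_assoc]
    rw [Matrix.mul_assoc, e1]
    simp only [w, Matrix.mul_assoc, matrix_mul_mul_of_eq (F'.left R), Matrix.one_mul, F.left,
      Matrix.mul_one]

end Half

end Datum

/-- The extension by the identity of an operator on `W_i`. -/
def Grading.Frame.extend {N p : ℕ} [Fact p.Prime] {s : GL (Fin N) ℂ} {σ : SupportKind}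
    {G : Grading p s σ} {i : ℝ} {n : ℕ} (F : G.Frame i n) {R : Alg} (k : GL (Fin n) R) : GL (Fin N) R where
  val := 1 + bc R F.vec * ((k.1 - 1) * bc R F.coord)
  inv := 1 + bc R F.vec * (((k⁻¹).1 - 1) * bc R F.coord)
  val_inv := by
    have h1 : k.1 * (k⁻¹).1 = 1 := k.mul_inv
    simp only [Matrix.add_mul, Matrix.mul_add, Matrix.one_mul, Matrix.mul_one, Matrix.sub_mul,
      Matrix.mul_sub, Matrix.mul_assoc, matrix_mul_mul_of_eq (F.left R), matrix_mul_mul_of_eq h1]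
    abel
  inv_val := by
    have h1 : (k⁻¹).1 * k.1 = 1 := k.inv_mul
    simp only [Matrix.add_mul, Matrix.mul_add, Matrix.one_mul, Matrix.mul_one, Matrix.sub_mul,
      Matrix.mul_sub, Matrix.mul_assoc, matrix_mul_mul_of_eq (F.left R), matrix_mul_mul_of_eq h1]
    abel

theorem Grading.Frame.det_one_add {N p : ℕ} [Fact p.Prime] {s : GL (Fin N) ℂ} {σ : SupportKind}
    {G : Grading p s σ} {i : ℝ} {n : ℕ} (F : G.Frame i n) {R : Alg} (k : Matrix (Fin n) (Fin n) R) :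
    (1 + bc R F.vec * ((k - 1) * bc R F.coord)).det = k.det := by
  rw [Matrix.det_one_add_mul_comm, Matrix.mul_assoc, F.left, Matrix.mul_one, add_sub_cancel]

namespace Datum

variable {N p : ℕ} [hp : Fact p.Prime] {B : Matrix (Fin N) (Fin N) ℂ} {s : GL (Fin N) ℂ}
  {z : Matrix (Fin N) (Fin N) ℂ} {n : ℕ} {D : Datum p B s .int}

/-! ### Integral exponents -/

theorem int_i₀_add_one : SupportKind.int.i₀ + 1 = 0 := by norm_num [SupportKind.i₀]

theorem int_i₀_ne : SupportKind.int.i₀ ≠ SupportKind.int.i₀ + 1 := by norm_num [SupportKind.i₀]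

theorem adj_eR_int (D : Datum p B s .int) (R : Alg) :
    D.adj (D.eR R (SupportKind.int.i₀ + 1)) = D.eR R (SupportKind.int.i₀ + 1) := by
  rw [D.adj_eR, int_i₀_add_one, neg_zero]

/-- A basis of `W_0` in which the form is standard. -/
theorem exists_stdFrame (D : Datum p B s .int) {ε : FormKind} (hε : D.c = ε.sign)
    (hn : eigDim p s SupportKind.int.i₀ = n) :
    (ε = .skew → Even n) ∧
      ∃ F : D.Frame (SupportKind.int.i₀ + 1) n, F.vecᵀ * B * F.vec = stdForm n ε := by
  have hn' : eigDim p s (SupportKind.int.i₀ + 1) = n := by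
    rw [int_i₀_add_one, ← D.dim_eq rfl]; exact hn
  obtain ⟨F⟩ := D.exists_frame hn'
  have h1 : (F.vecᵀ * B * F.vec)ᵀ = ε.sign • (F.vecᵀ * B * F.vec) := by
    rw [Matrix.transpose_mul, Matrix.transpose_mul, Matrix.transpose_transpose, D.transpose_B, hε,
      Int.cast_smul_eq_zsmul, Matrix.smul_mul, Matrix.mul_smul, Matrix.mul_assoc]
  have he : D.e (SupportKind.int.i₀ + 1) * B⁻¹ = B⁻¹ * (D.e (SupportKind.int.i₀ + 1))ᵀ := by
    have h := D.adj_eR_int cpt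
    rw [Grading.eR, bc_cpt, FormGrading.adj, bc_cpt, bc_cpt] at h
    calc _ = B⁻¹ * (D.e (SupportKind.int.i₀ + 1))ᵀ * B * B⁻¹ :=
          congrArg (· * B⁻¹) h.symm
      _ = _ := by rw [Matrix.mul_assoc, Matrix.mul_nonsing_inv _ D.isUnit_B, Matrix.mul_one]
  have hce : F.coord * D.e (SupportKind.int.i₀ + 1) = F.coord := by
    rw [← F.vec_mul_coord, ← Matrix.mul_assoc, F.coord_mul_vec, Matrix.one_mul]
  -- The projector onto `W_0` is self-adjoint, so the form restricted to `W_0` is non-degenerate,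
  -- its inverse being the restriction of `B⁻¹`.
  have h2 : IsUnit (F.vecᵀ * B * F.vec).det := by
    apply Matrix.isUnit_det_of_right_inverse (B := F.coord * B⁻¹ * F.coordᵀ)
    calc _ = F.vecᵀ * B * (F.vec * F.coord * B⁻¹) * F.coordᵀ := by simp only [Matrix.mul_assoc]
      _ = F.vecᵀ * (B * B⁻¹) * (F.coord * D.e (SupportKind.int.i₀ + 1))ᵀ := by
          rw [F.vec_mul_coord, he, Matrix.transpose_mul]; simp only [Matrix.mul_assoc]
      _ = 1 := by
          rw [hce, Matrix.mul_nonsing_inv _ D.isUnit_B, Matrix.mul_one, ← Matrix.transpose_mul,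
            F.coord_mul_vec, Matrix.transpose_one]
  have hev : ε = .skew → Even n := by
    rintro rfl
    exact even_of_skew (h1.trans (by rw [FormKind.sign, neg_smul, one_smul])) h2
  refine ⟨hev, ?_⟩
  have h3 := locCongr_stdForm (R := cpt) (ε := ε) hev (y := F.vecᵀ * B * F.vec) ⟨h1, h2⟩
  rw [bc_cpt] at h3
  obtain ⟨x, hx, he'⟩ := (MatCongr.of_locCongr_cpt h3).symm
  refine ⟨⟨F.vec * x, x⁻¹ * F.coord, ?_, ?_⟩, ?_⟩
  · rw [Matrix.mul_assoc, ← Matrix.mul_assoc F.coord, F.coord_mul_vec, Matrix.one_mul,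
      Matrix.nonsing_inv_mul _ hx]
  · rw [Matrix.mul_assoc, ← Matrix.mul_assoc x, Matrix.mul_nonsing_inv _ hx, Matrix.one_mul,
      F.vec_mul_coord]
  · rw [he', Matrix.transpose_mul]
    simp only [Matrix.mul_assoc]

section StdFrame

variable {J : Matrix (Fin n) (Fin n) ℂ} {F' : D.Frame (SupportKind.int.i₀ + 1) n}

theorem form_bc (hJ : F'.vecᵀ * B * F'.vec = J) (R : Alg) :
    (bc R F'.vec)ᵀ * (bc R B * bc R F'.vec) = bc R J := by
  rw [← bc_transpose, ← bc_mul, ← bc_mul, ← Matrix.mul_assoc, hJ]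

theorem transpose_vec_mul (hJ : F'.vecᵀ * B * F'.vec = J) (R : Alg) :
    (bc R F'.vec)ᵀ * bc R B = bc R J * bc R F'.coord := by
  have h1 := D.B_mul_adj (D.eR R (SupportKind.int.i₀ + 1))
  rw [D.adj_eR_int] at h1
  rw [← form_bc hJ, Matrix.mul_assoc, Matrix.mul_assoc, F'.right, h1, ← Matrix.mul_assoc,
    ← Matrix.transpose_mul, F'.e_mul_vec]

theorem B_mul_vec (hJ : F'.vecᵀ * B * F'.vec = J) (R : Alg) :
    bc R B * bc R F'.vec = (bc R F'.coord)ᵀ * bc R J := by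
  have h1 := D.B_mul_adj (D.eR R (SupportKind.int.i₀ + 1))
  rw [D.adj_eR_int] at h1
  conv_lhs => rw [← F'.e_mul_vec, ← Matrix.mul_assoc, h1, ← F'.right, Matrix.transpose_mul]
  rw [Matrix.mul_assoc, Matrix.mul_assoc, form_bc hJ]

theorem gl_mem_isomGroup (hJ : F'.vecᵀ * B * F'.vec = J) {R : Alg} (h : (hStab B s z).pts R) :
    glHom F' z R h ∈ (isomGroup J).pts R := by
  have hc := D.commute_of_mem_hStab h.2 (SupportKind.int.i₀ + 1)
  have h1 : bc R F'.vec * (bc R F'.coord * h.1.1 * bc R F'.vec) = h.1.1 * bc R F'.vec := by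
    rw [← Matrix.mul_assoc, ← Matrix.mul_assoc, F'.right, ← hc, Matrix.mul_assoc, F'.e_mul_vec]
  have h2 : h.1.1ᵀ * bc R B * h.1.1 = bc R B := h.2.1.1.1
  change (bc R F'.coord * h.1.1 * bc R F'.vec)ᵀ * bc R J * (bc R F'.coord * h.1.1 * bc R F'.vec) =
    bc R J
  rw [← form_bc hJ]
  calc _ = (bc R F'.vec * (bc R F'.coord * h.1.1 * bc R F'.vec))ᵀ * bc R B *
        (bc R F'.vec * (bc R F'.coord * h.1.1 * bc R F'.vec)) := by
        rw [Matrix.transpose_mul (bc R F'.vec)]; simp only [Matrix.mul_assoc]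
    _ = (bc R F'.vec)ᵀ * ((h.1.1ᵀ * bc R B * h.1.1) * bc R F'.vec) := by
        rw [h1, Matrix.transpose_mul]; simp only [Matrix.mul_assoc]
    _ = _ := by rw [h2]

theorem extend_mul_e {R : Alg} (k : GL (Fin n) R) {i : ℝ} (hi : i ≠ SupportKind.int.i₀ + 1) :
    (F'.extend k).1 * D.eR R i = D.eR R i := by
  have h1 := F'.coord_mul_e_of_ne R hi
  change (1 + bc R F'.vec * ((k.1 - 1) * bc R F'.coord)) * D.eR R i = _
  rw [Matrix.add_mul, Matrix.mul_assoc, Matrix.mul_assoc, h1]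
  simp

/-- An isometry of `W_0` extended by the identity commutes with `z`, because `z` neither enters nor
leaves `W_0`: the degrees `-1` and `0` are both forgotten. -/
theorem extend_mem (hz : D.Good z) (hJ : F'.vecᵀ * B * F'.vec = J) {R : Alg} {k : GL (Fin n) R}
    (hk : k ∈ (isomGroup J).pts R) (hdet : k.1.det = 1) :
    F'.extend k ∈ (hStab B s z).pts R := by
  have hval : (F'.extend k).1 = 1 + bc R F'.vec * ((k.1 - 1) * bc R F'.coord) := rfl
  have hinv : ((F'.extend k)⁻¹).1 = 1 + bc R F'.vec * (((k⁻¹).1 - 1) * bc R F'.coord) := rfl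
  have hforget : SupportKind.int.i₀ + 1 ∈ SupportKind.int.forgotten :=
    mem_forgotten_iff.2 (.inr (by norm_num [SupportKind.i₀]))
  refine ⟨D.mem_hGroup_iff.2 ⟨?_, ?_, fun i => ?_⟩, ?_⟩
  · have hk1 : k.1 * (k⁻¹).1 = 1 := k.mul_inv
    have hk2 : k.1ᵀ * bc R J * k.1 = bc R J := hk
    have hk3 : k.1ᵀ * bc R J = bc R J * (k⁻¹).1 := by
      conv_rhs => rw [← hk2, Matrix.mul_assoc, hk1, Matrix.mul_one]
    have h1 : D.adj (F'.extend k).1 = ((F'.extend k)⁻¹).1 := by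
      rw [D.adj_eq_iff, hval, hinv]
      simp only [Matrix.transpose_add, Matrix.transpose_one, Matrix.transpose_mul,
        Matrix.transpose_sub, Matrix.add_mul, Matrix.mul_add, Matrix.one_mul, Matrix.mul_one,
        Matrix.mul_assoc, Matrix.mul_sub, Matrix.sub_mul]
      simp only [transpose_vec_mul hJ, matrix_mul_mul_of_eq (B_mul_vec hJ R),
        matrix_mul_mul_of_eq hk3, Matrix.mul_assoc]
    rw [h1]
    exact (F'.extend k).inv_mul
  · rw [hval, F'.det_one_add, hdet]
  · by_cases hi : i = SupportKind.int.i₀ + 1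
    · rw [hval, hi]
      simp only [Matrix.add_mul, Matrix.mul_add, Matrix.one_mul, Matrix.mul_one, Matrix.mul_assoc,
        F'.coord_mul_e, matrix_mul_mul_of_eq (F'.e_mul_vec R)]
    · have h1 := F'.e_mul_vec_of_ne R hi
      rw [extend_mul_e k hi, hval, Matrix.mul_add, ← Matrix.mul_assoc, h1, Matrix.zero_mul,
        add_zero, Matrix.mul_one]
  · change (F'.extend k).1 * bc R z = bc R z * (F'.extend k).1
    have h1 : bc R z * bc R F'.vec = 0 := by
      rw [← F'.e_mul_vec, ← Matrix.mul_assoc, hz.forget' R hforget, Matrix.zero_mul]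
    have h2 : bc R F'.coord * bc R z = 0 := by
      rw [← F'.coord_mul_e, Matrix.mul_assoc, ← hz.shift,
        hz.forget' R (mem_forgotten_iff.2 (.inl rfl)), Matrix.mul_zero]
    rw [hval, Matrix.add_mul, Matrix.mul_add, Matrix.mul_assoc, Matrix.mul_assoc, h2,
      ← Matrix.mul_assoc (bc R z), h1]
    simp

/-- Dividing `h` by an element of the stabilizer with the same action on `W_{i₀}` and trivial on
`W_0` leaves the action on `W_0` unchanged and makes it trivial on all the other `W_i`. The total
determinant, which is one, is then the determinant on `W_0`. -/
theorem det_gl_eq_one {F : D.Frame SupportKind.int.i₀ n} (hz : D.Good z) (L : D.FlagFrame z F)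
    {b : Module.Basis (Fin n) ℂ (eig p s cpt SupportKind.int.i₀)}
    (hb : ∀ c : Fin n → ℂ, (b.equivFun.symm c : Fin N → ℂ) = F.vec *ᵥ c) {R : Alg}
    (h : (hStab B s z).pts R) : (glHom F' z R h).1.det = 1 := by
  obtain ⟨k, hk, hk1, hk0⟩ := L.exists_stab hz hb
    (L.gl_mem_parabolic hb h.2 (D.commute_of_mem_hStab h.2 _))
  have hk0' : k.1 * D.eR R (SupportKind.int.i₀ + 1) = D.eR R (SupportKind.int.i₀ + 1) := by
    rw [int_i₀_add_one]; exact hk0 rfl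
  have hkF : k.1 * bc R F'.vec = bc R F'.vec := by
    rw [← F'.e_mul_vec, ← Matrix.mul_assoc, hk0']
  let k' : (hStab B s z).pts R := ⟨k, hk⟩
  have e1 : glHom F z R (k'⁻¹ * h) = 1 := by
    rw [map_mul, map_inv, inv_mul_eq_one]
    exact Units.ext hk1
  have e2 : glHom F' z R (k'⁻¹ * h) = glHom F' z R h := by
    rw [map_mul, map_inv]
    have : glHom F' z R k' = 1 := Units.ext (by
      change bc R F'.coord * k.1 * bc R F'.vec = 1
      rw [Matrix.mul_assoc, hkF, F'.left])
    rw [this, inv_one, one_mul]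
  rw [← e2]
  generalize k'⁻¹ * h = m at e1
  have e3 : bc R F.coord * m.1.1 * bc R F.vec = 1 := congrArg Units.val e1
  have e4 : m.1.1 = 1 + bc R F'.vec * ((bc R F'.coord * m.1.1 * bc R F'.vec - 1) * bc R F'.coord) := by
    apply D.ext_right
    intro i
    by_cases hi : i = SupportKind.int.i₀ + 1
    · have hc := D.commute_of_mem_hStab m.2 (SupportKind.int.i₀ + 1)
      rw [hi]
      simp only [Matrix.add_mul, Matrix.mul_add, Matrix.one_mul, Matrix.mul_one, Matrix.mul_assoc,
        F'.coord_mul_e, matrix_mul_mul_of_eq (F'.right R), Matrix.sub_mul, Matrix.mul_sub, F'.right,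
        hc, matrix_mul_mul_of_eq (D.eR_mul_eR R _), D.eR_mul_eR]
      abel
    · rw [L.eq_one_of_gl m.2 e3 fun _ h0 => (hi (h0.trans int_i₀_add_one.symm)).elim]
      have h1 := F'.coord_mul_e_of_ne R hi
      rw [Matrix.add_mul, Matrix.mul_assoc, Matrix.mul_assoc, h1]
      simp
  have e5 := (D.mem_hGroup_iff.1 m.2.1).2.1
  rw [e4, F'.det_one_add] at e5
  exact e5

end StdFrame

/-- The stabilizer is a product: elements of the parabolic lift to operators trivial on `W_0`, and
elements of `K` to operators trivial on every other `W_i`. On the fibre the block `W_{-1} → W_0` is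
an arbitrary invertible matrix, and the block `W_0 → W_1` is forced to be minus its adjoint. -/
theorem Good.exists_iso_int (hz : D.Good z)
    (b : Module.Basis (Fin n) ℂ (eig p s cpt SupportKind.int.i₀))
    {J : Matrix (Fin n) (Fin n) ℂ} {F' : D.Frame (SupportKind.int.i₀ + 1) n}
    (hJ : F'.vecᵀ * B * F'.vec = J) {K : MatGroup n}
    (hK : ∀ (R : Alg) (k : GL (Fin n) R),
      k ∈ K.pts R ↔ k ∈ (isomGroup J).pts R ∧ k.1.det = 1) :
    ∃ u : (fiberSpace p B s .int z).Hom (prodSpace (parabolic p s .int z b) K), u.IsIso := by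
  obtain ⟨F, hb⟩ := D.exists_frame_of_basis b
  obtain ⟨L⟩ := hz.flagFrame_nonempty F
  let P := parabolic p s .int z b
  let u : (fiberSpace p B s .int z).Hom (prodSpace P K) :=
    { onG := fun R => (((glHom F z R).codRestrict (P.pts R)
          fun h => L.gl_mem_parabolic hb h.2 (D.commute_of_mem_hStab h.2 _)).prod
        ((glHom F' z R).codRestrict (K.pts R)
          fun h => (hK R _).2 ⟨gl_mem_isomGroup hJ h, det_gl_eq_one hz L hb h⟩) :
        (hStab B s z).pts R →* P.pts R × K.pts R)
      onG_map := fun {R S} f (g : (hStab B s z).pts R) =>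
        Prod.ext (Subtype.ext (glHom_map F f g.2)) (Subtype.ext (glHom_map F' f g.2))
      onX := fun R (x : (fiber p B s .int z).pts R) =>
        (⟨bc R F'.coord * x.1 * bc R F.vec, isUnit_det_of_mem_vReg F F' x.2.1⟩ :
          (glSpace n).pts R)
      onX_map := fun {R S} f (x : (fiber p B s .int z).pts R) =>
        Subtype.ext (coord_mul_map F F' f x.1)
      onX_smul := fun {R} (g : (hStab B s z).pts R) (x : (fiber p B s .int z).pts R) =>
        Subtype.ext (by
          change bc R F'.coord * (g.1.1 * x.1 * (g.1⁻¹).1) * bc R F.vec =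
            (bc R F'.coord * g.1.1 * bc R F'.vec) * (bc R F'.coord * x.1 * bc R F.vec) *
              (bc R F.coord * (g.1⁻¹).1 * bc R F.vec)
          rw [coord_conj F F' x.2.1.1 (D.commute_of_mem_hStab g.2)]) }
  refine ⟨u, fun R => ⟨⟨?_, ?_⟩, ⟨?_, ?_⟩⟩⟩
  · rw [injective_iff_map_eq_one]
    intro (g : (hStab B s z).pts R) hg
    have h1 : bc R F.coord * g.1.1 * bc R F.vec = 1 :=
      congrArg (fun a : P.pts R × K.pts R => a.1.1.1) hg
    have h2 : bc R F'.coord * g.1.1 * bc R F'.vec = 1 :=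
      congrArg (fun a : P.pts R × K.pts R => a.2.1.1) hg
    have h0 : g.1.1 * D.eR R 0 = D.eR R 0 := by
      have hc := D.commute_of_mem_hStab g.2 (SupportKind.int.i₀ + 1)
      rw [← int_i₀_add_one]
      conv_lhs => rw [← D.eR_mul_eR, ← Matrix.mul_assoc, hc, ← F'.right]
      calc bc R F'.vec * bc R F'.coord * g.1.1 * (bc R F'.vec * bc R F'.coord)
          = bc R F'.vec * (bc R F'.coord * g.1.1 * bc R F'.vec) * bc R F'.coord := by
            simp only [Matrix.mul_assoc]
        _ = _ := by rw [h2, Matrix.mul_one, F'.right]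
    refine Subtype.ext (Units.ext (D.ext_right fun i => ?_))
    rw [L.eq_one_of_gl g.2 h1 fun _ _ => h0]
    exact (Matrix.one_mul _).symm
  · intro (gk : P.pts R × K.pts R)
    obtain ⟨g, k⟩ := gk
    obtain ⟨h, hh, hg, h0⟩ := L.exists_stab hz hb g.2
    have hk := (hK R k.1).1 k.2
    have hm := extend_mem hz hJ hk.1 hk.2
    let h1 : (hStab B s z).pts R := ⟨h, hh⟩
    let h2 : (hStab B s z).pts R := ⟨F'.extend k.1, hm⟩
    have e1 : glHom F z R h2 = 1 := Units.ext (by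
      change bc R F.coord * (F'.extend k.1).1 * bc R F.vec = 1
      rw [← F.e_mul_vec, Matrix.mul_assoc, ← Matrix.mul_assoc (F'.extend k.1).1,
        extend_mul_e k.1 int_i₀_ne, F.e_mul_vec, F.left])
    have e2 : glHom F' z R h1 = 1 := Units.ext (by
      change bc R F'.coord * h.1 * bc R F'.vec = 1
      have h0' : h.1 * D.eR R (SupportKind.int.i₀ + 1) = D.eR R (SupportKind.int.i₀ + 1) := by
        rw [int_i₀_add_one]; exact h0 rfl
      rw [← F'.e_mul_vec, Matrix.mul_assoc, ← Matrix.mul_assoc h.1, h0', F'.e_mul_vec, F'.left])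
    have e3 : glHom F' z R h2 = k.1 := Units.ext (by
      change bc R F'.coord * (1 + bc R F'.vec * ((k.1.1 - 1) * bc R F'.coord)) * bc R F'.vec = k.1.1
      simp only [Matrix.add_mul, Matrix.mul_add, Matrix.one_mul, Matrix.mul_one, Matrix.mul_assoc,
        matrix_mul_mul_of_eq (F'.left R), F'.left]
      abel)
    refine ⟨h1 * h2, Prod.ext (Subtype.ext ?_) (Subtype.ext ?_)⟩
    · change glHom F z R (h1 * h2) = g.1
      rw [map_mul, e1, mul_one]
      exact Units.ext hg
    · change glHom F' z R (h1 * h2) = k.1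
      rw [map_mul, e2, one_mul, e3]
  · intro (x : (fiber p B s .int z).pts R) (y : (fiber p B s .int z).pts R) hxy
    have h1 : bc R F'.coord * x.1 * bc R F.vec = bc R F'.coord * y.1 * bc R F.vec :=
      congrArg (fun a : (glSpace n).pts R => a.1) hxy
    refine Subtype.ext (D.fiber_ext x.2 y.2 ?_)
    rw [← vec_mul_coord_of_mem_vogan F F' x.2.1.1, h1, vec_mul_coord_of_mem_vogan F F' y.2.1.1]
  · intro (y : (glSpace n).pts R)
    let w := bc R F'.vec * y.1 * bc R F.coord
    have hw0 : ∀ i, i ≠ SupportKind.int.i₀ → w * D.eR R i = 0 := fun i hi => by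
      rw [Matrix.mul_assoc, F.coord_mul_e_of_ne R hi, Matrix.mul_zero]
    have hw1 : w * D.eR R SupportKind.int.i₀ = w := by rw [Matrix.mul_assoc, F.coord_mul_e]
    have hw3 : ∀ i, w * D.eR R i = D.eR R (i + 1) * w := F.map_shift F' y.1
    have hw2 : D.eR R (SupportKind.int.i₀ + 1) * w = w := by rw [← hw3, hw1]
    have ha3 : ∀ i, D.adj w * D.eR R i = D.eR R (i + 1) * D.adj w := fun i => by
      have := congrArg D.adj (hw3 (-i - 1))
      rw [D.adj_mul, D.adj_mul, D.adj_eR, D.adj_eR, show -(-i - 1 + 1) = i by ring,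
        show -(-i - 1) = i + 1 by ring] at this
      exact this.symm
    have ha0 : ∀ i, i ≠ SupportKind.int.i₀ + 1 → D.adj w * D.eR R i = 0 := fun i hi => by
      rw [← hw2, D.adj_mul, D.adj_eR_int, Matrix.mul_assoc, D.eR_mul_eR_of_ne R hi.symm,
        Matrix.mul_zero]
    have hyy : (y.1)⁻¹ * y.1 = 1 := Matrix.nonsing_inv_mul _ y.2
    -- The operators `w` and `adj w` occupy the different degrees `-1` and `0`, so making `w`
    -- skew-adjoint does not alter the prescribed block.
    have hw4 : (w - D.adj w) * D.eR R SupportKind.int.i₀ = w := by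
      rw [Matrix.sub_mul, hw1, ha0 _ int_i₀_ne, sub_zero]
    have hmem : bc R z + (w - D.adj w) ∈ (fiber p B s .int z).pts R :=
      hz.add_mem_fiber (t := bc R F.vec * (y.1)⁻¹ * bc R F'.coord)
        (by rw [D.adj_sub, D.adj_adj, neg_sub])
        (fun i => by rw [Matrix.sub_mul, hw3, ha3, Matrix.mul_sub])
        (fun i hi => by
          rw [Matrix.sub_mul, hw0 i fun h => hi (mem_forgotten_iff.2 (.inl h)), ha0 i fun h =>
            hi (mem_forgotten_iff.2 (.inr (h.trans (by norm_num [SupportKind.i₀])))), sub_zero]) (by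
          rw [hw4]
          simp only [w, Matrix.mul_assoc, matrix_mul_mul_of_eq (F'.left R), Matrix.one_mul,
            matrix_mul_mul_of_eq hyy, F.right])
    refine ⟨(⟨bc R z + (w - D.adj w), hmem⟩ : (fiber p B s .int z).pts R), Subtype.ext ?_⟩
    change bc R F'.coord * (bc R z + (w - D.adj w)) * bc R F.vec = y.1
    have e1 : (bc R z + (w - D.adj w)) * bc R F.vec = w * bc R F.vec := by
      conv_lhs => rw [← F.e_mul_vec, ← Matrix.mul_assoc, Matrix.add_mul,
        hz.forget' R (mem_forgotten_iff.2 (.inl rfl)), zero_add, hw4]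
    rw [Matrix.mul_assoc, e1]
    simp only [w, Matrix.mul_assoc, matrix_mul_mul_of_eq (F'.left R), Matrix.one_mul, F.left,
      Matrix.mul_one]

end Datum

/-! ### The models -/

theorem model_isSheaf {n : ℕ} (P : MatGroup n) (σ : SupportKind) (ε : FormKind) :
    IsSheaf (model P σ ε).X := by
  cases σ <;> cases ε
  · exact (glSpace_isLocal n).isSheaf
  · exact (glSpace_isLocal n).isSheaf
  · exact (formSpace_isLocal n (-1)).isSheaf
  · exact (formSpace_isLocal n 1).isSheaf

theorem one_mem_glSpace (n : ℕ) (R : Alg) : (1 : Matrix (Fin n) (Fin n) R) ∈ (glSpace n).pts R := by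
  change IsUnit (Matrix.det 1)
  rw [Matrix.det_one]
  exact isUnit_one

theorem antidiagJ_transpose_smul {n : ℕ} (hn : Even n) :
    (antidiagJ n)ᵀ = (-1 : ℤ) • antidiagJ n := by
  rw [antidiagJ_transpose hn, neg_smul, one_smul]

theorem one_transpose_smul (n : ℕ) :
    (1 : Matrix (Fin n) (Fin n) ℂ)ᵀ = (1 : ℤ) • (1 : Matrix (Fin n) (Fin n) ℂ) := by
  rw [Matrix.transpose_one, one_smul]

theorem model_nonempty {n : ℕ} (P : MatGroup n) {σ : SupportKind} {ε : FormKind}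
    (heven : σ = .half → ε = .symm → Even n) : Nonempty ((model P σ ε).X.obj cpt) := by
  cases σ <;> cases ε
  · exact ⟨(⟨1, one_mem_glSpace n cpt⟩ : (glSpace n).pts cpt)⟩
  · exact ⟨(⟨1, one_mem_glSpace n cpt⟩ : (glSpace n).pts cpt)⟩
  · exact ⟨(⟨antidiagJ n, antidiagJ_transpose_smul (heven rfl rfl), isUnit_det_antidiagJ n⟩ :
      (formSpace n (-1)).pts cpt)⟩
  · exact ⟨(⟨1, one_transpose_smul n, one_mem_glSpace n cpt⟩ : (formSpace n 1).pts cpt)⟩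

/-- The double coset space maps to the model, and the map induces an equivalence of quotient
stacks. -/
theorem exists_doubleCoset_hom {n : ℕ} (P : MatGroup n) {σ : SupportKind} {ε : FormKind}
    (heven : σ = .half → ε = .symm → Even n) :
    ∃ w : (doubleCosetSpace (kHat n σ ε) P).Hom (model P σ ε), w.IsLocalEquiv := by
  cases σ <;> cases ε
  · obtain ⟨w, hw⟩ := prodSpace_iso P (specialOrthogonalGroup n)
    exact ⟨w, hw.isLocalEquiv⟩
  · obtain ⟨w, hw⟩ := prodSpace_iso P (symplecticGroup n)
    exact ⟨w, hw.isLocalEquiv⟩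
  · exact ⟨_, formHom_isLocalEquiv (antidiagJ n) (-1) (antidiagJ_transpose_smul (heven rfl rfl))
      (isUnit_det_antidiagJ n) P fun R y hy =>
        locCongr_stdForm (ε := .skew) (fun _ => heven rfl rfl) hy⟩
  · exact ⟨_, formHom_isLocalEquiv 1 1 (one_transpose_smul n) (by rw [Matrix.det_one]; exact isUnit_one)
      P fun R y hy => locCongr_stdForm (ε := .symm) (fun h => nomatch h) hy⟩

/-! ### Assembly of the four cases. -/

namespace Datum

variable {N p : ℕ} [hp : Fact p.Prime] {B : Matrix (Fin N) (Fin N) ℂ} {s : GL (Fin N) ℂ}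
  {σ : SupportKind} {D : Datum p B s σ} {z : Matrix (Fin N) (Fin N) ℂ} {n : ℕ}

theorem stackEquiv_of_isLocalEquiv (D : Datum p B s σ) {A : GSpace} (hA : IsSheaf A.X)
    {u : A.Hom (fiberSpace p B s σ z)} (hu : u.IsLocalEquiv) :
    GSpace.StackEquiv (fiberSpace p B s σ z) A :=
  hu.stackEquiv hA (D.fiber_isLocal z).isSheaf (hStab_isLocal B s z).isSheaf

/-- For integral exponents and a skew form, the restriction of the form to `W_0` forces `n` to be
even, and the determinant condition is automatic. For half-integral exponents the sign of the forms
on the fibre is opposite to `ε`. -/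
theorem Good.exists_iso_model {ε : FormKind} (hz : D.Good z) (hc : D.c = ε.sign)
    (b : Module.Basis (Fin n) ℂ (eig p s cpt σ.i₀)) :
    ∃ u : (fiberSpace p B s σ z).Hom (model (parabolic p s σ z b) σ ε), u.IsIso := by
  cases σ
  · have hn : eigDim p s SupportKind.int.i₀ = n := by
      rw [eigDim, Module.finrank_eq_card_basis b, Fintype.card_fin]
    obtain ⟨hev, F', hF'⟩ := D.exists_stdFrame hc hn
    cases ε
    · refine hz.exists_iso_int (K := specialOrthogonalGroup n) b hF' fun R k => and_congr Iff.rfl ?_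
      change Matrix.GeneralLinearGroup.det k = 1 ↔ _
      rw [Units.ext_iff]
      rfl
    · exact hz.exists_iso_int (K := symplecticGroup n) b hF' fun R k =>
        ⟨fun hk => ⟨hk, det_eq_one_of_mem_symplecticGroup (hev rfl) hk⟩, fun hk => hk.1⟩
  · cases ε
    · exact hz.exists_iso_half (c := -1) b (by rw [hc, FormKind.sign]; norm_num)
    · exact hz.exists_iso_half (c := 1) b (by rw [hc, FormKind.sign]; norm_num)

/-- A good point comes from a full rank point as soon as its fibre is non-empty, which is read off
from the model. Here the parity assumption enters: there is no invertible skew-symmetric matrix of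
odd size. -/
theorem Good.mem_vRegDiamond {ε : FormKind} (hz : D.Good z) (hc : D.c = ε.sign)
    (heven : σ = .half → ε = .symm → Even (eigDim p s σ.i₀)) : z ∈ vRegDiamond p B s σ := by
  obtain ⟨u, hu⟩ := hz.exists_iso_model hc (Module.finBasisOfFinrankEq ℂ (eig p s cpt σ.i₀) rfl)
  obtain ⟨y⟩ := model_nonempty (parabolic p s σ z
    (Module.finBasisOfFinrankEq ℂ (eig p s cpt σ.i₀) rfl)) heven
  obtain ⟨x, -⟩ := (hu cpt).2.2 y
  let x' : (fiber p B s σ z).pts cpt := x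
  refine ⟨x'.1, x'.2.1, ?_⟩
  have h := x'.2.2
  rwa [bc_cpt] at h

end Datum

end FullRank

end

theorem mainTheorem9 (p : ℕ) [Fact p.Prime] (N : ℕ)
    -- a non-degenerate symmetric or skew-symmetric form on `ℂ^N`
    (B : Matrix (Fin N) (Fin N) ℂ) (hB : IsUnit B.det) (ε : FormKind) (hε : ε.Holds B)
    -- the image of Frobenius: a semisimple isometry of determinant one
    (s : GL (Fin N) ℂ) (hsB : s.1ᵀ * B * s.1 = B) (hdet : s.1.det = 1)
    (hss : Module.End.IsSemisimple (Matrix.toLin' s.1))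
    (σ : SupportKind) (hσ : SupportedIn p s σ) (huni : Unimodal p s)
    (n : ℕ) (hn : n = eigDim p s σ.i₀)
    (heven : σ = SupportKind.half → ε = FormKind.symm → Even n) :
    (∃ z, vRegDiamond p B s σ =
      {z' | ∃ g ∈ (hGroup B s).pts cpt, z' = g.1 * z * (g⁻¹ : GL (Fin N) ℂ).1}) ∧
    ∀ z ∈ vRegDiamond p B s σ,
      (fiberInclusion p B s σ z).IsContractedProduct ∧
      GSpace.StackEquiv (vRegSpace p B s) (fiberSpace p B s σ z) ∧
      ∀ b : Module.Basis (Fin n) ℂ (eig p s cpt σ.i₀),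
        (∃ u : (fiberSpace p B s σ z).Hom (model (parabolic p s σ z b) σ ε), u.IsIso) ∧
        GSpace.StackEquiv (fiberSpace p B s σ z) (model (parabolic p s σ z b) σ ε) ∧
        GSpace.StackEquiv (fiberSpace p B s σ z)
          (doubleCosetSpace (kHat n σ ε) (parabolic p s σ z b)) := by
  obtain ⟨D, hc⟩ := exists_datum p B hB ε hε s hsB hss σ hσ huni
  refine ⟨?_, fun z hz => ?_⟩
  · obtain ⟨z, ⟨hz⟩⟩ := D.exists_good
    -- The set is non-empty, so that it really is one orbit.
    have hz' := hz.mem_vRegDiamond hc (hn ▸ heven)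
    refine ⟨z, Set.ext fun z' => ⟨fun h => hz.exists_conj h, ?_⟩⟩
    rintro ⟨g, hg, rfl⟩
    exact D.conj_mem_vRegDiamond hz' hg
  · obtain ⟨hz'⟩ := D.good_of_mem_vRegDiamond hz
    refine ⟨hz'.fiberInclusion_isContractedProduct, hz'.stackEquiv, fun b => ?_⟩
    obtain ⟨u, hu⟩ := hz'.exists_iso_model hc b
    -- The criterion for stacks gives equivalences out of the target of a morphism, so both
    -- comparisons are made with morphisms into the fibre.
    obtain ⟨v, hv⟩ := hu.exists_inv
    obtain ⟨w, hw⟩ := exists_doubleCoset_hom (parabolic p s σ z b) heven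
    exact ⟨⟨u, hu⟩, D.stackEquiv_of_isLocalEquiv (model_isSheaf (parabolic p s σ z b) σ ε) hv.isLocalEquiv,
      D.stackEquiv_of_isLocalEquiv (glSpace_isLocal n).isSheaf (hw.comp_isIso hv)⟩
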